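/- **Definitions.** *Sphere groups.* A *sphere group* is a group $G$ with conjugacy classes $\Gamma_1,\dots,\Gamma_n$ ($n\neq 1$), its *peripheral classes*, such that $G=\langle\gamma_1,\dots,\gamma_n\mid\gamma_1\cdots\gamma_n\rangle$ for some $\gamma_i\in\Gamma_i$. *Sphere bisets.* An $H$-$G$-biset is a set with commuting left $H$- and right $G$-actions. Let $B$ be left-free with finite set of left orbits $H\backslash B$. For $g\in G$ and an orbit (cycle) $S$ of $g$ on $H\backslash B$, of length $d_S$, choose $s\in B$ over $S$; there is $h\in H$ with $hs=sg^{d_S}$, and its conjugacy class is the lift of $g$ along $S$. For sphere groups $(H,\Delta_j)$, $(G,\Gamma_i)$, $B$ is a *sphere biset* if (1) $B$ is left-free and right-transitive; (2) for representatives $\gamma_i\in\Gamma_i$, with $d=\#(H\backslash B)<\infty$, one has $\sum_i\sum_{c}(\mathrm{length}(c)-1)=2d-2$, where $c$ runs over the cycles of $\gamma_i$ on $H\backslash B$; (3) in the multiset of all lifts of $\Gamma_1,\dots,\Gamma_n$ every $\Delta_j$ occurs exactly once, and all other classes are trivial. *Graphs of groups and bisets.* A graph has vertices and oriented edges $x$,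 with origin $x^-$, inverse $\bar x$ and end $x^+=\bar x^-$; for a vertex, $x^-=\bar x=x$. A graph morphism commutes with $x\mapsto x^-,\bar x$ and may send edges to vertices. A graph of groups $\mathfrak X$ has a group $G_x$ for every vertex and edge $x$ and homomorphisms $G_x\to G_{x^-}$, $G_x\to G_{\bar x}$, $g\mapsto g^-,\bar g$ (the second involutive, both the identity if $x$ is a vertex). Its path group is generated by the vertex groups and the edges subject to $x\bar x=1$ and $\bar x g^-x=g^+$ for $g\in G_x$, where $g^+=(\bar g)^-$; $\pi_1(\mathfrak X,v,w)$ is the set of its elements represented by group paths from $v$ to $w$. A $\mathfrak Y$-$\mathfrak X$-graph of bisets $\mathfrak B$ is a graph with graph morphisms $\lambda$ to $\mathfrak Y$ and $\rho$ to $\mathfrak X$, a $G_{\lambda(z)}$-$G_{\rho(z)}$-biset $B_z$ for every vertex and edge $z$, and compatible maps $B_z\to B_{z^-}$, $B_z\to B_{\bar z}$, $b\mapsto b^-,\bar b$ (the second involutive, both the identity if $z$ is a vertex). Its *fundamental biset* is $$\pi_1(\mathfrak B,\dagger,*)=\bigsqcup_{z\text{ vertex}}\pi_1(\mathfrak Y,\dagger,\lambda(z))\otimes_{G_{\lambda(z)}}B_z\otimes_{G_{\rho(z)}}\pi_1(\mathfrak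 X,\rho(z),*)\Big/\ q\,b^-\,p=q\,\lambda(z)\,b^+\,\overline{\rho(z)}\,p\quad(b\in B_z),$$ where $b^+=(\bar b)^-$. $\mathfrak B$ is *left-free* if $\rho$ sends edges to edges, all $B_z$ are left-free, and for each vertex $v$ of $\mathfrak B$ and edge $f$ of $\mathfrak X$ with $f^-=\rho(v)$ the map $\bigsqcup_{\rho(e)=f,\,e^-=v}G_{\lambda(v)}\otimes_{G_{\lambda(e)}}B_e\to B_v$, $h\otimes b\mapsto hb^-$, is bijective. *Sphere trees of groups.* A *stable sphere tree of groups* is a graph of groups on a finite tree that is the barycentric subdivision of a smaller tree (old vertices are *sphere vertices*, new ones *curve vertices*), with a sphere group at each vertex, infinite cyclic with two peripheral classes at curve vertices and with at least three peripheral classes at sphere vertices, and infinite cyclic edge groups embedded in the vertex groups. Every edge group has a generator $t_x$, with $\overline{t_x}=t_{\bar x}$, sent to a peripheral class of $G_{x^-}$, to which $x$ *attaches*; different edges attach to different peripheral classes. A peripheral class of a vertex group is *vacant* if no edge attaches to it. The vacant classes, transported along paths to the basepoint $*$, are the peripheral classes of $\pi_1(\mathfrak X,*)=\pi_1(\mathfrak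 X,*,*)$. A *sphere refinement* is obtained, up to congruence, by finitely many operations: (a) replace a curve vertex $v$, with its two adjacent edges, by a path curve–sphere–curve, with all groups equal to $G_v$; (b) attach at a vertex $v$ a path $v$–$\ell$–$w$ with $\ell$ a curve vertex and $w$ a sphere vertex, all new groups being the subgroup of $G_v$ generated by $h$, where $h=1$ or $h$ represents a vacant peripheral class of $v$ (to which the new edge at $v$ attaches). Trivial groups have no peripheral class, and infinite cyclic groups have those of their two generators; the same attaching conventions apply, edges with trivial group attaching to nothing. *Sphere trees of bisets.* A $\mathfrak Y$-$\mathfrak X$-graph of bisets $\mathfrak B$ whose graph is a tree is a *sphere tree of bisets* if: $\mathfrak Y$ and $\mathfrak X$ are stable sphere trees of groups; $\mathfrak B$ is left-free and every $B_z$ is transitive as a biset; and, for some choice of $b_z\in B_z$ with $\overline{b_z}=b_{\bar z}$, letting $P_z=\{h\in G_{\lambda(z)}: hb_z\in b_zG_{\rho(z)}\}$ and $\gamma_z\in G_{\lambda(z^-)}$ with $\gamma_z^{-1}b_z^-\in b_{z^-}G_{\rho(z^-)}$ (and $\gamma_z=1$ for vertices $z$), the graph of groups $\mathfrak P$ on the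 graph of $\mathfrak B$ with groups $P_z$ and maps $P_z\to P_{z^-}$, $h\mapsto\gamma_z^{-1}h^-\gamma_z$, and $P_z\to P_{\bar z}$, $h\mapsto\bar h$, has a sphere structure making it a sphere refinement of $\mathfrak Y$ via $\lambda$ and the inclusions $P_z\le G_{\lambda(z)}$, and all $P_z$-$G_{\rho(z)}$-bisets $P_zb_zG_{\rho(z)}$ are sphere bisets (edge groups having the sphere structure of cyclic groups). **Theorem.** Let $\mathfrak B$ be a sphere tree of bisets over stable sphere trees of groups $\mathfrak Y$ and $\mathfrak X$. Then, for all vertices $\dagger$ of $\mathfrak Y$ and $*$ of $\mathfrak X$, the fundamental biset $\pi_1(\mathfrak B,\dagger,*)$ is a sphere $\pi_1(\mathfrak Y,\dagger)$-$\pi_1(\mathfrak X,*)$-biset. That is, $\pi_1(\mathfrak Y,\dagger)$ and $\pi_1(\mathfrak X,*)$, with the peripheral classes given by the vacant classes, are sphere groups; the biset is left-free and right-transitive; it has finite degree $d$ and the total of $\mathrm{length}(c)-1$ over all cycles $c$ of representatives of the peripheral classes of $\pi_1(\mathfrak X,*)$ is $2d-2$; and every peripheral class of $\pi_1(\mathfrak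 Y,\dagger)$ occurs exactly once among all lifts of the peripheral classes of $\pi_1(\mathfrak X,*)$, all other lifts being trivial. -/

import Mathlib

universe u

/-! ## Sphere groups -/

/-- `(G, P)` is a sphere group: `G = ⟨γ₁, …, γₙ ∣ γ₁ ⋯ γₙ⟩` with `n ≠ 1`, and `P` is the set of the
conjugacy classes of `γ₁, …, γₙ`, the peripheral classes of `G`. In such a group the classes of
`γ₁, …, γₙ` are pairwise distinct, and any reordering of them arises from another choice of
generators, so that the set `P` carries the same information as the tuple of classes. -/
def IsSphereGroup {G : Type*} [Group G] (P : Set (ConjClasses G)) : Prop :=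
  ∃ (n : ℕ) (γ : Fin n → G), n ≠ 1 ∧
    Function.Surjective (FreeGroup.lift γ) ∧
    (FreeGroup.lift γ).ker =
      Subgroup.normalClosure {(List.ofFn fun i : Fin n => FreeGroup.of i).prod} ∧
    P = Set.range fun i => ConjClasses.mk (γ i)

/-! ## Bisets

An `H`-`G`-biset is a type `B` with commuting actions of `H` and of `Gᵐᵒᵖ`; the right translate
`b g` is `MulOpposite.op g • b`. -/

namespace Biset

section

variable (H : Type*) {G B : Type*} [Group H] [Group G] [MulAction H B] [MulAction Gᵐᵒᵖ B]
  [SMulCommClass H Gᵐᵒᵖ B]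

/-- The set `{·} ⊗_H B` of left orbits. -/
abbrev LeftOrbits (H B : Type*) [Group H] [MulAction H B] : Type _ :=
  MulAction.orbitRel.Quotient H B

/-- The class of `b` in `{·} ⊗_H B`. -/
def leftOrbit (b : B) : LeftOrbits H B := Quotient.mk'' b

theorem leftOrbit_op_smul (g : G) (a b : B) (h : leftOrbit H a = leftOrbit H b) :
    leftOrbit H (MulOpposite.op g • a) = leftOrbit H (MulOpposite.op g • b) := by
  obtain ⟨k, hk⟩ := Quotient.exact h
  refine Quotient.sound ⟨k, ?_⟩
  change k • b = a at hk
  change k • MulOpposite.op g • b = MulOpposite.op g • a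
  rw [smul_comm, hk]

/-- Right translation by `g` on `{·} ⊗_H B`. -/
def rightMap (g : G) (x : LeftOrbits H B) : LeftOrbits H B :=
  Quotient.liftOn x (fun b => leftOrbit H (MulOpposite.op g • b))
    fun a b h => leftOrbit_op_smul H g a b (Quotient.sound h)

theorem rightMap_leftOrbit (g : G) (b : B) :
    rightMap H g (leftOrbit H b) = leftOrbit H (MulOpposite.op g • b) := rfl

/-- The permutation of `{·} ⊗_H B` induced by the right action of `g`. -/
def rightPerm (g : G) : Equiv.Perm (LeftOrbits H B) where
  toFun := rightMap H g
  invFun := rightMap H g⁻¹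
  left_inv x := by
    induction x using Quotient.inductionOn with
    | h b => change rightMap H g⁻¹ (rightMap H g (leftOrbit H b)) = leftOrbit H b
             simp [rightMap_leftOrbit]
  right_inv x := by
    induction x using Quotient.inductionOn with
    | h b => change rightMap H g (rightMap H g⁻¹ (leftOrbit H b)) = leftOrbit H b
             simp [rightMap_leftOrbit]

/-- The cycles of `g` on `{·} ⊗_H B`, that is, the orbits of the right action of `g`. -/
abbrev Cycle (H : Type*) {G : Type*} (B : Type*) [Group H] [Group G] [MulAction H B]
    [MulAction Gᵐᵒᵖ B] [SMulCommClass H Gᵐᵒᵖ B] (g : G) : Type _ :=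
  MulAction.orbitRel.Quotient (Subgroup.zpowers (rightPerm H (B := B) g)) (LeftOrbits H B)

variable {H}

/-- The length of a cycle. -/
noncomputable def Cycle.length {g : G} (c : Cycle H B g) : ℕ := Nat.card c.orbit

/-- `C` is the conjugacy class attached to the cycle `c` in the multiset of lifts of `g`: it is the
class of an `h` with `h s = s g ^ d`, where `s` lies over `c` and `d` is the length of `c`. -/
def Cycle.IsLift {g : G} (c : Cycle H B g) (C : ConjClasses H) : Prop :=
  ∃ (s : B) (h : H), leftOrbit H s ∈ c.orbit ∧ h • s = MulOpposite.op (g ^ c.length) • s ∧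
    C = ConjClasses.mk h

/-- The biset `B` is left-free. -/
def IsLeftFree (H B : Type*) [Group H] [MulAction H B] : Prop :=
  ∀ (h : H) (b : B), h • b = b → h = 1

/-- The biset `B` is right-transitive. -/
def IsRightTransitive (G B : Type*) [Group G] [MulAction Gᵐᵒᵖ B] : Prop :=
  Nonempty B ∧ ∀ b b' : B, ∃ g : G, MulOpposite.op g • b = b'

/-- The `H`-`G`-biset `B` is transitive. -/
def IsTransitive (H G B : Type*) [Group H] [Group G] [MulAction H B] [MulAction Gᵐᵒᵖ B] : Prop :=
  Nonempty B ∧ ∀ b b' : B, ∃ (h : H) (g : G), b' = h • MulOpposite.op g • b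

/-- The `H`-`G`-biset `B` is a sphere biset with respect to the peripheral classes `PH` of `H` and
`PG` of `G`. -/
structure IsSphereBiset (PH : Set (ConjClasses H)) (PG : Set (ConjClasses G)) (B : Type*)
    [MulAction H B] [MulAction Gᵐᵒᵖ B] [SMulCommClass H Gᵐᵒᵖ B] : Prop where
  left_sphere : IsSphereGroup PH
  right_sphere : IsSphereGroup PG
  left_free : IsLeftFree H B
  right_transitive : IsRightTransitive G B
  /-- The degree `d`, the number of left orbits, is finite. -/
  finite_degree : Finite (LeftOrbits H B)
  /-- For all representatives `γ` of the peripheral classes, the lengths of the cycles satisfy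
  `∑ (length - 1) = 2 d - 2`. -/
  riemann_hurwitz : ∀ γ : PG → G, (∀ c, ConjClasses.mk (γ c) = c) →
    ∑ᶠ (c : PG) (o : Cycle H B (γ c)), ((o.length : ℤ) - 1) =
      2 * (Nat.card (LeftOrbits H B) : ℤ) - 2
  /-- Every class in `PH` occurs exactly once in the multiset of all lifts of classes in `PG`. -/
  lift_unique : ∀ γ : PG → G, (∀ c, ConjClasses.mk (γ c) = c) →
    ∀ D ∈ PH, ∃! i : (Σ c : PG, Cycle H B (γ c)), i.2.IsLift D
  /-- All other lifts of classes in `PG` are trivial. -/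
  lift_trivial : ∀ γ : PG → G, (∀ c, ConjClasses.mk (γ c) = c) →
    ∀ (i : Σ c : PG, Cycle H B (γ c)) (D : ConjClasses H), i.2.IsLift D →
      D ∈ PH ∨ D = ConjClasses.mk 1

variable (H G) in
/-- The stabilizer in `H` of `b ⊗ {·}` in `B ⊗_G {·}`. -/
def leftStab (b : B) : Subgroup H where
  carrier := {h | h • b ∈ MulAction.orbit Gᵐᵒᵖ b}
  one_mem' := by simp
  mul_mem' := by
    rintro a c ⟨g, hg⟩ ⟨k, hk⟩
    refine ⟨k * g, ?_⟩
    change g • b = a • b at hg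
    change k • b = c • b at hk
    change (k * g) • b = (a * c) • b
    rw [mul_smul, mul_smul, ← hk, hg, ← smul_comm]
  inv_mem' := by
    rintro a ⟨g, hg⟩
    refine ⟨g⁻¹, ?_⟩
    change g • b = a • b at hg
    change g⁻¹ • b = a⁻¹ • b
    rw [inv_smul_eq_iff, ← smul_comm, hg, inv_smul_smul]

/-- The right orbit `b G`, which is the `P`-`G`-biset `P b G` for `P` the stabilizer of `b ⊗ {·}`. -/
abbrev RightOrbit (G : Type*) {B : Type*} [Group G] [MulAction Gᵐᵒᵖ B] (b : B) : Type _ :=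
  MulAction.orbit Gᵐᵒᵖ b

instance (b : B) : MulAction (leftStab H G b) (RightOrbit G b) where
  smul h x := ⟨(h : H) • (x : B), by
    obtain ⟨g, hg⟩ := h.2
    obtain ⟨k, hk⟩ := x.2
    refine ⟨k * g, ?_⟩
    change g • b = (h : H) • b at hg
    change k • b = (x : B) at hk
    change (k * g) • b = (h : H) • (x : B)
    rw [← hk, mul_smul, hg, ← smul_comm]⟩
  one_smul x := Subtype.ext (one_smul H (x : B))
  mul_smul h k x := Subtype.ext (mul_smul (h : H) (k : H) (x : B))

instance (b : B) : SMulCommClass (leftStab H G b) Gᵐᵒᵖ (RightOrbit G b) where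
  smul_comm h g x := Subtype.ext (smul_comm (h : H) g (x : B))

end

end Biset

/-! ## Graphs -/

/-- A graph: a set with an origin map `x ↦ x⁻` and an involution `x ↦ x̄`. Its vertices are the `x`
with `x⁻ = x`, equivalently `x̄ = x`; the other elements are its (oriented) edges. -/
structure Graph' where
  carrier : Type u
  src : carrier → carrier
  bar : carrier → carrier
  bar_bar : ∀ x, bar (bar x) = x
  src_src : ∀ x, src (src x) = src x
  bar_src : ∀ x, bar (src x) = src x
  src_eq_of_bar_eq : ∀ x, bar x = x → src x = x

namespace Graph'

variable (Γ : Graph'.{u})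

/-- `x` is an edge. -/
def IsEdge (x : Γ.carrier) : Prop := Γ.src x ≠ x

/-- The set of vertices. -/
def Vert : Type u := {x : Γ.carrier // Γ.src x = x}

/-- The origin of `x`, as a vertex. -/
def o (x : Γ.carrier) : Γ.Vert := ⟨Γ.src x, Γ.src_src x⟩

/-- The end of `x`, as a vertex. -/
def t (x : Γ.carrier) : Γ.Vert := Γ.o (Γ.bar x)

/-- The simple graph of adjacency. -/
def toSimpleGraph : SimpleGraph Γ.Vert where
  Adj v w := v ≠ w ∧ ∃ x, Γ.o x = v ∧ Γ.t x = w
  symm := ⟨fun v w h => ⟨h.1.symm, by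
    obtain ⟨x, hx, hy⟩ := h.2
    exact ⟨Γ.bar x, hy, by rw [t, Γ.bar_bar, hx]⟩⟩⟩
  loopless := ⟨fun v h => h.1 rfl⟩

/-- A tree: no loops, no multiple edges, and the adjacency graph is a tree. -/
structure IsTree : Prop where
  no_loop : ∀ x, Γ.IsEdge x → Γ.o x ≠ Γ.t x
  no_multiple : ∀ x y, Γ.IsEdge x → Γ.IsEdge y → Γ.o x = Γ.o y → Γ.t x = Γ.t y → x = y
  isTree : Γ.toSimpleGraph.IsTree

end Graph'

/-- A graph morphism; it may send edges to vertices. -/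
structure IsGraphMorphism (Γ Δ : Graph'.{u}) (f : Γ.carrier → Δ.carrier) : Prop where
  map_src : ∀ x, f (Γ.src x) = Δ.src (f x)
  map_bar : ∀ x, f (Γ.bar x) = Δ.bar (f x)

/-- The action of a graph morphism on vertices. -/
def IsGraphMorphism.onVert {Γ Δ : Graph'.{u}} {f : Γ.carrier → Δ.carrier}
    (hf : IsGraphMorphism Γ Δ f) (v : Γ.Vert) : Δ.Vert :=
  ⟨f v.1, by rw [← hf.map_src, v.2]⟩

theorem IsGraphMorphism.onVert_o {Γ Δ : Graph'.{u}} {f : Γ.carrier → Δ.carrier}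
    (hf : IsGraphMorphism Γ Δ f) (x : Γ.carrier) : hf.onVert (Γ.o x) = Δ.o (f x) :=
  Subtype.ext (hf.map_src x)

theorem IsGraphMorphism.onVert_t {Γ Δ : Graph'.{u}} {f : Γ.carrier → Δ.carrier}
    (hf : IsGraphMorphism Γ Δ f) (x : Γ.carrier) : hf.onVert (Γ.t x) = Δ.t (f x) :=
  Subtype.ext (by
    change f (Γ.src (Γ.bar x)) = Δ.src (Δ.bar (f x))
    rw [hf.map_src, hf.map_bar])

/-! ## Graphs of groups -/

section

variable {ι : Type*} (G : ι → Type*) [∀ i, Group (G i)]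

/-- Transport in a family of groups along an equality of indices. -/
def transport {x y : ι} (h : x = y) : G x →* G y := h ▸ MonoidHom.id (G x)

@[simp] theorem transport_rfl {x : ι} (g : G x) : transport G rfl g = g := rfl

end

/-- A graph of groups: a graph with a group `G x` for every vertex and every edge `x`, and
homomorphisms `g ↦ g⁻` from `G x` to `G x⁻` and `g ↦ ḡ` from `G x` to `G x̄`, the second being
involutive, and both being the identity when `x` is a vertex. -/
structure GraphOfGroups where
  graph : Graph'.{u}
  G : graph.carrier → Type u
  [group : ∀ x, Group (G x)]
  minus : ∀ x, G x →* G (graph.src x)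
  inv : ∀ x, G x →* G (graph.bar x)
  inv_inv : ∀ x g, transport G (graph.bar_bar x) (inv (graph.bar x) (inv x g)) = g
  minus_vertex : ∀ x (h : graph.src x = x) g, transport G h (minus x g) = g
  inv_vertex : ∀ x (h : graph.bar x = x) g, transport G h (inv x g) = g

attribute [instance] GraphOfGroups.group

namespace GraphOfGroups

variable (X : GraphOfGroups.{u})

/-- The set of vertices. -/
abbrev Vert : Type u := X.graph.Vert

/-- `g ↦ g⁻`, with its target named up to equality. -/
def minusTo {x v : X.graph.carrier} (h : X.graph.src x = v) : X.G x →* X.G v :=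
  (transport X.G h).comp (X.minus x)

/-- `g ↦ ḡ`, with its target named up to equality. -/
def invTo {x y : X.graph.carrier} (h : X.graph.bar x = y) : X.G x →* X.G y :=
  (transport X.G h).comp (X.inv x)

/-- The relators of the path group: those of the vertex groups, `v = 1` for vertices `v`,
`x x̄ = 1`, and `x̄ g⁻ x = g⁺` for `g ∈ G x`, where `g⁺ = (ḡ)⁻`. -/
inductive IsRelator : FreeGroup ((Σ v : X.Vert, X.G v.1) ⊕ X.graph.carrier) → Prop
  | mul (v : X.Vert) (g h : X.G v.1) : IsRelator
      (.of (.inl ⟨v, g⟩) * .of (.inl ⟨v, h⟩) * (.of (.inl ⟨v, g * h⟩))⁻¹)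
  | vertex (v : X.Vert) : IsRelator (.of (.inr v.1))
  | bar (x : X.graph.carrier) : IsRelator (.of (.inr x) * .of (.inr (X.graph.bar x)))
  | conj (x : X.graph.carrier) (g : X.G x) : IsRelator
      (.of (.inr (X.graph.bar x)) * .of (.inl ⟨X.graph.o x, X.minus x g⟩) * .of (.inr x) *
        (.of (.inl ⟨X.graph.t x, X.minus (X.graph.bar x) (X.inv x g)⟩))⁻¹)

/-- The path group: it is generated by the vertex groups and by the edges. -/
abbrev PathGroup : Type u := PresentedGroup {r | X.IsRelator r}

/-- The element of the path group given by an element of a vertex group. -/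
def ofVert (v : X.Vert) (g : X.G v.1) : X.PathGroup := PresentedGroup.of (.inl ⟨v, g⟩)

/-- The element of the path group given by an edge (or by a vertex, which gives `1`). -/
def ofEdge (x : X.graph.carrier) : X.PathGroup := PresentedGroup.of (.inr x)

theorem ofVert_mul (v : X.Vert) (g h : X.G v.1) :
    X.ofVert v g * X.ofVert v h = X.ofVert v (g * h) := by
  have := PresentedGroup.one_of_mem (rels := {r | X.IsRelator r}) (IsRelator.mul v g h)
  simp only [map_mul, map_inv] at this
  exact mul_inv_eq_one.1 this

theorem ofVert_one (v : X.Vert) : X.ofVert v 1 = 1 := by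
  have := X.ofVert_mul v 1 1
  rwa [mul_one, mul_eq_left] at this

theorem ofVert_inv (v : X.Vert) (g : X.G v.1) : X.ofVert v g⁻¹ = (X.ofVert v g)⁻¹ := by
  rw [eq_inv_iff_mul_eq_one, X.ofVert_mul, inv_mul_cancel, X.ofVert_one]

theorem ofEdge_bar (x : X.graph.carrier) : X.ofEdge (X.graph.bar x) = (X.ofEdge x)⁻¹ := by
  have := PresentedGroup.one_of_mem (rels := {r | X.IsRelator r}) (IsRelator.bar x)
  rw [map_mul] at this
  exact eq_inv_of_mul_eq_one_right this

/-- `X.IsPath v w a`: the element `a` of the path group belongs to `π₁(X, v, w)`, that is, it is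
represented by a group path `g₀ x₁ g₁ ⋯ xₙ gₙ` from `v` to `w`. -/
inductive IsPath : X.Vert → X.Vert → X.PathGroup → Prop
  | vert (v : X.Vert) (g : X.G v.1) : IsPath v v (X.ofVert v g)
  | edge (x : X.graph.carrier) : IsPath (X.graph.o x) (X.graph.t x) (X.ofEdge x)
  | mul {u v w : X.Vert} {a b : X.PathGroup} : IsPath u v a → IsPath v w b → IsPath u w (a * b)

theorem IsPath.inv {X : GraphOfGroups.{u}} {v w : X.Vert} {a : X.PathGroup} (h : X.IsPath v w a) :
    X.IsPath w v a⁻¹ := by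
  induction h with
  | vert v g => rw [← X.ofVert_inv]; exact .vert v _
  | edge x =>
    have := IsPath.edge (X := X) (X.graph.bar x)
    rw [X.ofEdge_bar] at this
    have e : X.graph.t (X.graph.bar x) = X.graph.o x := by
      rw [Graph'.t, X.graph.bar_bar]
    rwa [e] at this
  | mul _ _ h₁ h₂ => rw [mul_inv_rev]; exact .mul h₂ h₁

/-- The fundamental group `π₁(X, v)`. -/
def fundGroup (v : X.Vert) : Subgroup X.PathGroup where
  carrier := {a | X.IsPath v v a}
  one_mem' := by
    have := IsPath.vert (X := X) v 1
    rwa [X.ofVert_one] at this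
  mul_mem' := .mul
  inv_mem' := .inv

end GraphOfGroups

/-! ## Sphere trees of groups -/

/-- A sphere structure on a graph of groups with trivial or cyclic edge groups: a sphere group
structure on every group, a partition of the vertices into curve vertices and sphere vertices, and
for every edge `x` a generator `gen x` of its group. When it is non-trivial, this generator is sent
to an element of a peripheral class of `G x⁻`, to which `x` is said to attach; different edges attach
to different peripheral classes. (The generators on the two orientations of an edge agree: if `x` runs
from a curve vertex `c` to a sphere vertex, and `t ∈ G c` generates the class to which `x` attaches,
then the other edge at `c` attaches to the class of `t⁻¹`. The values `gen v` at vertices `v` are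
irrelevant. The sphere structure of an infinite cyclic group has the classes of its two generators.) -/
structure SphereStructure (X : GraphOfGroups.{u}) where
  per : ∀ x, Set (ConjClasses (X.G x))
  isSphere : ∀ x, IsSphereGroup (per x)
  IsCurve : X.Vert → Prop
  gen : ∀ x, X.G x
  gen_generates : ∀ x, X.graph.IsEdge x → ∀ g, g ∈ Subgroup.zpowers (gen x)
  inv_gen : ∀ x, X.graph.IsEdge x → X.inv x (gen x) = gen (X.graph.bar x)
  minus_injective : ∀ x, Function.Injective (X.minus x)
  gen_mem : ∀ x, X.graph.IsEdge x → gen x ≠ 1 →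
    ConjClasses.mk (X.minus x (gen x)) ∈ per (X.graph.src x)
  attach_injective : ∀ (v : X.graph.carrier) (x y : X.graph.carrier)
    (hx : X.graph.src x = v) (hy : X.graph.src y = v), X.graph.IsEdge x → X.graph.IsEdge y →
    gen x ≠ 1 → gen y ≠ 1 →
    ConjClasses.mk (X.minusTo hx (gen x)) = ConjClasses.mk (X.minusTo hy (gen y)) → x = y

namespace SphereStructure

variable {X : GraphOfGroups.{u}} (S : SphereStructure X)

/-- A peripheral class of a vertex group is vacant if no edge attaches to it. -/
def IsVacant (v : X.Vert) (c : ConjClasses (X.G v.1)) : Prop :=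
  c ∈ S.per v.1 ∧ ∀ (x : X.graph.carrier) (hx : X.graph.src x = v.1), X.graph.IsEdge x →
    ConjClasses.mk (X.minusTo hx (S.gen x)) ≠ c

/-- The sphere structure is that of a stable sphere tree of groups: the graph is a finite tree, and
the barycentric subdivision of a smaller tree whose old vertices are the sphere vertices (every edge
joins a curve vertex and a sphere vertex, and a curve vertex is the origin of two edges); curve vertex
groups and edge groups are infinite cyclic; sphere vertex groups have at least three peripheral
classes. -/
structure IsStable : Prop where
  finite : Finite X.graph.carrier
  isTree : X.graph.IsTree
  bipartite : ∀ x, X.graph.IsEdge x → (S.IsCurve (X.graph.o x) ↔ ¬ S.IsCurve (X.graph.t x))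
  curve_valence : ∀ v, S.IsCurve v → {x | X.graph.IsEdge x ∧ X.graph.o x = v}.ncard = 2
  curve_cyclic : ∀ v, S.IsCurve v → (S.per v.1).ncard = 2
  three_le : ∀ v, ¬ S.IsCurve v → 3 ≤ (S.per v.1).ncard
  edge_ne_one : ∀ x, X.graph.IsEdge x → S.gen x ≠ 1

/-- The peripheral classes of `π₁(X, v₀)`: those of the elements `p g p⁻¹` where `g` represents a
vacant class of a vertex group `G v` and `p ∈ π₁(X, v₀, v)`. -/
def fundPer (v₀ : X.Vert) : Set (ConjClasses (X.fundGroup v₀)) :=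
  {c | ∃ (a : X.fundGroup v₀) (v : X.Vert) (g : X.G v.1) (p : X.PathGroup),
    X.IsPath v₀ v p ∧ S.IsVacant v (ConjClasses.mk g) ∧
    (a : X.PathGroup) = p * X.ofVert v g * p⁻¹ ∧ c = ConjClasses.mk a}

end SphereStructure

/-! ## Refinements -/

section Refinement

variable {P Q : GraphOfGroups.{u}}

/-- A morphism of graphs of groups; it commutes with the maps `g ↦ g⁻` up to conjugation in the target
groups, as is usual for congruences of graphs of groups. -/
structure IsGroupsMorphism (f : P.graph.carrier → Q.graph.carrier)
    (φ : ∀ x, P.G x →* Q.G (f x)) : Prop where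
  graph : IsGraphMorphism P.graph Q.graph f
  map_inv : ∀ x g, φ (P.graph.bar x) (P.inv x g) = Q.invTo (graph.map_bar x).symm (φ x g)
  map_minus : ∀ x, ∃ c : Q.G (f (P.graph.src x)), ∀ g,
    φ (P.graph.src x) (P.minus x g) = c⁻¹ * Q.minusTo (graph.map_src x).symm (φ x g) * c

variable (SP : SphereStructure P) (SQ : SphereStructure Q)

/-- `(f, φ)` is an isomorphism (a congruence) of graphs of groups with sphere structures. -/
structure IsSphereIso (f : P.graph.carrier → Q.graph.carrier)
    (φ : ∀ x, P.G x →* Q.G (f x)) : Prop where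
  hom : IsGroupsMorphism f φ
  bijective : Function.Bijective f
  groups_bijective : ∀ x, Function.Bijective (φ x)
  per : ∀ x c, c ∈ SP.per x ↔ ConjClasses.map (φ x) c ∈ SQ.per (f x)
  curve : ∀ v, SP.IsCurve v ↔ SQ.IsCurve (hom.graph.onVert v)
  gen : ∀ x, P.graph.IsEdge x → φ x (SP.gen x) = SQ.gen (f x)

/-- `P` is obtained from `Q` by splitting the curve vertex `v`, and `(f, φ)` is the retraction: the
vertex `v` is replaced by a path `l₀ - v' - l₁`, with edges `a₀` from `l₀` to `v'` and `a₁` from `l₁`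
to `v'`, where `v'` is a sphere vertex and `l₀`, `l₁` are curve vertices, with groups equal to that of
`v`; one of the two edges at `v` now starts at `l₀` and the other one at `l₁`. -/
structure IsSplitAt (f : P.graph.carrier → Q.graph.carrier) (φ : ∀ x, P.G x →* Q.G (f x))
    (v : Q.Vert) (v' l₀ l₁ : P.Vert) (a₀ a₁ e₀ e₁ : P.graph.carrier) : Prop where
  hom : IsGroupsMorphism f φ
  v_curve : SQ.IsCurve v
  distinct : v' ≠ l₀ ∧ v' ≠ l₁ ∧ l₀ ≠ l₁
  a₀_ends : P.graph.o a₀ = l₀ ∧ P.graph.t a₀ = v'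
  a₁_ends : P.graph.o a₁ = l₁ ∧ P.graph.t a₁ = v'
  fiber : ∀ x, f x = v.1 ↔
    x ∈ ({v'.1, l₀.1, l₁.1, a₀, P.graph.bar a₀, a₁, P.graph.bar a₁} : Set P.graph.carrier)
  off_fiber : ∀ y, y ≠ v.1 → ∃! x, f x = y
  edges : {y | Q.graph.IsEdge y ∧ Q.graph.o y = v} = {f e₀, f e₁} ∧ f e₀ ≠ f e₁
  edges_origin : P.graph.o e₀ = l₀ ∧ P.graph.o e₁ = l₁
  groups_bijective : ∀ x, Function.Bijective (φ x)
  per : ∀ x c, c ∈ SP.per x ↔ ConjClasses.map (φ x) c ∈ SQ.per (f x)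
  curve_new : ¬ SP.IsCurve v' ∧ SP.IsCurve l₀ ∧ SP.IsCurve l₁
  curve : ∀ u : P.Vert, f u.1 ≠ v.1 → (SP.IsCurve u ↔ SQ.IsCurve (hom.graph.onVert u))
  gen : ∀ x, P.graph.IsEdge x → f x ≠ v.1 → φ x (SP.gen x) = SQ.gen (f x)

/-- `P` is obtained from `Q` by adding an edge at the vertex `v`, and `(f, φ)` is the retraction: a
path `v - l - w`, with edges `e₀` from `v` to `l` and `e₁` from `l` to `w`, is attached at `v` (whose
copy in `P` is `v'`), where `l` is a curve vertex and `w` a sphere vertex. The new groups are (up to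
conjugation) the subgroup generated by `h`, where `h` is trivial or represents a vacant peripheral
class of `v`, to which `e₀` attaches. -/
structure IsEdgeAddedAt (f : P.graph.carrier → Q.graph.carrier) (φ : ∀ x, P.G x →* Q.G (f x))
    (v : Q.Vert) (h : Q.G v.1) (v' l w : P.Vert) (e₀ e₁ : P.graph.carrier) : Prop where
  hom : IsGroupsMorphism f φ
  trivial_or_vacant : h = 1 ∨ SQ.IsVacant v (ConjClasses.mk h)
  distinct : v' ≠ l ∧ v' ≠ w ∧ l ≠ w
  e₀_ends : P.graph.o e₀ = v' ∧ P.graph.t e₀ = l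
  e₁_ends : P.graph.o e₁ = l ∧ P.graph.t e₁ = w
  fiber : ∀ x, f x = v.1 ↔
    x ∈ ({v'.1, l.1, w.1, e₀, P.graph.bar e₀, e₁, P.graph.bar e₁} : Set P.graph.carrier)
  off_fiber : ∀ y, y ≠ v.1 → ∃! x, f x = y
  edges_origin : ∀ x, f x ≠ v.1 → f (P.graph.src x) = v.1 → P.graph.o x = v'
  groups_injective : ∀ x, Function.Injective (φ x)
  groups_new : ∀ x,
    x ∈ ({l.1, w.1, e₀, P.graph.bar e₀, e₁, P.graph.bar e₁} : Set P.graph.carrier) →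
    ∀ hx : f x = v.1, ∃ k : Q.G (f x), IsConj (transport Q.G hx k) h ∧
      (φ x).range = Subgroup.zpowers k
  groups_old : ∀ x,
    x ∉ ({l.1, w.1, e₀, P.graph.bar e₀, e₁, P.graph.bar e₁} : Set P.graph.carrier) →
    Function.Bijective (φ x) ∧ ∀ c, c ∈ SP.per x ↔ ConjClasses.map (φ x) c ∈ SQ.per (f x)
  curve_new : SP.IsCurve l ∧ ¬ SP.IsCurve w
  curve : ∀ u : P.Vert, u ≠ l → u ≠ w → (SP.IsCurve u ↔ SQ.IsCurve (hom.graph.onVert u))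
  gen_new : ∀ hx : f e₀ = v.1, IsConj (transport Q.G hx (φ e₀ (SP.gen e₀))) h
  gen : ∀ x, P.graph.IsEdge x → f x ≠ v.1 → φ x (SP.gen x) = SQ.gen (f x)

/-- `P` is a sphere refinement of `Y`, with retraction `(f, φ)`: it is obtained from `Y`, up to
isomorphism, by finitely many times splitting a curve vertex or adding an edge. -/
inductive IsRefinement {Y : GraphOfGroups.{u}} (SY : SphereStructure Y) :
    ∀ {P : GraphOfGroups.{u}} (_ : SphereStructure P) (f : P.graph.carrier → Y.graph.carrier)
      (_ : ∀ x, P.G x →* Y.G (f x)), Prop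
  | iso {P : GraphOfGroups.{u}} (SP : SphereStructure P) (f : P.graph.carrier → Y.graph.carrier)
      (φ : ∀ x, P.G x →* Y.G (f x)) (h : IsSphereIso SP SY f φ) : IsRefinement SY SP f φ
  | split {P Q : GraphOfGroups.{u}} (SP : SphereStructure P) (SQ : SphereStructure Q)
      (f : Q.graph.carrier → Y.graph.carrier) (φ : ∀ x, Q.G x →* Y.G (f x))
      (f' : P.graph.carrier → Q.graph.carrier) (φ' : ∀ x, P.G x →* Q.G (f' x))
      (v : Q.Vert) (v' l₀ l₁ : P.Vert) (a₀ a₁ e₀ e₁ : P.graph.carrier)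
      (h : IsRefinement SY SQ f φ) (h' : IsSplitAt SP SQ f' φ' v v' l₀ l₁ a₀ a₁ e₀ e₁) :
      IsRefinement SY SP (fun x => f (f' x)) (fun x => (φ (f' x)).comp (φ' x))
  | addEdge {P Q : GraphOfGroups.{u}} (SP : SphereStructure P) (SQ : SphereStructure Q)
      (f : Q.graph.carrier → Y.graph.carrier) (φ : ∀ x, Q.G x →* Y.G (f x))
      (f' : P.graph.carrier → Q.graph.carrier) (φ' : ∀ x, P.G x →* Q.G (f' x))
      (v : Q.Vert) (k : Q.G v.1) (v' l w : P.Vert) (e₀ e₁ : P.graph.carrier)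
      (h : IsRefinement SY SQ f φ) (h' : IsEdgeAddedAt SP SQ f' φ' v k v' l w e₀ e₁) :
      IsRefinement SY SP (fun x => f (f' x)) (fun x => (φ (f' x)).comp (φ' x))

end Refinement

/-! ## Graphs of bisets -/

/-- Transport in a family of types along an equality of indices. -/
def transportFun {ι : Type*} (B : ι → Type*) {x y : ι} (h : x = y) (b : B x) : B y := h ▸ b

/-- A `Y`-`X`-graph of bisets: a graph with graph morphisms `lam` to `Y` and `rho` to `X`, for every
vertex and every edge `z` a `G (lam z)`-`G (rho z)`-biset `B z`, and intertwiners `b ↦ b⁻` from `B z` to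
`B z⁻` and `b ↦ b̄` from `B z` to `B z̄`, the second being involutive, and both being the identity
when `z` is a vertex. -/
structure GraphOfBisets (Y X : GraphOfGroups.{u}) where
  graph : Graph'.{u}
  lam : graph.carrier → Y.graph.carrier
  rho : graph.carrier → X.graph.carrier
  lam_morphism : IsGraphMorphism graph Y.graph lam
  rho_morphism : IsGraphMorphism graph X.graph rho
  B : graph.carrier → Type u
  [leftAction : ∀ z, MulAction (Y.G (lam z)) (B z)]
  [rightAction : ∀ z, MulAction (X.G (rho z))ᵐᵒᵖ (B z)]
  [comm : ∀ z, SMulCommClass (Y.G (lam z)) (X.G (rho z))ᵐᵒᵖ (B z)]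
  minus : ∀ z, B z → B (graph.src z)
  minus_smul : ∀ z (h : Y.G (lam z)) (b : B z),
    minus z (h • b) = Y.minusTo (lam_morphism.map_src z).symm h • minus z b
  minus_op_smul : ∀ z (g : X.G (rho z)) (b : B z), minus z (MulOpposite.op g • b) =
    MulOpposite.op (X.minusTo (rho_morphism.map_src z).symm g) • minus z b
  inv : ∀ z, B z → B (graph.bar z)
  inv_smul : ∀ z (h : Y.G (lam z)) (b : B z),
    inv z (h • b) = Y.invTo (lam_morphism.map_bar z).symm h • inv z b
  inv_op_smul : ∀ z (g : X.G (rho z)) (b : B z), inv z (MulOpposite.op g • b) =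
    MulOpposite.op (X.invTo (rho_morphism.map_bar z).symm g) • inv z b
  inv_inv : ∀ z b, transportFun B (graph.bar_bar z) (inv (graph.bar z) (inv z b)) = b
  minus_vertex : ∀ z (h : graph.src z = z) b, transportFun B h (minus z b) = b
  inv_vertex : ∀ z (h : graph.bar z = z) b, transportFun B h (inv z b) = b

attribute [instance] GraphOfBisets.leftAction GraphOfBisets.rightAction GraphOfBisets.comm

namespace GraphOfBisets

variable {Y X : GraphOfGroups.{u}} (𝔅 : GraphOfBisets Y X)

/-- `b ↦ b⁻`, with its target named up to equality. -/
def minusTo {z v : 𝔅.graph.carrier} (h : 𝔅.graph.src z = v) (b : 𝔅.B z) : 𝔅.B v :=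
  transportFun 𝔅.B h (𝔅.minus z b)

/-- The image in `Y` of a vertex. -/
def lamV (z : 𝔅.graph.Vert) : Y.Vert := 𝔅.lam_morphism.onVert z

/-- The image in `X` of a vertex. -/
def rhoV (z : 𝔅.graph.Vert) : X.Vert := 𝔅.rho_morphism.onVert z

theorem lam_src {z v : 𝔅.graph.carrier} (h : 𝔅.graph.src z = v) :
    Y.graph.src (𝔅.lam z) = 𝔅.lam v := by
  rw [← 𝔅.lam_morphism.map_src, h]

/-- The graph of bisets is left-free: `rho` sends edges to edges; it is left-fibrant, namely for every
vertex `v` and every edge `f` of `X` with `f⁻ = rho v` the map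
`⨆ G (lam v) ⊗_{G (lam e)} B e → B v`, `h ⊗ b ↦ h b⁻`, over the disjoint union of all edges `e` with
`rho e = f` and `e⁻ = v`, is bijective; and all bisets are left-free. -/
structure IsLeftFree : Prop where
  simplicial : ∀ z, 𝔅.graph.IsEdge z → X.graph.IsEdge (𝔅.rho z)
  fibrant_surjective : ∀ (v : 𝔅.graph.Vert) (f : X.graph.carrier), X.graph.IsEdge f →
    X.graph.src f = 𝔅.rho v.1 → ∀ b : 𝔅.B v.1,
    ∃ (e : 𝔅.graph.carrier) (he : 𝔅.graph.src e = v.1) (h : Y.G (𝔅.lam v.1)) (b' : 𝔅.B e),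
      𝔅.rho e = f ∧ h • 𝔅.minusTo he b' = b
  /-- If two classes `h₁ ⊗ b₁` and `h₂ ⊗ b₂` have the same image, then they are equal: they belong to
  the same edge `e`, and there is a `k` in `G (lam e)` with `h₁ = h₂ k⁻` and `k b₁ = b₂`. -/
  fibrant_injective : ∀ (v : 𝔅.graph.Vert) (e₁ e₂ : 𝔅.graph.carrier)
    (he₁ : 𝔅.graph.src e₁ = v.1) (he₂ : 𝔅.graph.src e₂ = v.1),
    𝔅.graph.IsEdge e₁ → 𝔅.graph.IsEdge e₂ → 𝔅.rho e₁ = 𝔅.rho e₂ →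
    ∀ (h₁ h₂ : Y.G (𝔅.lam v.1)) (b₁ : 𝔅.B e₁) (b₂ : 𝔅.B e₂),
      h₁ • 𝔅.minusTo he₁ b₁ = h₂ • 𝔅.minusTo he₂ b₂ →
      ∃ (e : e₁ = e₂) (k : Y.G (𝔅.lam e₂)),
        h₁ = h₂ * Y.minusTo (𝔅.lam_src he₂) k ∧ k • transportFun 𝔅.B e b₁ = b₂
  left_free : ∀ z, Biset.IsLeftFree (Y.G (𝔅.lam z)) (𝔅.B z)

/-! ### The fundamental biset -/

/-- The triples `(q, b, p)` with `b ∈ B z`, `q ∈ π₁(Y, v₀, lam z)` and `p ∈ π₁(X, rho z, w₀)`, for the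
vertices `z`. -/
structure FundTriple (v₀ : Y.Vert) (w₀ : X.Vert) : Type u where
  z : 𝔅.graph.Vert
  q : Y.PathGroup
  hq : Y.IsPath v₀ (𝔅.lamV z) q
  b : 𝔅.B z.1
  p : X.PathGroup
  hp : X.IsPath (𝔅.rhoV z) w₀ p

variable {𝔅} in
/-- The relations `(q g, b, p) = (q, g b, p)`, `(q, b g, p) = (q, b, g p)` (which define tensor
products over the vertex groups) and `q b⁻ p = q (lam z) b⁺ (rho z)̄  p` for `b ∈ B z`. -/
inductive FundRel {v₀ : Y.Vert} {w₀ : X.Vert} :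
    𝔅.FundTriple v₀ w₀ → 𝔅.FundTriple v₀ w₀ → Prop
  | left (z : 𝔅.graph.Vert) (q : Y.PathGroup) (hq : Y.IsPath v₀ (𝔅.lamV z) q)
      (g : Y.G (𝔅.lam z.1)) (b : 𝔅.B z.1) (p : X.PathGroup) (hp : X.IsPath (𝔅.rhoV z) w₀ p) :
      FundRel ⟨z, q * Y.ofVert (𝔅.lamV z) g, hq.mul (.vert (𝔅.lamV z) g), b, p, hp⟩
        ⟨z, q, hq, g • b, p, hp⟩
  | right (z : 𝔅.graph.Vert) (q : Y.PathGroup) (hq : Y.IsPath v₀ (𝔅.lamV z) q)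
      (g : X.G (𝔅.rho z.1)) (b : 𝔅.B z.1) (p : X.PathGroup) (hp : X.IsPath (𝔅.rhoV z) w₀ p) :
      FundRel ⟨z, q, hq, MulOpposite.op g • b, p, hp⟩
        ⟨z, q, hq, b, X.ofVert (𝔅.rhoV z) g * p, .mul (.vert (𝔅.rhoV z) g) hp⟩
  | edge (z : 𝔅.graph.carrier) (q : Y.PathGroup) (hq : Y.IsPath v₀ (𝔅.lamV (𝔅.graph.o z)) q)
      (b : 𝔅.B z) (p : X.PathGroup) (hp : X.IsPath (𝔅.rhoV (𝔅.graph.o z)) w₀ p)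
      (hq' : Y.IsPath v₀ (𝔅.lamV (𝔅.graph.t z)) (q * Y.ofEdge (𝔅.lam z)))
      (hp' : X.IsPath (𝔅.rhoV (𝔅.graph.t z)) w₀ (X.ofEdge (X.graph.bar (𝔅.rho z)) * p)) :
      FundRel ⟨𝔅.graph.o z, q, hq, 𝔅.minus z b, p, hp⟩
        ⟨𝔅.graph.t z, q * Y.ofEdge (𝔅.lam z), hq', 𝔅.minus (𝔅.graph.bar z) (𝔅.inv z b),
          X.ofEdge (X.graph.bar (𝔅.rho z)) * p, hp'⟩

/-- The two path conditions in the last relation always hold. -/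
theorem fundRel_edge_paths {v₀ : Y.Vert} {w₀ : X.Vert} (z : 𝔅.graph.carrier) {q : Y.PathGroup}
    (hq : Y.IsPath v₀ (𝔅.lamV (𝔅.graph.o z)) q) {p : X.PathGroup}
    (hp : X.IsPath (𝔅.rhoV (𝔅.graph.o z)) w₀ p) :
    Y.IsPath v₀ (𝔅.lamV (𝔅.graph.t z)) (q * Y.ofEdge (𝔅.lam z)) ∧
      X.IsPath (𝔅.rhoV (𝔅.graph.t z)) w₀ (X.ofEdge (X.graph.bar (𝔅.rho z)) * p) := by
  constructor
  · refine hq.mul ?_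
    rw [lamV, lamV, IsGraphMorphism.onVert_o, IsGraphMorphism.onVert_t]
    exact .edge _
  · refine .mul ?_ hp
    rw [rhoV, rhoV, IsGraphMorphism.onVert_o, IsGraphMorphism.onVert_t]
    have := GraphOfGroups.IsPath.edge (X := X) (X.graph.bar (𝔅.rho z))
    have e : X.graph.t (X.graph.bar (𝔅.rho z)) = X.graph.o (𝔅.rho z) := by
      rw [Graph'.t, X.graph.bar_bar]
    rwa [e] at this

/-- The fundamental biset `π₁(𝔅, v₀, w₀)`, a `π₁(Y, v₀)`-`π₁(X, w₀)`-biset. -/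
def FundBiset (v₀ : Y.Vert) (w₀ : X.Vert) : Type u := Quot (FundRel (𝔅 := 𝔅) (v₀ := v₀) (w₀ := w₀))

variable {𝔅} in
/-- Left translation of a triple. -/
def FundTriple.leftMul {v₀ : Y.Vert} {w₀ : X.Vert} (a : Y.fundGroup v₀) (x : 𝔅.FundTriple v₀ w₀) :
    𝔅.FundTriple v₀ w₀ :=
  ⟨x.z, a * x.q, .mul a.2 x.hq, x.b, x.p, x.hp⟩

variable {𝔅} in
/-- Right translation of a triple. -/
def FundTriple.rightMul {v₀ : Y.Vert} {w₀ : X.Vert} (a : X.fundGroup w₀) (x : 𝔅.FundTriple v₀ w₀) :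
    𝔅.FundTriple v₀ w₀ :=
  ⟨x.z, x.q, x.hq, x.b, x.p * a, .mul x.hp a.2⟩

theorem FundTriple.ext' {v₀ : Y.Vert} {w₀ : X.Vert} {z : 𝔅.graph.Vert} {q q' : Y.PathGroup}
    {hq : Y.IsPath v₀ (𝔅.lamV z) q} {hq' : Y.IsPath v₀ (𝔅.lamV z) q'} {b : 𝔅.B z.1}
    {p p' : X.PathGroup} {hp : X.IsPath (𝔅.rhoV z) w₀ p} {hp' : X.IsPath (𝔅.rhoV z) w₀ p'}
    (h : q = q') (h' : p = p') :
    (⟨z, q, hq, b, p, hp⟩ : 𝔅.FundTriple v₀ w₀) = ⟨z, q', hq', b, p', hp'⟩ := by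
  subst h h'; rfl

instance (v₀ : Y.Vert) (w₀ : X.Vert) : MulAction (Y.fundGroup v₀) (𝔅.FundBiset v₀ w₀) where
  smul a := Quot.map (FundTriple.leftMul a) fun x y h => by
    induction h with
    | left z q hq g b p hp =>
      have := FundRel.left z (a * q) (.mul a.2 hq) g b p hp
      simp only [mul_assoc] at this
      exact this
    | right z q hq g b p hp => exact FundRel.right z (a * q) (.mul a.2 hq) g b p hp
    | edge z q hq b p hp hq' hp' =>
      have := FundRel.edge z (a * q) (.mul a.2 hq) b p hp
        (𝔅.fundRel_edge_paths z (.mul a.2 hq) hp).1 hp'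
      simp only [mul_assoc] at this
      exact this
  one_smul x := by
    induction x using Quot.ind with
    | mk x => exact congrArg (Quot.mk _) (FundTriple.ext' 𝔅 (one_mul _) rfl)
  mul_smul a c x := by
    induction x using Quot.ind with
    | mk x => exact congrArg (Quot.mk _) (FundTriple.ext' 𝔅 (mul_assoc _ _ _) rfl)

instance (v₀ : Y.Vert) (w₀ : X.Vert) : MulAction (X.fundGroup w₀)ᵐᵒᵖ (𝔅.FundBiset v₀ w₀) where
  smul a := Quot.map (FundTriple.rightMul a.unop) fun x y h => by
    induction h with
    | left z q hq g b p hp =>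
      exact FundRel.left z q hq g b (p * a.unop) (.mul hp a.unop.2)
    | right z q hq g b p hp =>
      have := FundRel.right z q hq g b (p * a.unop) (.mul hp a.unop.2)
      simp only [← mul_assoc] at this
      exact this
    | edge z q hq b p hp hq' hp' =>
      have := FundRel.edge z q hq b (p * a.unop) (.mul hp a.unop.2) hq'
        (𝔅.fundRel_edge_paths z hq (.mul hp a.unop.2)).2
      simp only [← mul_assoc] at this
      exact this
  one_smul x := by
    induction x using Quot.ind with
    | mk x => exact congrArg (Quot.mk _) (FundTriple.ext' 𝔅 rfl (mul_one _))
  mul_smul a c x := by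
    induction x using Quot.ind with
    | mk x => exact congrArg (Quot.mk _) (FundTriple.ext' 𝔅 rfl (mul_assoc _ _ _).symm)

instance (v₀ : Y.Vert) (w₀ : X.Vert) :
    SMulCommClass (Y.fundGroup v₀) (X.fundGroup w₀)ᵐᵒᵖ (𝔅.FundBiset v₀ w₀) where
  smul_comm a c x := by
    induction x using Quot.ind with
    | mk x => rfl

/-! ### The left epic-monic factorization -/

/-- A choice of elements `b z ∈ B z`, compatible with `z ↦ z̄`, and of elements `γ z ∈ G (lam z⁻)` with
`(γ z)⁻¹ (b z)⁻ ⊗ {·} = b z⁻ ⊗ {·}` in `B z⁻ ⊗ {·}`. -/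
structure BaseChoice where
  b : ∀ z, 𝔅.B z
  b_inv : ∀ z, 𝔅.inv z (b z) = b (𝔅.graph.bar z)
  γ : ∀ z, Y.G (𝔅.lam (𝔅.graph.src z))
  γ_spec : ∀ z, (γ z)⁻¹ • 𝔅.minus z (b z) ∈
    MulAction.orbit (X.G (𝔅.rho (𝔅.graph.src z)))ᵐᵒᵖ (b (𝔅.graph.src z))
  γ_vertex : ∀ z, 𝔅.graph.src z = z → γ z = 1

variable {𝔅} (c : 𝔅.BaseChoice)

/-- The group `P z`, the stabilizer in `G (lam z)` of `b z ⊗ {·}`. -/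
abbrev BaseChoice.stab (z : 𝔅.graph.carrier) : Subgroup (Y.G (𝔅.lam z)) :=
  Biset.leftStab (Y.G (𝔅.lam z)) (X.G (𝔅.rho z)) (c.b z)

/-- The biset `B' z = P z · b z · G (rho z)`. -/
abbrev BaseChoice.part (z : 𝔅.graph.carrier) : Type u :=
  Biset.RightOrbit (X.G (𝔅.rho z)) (c.b z)

theorem BaseChoice.minus_mem (z : 𝔅.graph.carrier) (h : c.stab z) :
    (c.γ z)⁻¹ * Y.minusTo (𝔅.lam_morphism.map_src z).symm (h : Y.G (𝔅.lam z)) * c.γ z ∈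
      c.stab (𝔅.graph.src z) := by
  obtain ⟨g, hg⟩ := h.2
  obtain ⟨k, hk⟩ := c.γ_spec z
  change g • c.b z = (h : Y.G (𝔅.lam z)) • c.b z at hg
  change k • c.b (𝔅.graph.src z) = (c.γ z)⁻¹ • 𝔅.minus z (c.b z) at hk
  have hb : c.γ z • c.b (𝔅.graph.src z) = k⁻¹ • 𝔅.minus z (c.b z) := by
    rw [eq_inv_smul_iff, ← smul_comm, hk, smul_inv_smul]
  have hm := 𝔅.minus_smul z h (c.b z)
  rw [← hg, ← MulOpposite.op_unop g, 𝔅.minus_op_smul] at hm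
  refine ⟨k⁻¹ * MulOpposite.op
    (X.minusTo (𝔅.rho_morphism.map_src z).symm g.unop) * k, ?_⟩
  change (k⁻¹ * _ * k) • c.b (𝔅.graph.src z) = (_ * _ * _) • c.b (𝔅.graph.src z)
  rw [mul_smul _ (c.γ z), hb, mul_smul, mul_smul, mul_smul, hk, ← smul_comm (c.γ z)⁻¹, hm,
    smul_comm _ k⁻¹, smul_comm _ k⁻¹]

theorem BaseChoice.inv_mem (z : 𝔅.graph.carrier) (h : c.stab z) :
    Y.invTo (𝔅.lam_morphism.map_bar z).symm (h : Y.G (𝔅.lam z)) ∈ c.stab (𝔅.graph.bar z) := by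
  obtain ⟨g, hg⟩ := h.2
  change g • c.b z = (h : Y.G (𝔅.lam z)) • c.b z at hg
  have hm := 𝔅.inv_smul z h (c.b z)
  rw [← hg, ← MulOpposite.op_unop g, 𝔅.inv_op_smul, c.b_inv] at hm
  exact ⟨_, hm⟩

theorem BaseChoice.coe_transport {z w : 𝔅.graph.carrier} (e : z = w) (h : c.stab z) :
    ((transport (fun z => c.stab z) e h : c.stab w) : Y.G (𝔅.lam w)) =
      transport Y.G (congrArg 𝔅.lam e) h := by
  subst e; rfl

theorem _root_.transport_transport {ι : Type*} (G : ι → Type*) [∀ i, Group (G i)] {x y z : ι}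
    (h : x = y) (h' : y = z) (g : G x) :
    transport G h' (transport G h g) = transport G (h.trans h') g := by
  subst h h'; rfl

theorem _root_.GraphOfGroups.inv_transport {X : GraphOfGroups.{u}} {x y : X.graph.carrier}
    (h : x = y) (g : X.G x) :
    X.inv y (transport X.G h g) = transport X.G (congrArg X.graph.bar h) (X.inv x g) := by
  subst h; rfl

/-- The graph of groups with groups `P z`, with maps `h ↦ (γ z)⁻¹ h⁻ (γ z)` from `P z` to `P z⁻` and
`h ↦ h̄` from `P z` to `P z̄`. -/
def BaseChoice.groups : GraphOfGroups.{u} where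
  graph := 𝔅.graph
  G z := c.stab z
  minus z :=
    { toFun h := ⟨_, c.minus_mem z h⟩
      map_one' := Subtype.ext (by simp)
      map_mul' h k := Subtype.ext (by simp [mul_assoc]) }
  inv z :=
    { toFun h := ⟨_, c.inv_mem z h⟩
      map_one' := Subtype.ext (by simp)
      map_mul' h k := Subtype.ext (by simp) }
  inv_inv z h := Subtype.ext (by
    refine (c.coe_transport _ _).trans ?_
    change transport Y.G _ (transport Y.G _ (Y.inv _ (transport Y.G _ (Y.inv _ _)))) = _
    rw [GraphOfGroups.inv_transport, transport_transport, transport_transport]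
    exact Y.inv_inv _ _)
  minus_vertex z e h := Subtype.ext (by
    refine (c.coe_transport _ _).trans ?_
    change transport Y.G _ ((c.γ z)⁻¹ * transport Y.G _ (Y.minus _ _) * c.γ z) = _
    rw [c.γ_vertex z e, inv_one, one_mul, mul_one, transport_transport]
    exact Y.minus_vertex _ _ _)
  inv_vertex z e h := Subtype.ext (by
    refine (c.coe_transport _ _).trans ?_
    change transport Y.G _ (transport Y.G _ (Y.inv _ _)) = _
    rw [transport_transport]
    exact Y.inv_vertex _ _ _)

/-- The inclusion of `P z` in `G (lam z)`. -/
def BaseChoice.incl (z : c.groups.graph.carrier) : c.groups.G z →* Y.G (𝔅.lam z) :=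
  Subgroup.subtype (c.stab z)

end GraphOfBisets

/-- `𝔅` is a sphere tree of bisets over the sphere trees of groups `Y` and `X`. -/
structure IsSphereTreeOfBisets {Y X : GraphOfGroups.{u}} (SY : SphereStructure Y)
    (SX : SphereStructure X) (𝔅 : GraphOfBisets Y X) : Prop where
  isTree : 𝔅.graph.IsTree
  left_stable : SY.IsStable
  right_stable : SX.IsStable
  left_free : 𝔅.IsLeftFree
  transitive : ∀ z, Biset.IsTransitive (Y.G (𝔅.lam z)) (X.G (𝔅.rho z)) (𝔅.B z)
  /-- In the left epic-monic factorization `𝔅 = (Y, P) ⊗ 𝔅'`, the graph of groups `P` has a sphere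
  structure for which it is a sphere refinement of `Y`, and all bisets in `𝔅'` are sphere bisets. -/
  refinement : ∃ (c : 𝔅.BaseChoice) (SP : SphereStructure c.groups),
    IsRefinement SY SP 𝔅.lam c.incl ∧
    ∀ z, Biset.IsSphereBiset (H := c.stab z) (SP.per z) (SX.per (𝔅.rho z)) (c.part z)

set_option linter.unusedSectionVars false

open MulOpposite

/-! Groups. Gluing two sphere groups by identifying a generator of one with the inverse of a
generator of the other yields the sphere group on the remaining generators (`IsSphereOn.glue`); this
is the algebraic form of gluing two punctured spheres along a boundary circle. Adding the vertices
of a stable tree one by one, away from a root, shows that its fundamental group is the amalgam of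
the vertex groups and the sphere group on the vacant classes (`hasModel_univ`,
`IsStable.fundGroup`).

Left structure of the biset. The disjoint union of the sets π₁(Y, v₀, λ(z)) ⊗ B_z carries a right
action of the path group of X: by left-fibrancy, an edge f of X matches the points above f⁻ with
those above f⁺ (`exists_action`). Hence q ⊗ b ⊗ p determines q ⊗ b once p is fixed. This gives
left-freeness, and it shows that, for every vertex x of X, the left orbits of the fundamental biset
are the disjoint union of those of the bisets B'_z = P_z b_z G_{ρ(z)} with z above x
(`BaseChoice.isDecomposition`). Degrees, cycles and lifts can therefore be computed vertex by
vertex.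

Right-transitivity. It holds because the tree of groups P is a refinement of Y: the groups P_z and
the edges of 𝔅 together generate all group paths of Y (`IsRefinement.generatesPaths`).

Lifts. A refinement has the same vacant classes as Y (`IsRefinement.bijOn_vacant`), so it suffices
to see that vacant classes at z arise exactly from vacant classes at ρ(z). Each B'_z is a sphere
biset, and the cycles of a class to which an edge f of X attaches are the edges e of 𝔅 at z above f,
so the question is which class such a cycle lifts to. It must be the class to which e attaches, and
the delicate point is orientation: a priori the generator of the edge group could lift to the
inverse of the chosen generator of P_e. A wrong sign forces the vertex group to have only two
peripheral classes and forces wrong signs on all its edges with non-trivial group. It therefore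
spreads along such edges and would reach a vertex with three peripheral classes, which is absurd
(`IsRefinement.exists_three_le`, `edgeLift_eq`).

Riemann–Hurwitz. The formulas of the bisets B'_z are added up. The degrees above each vertex of X
sum to d, and a tree with V vertices has 2V - 2 oriented edges. After removal of the contributions
of the classes to which edges attach, what is left is 2 V_X d - 2 V_𝔅 - (2 V_X - 2) d + (2 V_𝔅 - 2)
= 2 d - 2. -/

/-! ## Presentations of sphere groups -/

/-- `G = ⟨γ₁, …, γₙ ∣ γ₁ ⋯ γₙ⟩`. -/
def IsSpherePres {G : Type*} [Group G] {n : ℕ} (γ : Fin n → G) : Prop :=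
  Function.Surjective (FreeGroup.lift γ) ∧
    (FreeGroup.lift γ).ker =
      Subgroup.normalClosure {(List.ofFn fun i : Fin n => FreeGroup.of i).prod}

namespace IsSpherePres

variable {G : Type*} [Group G] {n : ℕ} {γ : Fin n → G}

theorem map_prod_of {K : Type*} [Group K] (κ : Fin n → K) :
    FreeGroup.lift κ (List.ofFn fun i : Fin n => FreeGroup.of i).prod = (List.ofFn κ).prod := by
  rw [map_list_prod, List.map_ofFn]
  congr 2
  funext i
  simp

theorem prod_eq_one (h : IsSpherePres γ) : (List.ofFn γ).prod = 1 := by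
  rw [← map_prod_of, ← MonoidHom.mem_ker, h.2]
  exact Subgroup.subset_normalClosure rfl

theorem exists_hom (h : IsSpherePres γ) {K : Type*} [Group K] (κ : Fin n → K)
    (hκ : (List.ofFn κ).prod = 1) : ∃ φ : G →* K, ∀ i, φ (γ i) = κ i := by
  have hle : (FreeGroup.lift γ).ker ≤ (FreeGroup.lift κ).ker := by
    rw [h.2]
    refine Subgroup.normalClosure_le_normal ?_
    rintro _ rfl
    change _ ∈ (FreeGroup.lift κ).ker
    rw [MonoidHom.mem_ker, map_prod_of, hκ]
  refine ⟨(FreeGroup.lift γ).liftOfSurjective h.1 ⟨FreeGroup.lift κ, hle⟩, fun i => ?_⟩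
  have := (FreeGroup.lift γ).liftOfRightInverse_comp_apply _
    (Function.rightInverse_surjInv h.1) ⟨FreeGroup.lift κ, hle⟩ (FreeGroup.of i)
  simpa using this

theorem closure_eq_top (h : IsSpherePres γ) : Subgroup.closure (Set.range γ) = ⊤ := by
  rw [← FreeGroup.range_lift_eq_closure, MonoidHom.range_eq_top]
  exact h.1

/-- The relator contains every generator exactly once, so integer weights on the generators define a
homomorphism as soon as their sum vanishes. Such weights are what tells peripheral classes apart
below. -/
theorem exists_intHom (h : IsSpherePres γ) (v : Fin n → ℤ) (hv : ∑ i, v i = 0) :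
    ∃ φ : G →* Multiplicative ℤ, ∀ i, φ (γ i) = Multiplicative.ofAdd (v i) := by
  refine h.exists_hom _ ?_
  rw [List.prod_ofFn, ← ofAdd_sum, hv, ofAdd_zero]

/-- A homomorphism to `ℤ` mapping `γ i` to `1`, `γ j` to `-1` and all other generators to `0`. -/
theorem exists_intHom_pair (h : IsSpherePres γ) {i j : Fin n} (hij : i ≠ j) :
    ∃ φ : G →* Multiplicative ℤ, φ (γ i) = Multiplicative.ofAdd 1 ∧
      φ (γ j) = Multiplicative.ofAdd (-1) ∧ ∀ k, k ≠ i → k ≠ j → φ (γ k) = 1 := by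
  obtain ⟨φ, hφ⟩ := h.exists_intHom (Pi.single i 1 - Pi.single j 1) (by simp)
  refine ⟨φ, ?_, ?_, fun k hi hj => ?_⟩
  · rw [hφ]; simp [hij]
  · rw [hφ]; simp [hij.symm]
  · rw [hφ]; simp [hi, hj]

theorem map_eq_of_isConj {K : Type*} [CommGroup K] (φ : G →* K) {a b : G} (h : IsConj a b) :
    φ a = φ b :=
  isConj_iff_eq.1 (φ.map_isConj h)

/-- This is where `n ≠ 1` matters: a second generator is needed to receive the weight `-1`, and for
one generator the group is trivial. -/
theorem not_isConj_one (h : IsSpherePres γ) (hn : n ≠ 1) (i : Fin n) : ¬ IsConj (γ i) 1 := by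
  intro hc
  have : Nontrivial (Fin n) := Fin.nontrivial_iff_two_le.2 (by have := i.2; omega)
  obtain ⟨j, hj⟩ := exists_ne i
  obtain ⟨φ, h1, -, -⟩ := h.exists_intHom_pair hj.symm
  have := map_eq_of_isConj φ hc
  rw [h1, map_one φ, ← ofAdd_zero] at this
  exact absurd (Multiplicative.ofAdd.injective this) (by decide)

theorem isConj_injective (h : IsSpherePres γ) {i j : Fin n} (hc : IsConj (γ i) (γ j)) : i = j := by
  by_contra hij
  obtain ⟨φ, h1, h2, -⟩ := h.exists_intHom_pair hij
  have := map_eq_of_isConj φ hc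
  rw [h1, h2] at this
  exact absurd (Multiplicative.ofAdd.injective this) (by decide)

/-- If there were a third generator, it could carry the weight `-1` that balances the weight `1` of
`γ i`, and `γ j` would have weight `0`. -/
theorem eq_two_of_isConj_inv (h : IsSpherePres γ) (hn : n ≠ 1) {i j : Fin n}
    (hc : IsConj (γ i) (γ j)⁻¹) : n = 2 ∧ i ≠ j := by
  have h2 : 2 ≤ n := by have := i.2; omega
  have : Nontrivial (Fin n) := Fin.nontrivial_iff_two_le.2 h2
  have hij : i ≠ j := by
    rintro rfl
    obtain ⟨j, hj⟩ := exists_ne i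
    obtain ⟨φ, h1, -, -⟩ := h.exists_intHom_pair hj.symm
    have := map_eq_of_isConj φ hc
    rw [map_inv, h1, ← ofAdd_neg] at this
    exact absurd (Multiplicative.ofAdd.injective this) (by decide)
  refine ⟨?_, hij⟩
  by_contra hne
  obtain ⟨k, hk⟩ : ∃ k, k ∉ ({i, j} : Finset (Fin n)) := by
    by_contra! hall
    have : Finset.card (Finset.univ : Finset (Fin n)) ≤ 2 :=
      (Finset.card_le_card fun k _ => hall k).trans Finset.card_le_two
    rw [Finset.card_univ, Fintype.card_fin] at this
    omega
  simp only [Finset.mem_insert, Finset.mem_singleton, not_or] at hk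
  obtain ⟨φ, h1, -, h3⟩ := h.exists_intHom_pair (Ne.symm hk.1)
  have := map_eq_of_isConj φ hc
  rw [map_inv, h1, h3 j hij.symm (Ne.symm hk.2), inv_one] at this
  exact absurd (Multiplicative.ofAdd.injective this) (by decide)

end IsSpherePres

namespace IsSphereGroup

variable {G : Type*} [Group G] {P : Set (ConjClasses G)}

theorem finite (h : IsSphereGroup P) : P.Finite := by
  obtain ⟨n, γ, -, -, -, rfl⟩ := h
  exact Set.finite_range _

theorem ncard_ne_one (h : IsSphereGroup P) : P.ncard ≠ 1 := by
  obtain ⟨n, γ, hn, h1, h2, rfl⟩ := h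
  have hp : IsSpherePres γ := ⟨h1, h2⟩
  rw [Set.ncard_range_of_injective, Nat.card_fin]
  · exact hn
  · intro i j hij
    exact hp.isConj_injective (ConjClasses.mk_eq_mk_iff_isConj.1 hij)

theorem mk_one_notMem (h : IsSphereGroup P) : ConjClasses.mk 1 ∉ P := by
  obtain ⟨n, γ, hn, h1, h2, rfl⟩ := h
  rintro ⟨i, hi⟩
  exact IsSpherePres.not_isConj_one ⟨h1, h2⟩ hn i (ConjClasses.mk_eq_mk_iff_isConj.1 hi)

theorem eq_pair_of_inv_mem (h : IsSphereGroup P) {g : G} (hg : ConjClasses.mk g ∈ P)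
    (hg' : ConjClasses.mk g⁻¹ ∈ P) :
    P = {ConjClasses.mk g, ConjClasses.mk g⁻¹} ∧ ConjClasses.mk g ≠ ConjClasses.mk g⁻¹ := by
  obtain ⟨n, γ, hn, h1, h2, rfl⟩ := h
  have hp : IsSpherePres γ := ⟨h1, h2⟩
  obtain ⟨i, hi⟩ := hg
  obtain ⟨j, hj⟩ := hg'
  have hi' := ConjClasses.mk_eq_mk_iff_isConj.1 hi
  have hj' := ConjClasses.mk_eq_mk_iff_isConj.1 hj
  obtain ⟨h2', hij⟩ := hp.eq_two_of_isConj_inv hn (i := j) (j := i) (hj'.trans (by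
    obtain ⟨k, hk⟩ := isConj_iff.1 hi'.symm
    refine isConj_iff.2 ⟨k, ?_⟩
    rw [← hk]; group))
  subst h2'
  change ConjClasses.mk (γ i) = _ at hi
  change ConjClasses.mk (γ j) = _ at hj
  rw [← hi, ← hj]
  constructor
  · ext c
    simp only [Set.mem_range, Set.mem_insert_iff, Set.mem_singleton_iff]
    constructor
    · rintro ⟨k, rfl⟩
      have : k = i ∨ k = j := by omega
      rcases this with rfl | rfl
      exacts [.inl rfl, .inr rfl]
    · rintro (rfl | rfl)
      exacts [⟨i, rfl⟩, ⟨j, rfl⟩]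
  · intro e
    exact hij (hp.isConj_injective (ConjClasses.mk_eq_mk_iff_isConj.1 e)).symm

/-- The peripheral classes of a nontrivial cyclic sphere group are those of its generators. -/
theorem eq_pair_of_cyclic (h : IsSphereGroup P) {t : G} (ht : ∀ g, g ∈ Subgroup.zpowers t)
    (ht1 : t ≠ 1) : P = {ConjClasses.mk t, ConjClasses.mk t⁻¹} := by
  obtain ⟨n, γ, hn, h1, h2, hP⟩ := id h
  have hp : IsSpherePres γ := ⟨h1, h2⟩
  have hn0 : n ≠ 0 := by
    rintro rfl
    obtain ⟨w, hw⟩ := h1 t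
    rw [Subsingleton.elim w 1, map_one] at hw
    exact ht1 hw.symm
  -- With three generators, `γ i0 = t ^ a` and `γ i1 = t ^ b` have independent weights. The values
  -- of `φ` give `a φ(t) = 1` and `b φ(t) = 0`, so `b = 0`, against the value `1` of `ψ` on `γ i1`.
  have hn2 : n = 2 := by
    by_contra hne
    let i0 : Fin n := ⟨0, by omega⟩
    let i1 : Fin n := ⟨1, by omega⟩
    let i2 : Fin n := ⟨2, by omega⟩
    have h02 : i0 ≠ i2 := by simp [i0, i2]
    have h12 : i1 ≠ i2 := by simp [i1, i2]
    have h01 : i0 ≠ i1 := by simp [i0, i1]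
    obtain ⟨φ, a1, -, a3⟩ := hp.exists_intHom_pair h02
    obtain ⟨ψ, b1, -, -⟩ := hp.exists_intHom_pair h12
    obtain ⟨a, ha⟩ := ht (γ i0)
    obtain ⟨b, hb⟩ := ht (γ i1)
    have c1 := congrArg (fun x => (φ x).toAdd) ha
    have c2 := congrArg (fun x => (φ x).toAdd) hb
    have c3 := congrArg (fun x => (ψ x).toAdd) hb
    simp only [map_zpow, a1, a3 i1 h01.symm h12, b1, toAdd_zpow, toAdd_ofAdd, toAdd_one,
      smul_eq_mul] at c1 c2 c3
    rcases mul_eq_zero.1 c2 with e | e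
    · rw [e, zero_mul] at c3; exact absurd c3 (by decide)
    · rw [e, mul_zero] at c1; exact absurd c1 (by decide)
  subst hn2
  have hprod : γ 0 * γ 1 = 1 := by simpa using hp.prod_eq_one
  have hinv : γ 1 = (γ 0)⁻¹ := eq_inv_of_mul_eq_one_right hprod
  have hgen : ∀ g, g ∈ Subgroup.zpowers (γ 0) := by
    have hle : Subgroup.closure (Set.range γ) ≤ Subgroup.zpowers (γ 0) := by
      rw [Subgroup.closure_le]
      rintro _ ⟨i, rfl⟩
      fin_cases i
      · exact Subgroup.mem_zpowers _
      · change γ 1 ∈ _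
        rw [hinv]
        exact inv_mem (Subgroup.mem_zpowers _)
    rw [hp.closure_eq_top] at hle
    exact fun g => hle trivial
  obtain ⟨φ, a1, -, -⟩ := hp.exists_intHom_pair (i := 0) (j := 1) (by decide)
  obtain ⟨a, ha⟩ := ht (γ 0)
  obtain ⟨b, hb⟩ := hgen t
  have c1 := congrArg (fun x => (φ x).toAdd) ha
  have c2 := congrArg (fun x => (φ x).toAdd) hb
  simp only [map_zpow, a1, toAdd_zpow, toAdd_ofAdd, smul_eq_mul, mul_one] at c1 c2
  have hP' : P = {ConjClasses.mk (γ 0), ConjClasses.mk (γ 1)} := by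
    rw [hP]; ext c; simp [Fin.exists_fin_two, eq_comm]
  -- Each of `t` and `γ 0` is a power of the other, and the weight `φ` shows that the product of the
  -- two exponents is `1`.
  have hb' : b = 1 ∨ b = -1 := by
    rw [← c2] at c1
    exact Int.isUnit_iff.1 (IsUnit.of_mul_eq_one_right _ c1)
  rw [hP', hinv]
  rcases hb' with rfl | rfl
  · change γ 0 ^ (1 : ℤ) = t at hb
    rw [zpow_one] at hb; rw [hb]
  · change γ 0 ^ (-1 : ℤ) = t at hb
    rw [zpow_neg_one] at hb
    rw [← hb, inv_inv, Set.pair_comm]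

end IsSphereGroup

/-! ## Labelled presentations and gluing -/

/-- The group `A` is the sphere group on the generators `f x`, for the labels `x` in the list `ℓ`. -/
structure IsSphereOn {Λ A : Type u} [Group A] (ℓ : List Λ) (f : Λ → A) : Prop where
  nodup : ℓ.Nodup
  prod_eq_one : (ℓ.map f).prod = 1
  closure_eq_top : Subgroup.closure {a | ∃ x ∈ ℓ, f x = a} = ⊤
  exists_hom : ∀ {K : Type u} [Group K] (κ : Λ → K), (ℓ.map κ).prod = 1 →
    ∃ φ : A →* K, ∀ x ∈ ℓ, φ (f x) = κ x

namespace IsSphereOn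

variable {Λ A : Type u} [Group A] {ℓ : List Λ} {f : Λ → A}

theorem hom_ext (h : IsSphereOn ℓ f) {K : Type*} [Group K] {φ ψ : A →* K}
    (e : ∀ x ∈ ℓ, φ (f x) = ψ (f x)) : φ = ψ := by
  refine MonoidHom.eq_of_eqOn_dense h.closure_eq_top ?_
  rintro _ ⟨x, hx, rfl⟩
  exact e x hx

theorem _root_.List.ofFn_comp_get {K : Type*} {Λ : Type*} (ℓ : List Λ) (κ : Λ → K) :
    List.ofFn (fun i : Fin ℓ.length => κ (ℓ.get i)) = ℓ.map κ := by
  conv_rhs => rw [← List.ofFn_get ℓ, List.map_ofFn]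
  rfl

/-- The universal property is applied to the free group modulo the relator: the homomorphism from
`A` that it provides shows that a word trivial in `A` is already trivial in this quotient. The
`ULift` is there because the targets in `exists_hom` live in the universe `u`. -/
theorem isSpherePres (h : IsSphereOn ℓ f) : IsSpherePres fun i : Fin ℓ.length => f (ℓ.get i) := by
  have hsurj : Function.Surjective (FreeGroup.lift fun i : Fin ℓ.length => f (ℓ.get i)) := by
    rw [← MonoidHom.range_eq_top, FreeGroup.range_lift_eq_closure, ← h.closure_eq_top]
    congr 1
    ext a
    constructor
    · rintro ⟨i, rfl⟩; exact ⟨_, List.get_mem _ _, rfl⟩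
    · rintro ⟨x, hx, rfl⟩
      obtain ⟨i, rfl⟩ := List.get_of_mem hx
      exact ⟨i, rfl⟩
  refine ⟨hsurj, le_antisymm ?_ ?_⟩
  · classical
    set N := Subgroup.normalClosure
      {(List.ofFn fun i : Fin ℓ.length => FreeGroup.of i).prod} with hN
    let q : FreeGroup (Fin ℓ.length) →* ULift.{u} (FreeGroup (Fin ℓ.length) ⧸ N) :=
      (MulEquiv.ulift.symm.toMonoidHom).comp (QuotientGroup.mk' N)
    have hq : ∀ w, q w = 1 ↔ w ∈ N := by
      intro w
      rw [← QuotientGroup.eq_one_iff]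
      exact (map_eq_one_iff MulEquiv.ulift.symm MulEquiv.ulift.symm.injective)
    let κ : Λ → ULift.{u} (FreeGroup (Fin ℓ.length) ⧸ N) := fun x =>
      if hx : x ∈ ℓ then q (.of ⟨ℓ.idxOf x, List.idxOf_lt_length_iff.2 hx⟩) else 1
    have hκ : ∀ i : Fin ℓ.length, κ (ℓ.get i) = q (.of i) := by
      intro i
      have : ℓ.get i ∈ ℓ := List.get_mem _ _
      simp only [κ, dif_pos this]
      congr 2
      exact Fin.ext (by simpa using h.nodup.idxOf_getElem i.1 i.2)
    obtain ⟨φ, hφ⟩ := h.exists_hom κ (by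
      have hm := map_list_prod q (List.ofFn fun i : Fin ℓ.length => FreeGroup.of i)
      rw [List.map_ofFn] at hm
      rw [← List.ofFn_comp_get, funext hκ]
      exact hm.symm.trans ((hq _).2 (Subgroup.subset_normalClosure rfl)))
    have hφq : φ.comp (FreeGroup.lift fun i : Fin ℓ.length => f (ℓ.get i)) = q := by
      ext i
      simp only [MonoidHom.comp_apply, FreeGroup.lift_apply_of]
      rw [hφ _ (List.get_mem _ _), hκ]
    intro w hw
    rw [← hq, ← hφq, MonoidHom.comp_apply, MonoidHom.mem_ker.1 hw, map_one]
  · refine Subgroup.normalClosure_le_normal ?_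
    rintro _ rfl
    change _ ∈ MonoidHom.ker _
    rw [MonoidHom.mem_ker, IsSpherePres.map_prod_of, List.ofFn_comp_get, h.prod_eq_one]

theorem isSphereGroup (h : IsSphereOn ℓ f) (hℓ : ℓ.length ≠ 1) :
    IsSphereGroup {c | ∃ x ∈ ℓ, ConjClasses.mk (f x) = c} := by
  refine ⟨ℓ.length, _, hℓ, h.isSpherePres.1, h.isSpherePres.2, ?_⟩
  ext c
  constructor
  · rintro ⟨x, hx, rfl⟩
    obtain ⟨i, rfl⟩ := List.get_of_mem hx
    exact ⟨i, rfl⟩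
  · rintro ⟨i, rfl⟩; exact ⟨_, List.get_mem _ _, rfl⟩

theorem injOn (h : IsSphereOn ℓ f) {x y : Λ} (hx : x ∈ ℓ) (hy : y ∈ ℓ)
    (e : IsConj (f x) (f y)) : x = y := by
  obtain ⟨i, rfl⟩ := List.get_of_mem hx
  obtain ⟨j, rfl⟩ := List.get_of_mem hy
  rw [h.isSpherePres.isConj_injective e]

theorem rotate (h : IsSphereOn ℓ f) {ℓ' : List Λ} (hr : ℓ.IsRotated ℓ') : IsSphereOn ℓ' f where
  nodup := hr.nodup_iff.1 h.nodup
  prod_eq_one := by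
    obtain ⟨k, rfl⟩ := hr
    rw [List.map_rotate]
    exact List.prod_rotate_eq_one_of_prod_eq_one h.prod_eq_one k
  closure_eq_top := by
    rw [← h.closure_eq_top]
    congr 1
    ext a
    exact exists_congr fun x => and_congr_left fun _ => hr.mem_iff.symm
  exists_hom κ hκ := by
    obtain ⟨φ, hφ⟩ := h.exists_hom κ (by
      obtain ⟨k, hk⟩ := hr.symm
      rw [← hk, List.map_rotate]
      exact List.prod_rotate_eq_one_of_prod_eq_one hκ k)
    exact ⟨φ, fun x hx => hφ x (hr.mem_iff.2 hx)⟩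

/-- Applying an automorphism to the generators. -/
theorem mulEquiv (h : IsSphereOn ℓ f) {A' : Type u} [Group A'] (e : A ≃* A') :
    IsSphereOn ℓ (fun x => e (f x)) where
  nodup := h.nodup
  prod_eq_one := by
    have := congrArg e h.prod_eq_one
    rwa [map_list_prod, List.map_map, map_one] at this
  closure_eq_top := by
    have := congrArg (Subgroup.map e.toMonoidHom) h.closure_eq_top
    rw [MonoidHom.map_closure, Subgroup.map_top_of_surjective _ e.surjective] at this
    rw [← this]
    congr 1
    ext a
    simp [Set.mem_image]
  exists_hom κ hκ := by
    obtain ⟨φ, hφ⟩ := h.exists_hom κ hκ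
    exact ⟨φ.comp e.symm.toMonoidHom, fun x hx => by simp [hφ x hx]⟩

theorem map_label (h : IsSphereOn ℓ f) {Λ' : Type u} {lab : Λ → Λ'} (hl : Function.Injective lab)
    {f' : Λ' → A} (hf : ∀ x, f' (lab x) = f x) : IsSphereOn (ℓ.map lab) f' where
  nodup := h.nodup.map hl
  prod_eq_one := by
    rw [List.map_map]
    exact (congrArg List.prod (List.map_congr_left fun x _ => hf x)).trans h.prod_eq_one
  closure_eq_top := by
    rw [← h.closure_eq_top]
    congr 1
    ext a
    simp [hf]
  exists_hom κ hκ := by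
    obtain ⟨φ, hφ⟩ := h.exists_hom (κ ∘ lab) (by rwa [List.map_map] at hκ)
    refine ⟨φ, fun x hx => ?_⟩
    obtain ⟨y, hy, rfl⟩ := List.mem_map.1 hx
    rw [hf, hφ y hy]; rfl

/-- For two generators, the inverses of the generators also give a presentation. -/
theorem inv_of_length_two (h : IsSphereOn ℓ f) (h2 : ℓ.length = 2) :
    IsSphereOn ℓ (fun x => (f x)⁻¹) := by
  obtain ⟨x, y, rfl⟩ := List.length_eq_two.1 h2
  have hxy : f x * f y = 1 := by simpa using h.prod_eq_one
  have hy : f y = (f x)⁻¹ := eq_inv_of_mul_eq_one_right hxy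
  refine ⟨h.nodup, by simp [hy], ?_, fun {K} _ κ hκ => ?_⟩
  · rw [← h.closure_eq_top, ← Subgroup.closure_inv]
    congr 1
    ext a
    simp only [hy, List.mem_cons, List.not_mem_nil, or_false, exists_eq_or_imp, exists_eq_left,
      Set.mem_inv, Set.mem_ofPred_eq, inv_inv, inv_inj]
    exact or_congr Iff.rfl ⟨fun e => e ▸ inv_inv _, fun e => e ▸ (inv_inv _).symm⟩
  · obtain ⟨φ, hφ⟩ := h.exists_hom (fun z => (κ z)⁻¹) (by
      have : κ y = (κ x)⁻¹ := eq_inv_of_mul_eq_one_right (by simpa using hκ)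
      simp [this])
    exact ⟨φ, fun z hz => by rw [map_inv, hφ z hz, inv_inv]⟩

theorem exists_universal (ℓ : List Λ) (hℓ : ℓ.Nodup) :
    ∃ (Q : Type u) (_ : Group Q) (F : Λ → Q), IsSphereOn ℓ F := by
  classical
  let R : Set (FreeGroup Λ) := {r | r = (ℓ.map .of).prod ∨ ∃ x, x ∉ ℓ ∧ r = .of x}
  refine ⟨PresentedGroup R, inferInstance, PresentedGroup.of, hℓ, ?_, ?_, fun {K} _ κ hκ => ?_⟩
  · have := PresentedGroup.one_of_mem (rels := R) (Or.inl rfl)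
    rwa [map_list_prod, List.map_map] at this
  · refine top_le_iff.1 ?_
    rw [← PresentedGroup.closure_range_of R, Subgroup.closure_le]
    rintro _ ⟨x, rfl⟩
    by_cases hx : x ∈ ℓ
    · exact Subgroup.subset_closure ⟨x, hx, rfl⟩
    · have := PresentedGroup.one_of_mem (rels := R) (Or.inr ⟨x, hx, rfl⟩)
      change PresentedGroup.of x = 1 at this
      rw [this]
      exact one_mem _
  · let κ' : Λ → K := fun x => if x ∈ ℓ then κ x else 1
    have hκ' : ∀ x ∈ ℓ, κ' x = κ x := fun x hx => if_pos hx
    refine ⟨PresentedGroup.toGroup (f := κ') ?_, fun x hx => ?_⟩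
    · rintro r (rfl | ⟨x, hx, rfl⟩)
      · rw [map_list_prod, List.map_map, ← hκ]
        congr 1
        exact List.map_congr_left fun x hx => by simpa using hκ' x hx
      · simp [κ', hx]
    · rw [PresentedGroup.toGroup.of, hκ' x hx]

/-- Amalgamation of two sphere groups along a generator of each of them. -/
theorem glue {A' : Type u} [Group A'] {f' : Λ → A'} {ℓ₁ ℓ₂ : List Λ} {a b : Λ}
    (h : IsSphereOn (ℓ₁ ++ [a]) f) (h' : IsSphereOn (ℓ₂ ++ [b]) f') (hd : ∀ x ∈ ℓ₁, x ∉ ℓ₂)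
    {s : A} {t : A'} (hs : IsConj (f a) s) (ht : IsConj (f' b) t) :
    ∃ (Q : Type u) (_ : Group Q) (i : A →* Q) (j : A' →* Q) (F : Λ → Q),
      IsSphereOn (ℓ₁ ++ ℓ₂) F ∧ i s = (j t)⁻¹ ∧ i.range ⊔ j.range = ⊤ ∧
      (∀ {K : Type u} [Group K] (α : A →* K) (β : A' →* K), α s = (β t)⁻¹ →
        ∃ Φ : Q →* K, Φ.comp i = α ∧ Φ.comp j = β) ∧
      (∀ x ∈ ℓ₁, IsConj (F x) (i (f x))) ∧ ∀ x ∈ ℓ₂, IsConj (F x) (j (f' x)) := by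
  -- Conjugating the two families of generators turns the generators of `a` and `b` into `s` and `t`
  -- themselves. The other generators change within their conjugacy classes, which is all that the
  -- last two conclusions record.
  obtain ⟨u, hu⟩ := isConj_iff.1 hs
  obtain ⟨w, hw⟩ := isConj_iff.1 ht
  have k := h.mulEquiv (MulAut.conj u)
  have k' := h'.mulEquiv (MulAut.conj w)
  set g : Λ → A := fun x => MulAut.conj u (f x) with hg
  set g' : Λ → A' := fun x => MulAut.conj w (f' x) with hg'
  have hga : g a = s := by simp [hg, ← hu]
  have hgb : g' b = t := by simp [hg', ← hw]
  have hn := List.nodup_append.1 h.nodup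
  have hn' := List.nodup_append.1 h'.nodup
  have ha : ∀ x ∈ ℓ₁, x ≠ a := fun x hx => hn.2.2 x hx a (by simp)
  have hb : ∀ x ∈ ℓ₂, x ≠ b := fun x hx => hn'.2.2 x hx b (by simp)
  obtain ⟨Q, _, F, hF⟩ := exists_universal (ℓ₁ ++ ℓ₂)
    (List.nodup_append.2 ⟨hn.1, hn'.1, fun x hx y hy e => hd x hx (e ▸ hy)⟩)
  have hFp : (ℓ₁.map F).prod * (ℓ₂.map F).prod = 1 := by
    simpa using hF.prod_eq_one
  classical
  -- The relator forces the image of `a` to be the inverse of the product over `ℓ₁`, and that of `b`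
  -- to be the inverse of the product over `ℓ₂`. These two products are inverse to each other in
  -- `Q`, hence so are the images of `s` and `t`.
  obtain ⟨i, hi⟩ := k.exists_hom (Function.update F a (ℓ₁.map F).prod⁻¹) (by
    rw [List.map_append, List.prod_append, List.map_congr_left (g := F)
      fun x hx => Function.update_of_ne (ha x hx) _ _]
    simp)
  obtain ⟨j, hj⟩ := k'.exists_hom (Function.update F b (ℓ₂.map F).prod⁻¹) (by
    rw [List.map_append, List.prod_append, List.map_congr_left (g := F)
      fun x hx => Function.update_of_ne (hb x hx) _ _]
    simp)
  have hi₁ : ∀ x ∈ ℓ₁, i (g x) = F x := fun x hx => by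
    rw [hi x (by simp [hx]), Function.update_of_ne (ha x hx)]
  have hj₁ : ∀ x ∈ ℓ₂, j (g' x) = F x := fun x hx => by
    rw [hj x (by simp [hx]), Function.update_of_ne (hb x hx)]
  have hia : i s = (ℓ₁.map F).prod⁻¹ := by rw [← hga, hi a (by simp)]; simp
  have hjb : j t = (ℓ₂.map F).prod⁻¹ := by rw [← hgb, hj b (by simp)]; simp
  refine ⟨Q, inferInstance, i, j, F, hF, ?_, ?_, fun {K} _ α β e => ?_, fun x hx => ?_,
    fun x hx => ?_⟩
  · rw [hia, hjb, inv_inv]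
    exact (eq_inv_of_mul_eq_one_right hFp).symm
  · rw [← top_le_iff, ← hF.closure_eq_top, Subgroup.closure_le]
    rintro _ ⟨x, hx, rfl⟩
    rcases List.mem_append.1 hx with hx | hx
    · exact (le_sup_left : i.range ≤ _) ⟨_, hi₁ x hx⟩
    · exact (le_sup_right : j.range ≤ _) ⟨_, hj₁ x hx⟩
  · have p₁ : (ℓ₁.map fun x => α (g x)).prod = (α s)⁻¹ := by
      have := congrArg α k.prod_eq_one
      rw [map_list_prod, List.map_map, map_one] at this
      rw [eq_inv_iff_mul_eq_one, ← hga, ← this]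
      simp [Function.comp_def]
    have p₂ : (ℓ₂.map fun x => β (g' x)).prod = (β t)⁻¹ := by
      have := congrArg β k'.prod_eq_one
      rw [map_list_prod, List.map_map, map_one] at this
      rw [eq_inv_iff_mul_eq_one, ← hgb, ← this]
      simp [Function.comp_def]
    let κ : Λ → K := fun x => if x ∈ ℓ₁ then α (g x) else β (g' x)
    have κ₁ : ∀ x ∈ ℓ₁, κ x = α (g x) := fun x hx => if_pos hx
    have κ₂ : ∀ x ∈ ℓ₂, κ x = β (g' x) := fun x hx => if_neg fun hx' => hd x hx' hx
    obtain ⟨Φ, hΦ⟩ := hF.exists_hom κ (by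
      rw [List.map_append, List.prod_append, List.map_congr_left κ₁, List.map_congr_left κ₂,
        p₁, p₂, e, inv_inv, mul_inv_cancel])
    have q₁ : (ℓ₁.map F).map Φ = ℓ₁.map fun x => α (g x) := by
      rw [List.map_map]
      exact List.map_congr_left fun x hx => (hΦ x (by simp [hx])).trans (κ₁ x hx)
    have q₂ : (ℓ₂.map F).map Φ = ℓ₂.map fun x => β (g' x) := by
      rw [List.map_map]
      exact List.map_congr_left fun x hx => (hΦ x (by simp [hx])).trans (κ₂ x hx)
    refine ⟨Φ, k.hom_ext fun x hx => ?_, k'.hom_ext fun x hx => ?_⟩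
    · rcases List.mem_append.1 hx with hx | hx
      · change Φ (i (g x)) = α (g x)
        rw [hi₁ x hx, hΦ x (by simp [hx]), κ₁ x hx]
      · obtain rfl := List.mem_singleton.1 hx
        change Φ (i (g x)) = α (g x)
        rw [hga, hia, map_inv, map_list_prod, q₁, p₁, inv_inv]
    · rcases List.mem_append.1 hx with hx | hx
      · change Φ (j (g' x)) = β (g' x)
        rw [hj₁ x hx, hΦ x (by simp [hx]), κ₂ x hx]
      · obtain rfl := List.mem_singleton.1 hx
        change Φ (j (g' x)) = β (g' x)
        rw [hgb, hjb, map_inv, map_list_prod, q₂, p₂, inv_inv]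
  · rw [← hi₁ x hx]
    exact i.map_isConj (isConj_iff.2 ⟨u, by simp [hg]⟩).symm
  · rw [← hj₁ x hx]
    exact j.map_isConj (isConj_iff.2 ⟨w, by simp [hg']⟩).symm

end IsSphereOn

/-- A sphere group is presented on the list of its peripheral classes. -/
theorem IsSphereGroup.exists_isSphereOn {G : Type u} [Group G] {P : Set (ConjClasses G)}
    (h : IsSphereGroup P) : ∃ (ℓ : List (ConjClasses G)) (f : ConjClasses G → G),
      IsSphereOn ℓ f ∧ ℓ.length = P.ncard ∧ (∀ c, c ∈ ℓ ↔ c ∈ P) ∧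
      ∀ c ∈ P, ConjClasses.mk (f c) = c := by
  classical
  obtain ⟨n, γ, hn, h1, h2, rfl⟩ := h
  have hp : IsSpherePres γ := ⟨h1, h2⟩
  have hinj : Function.Injective fun i => ConjClasses.mk (γ i) := fun i j hij =>
    hp.isConj_injective (ConjClasses.mk_eq_mk_iff_isConj.1 hij)
  let f : ConjClasses G → G := fun c => if hc : ∃ i, ConjClasses.mk (γ i) = c then γ hc.choose else 1
  have hf : ∀ i, f (ConjClasses.mk (γ i)) = γ i := by
    intro i
    have hc : ∃ j, ConjClasses.mk (γ j) = ConjClasses.mk (γ i) := ⟨i, rfl⟩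
    simp only [f, dif_pos hc]
    rw [hinj hc.choose_spec]
  refine ⟨List.ofFn fun i => ConjClasses.mk (γ i), f, ⟨?_, ?_, ?_, fun {K} _ κ hκ => ?_⟩, ?_, ?_, ?_⟩
  · exact List.nodup_ofFn.2 hinj
  · rw [List.map_ofFn, ← hp.prod_eq_one]
    congr 2
    exact funext hf
  · rw [← hp.closure_eq_top]
    congr 1
    ext a
    simp [List.mem_ofFn, hf]
  · obtain ⟨φ, hφ⟩ := hp.exists_hom (fun i => κ (ConjClasses.mk (γ i))) (by
      rwa [List.map_ofFn] at hκ)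
    refine ⟨φ, fun x hx => ?_⟩
    obtain ⟨i, rfl⟩ := List.mem_ofFn.1 hx
    rw [hf, hφ]
  · rw [List.length_ofFn, Set.ncard_range_of_injective hinj, Nat.card_fin]
  · exact fun c => List.mem_ofFn
  · rintro _ ⟨i, rfl⟩
    exact congrArg _ (hf i)

/-! ## Rooted trees -/

namespace Graph'

variable {Γ : Graph'.{u}}

theorem bar_eq_of_src_eq {x : Γ.carrier} (h : Γ.src x = x) : Γ.bar x = x := by
  have := Γ.bar_src x
  rwa [h] at this

theorem IsEdge.bar {x : Γ.carrier} (h : Γ.IsEdge x) : Γ.IsEdge (Γ.bar x) := by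
  intro h'
  have h2 := bar_eq_of_src_eq h'
  rw [Γ.bar_bar] at h2
  exact h (Γ.src_eq_of_bar_eq x h2.symm)

theorem o_bar (x : Γ.carrier) : Γ.o (Γ.bar x) = Γ.t x := rfl

theorem t_bar (x : Γ.carrier) : Γ.t (Γ.bar x) = Γ.o x := by rw [t, Γ.bar_bar]

theorem t_eq_o_of_src_eq {x : Γ.carrier} (h : Γ.src x = x) : Γ.t x = Γ.o x := by
  rw [t, bar_eq_of_src_eq h]

variable (Γ) in
/-- For every vertex `v` other than the root `r`, `par v` is the edge from `v` towards the root. -/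
structure Rooted (r : Γ.Vert) where
  depth : Γ.Vert → ℕ
  par : Γ.Vert → Γ.carrier
  isEdge_par : ∀ v, v ≠ r → Γ.IsEdge (par v)
  o_par : ∀ v, v ≠ r → Γ.o (par v) = v
  depth_par : ∀ v, v ≠ r → depth (Γ.t (par v)) < depth v
  eq_par : ∀ x, Γ.IsEdge x →
    (Γ.o x ≠ r ∧ x = par (Γ.o x)) ∨ (Γ.t x ≠ r ∧ Γ.bar x = par (Γ.t x))

theorem Rooted.depth_root_lt {r : Γ.Vert} (R : Γ.Rooted r) (v : Γ.Vert) (hv : v ≠ r) :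
    R.depth r < R.depth v := by
  induction hn : R.depth v using Nat.strong_induction_on generalizing v with
  | _ n ih =>
    subst hn
    by_cases h : Γ.t (R.par v) = r
    · have := R.depth_par v hv
      rwa [h] at this
    · exact (ih _ (R.depth_par v hv) _ h rfl).trans (R.depth_par v hv)

/-- Every neighbour of `v` that is closer to `r` is the penultimate vertex of one fixed geodesic `p`
from `r` to `v`: a geodesic to this neighbour is too short to pass through `v`, so acyclicity puts
the neighbour on `p`. -/
theorem _root_.SimpleGraph.IsTree.closer_unique {V : Type*} {G : SimpleGraph V} (hG : G.IsTree)
    {r v w w' : V} (h : G.Adj v w) (h' : G.Adj v w') (hd : G.dist r v = G.dist r w + 1)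
    (hd' : G.dist r v = G.dist r w' + 1) : w = w' := by
  classical
  obtain ⟨p, hp, -⟩ := hG.connected.exists_path_of_dist r v
  have key : ∀ {w}, G.Adj v w → G.dist r v = G.dist r w + 1 → w = p.penultimate := by
    intro w h hd
    obtain ⟨q, hq, hql⟩ := hG.connected.exists_path_of_dist r w
    refine hG.isAcyclic.eq_penultimate_of_adj_end hp h
      (hG.isAcyclic.mem_support_of_ne_mem_support_of_adj_of_isPath hp hq h fun hv => ?_)
    have h1 := SimpleGraph.dist_le (q.takeUntil v hv)
    have h2 := q.length_takeUntil_le_length hv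
    omega
  rw [key h hd, key h' hd']

theorem _root_.SimpleGraph.Connected.exists_closer {V : Type*} {G : SimpleGraph V}
    (hG : G.Connected) {r v : V} (h : v ≠ r) : ∃ w, G.Adj v w ∧ G.dist r w < G.dist r v := by
  obtain ⟨p, hp, hl⟩ := hG.exists_path_of_dist r v
  have hnil : ¬ p.Nil := fun hn => h hn.eq.symm
  refine ⟨p.penultimate, (p.adj_penultimate hnil).symm, ?_⟩
  have h1 := SimpleGraph.dist_le p.dropLast
  have h2 : 0 < G.dist r v := hG.pos_dist_of_ne (Ne.symm h)
  rw [SimpleGraph.Walk.length_dropLast] at h1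
  omega

/-- The depth is the distance to `r`. In a tree it changes by exactly one along every edge, so each
edge has a well-defined end closer to the root. -/
theorem IsTree.exists_rooted (h : Γ.IsTree) (r : Γ.Vert) : Nonempty (Γ.Rooted r) := by
  classical
  let d := Γ.toSimpleGraph.dist r
  have hex : ∀ v, ∃ x, v ≠ r → Γ.IsEdge x ∧ Γ.o x = v ∧ Γ.toSimpleGraph.Adj v (Γ.t x) ∧
      d (Γ.t x) < d v := by
    intro v
    by_cases hv : v = r
    · exact ⟨v.1, fun h => absurd hv h⟩
    · obtain ⟨w, hw, hlt⟩ := h.isTree.connected.exists_closer hv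
      obtain ⟨x, rfl, rfl⟩ := hw.2
      refine ⟨x, fun _ => ⟨fun hx => hw.1 (t_eq_o_of_src_eq hx).symm, rfl, hw, hlt⟩⟩
  choose par hpar using hex
  have key : ∀ x, Γ.IsEdge x → d (Γ.o x) = d (Γ.t x) + 1 → Γ.o x ≠ r ∧ x = par (Γ.o x) := by
    intro x hx hd
    have hr : Γ.o x ≠ r := by
      intro hr
      rw [hr] at hd
      simp [d] at hd
    obtain ⟨h1, h2, h3, h4⟩ := hpar _ hr
    refine ⟨hr, h.no_multiple _ _ hx h1 h2.symm ?_⟩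
    refine h.isTree.closer_unique (r := r) ⟨h.no_loop x hx, x, rfl, rfl⟩ h3 hd ?_
    rcases h.isTree.dist_eq_dist_add_one_of_adj r h3 with e | e
    · exact e
    · exact absurd h4 (by simp only [d]; omega)
  refine ⟨d, par, fun v hv => (hpar v hv).1, fun v hv => (hpar v hv).2.1,
    fun v hv => (hpar v hv).2.2.2, fun x hx => ?_⟩
  rcases h.isTree.dist_eq_dist_add_one_of_adj r
    (show Γ.toSimpleGraph.Adj (Γ.o x) (Γ.t x) from ⟨h.no_loop x hx, x, rfl, rfl⟩) with e | e
  · exact .inl (key x hx e)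
  · exact .inr (key (Γ.bar x) hx.bar (by rwa [o_bar, t_bar]))

/-- The number of oriented edges of a finite tree. -/
theorem IsTree.card_edges (h : Γ.IsTree) [Finite Γ.carrier] :
    (Nat.card {x // Γ.IsEdge x} : ℤ) = 2 * Nat.card Γ.Vert - 2 := by
  classical
  obtain ⟨r⟩ := h.isTree.connected.nonempty
  obtain ⟨R⟩ := h.exists_rooted r
  have : Finite Γ.Vert := Subtype.finite
  -- Each vertex other than the root contributes its edge towards the root and the reverse of that
  -- edge.
  let F : {v // v ≠ r} ⊕ {v // v ≠ r} → {x // Γ.IsEdge x} :=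
    Sum.elim (fun v => ⟨R.par v.1, R.isEdge_par _ v.2⟩) fun v => ⟨_, (R.isEdge_par _ v.2).bar⟩
  have hne : ∀ v w : {v // v ≠ r}, R.par v.1 ≠ Γ.bar (R.par w.1) := by
    intro v w e
    have h1 := R.o_par _ v.2
    have h2 := R.o_par _ w.2
    have h3 : Γ.t (R.par v.1) = w.1 := by rw [e, t_bar, h2]
    rw [e, o_bar] at h1
    have h4 := R.depth_par _ v.2
    have h5 := R.depth_par _ w.2
    rw [h3] at h4
    rw [h1] at h5
    omega
  have hinj : ∀ v w : {v // v ≠ r}, R.par v.1 = R.par w.1 → v = w := by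
    intro v w e
    refine Subtype.ext ?_
    rw [← R.o_par _ v.2, e, R.o_par _ w.2]
  have hF : Function.Bijective F := by
    constructor
    · rintro (v | v) (w | w) e
      · exact congrArg _ (hinj v w (Subtype.ext_iff.1 e))
      · exact absurd (Subtype.ext_iff.1 e) (hne v w)
      · exact absurd (Subtype.ext_iff.1 e).symm (hne w v)
      · refine congrArg _ (hinj v w ?_)
        have := congrArg Γ.bar (Subtype.ext_iff.1 e)
        simpa only [F, Sum.elim_inr, Γ.bar_bar] using this
    · rintro ⟨x, hx⟩
      rcases R.eq_par x hx with ⟨h1, h2⟩ | ⟨h1, h2⟩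
      · exact ⟨.inl ⟨_, h1⟩, Subtype.ext h2.symm⟩
      · refine ⟨.inr ⟨_, h1⟩, Subtype.ext ?_⟩
        change Γ.bar (R.par _) = x
        rw [← h2, Γ.bar_bar]
  have h1 := Nat.card_eq_of_bijective F hF
  have h2 : Nat.card {v // v ≠ r} + 1 = Nat.card Γ.Vert := by
    have := Fintype.ofFinite Γ.Vert
    rw [Nat.card_eq_fintype_card, Nat.card_eq_fintype_card, Fintype.card_subtype_compl,
      Fintype.card_subtype_eq]
    have : 0 < Fintype.card Γ.Vert := Fintype.card_pos_iff.2 ⟨r⟩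
    omega
  rw [Nat.card_sum] at h1
  omega

end Graph'

/-! ### Paths and potentials in a tree of groups. -/

namespace GraphOfGroups

variable {X : GraphOfGroups.{u}}

theorem ofEdge_eq_one {x : X.graph.carrier} (h : X.graph.src x = x) : X.ofEdge x = 1 :=
  PresentedGroup.one_of_mem (rels := {r | X.IsRelator r}) (IsRelator.vertex ⟨x, h⟩)

theorem IsPath.one (v : X.Vert) : X.IsPath v v 1 := by
  rw [← X.ofVert_one v]
  exact .vert v 1

/-- `x̄ g⁻ x = g⁺`, in the form `g⁻ x = x g⁺`. -/
theorem ofVert_mul_ofEdge (x : X.graph.carrier) (g : X.G x) :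
    X.ofVert (X.graph.o x) (X.minus x g) * X.ofEdge x =
      X.ofEdge x * X.ofVert (X.graph.t x) (X.minus (X.graph.bar x) (X.inv x g)) := by
  have := PresentedGroup.one_of_mem (rels := {r | X.IsRelator r}) (IsRelator.conj x g)
  simp only [map_mul, map_inv] at this
  have h2 : X.ofEdge (X.graph.bar x) * X.ofVert (X.graph.o x) (X.minus x g) * X.ofEdge x =
      X.ofVert (X.graph.t x) (X.minus (X.graph.bar x) (X.inv x g)) := mul_inv_eq_one.1 this
  rw [← h2, X.ofEdge_bar]
  group

/-- A potential on the vertices of a tree: a choice of paths from the root that are products of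
edges. -/
theorem exists_potential (h : X.graph.IsTree) (r : X.Vert) : ∃ τ : X.Vert → X.PathGroup,
    (∀ v, X.IsPath r v (τ v)) ∧ (∀ x, τ (X.graph.o x) * X.ofEdge x = τ (X.graph.t x)) ∧
      ∀ v, τ v ∈ Subgroup.closure (Set.range X.ofEdge) := by
  classical
  obtain ⟨R⟩ := h.exists_rooted r
  let τ : X.Vert → X.PathGroup := WellFounded.fix (measure R.depth).wf fun v F =>
    if hv : v ≠ r then F (X.graph.t (R.par v)) (R.depth_par v hv) * (X.ofEdge (R.par v))⁻¹ else 1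
  have hτ : ∀ v, v ≠ r → τ v = τ (X.graph.t (R.par v)) * (X.ofEdge (R.par v))⁻¹ := by
    intro v hv
    simp only [τ]
    rw [WellFounded.fix_eq, dif_pos hv]
  have hr : τ r = 1 := by
    simp only [τ]
    rw [WellFounded.fix_eq, dif_neg (by simp)]
  refine ⟨τ, ?_, ?_, ?_⟩
  · intro v
    induction hn : R.depth v using Nat.strong_induction_on generalizing v with
    | _ n ih =>
      by_cases hv : v = r
      · subst hv; rw [hr]; exact .one v
      · rw [hτ v hv]
        have h1 := ih _ (hn ▸ R.depth_par v hv) _ rfl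
        have h2 := (IsPath.edge (X := X) (R.par v)).inv
        rw [R.o_par v hv] at h2
        exact h1.mul h2
  · intro x
    by_cases hx : X.graph.IsEdge x
    · rcases R.eq_par x hx with ⟨h1, h2⟩ | ⟨h1, h2⟩
      · rw [hτ _ h1, ← h2]; simp
      · rw [hτ _ h1, ← h2, X.ofEdge_bar, X.graph.t_bar, _root_.inv_inv]
    · have hx' : X.graph.src x = x := not_not.1 hx
      rw [ofEdge_eq_one hx', mul_one, Graph'.t_eq_o_of_src_eq hx']
  · intro v
    induction hn : R.depth v using Nat.strong_induction_on generalizing v with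
    | _ n ih =>
      by_cases hv : v = r
      · subst hv; rw [hr]; exact one_mem _
      · rw [hτ v hv]
        exact mul_mem (ih _ (hn ▸ R.depth_par v hv) _ rfl)
          (inv_mem (Subgroup.subset_closure ⟨_, rfl⟩))

theorem exists_isPath (h : X.graph.IsTree) (v w : X.Vert) : ∃ p, X.IsPath v w p := by
  obtain ⟨τ, hτ, -, -⟩ := exists_potential h v
  exact ⟨τ w, hτ w⟩

end GraphOfGroups

/-! ## The fundamental group of a sphere tree of groups -/

theorem IsConj.inv' {G : Type*} [Group G] {a b : G} (h : IsConj a b) : IsConj a⁻¹ b⁻¹ := by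
  obtain ⟨c, rfl⟩ := isConj_iff.1 h
  exact isConj_iff.2 ⟨c, by group⟩

theorem MonoidHom.ext_of_zpowers {G K : Type*} [Group G] [Group K] {t : G}
    (ht : ∀ g, g ∈ Subgroup.zpowers t) {φ ψ : G →* K} (h : φ t = ψ t) : φ = ψ := by
  ext g
  obtain ⟨n, rfl⟩ := ht g
  change φ (t ^ n) = ψ (t ^ n)
  rw [map_zpow, map_zpow, h]

theorem GraphOfGroups.inv_transport_inv (X : GraphOfGroups.{u}) (x : X.graph.carrier)
    (g : X.G (X.graph.bar x)) :
    X.inv x (transport X.G (X.graph.bar_bar x) (X.inv (X.graph.bar x) g)) = g := by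
  rw [GraphOfGroups.inv_transport]
  exact X.inv_inv (X.graph.bar x) g

/-- The relation `g⁻ = g⁺` in an amalgam for the edge `x` implies that for the edge `x̄`. -/
theorem GraphOfGroups.compat_bar (X : GraphOfGroups.{u}) {A : Type*} [Group A]
    (ι : ∀ v : X.Vert, X.G v.1 →* A) (x : X.graph.carrier)
    (h : ∀ g, ι (X.graph.o x) (X.minus x g) =
      ι (X.graph.t x) (X.minus (X.graph.bar x) (X.inv x g))) (g : X.G (X.graph.bar x)) :
    ι (X.graph.o (X.graph.bar x)) (X.minus (X.graph.bar x) g) =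
      ι (X.graph.t (X.graph.bar x))
        (X.minus (X.graph.bar (X.graph.bar x)) (X.inv (X.graph.bar x) g)) := by
  have h1 := h (transport X.G (X.graph.bar_bar x) (X.inv (X.graph.bar x) g))
  rw [X.inv_transport_inv] at h1
  refine h1.symm.trans ?_
  have : ∀ (x' : X.graph.carrier) (e : x' = x) (k : X.G x'),
      ι (X.graph.o x) (X.minus x (transport X.G e k)) = ι (X.graph.o x') (X.minus x' k) := by
    rintro _ rfl k
    rfl
  exact this _ _ _

namespace SphereStructure

variable {X : GraphOfGroups.{u}} (S : SphereStructure X)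

open Classical in
/-- `g⁻¹` at curve vertices and `g` at sphere vertices. -/
noncomputable def sgn (v : X.Vert) {K : Type*} [Group K] (g : K) : K :=
  if S.IsCurve v then g⁻¹ else g

theorem map_sgn (v : X.Vert) {K L : Type*} [Group K] [Group L] (φ : K →* L) (g : K) :
    φ (S.sgn v g) = S.sgn v (φ g) := by
  unfold sgn
  split_ifs <;> simp

theorem isConj_sgn (v : X.Vert) {K : Type*} [Group K] {g h : K} (e : IsConj g h) :
    IsConj (S.sgn v g) (S.sgn v h) := by
  unfold sgn
  split_ifs
  exacts [e.inv', e]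

/-- Exactly one end of an edge is a curve vertex, so exactly one of the two signs inverts. This
reconciles the edge relation, which identifies two generators, with the gluing of sphere groups,
which identifies a generator with the inverse of another one. -/
theorem sgn_eq_inv_iff (hS : S.IsStable) {x : X.graph.carrier} (hx : X.graph.IsEdge x)
    {K : Type*} [Group K] (a b : K) :
    S.sgn (X.graph.t x) a = (S.sgn (X.graph.o x) b)⁻¹ ↔ a = b := by
  have h := hS.bipartite x hx
  unfold sgn
  by_cases h1 : S.IsCurve (X.graph.t x)
  · rw [if_pos h1, if_neg fun h2 => h.1 h2 h1, inv_inj]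
  · rw [if_neg h1, if_pos (h.2 h1), inv_inv]

/-- A vertex of a graph of groups together with a conjugacy class of its group. -/
abbrev Label (X : GraphOfGroups.{u}) : Type u := Σ v : X.Vert, ConjClasses (X.G v.1)

theorem two_le_ncard_per {S : SphereStructure X} (hS : S.IsStable) (v : X.Vert) :
    2 ≤ (S.per v.1).ncard := by
  by_cases h : S.IsCurve v
  · exact (hS.curve_cyclic v h).ge
  · exact (hS.three_le v h).trans' (by norm_num)

theorem exists_vertex_isSphereOn {S : SphereStructure X} (hS : S.IsStable) (v : X.Vert) :
    ∃ (ℓ : List (Label X)) (f : Label X → X.G v.1), IsSphereOn ℓ f ∧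
      ℓ.length = (S.per v.1).ncard ∧ (∀ x ∈ ℓ, x.1 = v) ∧ (∀ c, ⟨v, c⟩ ∈ ℓ ↔ c ∈ S.per v.1) ∧
      ∀ c, ⟨v, c⟩ ∈ ℓ → ∃ g, ConjClasses.mk g = c ∧ f ⟨v, c⟩ = S.sgn v g := by
  classical
  obtain ⟨ℓ, f, h, hlen, hmem, hf⟩ := (S.isSphere v.1).exists_isSphereOn
  -- At a curve vertex there are only two generators, inverse to each other, and this is why
  -- inverting them again gives a presentation.
  have h' : IsSphereOn ℓ (fun c => S.sgn v (f c)) := by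
    unfold sgn
    split_ifs with hv
    · exact h.inv_of_length_two (hlen.trans (hS.curve_cyclic v hv))
    · exact h
  let lab : ConjClasses (X.G v.1) → Label X := fun c => ⟨v, c⟩
  have hlab : Function.Injective lab := fun c c' e => by simpa [lab] using e
  let f' : Label X → X.G v.1 := fun x =>
    if hx : ∃ c, lab c = x then S.sgn v (f hx.choose) else 1
  have hf' : ∀ c, f' (lab c) = S.sgn v (f c) := by
    intro c
    have hx : ∃ c', lab c' = lab c := ⟨c, rfl⟩
    simp only [f', dif_pos hx]
    rw [hlab hx.choose_spec]
  have hm : ∀ c, ⟨v, c⟩ ∈ ℓ.map lab ↔ c ∈ S.per v.1 := fun c => by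
    rw [← hmem]
    exact List.mem_map_of_injective hlab
  refine ⟨ℓ.map lab, f', h'.map_label hlab hf', by simpa using hlen, ?_, hm, fun c hc => ?_⟩
  · intro x hx
    obtain ⟨c, -, rfl⟩ := List.mem_map.1 hx
    rfl
  · exact ⟨f c, hf c ((hm c).1 hc), hf' c⟩

/-- `A`, with the homomorphisms `ι v`, is the amalgam of the groups at the vertices in `T`; it is the
sphere group on the elements `f x`, for `x` in `ℓ`, which represent the classes at vertices in `T` that
are vacant relative to `T`. -/
structure IsModel (T : Set X.Vert) {A : Type u} [Group A] (ι : ∀ v : X.Vert, X.G v.1 →* A)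
    (ℓ : List (Label X)) (f : Label X → A) : Prop where
  compat : ∀ x, X.graph.IsEdge x → X.graph.o x ∈ T → X.graph.t x ∈ T → ∀ g,
    ι (X.graph.o x) (X.minus x g) = ι (X.graph.t x) (X.minus (X.graph.bar x) (X.inv x g))
  sphere : IsSphereOn ℓ f
  mem_iff : ∀ v c, ⟨v, c⟩ ∈ ℓ ↔ v ∈ T ∧ c ∈ S.per v.1 ∧
    ∀ (x : X.graph.carrier) (hx : X.graph.src x = v.1), X.graph.IsEdge x → X.graph.t x ∈ T →
      ConjClasses.mk (X.minusTo hx (S.gen x)) ≠ c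
  length : 2 ≤ ℓ.length
  conj : ∀ v c, ⟨v, c⟩ ∈ ℓ → ∃ g, ConjClasses.mk g = c ∧ IsConj (f ⟨v, c⟩) (ι v (S.sgn v g))
  generate : ⨆ v ∈ T, (ι v).range = ⊤
  exists_hom : ∀ {K : Type u} [Group K] (φ : ∀ v : X.Vert, X.G v.1 →* K),
    (∀ x, X.graph.IsEdge x → X.graph.o x ∈ T → X.graph.t x ∈ T → ∀ g,
      φ (X.graph.o x) (X.minus x g) = φ (X.graph.t x) (X.minus (X.graph.bar x) (X.inv x g))) →
    ∃ Φ : A →* K, ∀ v ∈ T, Φ.comp (ι v) = φ v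

/-- There is a model for the set `T` of vertices. -/
def HasModel (T : Set X.Vert) : Prop :=
  ∃ (A : Type u) (_ : Group A) (ι : ∀ v : X.Vert, X.G v.1 →* A) (ℓ : List (Label X))
    (f : Label X → A), S.IsModel T ι ℓ f

variable {S}

theorem hasModel_singleton (hS : S.IsStable) (r : X.Vert) : S.HasModel {r} := by
  classical
  obtain ⟨ℓ, f, h, hlen, hfst, hmem, hf⟩ := exists_vertex_isSphereOn hS r
  have hloop : ∀ x, X.graph.IsEdge x → X.graph.o x ∈ ({r} : Set X.Vert) →
      X.graph.t x ∈ ({r} : Set X.Vert) → False := fun x hx ho ht =>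
    hS.isTree.no_loop x hx (ho.trans ht.symm)
  let ι : ∀ v : X.Vert, X.G v.1 →* X.G r.1 := Function.update (fun _ => 1) r (MonoidHom.id _)
  have hι : ι r = MonoidHom.id _ := Function.update_self ..
  refine ⟨X.G r.1, inferInstance, ι, ℓ, f, fun x hx ho ht => (hloop x hx ho ht).elim, h,
    fun v c => ?_, hlen ▸ two_le_ncard_per hS r, fun v c hvc => ?_, ?_, fun {K} _ φ _ => ?_⟩
  · constructor
    · intro hvc
      obtain rfl : v = r := hfst _ hvc
      refine ⟨rfl, (hmem c).1 hvc, fun x hx hxe ht => (hloop x hxe ?_ ht).elim⟩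
      exact Subtype.ext hx
    · rintro ⟨rfl, hc, -⟩
      exact (hmem c).2 hc
  · obtain rfl : v = r := hfst _ hvc
    obtain ⟨g, hg, hfg⟩ := hf c hvc
    refine ⟨g, hg, ?_⟩
    rw [hfg, hι]
    exact IsConj.refl _
  · rw [← top_le_iff]
    refine le_trans ?_ (le_iSup₂ (f := fun v (_ : v ∈ ({r} : Set X.Vert)) => (ι v).range) r rfl)
    rw [hι]
    exact fun x _ => ⟨x, rfl⟩
  · refine ⟨φ r, ?_⟩
    rintro _ rfl
    rw [hι, MonoidHom.comp_id]

theorem eq_of_attach {S : SphereStructure X} (hS : S.IsStable) {v : X.graph.carrier}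
    {x y : X.graph.carrier} (hx : X.graph.src x = v) (hy : X.graph.src y = v)
    (ex : X.graph.IsEdge x) (ey : X.graph.IsEdge y)
    (h : ConjClasses.mk (X.minusTo hx (S.gen x)) = ConjClasses.mk (X.minusTo hy (S.gen y))) :
    x = y :=
  S.attach_injective v x y hx hy ex ey (hS.edge_ne_one x ex) (hS.edge_ne_one y ey) h

/-- The relator may be rotated cyclically, so any prescribed generator can be brought to the last
position, as `IsSphereOn.glue` requires. -/
theorem exists_split {Λ : Type*} {ℓ : List Λ} {a : Λ} (hℓ : ℓ.Nodup) (ha : a ∈ ℓ) :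
    ∃ ℓ₁, ℓ.IsRotated (ℓ₁ ++ [a]) ∧ ∀ x, x ∈ ℓ₁ ↔ x ∈ ℓ ∧ x ≠ a := by
  obtain ⟨p, q, rfl⟩ := List.append_of_mem ha
  have hr : (p ++ a :: q).IsRotated (q ++ p ++ [a]) := by
    have : p ++ a :: q = (p ++ [a]) ++ q := by simp
    rw [this, List.append_assoc q]
    exact List.isRotated_append
  refine ⟨q ++ p, hr, fun x => ?_⟩
  have hn := List.nodup_append.1 (hr.nodup_iff.1 hℓ)
  rw [hr.mem_iff, List.mem_append (t := [a]), List.mem_singleton]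
  constructor
  · exact fun h => ⟨.inl h, hn.2.2 x h a (by simp)⟩
  · rintro ⟨h | h, h'⟩
    exacts [h, absurd h h']

/-- The edge `x` is the only one between the new vertex and `T`, so it imposes the only new
relation. The new amalgam is obtained by gluing along the classes to which `x` and its reverse
attach, and exactly these two classes stop being vacant. -/
theorem HasModel.insert_vertex (hS : S.IsStable) {T : Set X.Vert} (hT : S.HasModel T)
    {x : X.graph.carrier} (hx : X.graph.IsEdge x) (ho : X.graph.o x ∉ T) (ht : X.graph.t x ∈ T)
    (huniq : ∀ y, X.graph.IsEdge y → X.graph.o y = X.graph.o x → X.graph.t y ∈ T → y = x) :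
    S.HasModel (insert (X.graph.o x) T) := by
  classical
  obtain ⟨A, _, ι, ℓ, f, M⟩ := hT
  set u := X.graph.o x with hu
  set v := X.graph.t x with hv
  obtain ⟨ℓ', f', h', hlen', hfst', hmem', hf'⟩ := exists_vertex_isSphereOn hS u
  -- The images of the generator of the edge group at the two ends; `a` and `b` are the labels that
  -- disappear in the gluing.
  let g₁ : X.G v.1 := X.minus (X.graph.bar x) (X.inv x (S.gen x))
  let g₂ : X.G u.1 := X.minus x (S.gen x)
  have hg₁ : g₁ = X.minus (X.graph.bar x) (S.gen (X.graph.bar x)) := by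
    simp only [g₁]; rw [S.inv_gen x hx]
  let a : Label X := ⟨v, ConjClasses.mk g₁⟩
  let b : Label X := ⟨u, ConjClasses.mk g₂⟩
  have ha : a ∈ ℓ := by
    refine (M.mem_iff _ _).2 ⟨ht, ?_, fun y hy hye hyt e => ?_⟩
    · rw [hg₁]
      exact S.gen_mem _ hx.bar (hS.edge_ne_one _ hx.bar)
    · rw [hg₁] at e
      have := eq_of_attach hS hy rfl hye hx.bar e
      rw [this, X.graph.t_bar] at hyt
      exact ho hyt
  have hb : b ∈ ℓ' := (hmem' _).2 (S.gen_mem _ hx (hS.edge_ne_one _ hx))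
  obtain ⟨ℓ₁, hr₁, hm₁⟩ := exists_split M.sphere.nodup ha
  obtain ⟨ℓ₂, hr₂, hm₂⟩ := exists_split h'.nodup hb
  have hs : IsConj (f a) (ι v (S.sgn v g₁)) := by
    obtain ⟨g, hg, hfg⟩ := M.conj _ _ ha
    exact hfg.trans ((ι v).map_isConj (S.isConj_sgn v (ConjClasses.mk_eq_mk_iff_isConj.1 hg)))
  have htt : IsConj (f' b) (S.sgn u g₂) := by
    obtain ⟨g, hg, hfg⟩ := hf' _ hb
    rw [hfg]
    exact S.isConj_sgn u (ConjClasses.mk_eq_mk_iff_isConj.1 hg)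
  have hT₁ : ∀ y ∈ ℓ₁, y.1 ∈ T := fun y hy => ((M.mem_iff y.1 y.2).1 ((hm₁ y).1 hy).1).1
  have hT₂ : ∀ y ∈ ℓ₂, y.1 = u := fun y hy => hfst' y ((hm₂ y).1 hy).1
  obtain ⟨Q, _, i, j, F, hF, hij, hgen, hext, hc₁, hc₂⟩ :=
    (M.sphere.rotate hr₁).glue (h'.rotate hr₂)
      (fun y hy hy' => ho (hT₂ y hy' ▸ hT₁ y hy)) hs htt
  let ι' : ∀ w : X.Vert, X.G w.1 →* Q := Function.update (fun w => i.comp (ι w)) u j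
  have hι'u : ι' u = j := Function.update_self ..
  have hι' : ∀ w ∈ T, ι' w = i.comp (ι w) := fun w hw =>
    Function.update_of_ne (by rintro rfl; exact ho hw) ..
  have hvT : ι' v = i.comp (ι v) := hι' v ht
  -- The edge group is cyclic, so the relation on its generator, which `glue` provides up to the
  -- signs, implies the relation on all its elements.
  have hmin : ∀ g : X.G x, j (X.minus x g) =
      i (ι v (X.minus (X.graph.bar x) (X.inv x g))) := by
    have h1 : i (ι v g₁) = j g₂ := by
      rw [S.map_sgn, S.map_sgn, S.map_sgn] at hij
      exact (S.sgn_eq_inv_iff hS hx _ _).1 hij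
    exact DFunLike.congr_fun (MonoidHom.ext_of_zpowers (S.gen_generates x hx)
      (φ := j.comp (X.minus x))
      (ψ := (i.comp (ι v)).comp ((X.minus (X.graph.bar x)).comp (X.inv x))) h1.symm)
  have hedge : ∀ y, X.graph.IsEdge y → X.graph.o y ∈ insert u T → X.graph.t y ∈ insert u T →
      (X.graph.o y ∈ T ∧ X.graph.t y ∈ T) ∨ y = x ∨ y = X.graph.bar x := by
    rintro y hy (h1 | h1) (h2 | h2)
    · exact absurd (h1.trans h2.symm) (hS.isTree.no_loop y hy)
    · exact .inr (.inl (huniq y hy h1 h2))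
    · refine .inr (.inr ?_)
      have := huniq (X.graph.bar y) hy.bar h2 (by rwa [X.graph.t_bar])
      rw [← this, X.graph.bar_bar]
    · exact .inl ⟨h1, h2⟩
  refine ⟨Q, inferInstance, ι', ℓ₁ ++ ℓ₂, F, ?_, hF, ?_, ?_, ?_, ?_, ?_⟩
  · intro y hy h1 h2 g
    rcases hedge y hy h1 h2 with ⟨h3, h4⟩ | rfl | rfl
    · rw [hι' _ h3, hι' _ h4]
      exact congrArg i (M.compat y hy h3 h4 g)
    · exact (DFunLike.congr_fun hι'u _).trans
        ((hmin g).trans (DFunLike.congr_fun hvT _).symm)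
    · refine X.compat_bar ι' x (fun g => ?_) g
      exact (DFunLike.congr_fun hι'u _).trans
        ((hmin g).trans (DFunLike.congr_fun hvT _).symm)
  · intro w c
    rw [List.mem_append, hm₁, hm₂]
    by_cases hw : w = u
    · subst hw
      have h0 : (⟨u, c⟩ : Label X) ∉ ℓ := fun h => ho ((M.mem_iff _ _).1 h).1
      rw [hmem' c]
      constructor
      · rintro (⟨h1, -⟩ | ⟨h1, h2⟩)
        · exact absurd h1 h0
        · refine ⟨.inl rfl, h1, fun y hy hye hyt e => ?_⟩
          rcases hyt with hyt | hyt
          · exact hS.isTree.no_loop y hye (Subtype.ext (hy.trans (Subtype.ext_iff.1 hyt).symm))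
          · obtain rfl : x = y := (huniq y hye (Subtype.ext hy) hyt).symm
            exact h2 (congrArg (Sigma.mk u) e.symm)
      · rintro ⟨-, h1, h2⟩
        refine .inr ⟨h1, fun e => ?_⟩
        have e' : c = ConjClasses.mk g₂ := by simpa [b] using e
        exact h2 x rfl hx (.inr ht) e'.symm
    · have h0 : (⟨w, c⟩ : Label X) ∉ ℓ' := fun h => hw (hfst' _ h)
      rw [M.mem_iff w c]
      constructor
      · rintro (⟨⟨h1, h2, h3⟩, h4⟩ | ⟨h1, -⟩)
        · refine ⟨.inr h1, h2, fun y hy hye hyt e => ?_⟩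
          rcases hyt with hyt | hyt
          · have hyx := huniq (X.graph.bar y) hye.bar hyt
              (by rw [X.graph.t_bar]; exact (Subtype.ext hy : X.graph.o y = w) ▸ h1)
            have hyx' : y = X.graph.bar x := by rw [← hyx, X.graph.bar_bar]
            subst hyx'
            obtain rfl : w = v := Subtype.ext hy.symm
            refine h4 (congrArg (Sigma.mk v) (e.symm.trans ?_))
            rw [hg₁]
            rfl
          · exact h3 y hy hye hyt e
        · exact absurd h1 h0
      · rintro ⟨h1 | h1, h2, h3⟩
        · exact absurd h1 hw
        · refine .inl ⟨⟨h1, h2, fun y hy hye hyt => h3 y hy hye (.inr hyt)⟩, fun e => ?_⟩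
          obtain rfl : w = v := congrArg Sigma.fst e
          have e' : c = ConjClasses.mk g₁ := by simpa [a] using e
          refine h3 (X.graph.bar x) rfl hx.bar (.inl (X.graph.t_bar x)) ?_
          rw [e', hg₁]
          rfl
  -- Gluing removes one label on each side, and `2 + 2 - 2 = 2`. The bound is carried along because
  -- a sphere group must not have exactly one generator.
  · have e₁ := hr₁.perm.length_eq
    have e₂ := hr₂.perm.length_eq
    have e₃ := M.length
    have e₄ := two_le_ncard_per hS u
    simp only [List.length_append, List.length_singleton] at e₁ e₂ ⊢
    omega
  · intro w c hwc
    rcases List.mem_append.1 hwc with h | h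
    · obtain ⟨g, hg, hfg⟩ := M.conj w c ((hm₁ _).1 h).1
      refine ⟨g, hg, (hc₁ _ h).trans ?_⟩
      rw [hι' w (hT₁ _ h)]
      exact i.map_isConj hfg
    · obtain rfl : w = u := hT₂ _ h
      obtain ⟨g, hg, hfg⟩ := hf' c ((hm₂ _).1 h).1
      refine ⟨g, hg, (hc₂ _ h).trans ?_⟩
      rw [hι'u, ← hfg]
  · rw [← top_le_iff, ← hgen]
    refine sup_le ?_ ?_
    · rw [MonoidHom.range_eq_map, ← M.generate]
      simp only [Subgroup.map_iSup]
      refine iSup₂_le fun w hw => ?_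
      refine le_trans ?_ (le_iSup₂ (f := fun w (_ : w ∈ insert u T) => (ι' w).range) w (.inr hw))
      rw [hι' w hw, MonoidHom.range_comp]
    · refine le_trans ?_ (le_iSup₂ (f := fun w (_ : w ∈ insert u T) => (ι' w).range) u (.inl rfl))
      rw [hι'u]
  · intro K _ φ hφ
    obtain ⟨α, hα⟩ := M.exists_hom φ fun y hy h1 h2 => hφ y hy (.inr h1) (.inr h2)
    obtain ⟨Φ, h1, h2⟩ := hext α (φ u) (by
      have h3 := hφ x hx (.inl rfl) (.inr ht) (S.gen x)
      have h4 := DFunLike.congr_fun (hα v ht) g₁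
      rw [S.map_sgn, S.map_sgn, S.map_sgn]
      exact (S.sgn_eq_inv_iff hS hx _ _).2 (h4.trans h3.symm))
    refine ⟨Φ, ?_⟩
    rintro w (rfl | hw)
    · rw [hι'u, h2]
    · rw [hι' w hw, ← MonoidHom.comp_assoc, h1, hα w hw]

/-- The vertices are added in order of non-decreasing depth. The sets that occur are closed under
passing to the parent, and a new vertex has no neighbour among the earlier ones except its parent.
-/
theorem hasModel_univ (hS : S.IsStable) : S.HasModel Set.univ := by
  classical
  obtain ⟨r⟩ := hS.isTree.isTree.connected.nonempty
  obtain ⟨R⟩ := hS.isTree.exists_rooted r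
  have := hS.finite
  have : Finite X.graph.Vert := Subtype.finite
  have := Fintype.ofFinite X.graph.Vert
  suffices H : ∀ T : Finset X.graph.Vert, r ∈ T → (∀ v ∈ T, v ≠ r → X.graph.t (R.par v) ∈ T) →
      S.HasModel (T : Set X.graph.Vert) by
    have := H Finset.univ (Finset.mem_univ _) fun _ _ _ => Finset.mem_univ _
    rwa [Finset.coe_univ] at this
  intro T
  induction T using Finset.induction_on_max_value R.depth with
  | empty => exact fun h => absurd h (Finset.notMem_empty r)
  | insert a T ha hmax ih =>
    intro hr hcl
    by_cases har : a = r
    · subst har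
      have hT : T = ∅ := Finset.eq_empty_of_forall_notMem fun x hx =>
        absurd (hmax x hx) (not_le.2 (R.depth_root_lt x fun e => ha (e ▸ hx)))
      subst hT
      simpa using hasModel_singleton hS a
    · have hrT : r ∈ T := (Finset.mem_insert.1 hr).resolve_left (Ne.symm har)
      have hpar : X.graph.t (R.par a) ∈ T := by
        refine (Finset.mem_insert.1 (hcl a (Finset.mem_insert_self _ _) har)).resolve_left ?_
        intro e
        exact hS.isTree.no_loop _ (R.isEdge_par a har) ((R.o_par a har).trans e.symm)
      have hM := ih hrT fun v hv hvr => by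
        refine (Finset.mem_insert.1 (hcl v (Finset.mem_insert_of_mem hv) hvr)).resolve_left ?_
        intro e
        have h1 := R.depth_par v hvr
        rw [e] at h1
        exact absurd (hmax v hv) (not_le.2 h1)
      have := HasModel.insert_vertex hS hM (R.isEdge_par a har)
        (by rw [R.o_par a har]; exact ha) hpar (fun y hy ho ht => by
          rw [R.o_par a har] at ho
          rcases R.eq_par y hy with ⟨-, h⟩ | ⟨h1, h⟩
          · rw [h, ho]
          · exfalso
            have h2 := R.depth_par _ h1
            rw [← h, X.graph.t_bar, ho] at h2
            exact absurd (hmax _ ht) (not_le.2 h2))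
      rwa [R.o_par a har, ← Finset.coe_insert] at this

/-- The two edges at a curve vertex attach to different classes, and there are only two peripheral
classes. -/
theorem IsVacant.not_isCurve (hS : S.IsStable) {v : X.Vert} {c : ConjClasses (X.G v.1)}
    (h : S.IsVacant v c) : ¬ S.IsCurve v := by
  classical
  intro hv
  have h2 := hS.curve_valence v hv
  have h3 := hS.curve_cyclic v hv
  let E : Set X.graph.carrier := {x | X.graph.IsEdge x ∧ X.graph.o x = v}
  have hE : ∀ x : E, X.graph.src x.1 = v.1 := fun x => Subtype.ext_iff.1 x.2.2
  let F : E → ConjClasses (X.G v.1) := fun x => ConjClasses.mk (X.minusTo (hE x) (S.gen x.1))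
  have hF : Function.Injective F := fun x y e =>
    Subtype.ext (eq_of_attach hS (hE x) (hE y) x.2.1 y.2.1 e)
  have hper : ∀ x, F x ∈ S.per v.1 := by
    rintro ⟨x, hx, rfl⟩
    exact S.gen_mem x hx (hS.edge_ne_one x hx)
  have hle : Set.range F ⊆ S.per v.1 := by
    rintro _ ⟨x, rfl⟩
    exact hper x
  have hcard : (Set.range F).ncard = 2 := by
    rw [Set.ncard_range_of_injective hF]
    exact h2
  have heq := Set.eq_of_subset_of_ncard_le hle (by rw [h3, hcard]) (S.isSphere v.1).finite
  obtain ⟨x, hx⟩ : c ∈ Set.range F := heq ▸ h.1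
  exact h.2 x.1 (hE x) x.2.1 hx

end SphereStructure

namespace GraphOfGroups

variable {X : GraphOfGroups.{u}}

/-- The homomorphism `g ↦ p g p⁻¹` from a vertex group to the fundamental group. -/
def conjHom {v₀ v : X.Vert} {p : X.PathGroup} (hp : X.IsPath v₀ v p) :
    X.G v.1 →* X.fundGroup v₀ where
  toFun g := ⟨p * X.ofVert v g * p⁻¹, (hp.mul (.vert v g)).mul hp.inv⟩
  map_one' := Subtype.ext (by simp [X.ofVert_one])
  map_mul' g h := Subtype.ext (by
    change p * X.ofVert v (g * h) * p⁻¹ = (p * X.ofVert v g * p⁻¹) * (p * X.ofVert v h * p⁻¹)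
    rw [← X.ofVert_mul]; group)

theorem coe_conjHom {v₀ v : X.Vert} {p : X.PathGroup} (hp : X.IsPath v₀ v p) (g : X.G v.1) :
    (conjHom hp g : X.PathGroup) = p * X.ofVert v g * p⁻¹ := rfl

theorem isConj_conjHom {v₀ v : X.Vert} {p p' : X.PathGroup} (hp : X.IsPath v₀ v p)
    (hp' : X.IsPath v₀ v p') (g : X.G v.1) : IsConj (conjHom hp g) (conjHom hp' g) := by
  refine isConj_iff.2 ⟨⟨p' * p⁻¹, hp'.mul hp.inv⟩, Subtype.ext ?_⟩
  change p' * p⁻¹ * (p * X.ofVert v g * p⁻¹) * (p' * p⁻¹)⁻¹ = p' * X.ofVert v g * p'⁻¹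
  group

/-- The homomorphism from the path group to a group `A` that maps all edges to `1`. -/
theorem exists_pathGroup_hom {A : Type u} [Group A] (ι : ∀ v : X.Vert, X.G v.1 →* A)
    (h : ∀ x, X.graph.IsEdge x → ∀ g, ι (X.graph.o x) (X.minus x g) =
      ι (X.graph.t x) (X.minus (X.graph.bar x) (X.inv x g))) :
    ∃ Φ : X.PathGroup →* A, (∀ v g, Φ (X.ofVert v g) = ι v g) ∧ ∀ x, Φ (X.ofEdge x) = 1 := by
  let F : (Σ v : X.Vert, X.G v.1) ⊕ X.graph.carrier → A := Sum.elim (fun y => ι y.1 y.2) fun _ => 1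
  have hv : ∀ x, X.graph.src x = x → ∀ g, ι (X.graph.o x) (X.minus x g) =
      ι (X.graph.t x) (X.minus (X.graph.bar x) (X.inv x g)) := by
    intro x hx g
    have key : ∀ (y : X.graph.carrier) (e : y = x) (k : X.G y), transport X.G e k = g →
        ι (X.graph.o x) (X.minus x g) = ι (X.graph.o y) (X.minus y k) := by
      rintro _ rfl k rfl
      rfl
    exact key _ (Graph'.bar_eq_of_src_eq hx) _ (X.inv_vertex x _ g)
  refine ⟨PresentedGroup.toGroup (f := F) ?_, fun v g => ?_, fun x => ?_⟩
  · rintro r (⟨v, g, h'⟩ | ⟨v⟩ | ⟨x⟩ | ⟨x, g⟩)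
    · simp only [map_mul, map_inv, FreeGroup.lift_apply_of, F, Sum.elim_inl]
      rw [mul_inv_eq_one]
    · simp [F]
    · simp [F]
    · simp only [map_mul, map_inv, FreeGroup.lift_apply_of, F, Sum.elim_inl, Sum.elim_inr, one_mul,
        mul_one]
      rw [mul_inv_eq_one]
      by_cases hx : X.graph.IsEdge x
      · exact h x hx g
      · exact hv x (not_not.1 hx) g
  · exact PresentedGroup.toGroup.of _
  · exact PresentedGroup.toGroup.of _

end GraphOfGroups

namespace SphereStructure

open GraphOfGroups

variable {X : GraphOfGroups.{u}} {S : SphereStructure X}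

/-- The fundamental group of a stable sphere tree of groups is a sphere group; its peripheral classes
are those of the vacant classes, and they are pairwise distinct. -/
theorem IsStable.fundGroup (hS : S.IsStable) (v₀ : X.Vert) :
    IsSphereGroup (S.fundPer v₀) ∧
      ∀ {p : X.Vert → X.PathGroup} (hp : ∀ v, X.IsPath v₀ v (p v)) (x y : Label X),
        S.IsVacant x.1 x.2 → S.IsVacant y.1 y.2 →
        ConjClasses.map (conjHom (hp x.1)) x.2 = ConjClasses.map (conjHom (hp y.1)) y.2 →
        x = y := by
  obtain ⟨τ, hτ, hτe, hτc⟩ := exists_potential hS.isTree v₀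
  obtain ⟨A, _, ι, ℓ, f, M⟩ := hasModel_univ hS
  obtain ⟨Φ, hΦv, hΦe⟩ := exists_pathGroup_hom ι fun x hx g =>
    M.compat x hx (Set.mem_univ _) (Set.mem_univ _) g
  -- `Ψ` transports the vertex groups to the basepoint along the potential `τ`, whereas `Φ` forgets
  -- the edges and hence kills `τ`. This makes `Φ` a left inverse of `Ψ`.
  obtain ⟨Ψ, hΨ⟩ := M.exists_hom (fun v => conjHom (hτ v)) fun x _ _ _ g => by
    refine Subtype.ext ?_
    change τ (X.graph.o x) * X.ofVert _ _ * (τ (X.graph.o x))⁻¹ =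
      τ (X.graph.t x) * X.ofVert _ _ * (τ (X.graph.t x))⁻¹
    rw [← hτe x, mul_assoc (τ (X.graph.o x)) (X.ofEdge x), ← X.ofVert_mul_ofEdge x g]
    group
  have hΨ' : ∀ v g, Ψ (ι v g) = conjHom (hτ v) g := fun v g =>
    DFunLike.congr_fun (hΨ v (Set.mem_univ _)) g
  have hΦτ : ∀ v, Φ (τ v) = 1 := by
    intro v
    have hle : Subgroup.closure (Set.range X.ofEdge) ≤ Φ.ker := by
      rw [Subgroup.closure_le]
      rintro _ ⟨x, rfl⟩
      exact hΦe x
    exact hle (hτc v)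
  have hinj : Function.Injective Ψ := by
    have hid : (Φ.comp (X.fundGroup v₀).subtype).comp Ψ = MonoidHom.id A := by
      have hle : ⨆ v ∈ (Set.univ : Set X.Vert), (ι v).range ≤
          ((Φ.comp (X.fundGroup v₀).subtype).comp Ψ).eqLocus (MonoidHom.id A) := by
        refine iSup₂_le fun v _ => ?_
        rintro _ ⟨g, rfl⟩
        change Φ (Ψ (ι v g) : X.PathGroup) = ι v g
        rw [hΨ', coe_conjHom, map_mul, map_mul, map_inv, hΦτ, hΦv]
        simp
      rw [M.generate] at hle
      exact MonoidHom.ext fun a => hle trivial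
    exact fun a b e => (DFunLike.congr_fun hid a).symm.trans
      ((congrArg (fun z : X.fundGroup v₀ => Φ z) e).trans (DFunLike.congr_fun hid b))
  -- The discrepancy between `Ψ ∘ Φ` and the identity is the potential at the two ends; for a loop
  -- at `v₀` it is undone by conjugation with `τ v₀`.
  have hΨΦ : ∀ {v w a}, X.IsPath v w a → (Ψ (Φ a) : X.PathGroup) = τ v * a * (τ w)⁻¹ := by
    intro v w a h
    induction h with
    | vert v g => rw [hΦv, hΨ', coe_conjHom]
    | edge x => rw [hΦe, hτe, map_one, mul_inv_cancel]; rfl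
    | mul _ _ h1 h2 =>
      rw [map_mul, map_mul, Subgroup.coe_mul, h1, h2]
      group
  have hsurj : Function.Surjective Ψ := by
    intro b
    refine ⟨Φ ((τ v₀)⁻¹ * b * τ v₀), Subtype.ext ?_⟩
    rw [hΨΦ (((hτ v₀).inv.mul b.2).mul (hτ v₀))]
    group
  let e : A ≃* X.fundGroup v₀ := MulEquiv.ofBijective Ψ ⟨hinj, hsurj⟩
  have hsph := M.sphere.mulEquiv e
  have hvac : ∀ v c, ⟨v, c⟩ ∈ ℓ ↔ S.IsVacant v c := by
    intro v c
    rw [M.mem_iff]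
    constructor
    · exact fun h => ⟨h.2.1, fun x hx hxe => h.2.2 x hx hxe (Set.mem_univ _)⟩
    · exact fun h => ⟨Set.mem_univ _, h.1, fun x hx hxe _ => h.2 x hx hxe⟩
  have hcls : ∀ {p : X.Vert → X.PathGroup} (hp : ∀ v, X.IsPath v₀ v (p v)) (x : Label X), x ∈ ℓ →
      ConjClasses.mk (e (f x)) = ConjClasses.map (conjHom (hp x.1)) x.2 := by
    rintro p hp ⟨v, c⟩ hx
    obtain ⟨g, rfl, hg⟩ := M.conj v c hx
    -- Vacant classes occur only at sphere vertices, so the signs introduced for the gluing do not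
    -- affect the peripheral classes.
    have hv : ¬ S.IsCurve v := ((hvac v _).1 hx).not_isCurve hS
    have hsgn : S.sgn v g = g := if_neg hv
    rw [hsgn] at hg
    refine ConjClasses.mk_eq_mk_iff_isConj.2 ((Ψ.map_isConj hg).trans ?_)
    rw [hΨ']
    exact isConj_conjHom _ _ _
  constructor
  · have hlen := M.length
    convert hsph.isSphereGroup (by omega) using 1
    ext c
    constructor
    · rintro ⟨a, v, g, p, hp, hg, ha, rfl⟩
      refine ⟨⟨v, ConjClasses.mk g⟩, (hvac _ _).2 hg, ?_⟩
      rw [hcls hτ _ ((hvac _ _).2 hg)]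
      refine ConjClasses.mk_eq_mk_iff_isConj.2 ?_
      have : a = conjHom hp g := Subtype.ext ha
      rw [this]
      exact isConj_conjHom _ _ _
    · rintro ⟨⟨v, c⟩, hx, rfl⟩
      rw [hcls hτ _ hx]
      have hv := (hvac _ _).1 hx
      induction c using Quotient.inductionOn with
      | h g => exact ⟨conjHom (hτ v) g, v, g, τ v, hτ v, hv, rfl, rfl⟩
  · intro p hp x y hx hy hxy
    have hx' := (hvac _ _).2 hx
    have hy' := (hvac _ _).2 hy
    rw [← hcls hp x hx', ← hcls hp y hy'] at hxy
    exact hsph.injOn hx' hy' (ConjClasses.mk_eq_mk_iff_isConj.1 hxy)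

end SphereStructure

/-! ## Cycles and lifts -/


namespace Biset

section

variable {H G B : Type*} [Group H] [Group G] [MulAction H B] [MulAction Gᵐᵒᵖ B]
  [SMulCommClass H Gᵐᵒᵖ B]

theorem leftOrbit_eq_iff {b b' : B} : leftOrbit H b = leftOrbit H b' ↔ ∃ h : H, h • b = b' := by
  rw [leftOrbit, leftOrbit, Quotient.eq'', MulAction.orbitRel_apply]
  constructor
  · rintro ⟨h, rfl⟩
    exact ⟨h⁻¹, inv_smul_smul _ _⟩
  · rintro ⟨h, rfl⟩
    exact ⟨h⁻¹, inv_smul_smul _ _⟩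

theorem exists_leftOrbit_eq (x : LeftOrbits H B) : ∃ b, leftOrbit H b = x :=
  Quotient.inductionOn x fun b => ⟨b, rfl⟩

theorem rightPerm_zpow_leftOrbit (g : G) (n : ℤ) (b : B) :
    (rightPerm H g ^ n) (leftOrbit H b) = leftOrbit H (op (g ^ n) • b) := by
  let ρ : G →* (Equiv.Perm (LeftOrbits H B))ᵐᵒᵖ :=
    { toFun := fun g => op (rightPerm H g)
      map_one' := congrArg op (Equiv.ext fun x => by
        obtain ⟨b, rfl⟩ := exists_leftOrbit_eq x
        exact congrArg (leftOrbit H) (one_smul _ b))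
      map_mul' := fun g h => congrArg op (Equiv.ext fun x => by
        obtain ⟨b, rfl⟩ := exists_leftOrbit_eq x
        exact congrArg (leftOrbit H) (mul_smul (op h) (op g) b)) }
  have := congrArg (fun p => (unop p) (leftOrbit H b)) (map_zpow ρ g n)
  exact this.symm

/-- The cycle of the left orbit of `b`. -/
def cyc (H : Type*) {G B : Type*} [Group H] [Group G] [MulAction H B] [MulAction Gᵐᵒᵖ B]
    [SMulCommClass H Gᵐᵒᵖ B] (g : G) (b : B) : Cycle H B g :=
  Quotient.mk'' (leftOrbit H b)

theorem cyc_eq_iff {g : G} {b b' : B} :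
    cyc H g b = cyc H g b' ↔ ∃ (n : ℤ) (h : H), h • b = op (g ^ n) • b' := by
  rw [cyc, cyc, Quotient.eq'', MulAction.orbitRel_apply]
  constructor
  · rintro ⟨⟨_, n, rfl⟩, h⟩
    change (rightPerm H g ^ n) (leftOrbit H b') = leftOrbit H b at h
    rw [rightPerm_zpow_leftOrbit] at h
    obtain ⟨k, hk⟩ := leftOrbit_eq_iff.1 h.symm
    exact ⟨n, k, hk⟩
  · rintro ⟨n, h, e⟩
    refine ⟨⟨_, n, rfl⟩, ?_⟩
    change (rightPerm H g ^ n) (leftOrbit H b') = leftOrbit H b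
    rw [rightPerm_zpow_leftOrbit]
    exact (leftOrbit_eq_iff.2 ⟨h, e⟩).symm

theorem exists_cyc_eq {g : G} (c : Cycle H B g) : ∃ b : B, cyc H g b = c := by
  obtain ⟨x, rfl⟩ := Quotient.exists_rep c
  obtain ⟨b, rfl⟩ := exists_leftOrbit_eq x
  exact ⟨b, rfl⟩

theorem mem_orbit_iff {g : G} {c : Cycle H B g} {b : B} : leftOrbit H b ∈ c.orbit ↔ cyc H g b = c :=
  MulAction.orbitRel.Quotient.mem_orbit

/-- The length is the minimal period of the left orbit of `b` under `g`. Lengths are compared below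
through the integers that they divide. -/
theorem length_dvd_iff (g : G) (b : B) (k : ℤ) :
    ((cyc H g b).length : ℤ) ∣ k ↔ ∃ h : H, h • b = op (g ^ k) • b := by
  have h1 : (cyc H g b).length =
      Function.minimalPeriod ((rightPerm H (B := B) g) • ·) (leftOrbit H b) := by
    have := Nat.card_congr (MulAction.orbitZPowersEquiv (rightPerm H (B := B) g) (leftOrbit H b))
    rw [Nat.card_zmod] at this
    rw [← this]
    rfl
  rw [h1, ← MulAction.zpow_smul_eq_iff_minimalPeriod_dvd]
  change (rightPerm H g ^ k) (leftOrbit H b) = leftOrbit H b ↔ _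
  rw [rightPerm_zpow_leftOrbit, eq_comm, leftOrbit_eq_iff]

theorem isLift_iff {g : G} {c : Cycle H B g} {C : ConjClasses H} : c.IsLift C ↔
    ∃ (s : B) (h : H), cyc H g s = c ∧ h • s = op (g ^ c.length) • s ∧ C = ConjClasses.mk h := by
  simp only [Cycle.IsLift, mem_orbit_iff]

theorem exists_isLift {g : G} (s : B) : ∃ h : H, h • s = op (g ^ (cyc H g s).length) • s ∧
    (cyc H g s).IsLift (ConjClasses.mk h) := by
  obtain ⟨h, hh⟩ := (length_dvd_iff (H := H) g s _).1 (dvd_refl ((cyc H g s).length : ℤ))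
  rw [zpow_natCast] at hh
  exact ⟨h, hh, isLift_iff.2 ⟨s, h, rfl, hh, rfl⟩⟩

theorem exists_isLift' {g : G} (c : Cycle H B g) : ∃ C, c.IsLift C := by
  obtain ⟨s, rfl⟩ := exists_cyc_eq c
  obtain ⟨h, -, hh⟩ := exists_isLift (H := H) (g := g) s
  exact ⟨_, hh⟩

/-- For a given point over the cycle, left-freeness determines `h`. Passing to another point by `k s
= s' g ^ n` conjugates `h` by `k`. -/
theorem Cycle.IsLift.unique (hB : IsLeftFree H B) {g : G} {c : Cycle H B g} {C C' : ConjClasses H}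
    (hC : c.IsLift C) (hC' : c.IsLift C') : C = C' := by
  obtain ⟨s, h, hs, hh, rfl⟩ := isLift_iff.1 hC
  obtain ⟨s', h', hs', hh', rfl⟩ := isLift_iff.1 hC'
  obtain ⟨n, k, e⟩ := cyc_eq_iff.1 (hs.trans hs'.symm)
  refine (ConjClasses.mk_eq_mk_iff_isConj.2 (isConj_iff.2 ⟨k, ?_⟩))
  rw [mul_inv_eq_iff_eq_mul]
  have h1 : (h'⁻¹ * (k * h * k⁻¹)) • (k • s) = k • s := by
    have h2 : h' • (k • s) = (k * h) • s := by
      rw [e, smul_comm, hh', mul_smul, hh, smul_comm k, e, smul_smul, smul_smul, ← op_mul, ← op_mul,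
        ← zpow_natCast, ← zpow_add, ← zpow_add, add_comm]
    rw [mul_smul, inv_smul_eq_iff, h2, mul_smul (k * h), inv_smul_smul]
  have := hB _ _ h1
  rw [inv_mul_eq_one] at this
  rw [this]; group

/-- The number of cycles. -/
noncomputable def ncyc (H : Type*) {G : Type*} (B : Type*) [Group H] [Group G] [MulAction H B]
    [MulAction Gᵐᵒᵖ B] [SMulCommClass H Gᵐᵒᵖ B] (g : G) : ℤ := Nat.card (Cycle H B g)

/-- The cycles partition the left orbits, so their lengths add up to the degree. The Riemann–Hurwitz
condition becomes a statement about numbers of cycles. -/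
theorem finsum_length_sub_one [Finite (LeftOrbits H B)] (g : G) :
    ∑ᶠ o : Cycle H B g, ((o.length : ℤ) - 1) = Nat.card (LeftOrbits H B) - ncyc H B g := by
  classical
  have : Finite (Cycle H B g) := Quotient.finite _
  have := Fintype.ofFinite (Cycle H B g)
  rw [finsum_eq_sum_of_fintype, Finset.sum_sub_distrib]
  congr 1
  · rw [Nat.card_congr (MulAction.selfEquivSigmaOrbits' (Subgroup.zpowers (rightPerm H (B := B) g))
      (LeftOrbits H B)), Nat.card_sigma]
    push_cast
    rfl
  · simp [ncyc, Nat.card_eq_fintype_card]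

theorem IsSphereBiset.finsum_ncyc {PH : Set (ConjClasses H)} {PG : Set (ConjClasses G)}
    (h : IsSphereBiset PH PG B) (γ : PG → G) (hγ : ∀ c, ConjClasses.mk (γ c) = c) :
    ∑ᶠ c : PG, ((Nat.card (LeftOrbits H B) : ℤ) - ncyc H B (γ c)) =
      2 * Nat.card (LeftOrbits H B) - 2 := by
  have := h.finite_degree
  rw [← h.riemann_hurwitz γ hγ]
  exact finsum_congr fun c => (finsum_length_sub_one _).symm

end

/-! ### Decompositions -/

section

variable {I : Type*} {H G B : I → Type*} [∀ i, Group (H i)] [∀ i, Group (G i)]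
  [∀ i, MulAction (H i) (B i)] [∀ i, MulAction (G i)ᵐᵒᵖ (B i)]
  [∀ i, SMulCommClass (H i) (G i)ᵐᵒᵖ (B i)]
  {H' G' B' : Type*} [Group H'] [Group G'] [MulAction H' B'] [MulAction G'ᵐᵒᵖ B']
  [SMulCommClass H' G'ᵐᵒᵖ B']

/-- A family of intertwiners for which the left orbits of `B'` are the disjoint union of those of
the `B i`. -/
structure IsDecomposition (φ : ∀ i, H i →* H') (ψ : ∀ i, G i →* G') (F : ∀ i, B i → B') : Prop where
  map_smul : ∀ i (h : H i) b, F i (h • b) = φ i h • F i b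
  map_op_smul : ∀ i (g : G i) b, F i (op g • b) = op (ψ i g) • F i b
  injective : ∀ i b j b' (h : H'), h • F i b = F j b' →
    (⟨i, leftOrbit (H i) b⟩ : Σ i, LeftOrbits (H i) (B i)) = ⟨j, leftOrbit (H j) b'⟩
  surjective : ∀ b', ∃ i b, ∃ h : H', h • F i b = b'

namespace IsDecomposition

variable {φ : ∀ i, H i →* H'} {ψ : ∀ i, G i →* G'} {F : ∀ i, B i → B'}

theorem exists_smul_eq (D : IsDecomposition φ ψ F) {i : I} {b b' : B i} {h : H'}
    (e : h • F i b = F i b') :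
    ∃ k : H i, k • b = b' := by
  have := D.injective i b i b' h e
  simp only [Sigma.mk.injEq, heq_eq_eq, true_and] at this
  exact leftOrbit_eq_iff.1 this

theorem exists_orbits_bijective (D : IsDecomposition φ ψ F) :
    ∃ f : (Σ i, LeftOrbits (H i) (B i)) → LeftOrbits H' B',
    Function.Bijective f := by
  refine ⟨fun x => Quotient.liftOn x.2 (fun b => leftOrbit H' (F x.1 b)) ?_, ?_, ?_⟩
  · rintro b b' h
    have h' : leftOrbit (H x.1) b = leftOrbit (H x.1) b' := Quotient.sound h
    obtain ⟨k, rfl⟩ := leftOrbit_eq_iff.1 h'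
    exact leftOrbit_eq_iff.2 ⟨φ x.1 k, (D.map_smul _ _ _).symm⟩
  · rintro ⟨i, x⟩ ⟨j, y⟩ e
    obtain ⟨b, rfl⟩ := exists_leftOrbit_eq x
    obtain ⟨b', rfl⟩ := exists_leftOrbit_eq y
    obtain ⟨h, hh⟩ := leftOrbit_eq_iff.1 (show leftOrbit H' (F i b) = leftOrbit H' (F j b') from e)
    exact D.injective i b j b' h hh
  · intro y
    obtain ⟨b', rfl⟩ := exists_leftOrbit_eq y
    obtain ⟨i, b, h, rfl⟩ := D.surjective b'
    exact ⟨⟨i, leftOrbit _ b⟩, leftOrbit_eq_iff.2 ⟨h, rfl⟩⟩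

theorem cyc_eq_cyc_iff (D : IsDecomposition φ ψ F) {g : ∀ i, G i} {g' : G'}
    (hg : ∀ i, ψ i (g i) = g') {i j : I} {b : B i}
    {b' : B j} : cyc H' g' (F i b) = cyc H' g' (F j b') ↔
      (⟨i, cyc (H i) (g i) b⟩ : Σ i, Cycle (H i) (B i) (g i)) = ⟨j, cyc (H j) (g j) b'⟩ := by
  constructor
  · intro e
    obtain ⟨n, h, e⟩ := cyc_eq_iff.1 e
    rw [← hg j, ← map_zpow, ← D.map_op_smul] at e
    have := D.injective _ _ _ _ _ e
    obtain rfl : i = j := congrArg Sigma.fst this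
    simp only [Sigma.mk.injEq, heq_eq_eq, true_and] at this ⊢
    obtain ⟨k, hk⟩ := leftOrbit_eq_iff.1 this
    exact cyc_eq_iff.2 ⟨n, k, hk⟩
  · intro e
    obtain rfl : i = j := congrArg Sigma.fst e
    simp only [Sigma.mk.injEq, heq_eq_eq, true_and] at e
    obtain ⟨n, k, e⟩ := cyc_eq_iff.1 e
    refine cyc_eq_iff.2 ⟨n, φ i k, ?_⟩
    rw [← D.map_smul, e, D.map_op_smul, map_zpow, hg]

theorem length_eq (D : IsDecomposition φ ψ F) {g : ∀ i, G i} {g' : G'} (hg : ∀ i, ψ i (g i) = g')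
    (i : I) (b : B i) :
    (cyc H' g' (F i b)).length = (cyc (H i) (g i) b).length := by
  have key : ∀ k : ℤ, ((cyc H' g' (F i b)).length : ℤ) ∣ k ↔
      ((cyc (H i) (g i) b).length : ℤ) ∣ k := by
    intro k
    rw [length_dvd_iff, length_dvd_iff]
    constructor
    · rintro ⟨h, e⟩
      rw [← hg i, ← map_zpow, ← D.map_op_smul] at e
      exact D.exists_smul_eq e
    · rintro ⟨h, e⟩
      refine ⟨φ i h, ?_⟩
      rw [← D.map_smul, e, D.map_op_smul, map_zpow, hg]
  exact Nat.dvd_antisymm (Int.natCast_dvd_natCast.1 ((key _).2 dvd_rfl))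
    (Int.natCast_dvd_natCast.1 ((key _).1 dvd_rfl))

/-- The bijection on cycles; it maps lifts to lifts. -/
theorem exists_cycles_bijective (D : IsDecomposition φ ψ F) {g : ∀ i, G i} {g' : G'}
    (hg : ∀ i, ψ i (g i) = g') :
    ∃ f : (Σ i, Cycle (H i) (B i) (g i)) → Cycle H' B' g', Function.Bijective f ∧
      (∀ i b, f ⟨i, cyc (H i) (g i) b⟩ = cyc H' g' (F i b)) ∧
      ∀ i (c : Cycle (H i) (B i) (g i)) C, c.IsLift C →
        (f ⟨i, c⟩).IsLift (ConjClasses.map (φ i) C) := by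
  have hex : ∀ x : Σ i, Cycle (H i) (B i) (g i), ∃ b, cyc (H x.1) (g x.1) b = x.2 :=
    fun x => exists_cyc_eq x.2
  choose s hs using hex
  let f : (Σ i, Cycle (H i) (B i) (g i)) → Cycle H' B' g' := fun x => cyc H' g' (F x.1 (s x))
  have hf : ∀ i b, f ⟨i, cyc (H i) (g i) b⟩ = cyc H' g' (F i b) := by
    intro i b
    refine (D.cyc_eq_cyc_iff hg).2 ?_
    exact congrArg (Sigma.mk i) (hs ⟨i, cyc (H i) (g i) b⟩)
  refine ⟨f, ⟨?_, ?_⟩, hf, ?_⟩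
  · rintro ⟨i, x⟩ ⟨j, y⟩ e
    obtain ⟨b, rfl⟩ := exists_cyc_eq x
    obtain ⟨b', rfl⟩ := exists_cyc_eq y
    rw [hf, hf] at e
    exact (D.cyc_eq_cyc_iff hg).1 e
  · intro y
    obtain ⟨b', rfl⟩ := exists_cyc_eq y
    obtain ⟨i, b, h, rfl⟩ := D.surjective b'
    refine ⟨⟨i, cyc _ _ b⟩, (hf i b).trans (cyc_eq_iff.2 ⟨0, h, ?_⟩)⟩
    simp
  · intro i c C hC
    obtain ⟨b, h, rfl, hh, rfl⟩ := isLift_iff.1 hC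
    rw [hf]
    refine isLift_iff.2 ⟨F i b, φ i h, rfl, ?_, rfl⟩
    rw [← D.map_smul, hh, D.map_op_smul, map_pow, hg, D.length_eq hg]

theorem card_leftOrbits (D : IsDecomposition φ ψ F) [Fintype I]
    [∀ i, Finite (LeftOrbits (H i) (B i))] :
    Finite (LeftOrbits H' B') ∧
      (Nat.card (LeftOrbits H' B') : ℤ) = ∑ i, (Nat.card (LeftOrbits (H i) (B i)) : ℤ) := by
  obtain ⟨f, hf⟩ := D.exists_orbits_bijective
  refine ⟨Finite.of_surjective f hf.2, ?_⟩
  rw [← Nat.card_eq_of_bijective f hf, Nat.card_sigma]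
  push_cast
  rfl

theorem ncyc_eq (D : IsDecomposition φ ψ F) [Fintype I] [∀ i, Finite (LeftOrbits (H i) (B i))]
    {g : ∀ i, G i} {g' : G'}
    (hg : ∀ i, ψ i (g i) = g') : ncyc H' B' g' = ∑ i, ncyc (H i) (B i) (g i) := by
  obtain ⟨f, hf, -⟩ := D.exists_cycles_bijective hg
  have : ∀ i, Finite (Cycle (H i) (B i) (g i)) := fun i => Quotient.finite _
  unfold ncyc
  rw [← Nat.card_eq_of_bijective f hf, Nat.card_sigma]
  push_cast
  rfl

end IsDecomposition

end

end Biset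

/-! ## The structure of the fundamental biset -/

namespace GraphOfGroups

theorem minus_transport (X : GraphOfGroups.{u}) {x y : X.graph.carrier} (h : x = y) (g : X.G x) :
    X.minus y (transport X.G h g) = transport X.G (congrArg X.graph.src h) (X.minus x g) := by
  subst h; rfl

end GraphOfGroups

namespace GraphOfBisets

variable {Y X : GraphOfGroups.{u}} {𝔅 : GraphOfBisets Y X}

theorem rhoV_o (e : 𝔅.graph.carrier) : 𝔅.rhoV (𝔅.graph.o e) = X.graph.o (𝔅.rho e) :=
  IsGraphMorphism.onVert_o _ _

theorem rhoV_t (e : 𝔅.graph.carrier) : 𝔅.rhoV (𝔅.graph.t e) = X.graph.t (𝔅.rho e) :=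
  IsGraphMorphism.onVert_t _ _

theorem lamV_o (e : 𝔅.graph.carrier) : 𝔅.lamV (𝔅.graph.o e) = Y.graph.o (𝔅.lam e) :=
  IsGraphMorphism.onVert_o _ _

theorem lamV_t (e : 𝔅.graph.carrier) : 𝔅.lamV (𝔅.graph.t e) = Y.graph.t (𝔅.lam e) :=
  IsGraphMorphism.onVert_t _ _

theorem isPath_lam (e : 𝔅.graph.carrier) :
    Y.IsPath (𝔅.lamV (𝔅.graph.o e)) (𝔅.lamV (𝔅.graph.t e)) (Y.ofEdge (𝔅.lam e)) := by
  rw [lamV_o, lamV_t]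
  exact .edge _

theorem isPath_rho_bar (e : 𝔅.graph.carrier) :
    X.IsPath (𝔅.rhoV (𝔅.graph.t e)) (𝔅.rhoV (𝔅.graph.o e)) (X.ofEdge (X.graph.bar (𝔅.rho e))) := by
  have h : X.IsPath (𝔅.rhoV (𝔅.graph.o e)) (𝔅.rhoV (𝔅.graph.t e)) (X.ofEdge (𝔅.rho e)) := by
    rw [rhoV_o, rhoV_t]
    exact .edge _
  rw [X.ofEdge_bar]
  exact h.inv

variable (𝔅) in
/-- The pairs `(q, b)` with `b ∈ B z` and `q ∈ π₁(Y, v₀, lam z)`, for the vertices `z`. -/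
structure Point (v₀ : Y.Vert) : Type u where
  z : 𝔅.graph.Vert
  q : Y.PathGroup
  hq : Y.IsPath v₀ (𝔅.lamV z) q
  b : 𝔅.B z.1

/-- The relation `(q g, b) = (q, g b)`. -/
def Point.Rel {v₀ : Y.Vert} (s t : 𝔅.Point v₀) : Prop :=
  ∃ g : Y.G (𝔅.lam s.z.1),
    t = ⟨s.z, s.q * Y.ofVert (𝔅.lamV s.z) g, s.hq.mul (.vert _ _), g⁻¹ • s.b⟩

theorem Point.ext' {v₀ : Y.Vert} {z : 𝔅.graph.Vert} {q q' : Y.PathGroup}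
    {hq : Y.IsPath v₀ (𝔅.lamV z) q} {hq' : Y.IsPath v₀ (𝔅.lamV z) q'} {b b' : 𝔅.B z.1}
    (h : q = q') (h' : b = b') : (⟨z, q, hq, b⟩ : 𝔅.Point v₀) = ⟨z, q', hq', b'⟩ := by
  subst h h'; rfl

theorem ofVert_one' (z : 𝔅.graph.Vert) : Y.ofVert (𝔅.lamV z) (1 : Y.G (𝔅.lam z.1)) = 1 :=
  Y.ofVert_one _

theorem ofVert_mul' (z : 𝔅.graph.Vert) (g h : Y.G (𝔅.lam z.1)) :
    Y.ofVert (𝔅.lamV z) (g * h) = Y.ofVert (𝔅.lamV z) g * Y.ofVert (𝔅.lamV z) h :=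
  (Y.ofVert_mul _ _ _).symm

theorem ofVert_inv' (z : 𝔅.graph.Vert) (g : Y.G (𝔅.lam z.1)) :
    Y.ofVert (𝔅.lamV z) g⁻¹ = (Y.ofVert (𝔅.lamV z) g)⁻¹ :=
  Y.ofVert_inv _ _

variable (𝔅) in
def pointSetoid (v₀ : Y.Vert) : Setoid (𝔅.Point v₀) where
  r := Point.Rel
  iseqv :=
    { refl := fun s => ⟨1, Point.ext' (by rw [ofVert_one', mul_one]) (by rw [inv_one, one_smul])⟩
      symm := by
        rintro s _ ⟨g, rfl⟩
        refine ⟨g⁻¹, Point.ext' ?_ ?_⟩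
        · change s.q = s.q * Y.ofVert (𝔅.lamV s.z) g * Y.ofVert (𝔅.lamV s.z) g⁻¹
          rw [ofVert_inv', mul_inv_cancel_right]
        · change s.b = g⁻¹⁻¹ • g⁻¹ • s.b
          rw [inv_smul_smul]
      trans := by
        rintro s _ _ ⟨g, rfl⟩ ⟨h, rfl⟩
        refine ⟨g * h, Point.ext' ?_ ?_⟩
        · change s.q * Y.ofVert (𝔅.lamV s.z) g * Y.ofVert (𝔅.lamV s.z) h = _
          rw [ofVert_mul', mul_assoc]
        · change h⁻¹ • g⁻¹ • s.b = (g * h)⁻¹ • s.b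
          rw [smul_smul, mul_inv_rev] }

variable (𝔅) in
/-- The disjoint union of the `π₁(Y, v₀, lam z) ⊗ B z`. -/
def Points (v₀ : Y.Vert) : Type u := Quotient (𝔅.pointSetoid v₀)

variable {v₀ : Y.Vert}

/-- The element `q ⊗ b`. -/
def pt (z : 𝔅.graph.Vert) (q : Y.PathGroup) (hq : Y.IsPath v₀ (𝔅.lamV z) q) (b : 𝔅.B z.1) :
    𝔅.Points v₀ :=
  Quotient.mk (𝔅.pointSetoid v₀) ⟨z, q, hq, b⟩

theorem exists_pt_eq (t : 𝔅.Points v₀) : ∃ z q hq b, pt z q hq b = t := by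
  obtain ⟨⟨z, q, hq, b⟩, rfl⟩ := Quotient.exists_rep t
  exact ⟨z, q, hq, b, rfl⟩

theorem pt_congr {z : 𝔅.graph.Vert} {q q' : Y.PathGroup} {hq : Y.IsPath v₀ (𝔅.lamV z) q}
    {hq' : Y.IsPath v₀ (𝔅.lamV z) q'} {b b' : 𝔅.B z.1} (h : q = q') (h' : b = b') :
    pt z q hq b = pt z q' hq' b' := by
  subst h h'; rfl

theorem pt_eq_iff {z : 𝔅.graph.Vert} {q q' : Y.PathGroup} {hq : Y.IsPath v₀ (𝔅.lamV z) q}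
    {hq' : Y.IsPath v₀ (𝔅.lamV z) q'} {b b' : 𝔅.B z.1} : pt z q hq b = pt z q' hq' b' ↔
      ∃ g : Y.G (𝔅.lam z.1), q' = q * Y.ofVert (𝔅.lamV z) g ∧ b' = g⁻¹ • b := by
  constructor
  · intro e
    obtain ⟨g, hg⟩ := Quotient.exact e
    injection hg with h1 h2 h3
    exact ⟨g, h2, h3⟩
  · rintro ⟨g, rfl, rfl⟩
    exact Quotient.sound ⟨g, rfl⟩

theorem pt_eq_vert {z z' : 𝔅.graph.Vert} {q q' : Y.PathGroup} {hq : Y.IsPath v₀ (𝔅.lamV z) q}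
    {hq' : Y.IsPath v₀ (𝔅.lamV z') q'} {b : 𝔅.B z.1} {b' : 𝔅.B z'.1}
    (e : pt z q hq b = pt z' q' hq' b') : z = z' := by
  obtain ⟨g, hg⟩ := Quotient.exact e
  injection hg with h1 h2 h3
  exact h1.symm

theorem pt_mul (z : 𝔅.graph.Vert) (q : Y.PathGroup) (hq : Y.IsPath v₀ (𝔅.lamV z) q)
    (g : Y.G (𝔅.lam z.1)) (hq' : Y.IsPath v₀ (𝔅.lamV z) (q * Y.ofVert (𝔅.lamV z) g)) (b : 𝔅.B z.1) :
    pt z (q * Y.ofVert (𝔅.lamV z) g) hq' b = pt z q hq (g • b) :=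
  (pt_eq_iff.2 ⟨g, rfl, (inv_smul_smul _ _).symm⟩).symm

/-- The vertex of `X` below an element. -/
def base : 𝔅.Points v₀ → X.Vert :=
  Quotient.lift (fun s => 𝔅.rhoV s.z) (by rintro s _ ⟨g, rfl⟩; rfl)

/-- Transport to the group at `rho z`. -/
def rcast {z : 𝔅.graph.Vert} {x : X.Vert} (h : 𝔅.rhoV z = x) : X.G x.1 →* X.G (𝔅.rho z.1) :=
  transport X.G (congrArg Subtype.val h).symm

open Classical in
/-- The right action of `g`, an element of the group at the vertex `x`, on the elements above `x`; the
other elements are fixed. -/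
noncomputable def ract (x : X.Vert) (g : X.G x.1) : 𝔅.Points v₀ → 𝔅.Points v₀ :=
  Quotient.lift (fun s => if h : 𝔅.rhoV s.z = x then
      pt s.z s.q s.hq (op (rcast h g) • s.b)
    else pt s.z s.q s.hq s.b) (by
    rintro s _ ⟨k, rfl⟩
    dsimp only
    split_ifs with h
    · exact pt_eq_iff.2 ⟨k, rfl, (smul_comm _ _ _).symm⟩
    · exact pt_eq_iff.2 ⟨k, rfl, rfl⟩)

theorem ract_pt {x : X.Vert} (g : X.G x.1) {z : 𝔅.graph.Vert} (h : 𝔅.rhoV z = x) (q : Y.PathGroup)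
    (hq : Y.IsPath v₀ (𝔅.lamV z) q) (b : 𝔅.B z.1) : ract x g (pt z q hq b) =
      pt z q hq (op (rcast h g) • b) :=
  dif_pos h

theorem ract_of_ne {x : X.Vert} (g : X.G x.1) {t : 𝔅.Points v₀} (h : base t ≠ x) :
    ract x g t = t := by
  obtain ⟨z, q, hq, b, rfl⟩ := exists_pt_eq t
  exact dif_neg h

theorem ract_mul (x : X.Vert) (g h : X.G x.1) (t : 𝔅.Points v₀) :
    ract x (g * h) t = ract x h (ract x g t) := by
  by_cases e : base t = x
  · obtain ⟨z, q, hq, b, rfl⟩ := exists_pt_eq t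
    rw [ract_pt g e, ract_pt h e, ract_pt (g * h) e, map_mul, op_mul, mul_smul]
  · rw [ract_of_ne g e, ract_of_ne h e, ract_of_ne (g * h) e]

theorem ract_one (x : X.Vert) (t : 𝔅.Points v₀) : ract x 1 t = t := by
  by_cases e : base t = x
  · obtain ⟨z, q, hq, b, rfl⟩ := exists_pt_eq t
    rw [ract_pt 1 e, map_one, op_one, one_smul]
  · exact ract_of_ne 1 e

/-- The right action of a vertex group, as a permutation. -/
noncomputable def ractPerm (x : X.Vert) (g : X.G x.1) : Equiv.Perm (𝔅.Points v₀) where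
  toFun := ract x g
  invFun := ract x g⁻¹
  left_inv t := by rw [← ract_mul, mul_inv_cancel, ract_one]
  right_inv t := by rw [← ract_mul, inv_mul_cancel, ract_one]

/-- The correspondence between elements above `f⁻` and elements above `f⁺` for an edge `f` of `X`. -/
def Crosses (f : X.graph.carrier) (t t' : 𝔅.Points v₀) : Prop :=
  ∃ (e : 𝔅.graph.carrier) (q : Y.PathGroup) (hq : Y.IsPath v₀ (𝔅.lamV (𝔅.graph.o e)) q) (b : 𝔅.B e),
    𝔅.rho e = f ∧ t = pt (𝔅.graph.o e) q hq (𝔅.minus e b) ∧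
      t' = pt (𝔅.graph.t e) (q * Y.ofEdge (𝔅.lam e)) (hq.mul (isPath_lam e))
        (𝔅.minus (𝔅.graph.bar e) (𝔅.inv e b))

theorem Crosses.base_left {f : X.graph.carrier} {t t' : 𝔅.Points v₀} (h : Crosses f t t') :
    base t = X.graph.o f := by
  obtain ⟨e, q, hq, b, rfl, rfl, -⟩ := h
  exact rhoV_o e

theorem Crosses.base_right {f : X.graph.carrier} {t t' : 𝔅.Points v₀} (h : Crosses f t t') :
    base t' = X.graph.t f := by
  obtain ⟨e, q, hq, b, rfl, -, rfl⟩ := h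
  exact rhoV_t e

theorem Crosses.symm {f : X.graph.carrier} {t t' : 𝔅.Points v₀} (h : Crosses f t t') :
    Crosses (X.graph.bar f) t' t := by
  obtain ⟨e, q, hq, b, rfl, rfl, rfl⟩ := h
  refine ⟨𝔅.graph.bar e, q * Y.ofEdge (𝔅.lam e), hq.mul (isPath_lam e), 𝔅.inv e b,
    𝔅.rho_morphism.map_bar e, rfl, ?_⟩
  have key : ∀ (e' : 𝔅.graph.carrier) (h : e' = e) (b' : 𝔅.B e') (q' : Y.PathGroup)
      (hq' : Y.IsPath v₀ (𝔅.lamV (𝔅.graph.o e')) q'), q' = q → transportFun 𝔅.B h b' = b →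
      pt (𝔅.graph.o e) q hq (𝔅.minus e b) = pt (𝔅.graph.o e') q' hq' (𝔅.minus e' b') := by
    rintro _ rfl b' _ hq' rfl rfl
    rfl
  refine key _ (𝔅.graph.bar_bar e) _ _ _ ?_ (𝔅.inv_inv e b)
  rw [𝔅.lam_morphism.map_bar, Y.ofEdge_bar, mul_inv_cancel_right]

theorem Crosses.ract {f : X.graph.carrier} {t t' : 𝔅.Points v₀} (h : Crosses f t t') (g : X.G f) :
    Crosses f (ract (X.graph.o f) (X.minus f g) t)
      (ract (X.graph.t f) (X.minus (X.graph.bar f) (X.inv f g)) t') := by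
  obtain ⟨e, q, hq, b, rfl, rfl, rfl⟩ := h
  refine ⟨e, q, hq, op g • b, rfl, ?_, ?_⟩
  · rw [𝔅.minus_op_smul]
    exact ract_pt _ (rhoV_o e) _ _ _
  · rw [𝔅.inv_op_smul, 𝔅.minus_op_smul]
    refine (ract_pt _ (rhoV_t e) _ _ _).trans ?_
    have : X.minusTo (𝔅.rho_morphism.map_src (𝔅.graph.bar e)).symm
        (X.invTo (𝔅.rho_morphism.map_bar e).symm g) =
        rcast (rhoV_t e) (X.minus (X.graph.bar (𝔅.rho e)) (X.inv (𝔅.rho e) g)) := by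
      change transport X.G _ (X.minus _ (transport X.G _ _)) = transport X.G _ _
      rw [X.minus_transport, transport_transport]
      rfl
    rw [this]
    rfl

/-- Surjectivity in the left-fibrancy condition writes the element of the biset as `h b'⁻`, and `h`
is absorbed into the path. -/
theorem Crosses.exists_right (hF : 𝔅.IsLeftFree) {f : X.graph.carrier} (hf : X.graph.IsEdge f)
    {t : 𝔅.Points v₀} (ht : base t = X.graph.o f) : ∃ t', Crosses f t t' := by
  obtain ⟨z, q, hq, b, rfl⟩ := exists_pt_eq t
  obtain ⟨e, he, h, b', rfl, rfl⟩ :=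
    hF.fibrant_surjective z f hf (congrArg Subtype.val ht).symm b
  obtain rfl : 𝔅.graph.o e = z := Subtype.ext he
  refine ⟨_, e, q * Y.ofVert _ h, hq.mul (.vert _ _), b', rfl, ?_, rfl⟩
  exact (pt_mul _ _ _ _ _ _).symm

/-- The edge relation of the path group of `Y`, written with the maps attached to an edge of `𝔅`. It
makes the result of crossing an edge independent of the representative. -/
theorem lam_conj (e : 𝔅.graph.carrier) (k : Y.G (𝔅.lam e)) :
    Y.ofVert (𝔅.lamV (𝔅.graph.o e)) (Y.minusTo (𝔅.lam_morphism.map_src e).symm k) *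
      Y.ofEdge (𝔅.lam e) = Y.ofEdge (𝔅.lam e) * Y.ofVert (𝔅.lamV (𝔅.graph.t e))
        (Y.minusTo (𝔅.lam_morphism.map_src (𝔅.graph.bar e)).symm
          (Y.invTo (𝔅.lam_morphism.map_bar e).symm k)) := by
  have key : ∀ {v w : Y.Vert} (h : v = w) (g : Y.G v.1),
      Y.ofVert w (transport Y.G (congrArg Subtype.val h) g) = Y.ofVert v g := by
    rintro v _ rfl g
    rfl
  have h2 : Y.ofVert (𝔅.lamV (𝔅.graph.t e))
        (Y.minusTo (𝔅.lam_morphism.map_src (𝔅.graph.bar e)).symm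
          (Y.invTo (𝔅.lam_morphism.map_bar e).symm k)) =
      Y.ofVert (Y.graph.t (𝔅.lam e)) (Y.minus (Y.graph.bar (𝔅.lam e)) (Y.inv (𝔅.lam e) k)) := by
    refine Eq.trans (congrArg (Y.ofVert (𝔅.lamV (𝔅.graph.t e))) ?_) (key (lamV_t e).symm _)
    change transport Y.G _ (Y.minus _ (transport Y.G _ _)) = _
    rw [Y.minus_transport, transport_transport]
    rfl
  rw [h2]
  exact (congrArg (· * Y.ofEdge (𝔅.lam e)) (key (lamV_o e).symm (Y.minus (𝔅.lam e) k))).trans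
    (Y.ofVert_mul_ofEdge (𝔅.lam e) k)

/-- By injectivity in the left-fibrancy condition, two representations of a point over the same edge
`f` use the same edge of `𝔅` and differ by an element `k` of its group, which `lam_conj` moves
across the edge. -/
theorem Crosses.right_unique (hF : 𝔅.IsLeftFree) {f : X.graph.carrier} (hf : X.graph.IsEdge f)
    {t t₁ t₂ : 𝔅.Points v₀} (h₁ : Crosses f t t₁) (h₂ : Crosses f t t₂) : t₁ = t₂ := by
  obtain ⟨e₁, q₁, hq₁, b₁, rfl, rfl, rfl⟩ := h₁
  obtain ⟨e₂, q₂, hq₂, b₂, hρ, e, rfl⟩ := h₂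
  have hv := pt_eq_vert e
  have hsrc : 𝔅.graph.src e₂ = (𝔅.graph.o e₁).1 := congrArg Subtype.val hv.symm
  have hedge : ∀ e, 𝔅.rho e = 𝔅.rho e₁ → 𝔅.graph.IsEdge e := by
    intro e he h
    apply hf
    rw [← he, ← 𝔅.rho_morphism.map_src, h]
  have key : ∀ (z : 𝔅.graph.Vert) (hz : 𝔅.graph.o e₂ = z) (hz' : Y.IsPath v₀ (𝔅.lamV z) q₂),
      pt (𝔅.graph.o e₂) q₂ hq₂ (𝔅.minus e₂ b₂) =
        pt z q₂ hz' (𝔅.minusTo (congrArg Subtype.val hz) b₂) := by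
    rintro _ rfl _
    rfl
  rw [key _ hv.symm (by rw [hv]; exact hq₂)] at e
  obtain ⟨g, hg, hb⟩ := pt_eq_iff.1 e
  have hb' : (1 : Y.G (𝔅.lam (𝔅.graph.o e₁).1)) • 𝔅.minusTo (v := (𝔅.graph.o e₁).1) rfl b₁ =
      g • 𝔅.minusTo hsrc b₂ := by
    exact (one_smul _ _).trans ((smul_inv_smul g _).symm.trans (congrArg (g • ·) hb.symm))
  obtain ⟨rfl, k, hk, hkb⟩ := hF.fibrant_injective (𝔅.graph.o e₁) e₁ e₂ rfl hsrc (hedge _ rfl)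
    (hedge _ hρ) hρ.symm 1 g b₁ b₂ hb'
  change k • b₁ = b₂ at hkb
  subst hkb
  have hgk : g = (Y.minusTo (𝔅.lam_morphism.map_src e₁).symm k)⁻¹ :=
    eq_inv_of_mul_eq_one_left hk.symm
  rw [𝔅.inv_smul, 𝔅.minus_smul]
  refine Eq.trans ?_ (pt_mul _ _ _ _ ((hq₂.mul (isPath_lam e₁)).mul (.vert _ _)) _)
  refine pt_congr ?_ rfl
  have hginv := (congrArg (Y.ofVert (𝔅.lamV (𝔅.graph.o e₁))) hgk).trans (ofVert_inv' _ _)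
  rw [hg, hginv, mul_assoc _ (Y.ofEdge _), ← lam_conj, mul_assoc, inv_mul_cancel_left]

/-- The graph of the involution that exchanges the elements above `f⁻` and those above `f⁺`. -/
def Flips (f : X.graph.carrier) (t t' : 𝔅.Points v₀) : Prop :=
  Crosses f t t' ∨ Crosses (X.graph.bar f) t t' ∨
    (base t ≠ X.graph.o f ∧ base t ≠ X.graph.t f ∧ t = t')

theorem Flips.symm {f : X.graph.carrier} {t t' : 𝔅.Points v₀} (h : Flips f t t') :
    Flips f t' t := by
  rcases h with h | h | ⟨h1, h2, rfl⟩
  · exact .inr (.inl h.symm)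
  · refine .inl ?_
    have := h.symm
    rwa [X.graph.bar_bar] at this
  · exact .inr (.inr ⟨h1, h2, rfl⟩)

theorem Flips.bar {f : X.graph.carrier} {t t' : 𝔅.Points v₀} (h : Flips f t t') :
    Flips (X.graph.bar f) t t' := by
  rcases h with h | h | ⟨h1, h2, rfl⟩
  · refine .inr (.inl ?_)
    rwa [X.graph.bar_bar]
  · exact .inl h
  · exact .inr (.inr ⟨h2, by rwa [X.graph.t_bar], rfl⟩)

/-- As `f` is not a loop, a point lies above at most one of its ends, so the three cases of `Flips`
exclude each other. Fibrancy, for `f` and for its reverse, makes crossing everywhere defined and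
single-valued. -/
theorem Flips.existsUnique (hF : 𝔅.IsLeftFree) {f : X.graph.carrier} (hf : X.graph.IsEdge f)
    (hl : X.graph.o f ≠ X.graph.t f) (t : 𝔅.Points v₀) : ∃! t', Flips f t t' := by
  have hb : ∀ {t t' : 𝔅.Points v₀}, Crosses (X.graph.bar f) t t' → base t = X.graph.t f :=
    fun h => h.base_left
  by_cases h1 : base t = X.graph.o f
  · obtain ⟨t', h'⟩ := Crosses.exists_right hF hf h1
    refine ⟨t', .inl h', fun s hs => ?_⟩
    rcases hs with hs | hs | hs
    · exact hs.right_unique hF hf h'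
    · exact absurd (h1.symm.trans (hb hs)) hl
    · exact absurd h1 hs.1
  · by_cases h2 : base t = X.graph.t f
    · obtain ⟨t', h'⟩ := Crosses.exists_right hF hf.bar (t := t) h2
      refine ⟨t', .inr (.inl h'), fun s hs => ?_⟩
      rcases hs with hs | hs | hs
      · exact absurd hs.base_left h1
      · exact hs.right_unique hF hf.bar h'
      · exact absurd h2 hs.2.1
    · refine ⟨t, .inr (.inr ⟨h1, h2, rfl⟩), fun s hs => ?_⟩
      rcases hs with hs | hs | hs
      · exact absurd hs.base_left h1
      · exact absurd (hb hs) h2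
      · exact hs.2.2.symm

/-- The right action of the path group of `X` on `Points`. -/
theorem exists_action (hF : 𝔅.IsLeftFree) (hX : X.graph.IsTree) (v₀ : Y.Vert) :
    ∃ act : X.PathGroup →* (Equiv.Perm (𝔅.Points v₀))ᵐᵒᵖ,
      (∀ (z : 𝔅.graph.Vert) q hq (b : 𝔅.B z.1) (g : X.G (𝔅.rho z.1)),
        unop (act (X.ofVert (𝔅.rhoV z) g)) (pt z q hq b) = pt z q hq (op g • b)) ∧
      ∀ (e : 𝔅.graph.carrier) q hq (b : 𝔅.B e),
        unop (act (X.ofEdge (𝔅.rho e))) (pt (𝔅.graph.o e) q hq (𝔅.minus e b)) =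
          pt (𝔅.graph.t e) (q * Y.ofEdge (𝔅.lam e)) (hq.mul (isPath_lam e))
            (𝔅.minus (𝔅.graph.bar e) (𝔅.inv e b)) := by
  classical
  -- An edge has to act by a permutation of all points and not only map those above its origin to
  -- those above its end. Exchanging the two sides and fixing everything else gives an involution
  -- that is also the one for the reversed edge.
  have hex : ∀ f, ∃ σ : Equiv.Perm (𝔅.Points v₀), (X.graph.IsEdge f → ∀ t, Flips f t (σ t)) ∧
      (X.graph.src f = f → σ = 1) := by
    intro f
    by_cases hf : X.graph.IsEdge f
    · choose φ hφ hφu using Flips.existsUnique hF hf (hX.no_loop f hf) (v₀ := v₀)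
      have hinv : Function.Involutive φ := fun t => (hφu _ _ (hφ t).symm).symm
      exact ⟨hinv.toPerm, fun _ => hφ, fun h => absurd h hf⟩
    · exact ⟨1, fun h => absurd h hf, fun _ => rfl⟩
  choose σ hσ hσ1 using hex
  have huniq : ∀ {f}, X.graph.IsEdge f → ∀ {t t'}, Flips f t t' → σ f t = t' :=
    fun {f} hf {t t'} h =>
      (Flips.existsUnique hF hf (hX.no_loop f hf) t).unique (hσ f hf t) h
  have hbar : ∀ f t, σ (X.graph.bar f) (σ f t) = t := by
    intro f t
    by_cases hf : X.graph.IsEdge f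
    · exact huniq hf.bar (hσ f hf t).symm.bar
    · have hf' := not_not.1 hf
      rw [hσ1 f hf', Graph'.bar_eq_of_src_eq hf', hσ1 f hf']
      rfl
  let F : (Σ v : X.Vert, X.G v.1) ⊕ X.graph.carrier → (Equiv.Perm (𝔅.Points v₀))ᵐᵒᵖ :=
    Sum.elim (fun y => op (ractPerm y.1 y.2)) fun f => op (σ f)
  have hmul : ∀ (v : X.Vert) (g h : X.G v.1),
      (op (ractPerm v g) * op (ractPerm v h) : (Equiv.Perm (𝔅.Points v₀))ᵐᵒᵖ) =
        op (ractPerm v (g * h)) := fun v g h =>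
    congrArg op (Equiv.ext fun t => (ract_mul v g h t).symm)
  -- For an edge `f`, the relation has content only for a point above the origin of `f`. At all
  -- other points the two vertex groups act trivially where they are applied.
  have hconj : ∀ (f : X.graph.carrier) (g : X.G f) (t : 𝔅.Points v₀),
      σ f (ract (X.graph.o f) (X.minus f g) t) =
        ract (X.graph.t f) (X.minus (X.graph.bar f) (X.inv f g)) (σ f t) := by
    intro f g t
    by_cases hf : X.graph.IsEdge f
    · have hl := hX.no_loop f hf
      refine huniq hf ?_
      rcases hσ f hf t with h | h | ⟨h1, h2, h3⟩
      · exact .inl (h.ract g)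
      · have h1 : base t = X.graph.t f := h.base_left
        have h2 : base (σ f t) = X.graph.o f := h.base_right.trans (X.graph.t_bar f)
        have e1 : ract (X.graph.o f) (X.minus f g) t = t := ract_of_ne _ (h1.trans_ne hl.symm)
        have e2 : ract (X.graph.t f) (X.minus (X.graph.bar f) (X.inv f g)) (σ f t) = σ f t :=
          ract_of_ne _ (h2.trans_ne hl)
        rw [e1, e2]
        exact .inr (.inl h)
      · have e1 : ract (X.graph.o f) (X.minus f g) t = t := ract_of_ne _ h1
        have e2 : ract (X.graph.t f) (X.minus (X.graph.bar f) (X.inv f g)) t = t :=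
          ract_of_ne _ h2
        rw [← h3, e1, e2]
        exact .inr (.inr ⟨h1, h2, rfl⟩)
    · have hf' := not_not.1 hf
      rw [hσ1 f hf']
      have key : ∀ (y : X.graph.carrier) (e : y = f) (k : X.G y), transport X.G e k = g →
          ract (X.graph.o f) (X.minus f g) t = ract (X.graph.o y) (X.minus y k) t := by
        rintro _ rfl k rfl
        rfl
      exact key _ (Graph'.bar_eq_of_src_eq hf') _ (X.inv_vertex f _ g)
  have hrel : ∀ r ∈ {r | X.IsRelator r}, FreeGroup.lift F r = 1 := by
    rintro r (⟨v, g, h⟩ | ⟨v⟩ | ⟨f⟩ | ⟨f, g⟩)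
    · simp only [map_mul, map_inv, FreeGroup.lift_apply_of, F, Sum.elim_inl]
      rw [mul_inv_eq_one]
      exact hmul v g h
    · simp only [FreeGroup.lift_apply_of, F, Sum.elim_inr]
      rw [hσ1 _ v.2]
      rfl
    · simp only [map_mul, FreeGroup.lift_apply_of, F, Sum.elim_inr]
      exact congrArg op (Equiv.ext fun t => hbar f t)
    · simp only [map_mul, map_inv, FreeGroup.lift_apply_of, F, Sum.elim_inl, Sum.elim_inr]
      rw [mul_inv_eq_one]
      refine congrArg op (Equiv.ext fun t => ?_)
      change σ f (ract (X.graph.o f) (X.minus f g) (σ (X.graph.bar f) t)) =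
        ract (X.graph.t f) (X.minus (X.graph.bar f) (X.inv f g)) t
      rw [hconj]
      congr 1
      have := hbar (X.graph.bar f) t
      rwa [X.graph.bar_bar] at this
  refine ⟨PresentedGroup.toGroup hrel, ?_, ?_⟩
  · intro z q hq b g
    have h : PresentedGroup.toGroup hrel (X.ofVert (𝔅.rhoV z) g) =
      op (ractPerm (𝔅.rhoV z) g) := PresentedGroup.toGroup.of _
    rw [h]
    exact ract_pt g rfl q hq b
  · intro e q hq b
    have h : PresentedGroup.toGroup hrel (X.ofEdge (𝔅.rho e)) = op (σ (𝔅.rho e)) :=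
      PresentedGroup.toGroup.of _
    rw [h]
    change σ (𝔅.rho e) _ = _
    by_cases he : 𝔅.graph.IsEdge e
    · exact huniq (hF.simplicial e he) (.inl ⟨e, q, hq, b, rfl, rfl, rfl⟩)
    · have he' : 𝔅.graph.src e = e := not_not.1 he
      have hρ : X.graph.src (𝔅.rho e) = 𝔅.rho e := by rw [← 𝔅.rho_morphism.map_src, he']
      have hlam : Y.graph.src (𝔅.lam e) = 𝔅.lam e := by rw [← 𝔅.lam_morphism.map_src, he']
      rw [hσ1 _ hρ]
      change pt (𝔅.graph.o e) q hq (𝔅.minus e b) = _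
      have key : ∀ (e' : 𝔅.graph.carrier) (h : e' = e) (b' : 𝔅.B e') (q' : Y.PathGroup)
          (hq' : Y.IsPath v₀ (𝔅.lamV (𝔅.graph.o e')) q'), q' = q → transportFun 𝔅.B h b' = b →
          pt (𝔅.graph.o e) q hq (𝔅.minus e b) = pt (𝔅.graph.o e') q' hq' (𝔅.minus e' b') := by
        rintro _ rfl b' _ hq' rfl rfl
        rfl
      refine key _ (Graph'.bar_eq_of_src_eq he') _ _ _ ?_ (𝔅.inv_vertex e _ b)
      rw [GraphOfGroups.ofEdge_eq_one hlam, mul_one]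

end GraphOfBisets

/-! ### Left-freeness and left orbits of the fundamental biset. -/

namespace GraphOfBisets

open GraphOfGroups

variable {Y X : GraphOfGroups.{u}} {𝔅 : GraphOfBisets Y X} {v₀ : Y.Vert} {w₀ : X.Vert}

/-- The class of a triple in the fundamental biset. -/
def fmk (z : 𝔅.graph.Vert) (q : Y.PathGroup) (hq : Y.IsPath v₀ (𝔅.lamV z) q) (b : 𝔅.B z.1)
    (p : X.PathGroup) (hp : X.IsPath (𝔅.rhoV z) w₀ p) : 𝔅.FundBiset v₀ w₀ :=
  Quot.mk _ ⟨z, q, hq, b, p, hp⟩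

theorem exists_fmk_eq (ξ : 𝔅.FundBiset v₀ w₀) : ∃ z q hq b p hp, fmk z q hq b p hp = ξ := by
  obtain ⟨⟨z, q, hq, b, p, hp⟩, rfl⟩ := Quot.exists_rep ξ
  exact ⟨z, q, hq, b, p, hp, rfl⟩

theorem fmk_congr {z : 𝔅.graph.Vert} {q q' : Y.PathGroup} {hq : Y.IsPath v₀ (𝔅.lamV z) q}
    {hq' : Y.IsPath v₀ (𝔅.lamV z) q'} {b b' : 𝔅.B z.1} {p p' : X.PathGroup}
    {hp : X.IsPath (𝔅.rhoV z) w₀ p} {hp' : X.IsPath (𝔅.rhoV z) w₀ p'} (h₁ : q = q') (h₂ : b = b')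
    (h₃ : p = p') : fmk z q hq b p hp = fmk z q' hq' b' p' hp' := by
  subst h₁ h₂ h₃; rfl

theorem fmk_left (z : 𝔅.graph.Vert) (q : Y.PathGroup) (hq : Y.IsPath v₀ (𝔅.lamV z) q)
    (g : Y.G (𝔅.lam z.1)) (hq' : Y.IsPath v₀ (𝔅.lamV z) (q * Y.ofVert (𝔅.lamV z) g)) (b : 𝔅.B z.1)
    (p : X.PathGroup) (hp : X.IsPath (𝔅.rhoV z) w₀ p) :
    fmk z (q * Y.ofVert (𝔅.lamV z) g) hq' b p hp = fmk z q hq (g • b) p hp :=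
  Quot.sound (.left z q hq g b p hp)

theorem fmk_right (z : 𝔅.graph.Vert) (q : Y.PathGroup) (hq : Y.IsPath v₀ (𝔅.lamV z) q)
    (g : X.G (𝔅.rho z.1)) (b : 𝔅.B z.1) (p : X.PathGroup) (hp : X.IsPath (𝔅.rhoV z) w₀ p)
    (hp' : X.IsPath (𝔅.rhoV z) w₀ (X.ofVert (𝔅.rhoV z) g * p)) :
    fmk z q hq (op g • b) p hp = fmk z q hq b (X.ofVert (𝔅.rhoV z) g * p) hp' :=
  Quot.sound (.right z q hq g b p hp)

theorem fmk_edge (e : 𝔅.graph.carrier) (q : Y.PathGroup) (hq : Y.IsPath v₀ (𝔅.lamV (𝔅.graph.o e)) q)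
    (b : 𝔅.B e) (p : X.PathGroup) (hp : X.IsPath (𝔅.rhoV (𝔅.graph.o e)) w₀ p) :
    fmk (𝔅.graph.o e) q hq (𝔅.minus e b) p hp =
      fmk (𝔅.graph.t e) (q * Y.ofEdge (𝔅.lam e)) (hq.mul (isPath_lam e))
        (𝔅.minus (𝔅.graph.bar e) (𝔅.inv e b)) (X.ofEdge (X.graph.bar (𝔅.rho e)) * p)
        ((isPath_rho_bar e).mul hp) :=
  Quot.sound (.edge e q hq b p hp _ _)

theorem smul_fmk (a : Y.fundGroup v₀) (z : 𝔅.graph.Vert) (q : Y.PathGroup)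
    (hq : Y.IsPath v₀ (𝔅.lamV z) q) (b : 𝔅.B z.1) (p : X.PathGroup)
    (hp : X.IsPath (𝔅.rhoV z) w₀ p) :
    a • fmk z q hq b p hp = fmk z (a * q) (.mul a.2 hq) b p hp := rfl

/-- Elements `q ⊗ b ⊗ p` and `q' ⊗ b' ⊗ p` of the fundamental biset with the same right factor are
equal only if `q ⊗ b = q' ⊗ b'`. -/
theorem pt_eq_of_fmk_eq (hF : 𝔅.IsLeftFree) (hX : X.graph.IsTree) {z z' : 𝔅.graph.Vert}
    {q q' : Y.PathGroup} {hq : Y.IsPath v₀ (𝔅.lamV z) q} {hq' : Y.IsPath v₀ (𝔅.lamV z') q'}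
    {b : 𝔅.B z.1} {b' : 𝔅.B z'.1} {p : X.PathGroup} {hp : X.IsPath (𝔅.rhoV z) w₀ p}
    {hp' : X.IsPath (𝔅.rhoV z') w₀ p} (e : fmk z q hq b p hp = fmk z' q' hq' b' p hp') :
    pt z q hq b = pt z' q' hq' b' := by
  obtain ⟨act, hv, he⟩ := exists_action hF hX v₀
  have hact : ∀ (p₁ p₂ : X.PathGroup) (t : 𝔅.Points v₀),
      unop (act (p₁ * p₂)) t = unop (act p₂) (unop (act p₁) t) := by
    intro p₁ p₂ t
    rw [map_mul]
    rfl
  -- Sending `q ⊗ b ⊗ p` to the image of `q ⊗ b` under `p` respects the three defining relations,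
  -- and a fixed `p` acts injectively.
  let toP : 𝔅.FundBiset v₀ w₀ → 𝔅.Points v₀ :=
    Quot.lift (fun s => unop (act s.p) (pt s.z s.q s.hq s.b)) (by
      rintro _ _ (⟨z, q, hq, g, b, p, hp⟩ | ⟨z, q, hq, g, b, p, hp⟩ | ⟨e, q, hq, b, p, hp, h₁, h₂⟩)
      · dsimp only
        rw [pt_mul z q hq g]
      · dsimp only
        rw [hact, hv]
      · dsimp only
        rw [← he e q hq b, ← hact, X.ofEdge_bar, mul_inv_cancel_left])
  exact (unop (act p)).injective (congrArg toP e)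

/-- After cancellation of the right factor, `a q ⊗ b = q ⊗ b` means that `a` is the conjugate by `q`
of an element of a vertex group fixing `b`, and the vertex bisets are left-free. -/
theorem fundBiset_isLeftFree (hF : 𝔅.IsLeftFree) (hX : X.graph.IsTree) :
    Biset.IsLeftFree (Y.fundGroup v₀) (𝔅.FundBiset v₀ w₀) := by
  intro a ξ h
  obtain ⟨z, q, hq, b, p, hp, rfl⟩ := exists_fmk_eq ξ
  rw [smul_fmk] at h
  obtain ⟨g, hg, hb⟩ := pt_eq_iff.1 (pt_eq_of_fmk_eq hF hX h)
  have h1 : g⁻¹ = 1 := hF.left_free _ _ _ hb.symm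
  have h2 : g = 1 := inv_eq_one.1 h1
  rw [h2, ofVert_one', mul_one, eq_comm, mul_eq_right] at hg
  exact Subtype.ext hg

/-- Lifting of paths. -/
theorem exists_lift_path (hF : 𝔅.IsLeftFree) {u w : X.Vert} {a : X.PathGroup}
    (ha : X.IsPath u w a) :
    ∀ (z : 𝔅.graph.Vert) (_ : 𝔅.rhoV z = u) (q : Y.PathGroup) (hq : Y.IsPath v₀ (𝔅.lamV z) q)
      (b : 𝔅.B z.1), ∃ (z' : 𝔅.graph.Vert) (_ : 𝔅.rhoV z' = w) (q' : Y.PathGroup)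
        (hq' : Y.IsPath v₀ (𝔅.lamV z') q') (b' : 𝔅.B z'.1), ∀ (p : X.PathGroup)
        (hp : X.IsPath (𝔅.rhoV z) w₀ (a * p)) (hp' : X.IsPath (𝔅.rhoV z') w₀ p),
          fmk z q hq b (a * p) hp = fmk z' q' hq' b' p hp' := by
  induction ha with
  | vert v g =>
    rintro z rfl q hq b
    refine ⟨z, rfl, q, hq, op (rcast rfl g) • b, fun p hp hp' => ?_⟩
    exact (fmk_right z q hq (rcast rfl g) b p hp' hp).symm
  | edge f =>
    intro z hz q hq b
    by_cases hf : X.graph.IsEdge f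
    · obtain ⟨e, he, h, b', rfl, rfl⟩ :=
        hF.fibrant_surjective z f hf (congrArg Subtype.val hz).symm b
      obtain rfl : 𝔅.graph.o e = z := Subtype.ext he
      refine ⟨𝔅.graph.t e, rhoV_t e, q * Y.ofVert (𝔅.lamV (𝔅.graph.o e)) h * Y.ofEdge (𝔅.lam e),
        (hq.mul (.vert _ _)).mul (isPath_lam e), 𝔅.minus (𝔅.graph.bar e) (𝔅.inv e b'),
        fun p hp hp' => ?_⟩
      refine (fmk_left _ _ _ h (hq.mul (.vert _ _)) _ _ _).symm.trans ((fmk_edge e _ _ _ _ _).trans ?_)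
      refine fmk_congr rfl rfl ?_
      rw [X.ofEdge_bar, inv_mul_cancel_left]
    · have hf' := not_not.1 hf
      refine ⟨z, hz.trans (Graph'.t_eq_o_of_src_eq hf').symm, q, hq, b, fun p hp hp' => ?_⟩
      exact fmk_congr rfl rfl (by rw [ofEdge_eq_one hf', one_mul])
  | @mul u v w a₁ a₂ h₁ h₂ ih₁ ih₂ =>
    intro z hz q hq b
    obtain ⟨z₁, hz₁, q₁, hq₁, b₁, e₁⟩ := ih₁ z hz q hq b
    obtain ⟨z₂, hz₂, q₂, hq₂, b₂, e₂⟩ := ih₂ z₁ hz₁ q₁ hq₁ b₁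
    refine ⟨z₂, hz₂, q₂, hq₂, b₂, fun p hp hp' => ?_⟩
    have hp₂ : X.IsPath (𝔅.rhoV z₁) w₀ (a₂ * p) := by
      rw [hz₁]; rw [hz₂] at hp'; exact h₂.mul hp'
    refine Eq.trans ?_ (e₂ p hp₂ hp')
    refine Eq.trans (fmk_congr rfl rfl (mul_assoc _ _ _)) (e₁ (a₂ * p) ?_ hp₂)
    rwa [mul_assoc] at hp

/-- Lifting the path that leads from the given right factor to `p⁻¹` normalises the right factor.
All elements can thus be compared with one common right factor, above one vertex `x`. -/
theorem exists_fmk_eq' (hF : 𝔅.IsLeftFree) {x : X.Vert} {p : X.PathGroup} (hp : X.IsPath w₀ x p)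
    (ξ : 𝔅.FundBiset v₀ w₀) : ∃ (z : 𝔅.graph.Vert) (_ : 𝔅.rhoV z = x) (q : Y.PathGroup)
      (hq : Y.IsPath v₀ (𝔅.lamV z) q) (b : 𝔅.B z.1) (hp' : X.IsPath (𝔅.rhoV z) w₀ p⁻¹),
      fmk z q hq b p⁻¹ hp' = ξ := by
  obtain ⟨z, q, hq, b, p₀, hp₀, rfl⟩ := exists_fmk_eq ξ
  obtain ⟨z', hz', q', hq', b', h⟩ := exists_lift_path (w₀ := w₀) hF (hp₀.mul hp) z rfl q hq b
  have h1 : X.IsPath (𝔅.rhoV z') w₀ p⁻¹ := hz' ▸ hp.inv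
  have h2 : p₀ * p * p⁻¹ = p₀ := mul_inv_cancel_right _ _
  refine ⟨z', hz', q', hq', b', h1, ?_⟩
  exact (h p⁻¹ (h2.symm ▸ hp₀) h1).symm.trans (fmk_congr rfl rfl h2)

variable (c : 𝔅.BaseChoice)

theorem BaseChoice.mem_stab_of_smul_eq {z : 𝔅.graph.carrier} {g : Y.G (𝔅.lam z)} {b b' : c.part z}
    (h : g • (b : 𝔅.B z) = b') : g ∈ c.stab z := by
  obtain ⟨_, k, rfl⟩ := b
  obtain ⟨_, k', rfl⟩ := b'
  refine ⟨k⁻¹ * k', ?_⟩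
  change (k⁻¹ * k') • c.b z = g • c.b z
  change g • k • c.b z = k' • c.b z at h
  rw [mul_smul, ← h, ← smul_comm g, inv_smul_smul]

theorem BaseChoice.part_isLeftFree (hF : 𝔅.IsLeftFree) (z : 𝔅.graph.carrier) :
    Biset.IsLeftFree (c.stab z) (c.part z) := fun h b e =>
  Subtype.ext (hF.left_free z h b (congrArg Subtype.val e))

/-- The left orbits of the fundamental biset are those of the bisets `B' z`, for the vertices `z` above
a fixed vertex `x`. -/
theorem BaseChoice.isDecomposition (hF : 𝔅.IsLeftFree) (hX : X.graph.IsTree)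
    (htr : ∀ z, Biset.IsTransitive (Y.G (𝔅.lam z)) (X.G (𝔅.rho z)) (𝔅.B z))
    {x : X.Vert} {p : X.PathGroup} (hp : X.IsPath w₀ x p) {q : 𝔅.graph.Vert → Y.PathGroup}
    (hq : ∀ z, Y.IsPath v₀ (𝔅.lamV z) (q z)) :
    Biset.IsDecomposition (I := {z : 𝔅.graph.Vert // 𝔅.rhoV z = x})
      (H := fun i => c.stab i.1.1) (G := fun i => X.G (𝔅.rho i.1.1)) (B := fun i => c.part i.1.1)
      (B' := 𝔅.FundBiset v₀ w₀)
      (fun i => (conjHom (hq i.1)).comp (c.stab i.1.1).subtype)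
      (fun i => conjHom (v := 𝔅.rhoV i.1) (p := p) (i.2.symm ▸ hp))
      (fun i b => fmk i.1 (q i.1) (hq i.1) b.1 p⁻¹ (i.2.symm ▸ hp.inv)) := by
  constructor
  · rintro ⟨z, rfl⟩ h b
    refine (fmk_left z (q z) (hq z) (h : Y.G (𝔅.lam z.1)) ((hq z).mul (.vert _ _)) _ _ _).symm.trans ?_
    refine fmk_congr ?_ rfl rfl
    change _ = (q z * Y.ofVert _ _ * (q z)⁻¹) * q z
    rw [inv_mul_cancel_right]
    rfl
  · rintro ⟨z, rfl⟩ g b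
    refine (fmk_right z (q z) (hq z) g b.1 p⁻¹ hp.inv (.mul (.vert _ _) hp.inv)).trans ?_
    refine fmk_congr rfl rfl ?_
    have h1 : ((conjHom hp g : X.fundGroup w₀) : X.PathGroup) = p * X.ofVert (𝔅.rhoV z) g * p⁻¹ := rfl
    change _ = p⁻¹ * ((conjHom hp g : X.fundGroup w₀) : X.PathGroup)
    rw [h1, mul_assoc p, inv_mul_cancel_left]
  -- Both elements have the right factor `p⁻¹`, so the equality already holds for `q ⊗ b`. It
  -- identifies the vertices and yields a left translation between points of the same right orbit,
  -- which therefore lies in `P z`.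
  · rintro ⟨z, hz⟩ b ⟨z', hz'⟩ b' h e
    have e' := pt_eq_of_fmk_eq hF hX e
    obtain rfl := pt_eq_vert e'
    obtain ⟨g, -, hb⟩ := pt_eq_iff.1 e'
    refine congrArg (Sigma.mk _) (Biset.leftOrbit_eq_iff.2 ?_)
    exact ⟨⟨g⁻¹, c.mem_stab_of_smul_eq hb.symm⟩, Subtype.ext hb.symm⟩
  · intro ξ
    obtain ⟨z, rfl, q', hq', b, hp', rfl⟩ := exists_fmk_eq' hF hp ξ
    -- Transitivity of `B z` moves `b` into the right orbit of `c.b z`; the left factor `h` becomes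
    -- part of an element of the fundamental group of `Y`.
    obtain ⟨h, g, rfl⟩ := (htr z.1).2 (c.b z.1) b
    refine ⟨⟨z, rfl⟩, ⟨op g • c.b z.1, ⟨op g, rfl⟩⟩,
      ⟨q' * Y.ofVert (𝔅.lamV z) h * (q z)⁻¹, (hq'.mul (.vert _ _)).mul (hq z).inv⟩, ?_⟩
    refine Eq.trans ?_ (fmk_left z q' hq' h (hq'.mul (.vert _ _)) _ _ _)
    refine fmk_congr ?_ rfl rfl
    exact inv_mul_cancel_right _ _

theorem conjHom_rcast {x : X.Vert} {p : X.PathGroup} (hp : X.IsPath w₀ x p) (z : 𝔅.graph.Vert)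
    (hz : 𝔅.rhoV z = x) (g : X.G x.1) :
    conjHom (v := 𝔅.rhoV z) (p := p) (hz.symm ▸ hp) (rcast hz g) = conjHom hp g := by
  subst hz
  rfl

end GraphOfBisets

/-! ### Refinements and their vacant classes. -/

theorem ConjClasses.map_injective_of_bijective {G K : Type*} [Group G] [Group K] {φ : G →* K}
    (h : Function.Bijective φ) : Function.Injective (ConjClasses.map φ) := by
  intro a b e
  induction a using Quotient.inductionOn with | h a => ?_
  induction b using Quotient.inductionOn with | h b => ?_
  obtain ⟨c, hc⟩ := isConj_iff.1 (ConjClasses.mk_eq_mk_iff_isConj.1 e)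
  obtain ⟨d, rfl⟩ := h.2 c
  refine ConjClasses.mk_eq_mk_iff_isConj.2 (isConj_iff.2 ⟨d, h.1 ?_⟩)
  rw [map_mul, map_mul, map_inv]
  exact hc

theorem ConjClasses.map_surjective_of_surjective {G K : Type*} [Group G] [Group K] {φ : G →* K}
    (h : Function.Surjective φ) : Function.Surjective (ConjClasses.map φ) := by
  intro b
  induction b using Quotient.inductionOn with | h b => ?_
  obtain ⟨a, rfl⟩ := h b
  exact ⟨ConjClasses.mk a, rfl⟩

theorem IsConj.eq_of_zpowers {G : Type*} [Group G] {t : G} (ht : ∀ g, g ∈ Subgroup.zpowers t)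
    {a b : G} (h : IsConj a b) : a = b := by
  obtain ⟨c, rfl⟩ := isConj_iff.1 h
  obtain ⟨i, rfl⟩ := Subgroup.mem_zpowers_iff.1 (ht a)
  obtain ⟨j, rfl⟩ := Subgroup.mem_zpowers_iff.1 (ht c)
  rw [← zpow_add, add_comm, zpow_add, mul_inv_cancel_right]

/-- Conjugate elements of a cyclic group are equal, and the peripheral classes of a non-trivial
cyclic sphere group are those of a generator and its inverse. -/
theorem IsSphereGroup.eq_inv_of_zpowers {G : Type u} [Group G] {P : Set (ConjClasses G)}
    (h : IsSphereGroup P) {t : G} (ht : ∀ g, g ∈ Subgroup.zpowers t) {a b : G}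
    (ha : ConjClasses.mk a ∈ P) (hb : ConjClasses.mk b ∈ P)
    (hab : ConjClasses.mk a ≠ ConjClasses.mk b) : b = a⁻¹ := by
  have key : ∀ {x y : G}, ConjClasses.mk x = ConjClasses.mk y → x = y := fun e =>
    (ConjClasses.mk_eq_mk_iff_isConj.1 e).eq_of_zpowers ht
  have ht1 : t ≠ 1 := by
    rintro rfl
    have h1 : a = 1 := by simpa using ht a
    exact h.mk_one_notMem (h1 ▸ ha)
  have hP := h.eq_pair_of_cyclic ht ht1
  rw [hP] at ha hb
  rcases ha with ha | ha <;> rcases hb with hb | hb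
  · exact absurd (ha.trans hb.symm) hab
  · rw [key ha, key hb]
  · rw [key ha, key hb, inv_inv]
  · exact absurd (ha.trans hb.symm) hab

section Refinement

variable {P Q : GraphOfGroups.{u}} {SP : SphereStructure P} {SQ : SphereStructure Q}
  {f : P.graph.carrier → Q.graph.carrier} {φ : ∀ x, P.G x →* Q.G (f x)}

theorem IsGraphMorphism.isEdge_of_isEdge_map {Γ Δ : Graph'.{u}} {f : Γ.carrier → Δ.carrier}
    (hf : IsGraphMorphism Γ Δ f) {x : Γ.carrier} (h : Δ.IsEdge (f x)) : Γ.IsEdge x := by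
  intro e
  exact h (by rw [← hf.map_src, e])

theorem IsGraphMorphism.isEdge_map {Γ Δ : Graph'.{u}} {f : Γ.carrier → Δ.carrier}
    (hf : IsGraphMorphism Γ Δ f) {x : Γ.carrier} (hx : Γ.IsEdge x) (h : ∃! x', f x' = f x) :
    Δ.IsEdge (f x) := fun e => hx (h.unique ((hf.map_src x).trans e) rfl)

theorem isConj_minusTo (h : IsGroupsMorphism f φ) {x u : P.graph.carrier} (hx : P.graph.src x = u)
    (g : P.G x) : IsConj (φ u (P.minusTo hx g))
      (Q.minusTo ((h.graph.map_src x).symm.trans (congrArg f hx)) (φ x g)) := by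
  subst hx
  obtain ⟨c, hc⟩ := h.map_minus x
  refine isConj_iff.2 ⟨c, ?_⟩
  refine (congrArg (fun a => c * a * c⁻¹) (hc g)).trans ?_
  group

theorem map_mk_minusTo (h : IsGroupsMorphism f φ) {x u : P.graph.carrier}
    (hx : P.graph.src x = u) (g : P.G x) :
    ConjClasses.map (φ u) (ConjClasses.mk (P.minusTo hx g)) = ConjClasses.mk
      (Q.minusTo ((h.graph.map_src x).symm.trans (congrArg f hx)) (φ x g)) :=
  ConjClasses.mk_eq_mk_iff_isConj.2 (isConj_minusTo h hx g)

theorem SphereStructure.minusTo_gen_ne_one (S : SphereStructure P) {x u : P.graph.carrier}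
    (hx : P.graph.src x = u) (h : S.gen x ≠ 1) : P.minusTo hx (S.gen x) ≠ 1 := by
  subst hx
  exact fun e => h (S.minus_injective x (e.trans (map_one _).symm))

theorem SphereStructure.mk_minusTo_gen_mem (S : SphereStructure P) {x u : P.graph.carrier}
    (hx : P.graph.src x = u) (hx' : P.graph.IsEdge x) (h : S.gen x ≠ 1) :
    ConjClasses.mk (P.minusTo hx (S.gen x)) ∈ S.per u := by
  subst hx
  exact S.gen_mem x hx' h

theorem SphereStructure.gen_ne_one_of_mem (S : SphereStructure P) {x u : P.graph.carrier}
    (hx : P.graph.src x = u) (h : ConjClasses.mk (P.minusTo hx (S.gen x)) ∈ S.per u) :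
    S.gen x ≠ 1 := by
  intro e
  rw [e, map_one] at h
  exact (S.isSphere u).mk_one_notMem h

/-- The two edges attach to different classes, so a vacant class would be a third one. -/
theorem SphereStructure.not_isVacant_of_pair (S : SphereStructure P) {u : P.Vert}
    {x y : P.graph.carrier} (hx : P.graph.src x = u.1) (hy : P.graph.src y = u.1)
    (hx' : P.graph.IsEdge x) (hy' : P.graph.IsEdge y) (hxy : x ≠ y) (gx : S.gen x ≠ 1)
    (gy : S.gen y ≠ 1) (h2 : (S.per u.1).ncard ≤ 2) (C : ConjClasses (P.G u.1)) :
    ¬ S.IsVacant u C := by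
  rintro ⟨hC, h⟩
  have h1 := h x hx hx'
  have h3 := h y hy hy'
  have h4 : ConjClasses.mk (P.minusTo hx (S.gen x)) ≠ ConjClasses.mk (P.minusTo hy (S.gen y)) :=
    fun e => hxy (S.attach_injective _ x y hx hy hx' hy' gx gy e)
  have h5 : ({ConjClasses.mk (P.minusTo hx (S.gen x)), ConjClasses.mk (P.minusTo hy (S.gen y)), C} :
      Set (ConjClasses (P.G u.1))) ⊆ S.per u.1 := by
    rintro _ (rfl | rfl | rfl)
    · exact S.mk_minusTo_gen_mem hx hx' gx
    · exact S.mk_minusTo_gen_mem hy hy' gy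
    · exact hC
  have h6 := Set.ncard_le_ncard h5 (S.isSphere u.1).finite
  rw [Set.ncard_eq_three.2 ⟨_, _, _, h4, h1, h3, rfl⟩] at h6
  omega

/-- Vacancy depends only on the peripheral classes at the vertex and on the edges starting there, so
it is enough that `f` and `φ` match these. -/
theorem isVacant_iff_of_edges (h : IsGroupsMorphism f φ) {u : P.Vert}
    (hb : Function.Bijective (φ u.1))
    (hper : ∀ c, c ∈ SP.per u.1 ↔ ConjClasses.map (φ u.1) c ∈ SQ.per (f u.1))
    (hgen : ∀ x, P.graph.IsEdge x → P.graph.src x = u.1 →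
      Q.graph.IsEdge (f x) ∧ φ x (SP.gen x) = SQ.gen (f x))
    (hlift : ∀ y, Q.graph.IsEdge y → Q.graph.src y = f u.1 →
      ∃ x, P.graph.IsEdge x ∧ P.graph.src x = u.1 ∧ f x = y) (c : ConjClasses (P.G u.1)) :
    SP.IsVacant u c ↔ SQ.IsVacant (h.graph.onVert u) (ConjClasses.map (φ u.1) c) := by
  refine and_congr (hper c) ⟨fun hc y hy hy' e => ?_, fun hc x hx hx' e => ?_⟩
  · obtain ⟨x, hx, hxu, rfl⟩ := hlift y hy' hy
    refine hc x hxu hx (ConjClasses.map_injective_of_bijective hb ?_)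
    rw [map_mk_minusTo h, (hgen x hx hxu).2]
    exact e
  · obtain ⟨hx1, hx2⟩ := hgen x hx' hx
    refine hc (f x) ((h.graph.map_src x).symm.trans (congrArg f hx)) hx1 ?_
    refine Eq.trans ?_ ((map_mk_minusTo h hx (SP.gen x)).symm.trans (congrArg _ e))
    exact congrArg (fun g => ConjClasses.mk (Q.minusTo _ g)) hx2.symm

theorem isVacant_iff_off (h : IsGroupsMorphism f φ) {v : Q.Vert}
    (hoff : ∀ y, y ≠ v.1 → ∃! x, f x = y)
    (hgen : ∀ x, P.graph.IsEdge x → f x ≠ v.1 → φ x (SP.gen x) = SQ.gen (f x))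
    {u : P.Vert} (hu : f u.1 ≠ v.1) (hb : Function.Bijective (φ u.1))
    (hper : ∀ c, c ∈ SP.per u.1 ↔ ConjClasses.map (φ u.1) c ∈ SQ.per (f u.1))
    (c : ConjClasses (P.G u.1)) :
    SP.IsVacant u c ↔ SQ.IsVacant (h.graph.onVert u) (ConjClasses.map (φ u.1) c) := by
  have key : ∀ x, P.graph.src x = u.1 → f x ≠ v.1 := by
    intro x hx e
    apply hu
    rw [← hx, h.graph.map_src, e, v.2]
  refine isVacant_iff_of_edges h hb hper (fun x hx hxu => ?_) (fun y hy hyu => ?_) c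
  · exact ⟨h.graph.isEdge_map hx (hoff _ (key x hxu)), hgen x hx (key x hxu)⟩
  · have hyv : y ≠ v.1 := by
      rintro rfl
      exact hy v.2
    obtain ⟨x, rfl, -⟩ := hoff y hyv
    refine ⟨x, h.graph.isEdge_of_isEdge_map hy, (hoff _ hu).unique ?_ rfl, rfl⟩
    rw [h.graph.map_src, hyu]

/-- The map of labelled peripheral classes induced by a morphism. -/
def SphereStructure.Label.map (hf : IsGraphMorphism P.graph Q.graph f) (φ : ∀ x, P.G x →* Q.G (f x))
    (x : SphereStructure.Label P) : SphereStructure.Label Q :=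
  ⟨hf.onVert x.1, ConjClasses.map (φ x.1.1) x.2⟩

/-- The set of vacant classes. -/
def SphereStructure.vacant (S : SphereStructure P) : Set (SphereStructure.Label P) :=
  {x | S.IsVacant x.1 x.2}

open SphereStructure

theorem IsSphereIso.isVacant_iff (h : IsSphereIso SP SQ f φ) (u : P.Vert)
    (c : ConjClasses (P.G u.1)) :
    SP.IsVacant u c ↔ SQ.IsVacant (h.hom.graph.onVert u) (ConjClasses.map (φ u.1) c) := by
  refine isVacant_iff_of_edges h.hom (h.groups_bijective _) (h.per _) (fun x hx _ => ?_)
    (fun y hy hyu => ?_) c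
  · exact ⟨h.hom.graph.isEdge_map hx (h.bijective.existsUnique _), h.gen x hx⟩
  · obtain ⟨x, rfl⟩ := h.bijective.2 y
    refine ⟨x, h.hom.graph.isEdge_of_isEdge_map hy, h.bijective.1 ?_, rfl⟩
    rw [h.hom.graph.map_src, hyu]

theorem IsSphereIso.bijOn_vacant (h : IsSphereIso SP SQ f φ) :
    Set.BijOn (Label.map h.hom.graph φ) SP.vacant SQ.vacant := by
  refine ⟨fun x hx => (h.isVacant_iff x.1 x.2).1 hx, ?_, ?_⟩
  · rintro ⟨u, c⟩ - ⟨u', c'⟩ - e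
    obtain rfl : u = u' := Subtype.ext (h.bijective.1 (congrArg (fun x => x.1.1) e))
    have e1 : ConjClasses.map (φ u.1) c = ConjClasses.map (φ u.1) c' :=
      eq_of_heq (Sigma.mk.inj e).2
    rw [ConjClasses.map_injective_of_bijective (h.groups_bijective _) e1]
  · rintro ⟨⟨y, hy⟩, d⟩ hd
    obtain ⟨x, rfl⟩ := h.bijective.2 y
    have hx : P.graph.src x = x := h.bijective.1 ((h.hom.graph.map_src x).trans hy)
    obtain ⟨c, rfl⟩ := ConjClasses.map_surjective_of_surjective (h.groups_bijective x).2 d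
    exact ⟨⟨⟨x, hx⟩, c⟩, (h.isVacant_iff ⟨x, hx⟩ c).2 hd, rfl⟩

section Split

variable {v : Q.Vert} {v' l₀ l₁ : P.Vert} {a₀ a₁ e₀ e₁ : P.graph.carrier}

theorem isEdge_of_o_ne_t {x : P.graph.carrier} (h : P.graph.o x ≠ P.graph.t x) :
    P.graph.IsEdge x := fun e => h (Graph'.t_eq_o_of_src_eq e).symm

theorem src_eq_of_o_eq {x : P.graph.carrier} {u : P.Vert} (h : P.graph.o x = u) :
    P.graph.src x = u.1 := congrArg Subtype.val h

namespace IsSplitAt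

theorem eq_of_map_eq_v (h : IsSplitAt SP SQ f φ v v' l₀ l₁ a₀ a₁ e₀ e₁) {u : P.Vert}
    (hu : f u.1 = v.1) : u = v' ∨ u = l₀ ∨ u = l₁ := by
  have key : ∀ x, P.graph.IsEdge x → u.1 ≠ x := by
    rintro x hx rfl
    exact hx u.2
  have h₀ : P.graph.IsEdge a₀ := isEdge_of_o_ne_t (by
    rw [h.a₀_ends.1, h.a₀_ends.2]; exact h.distinct.1.symm)
  have h₁ : P.graph.IsEdge a₁ := isEdge_of_o_ne_t (by
    rw [h.a₁_ends.1, h.a₁_ends.2]; exact h.distinct.2.1.symm)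
  rcases (h.fiber _).1 hu with e | e | e | e | e | e | e
  · exact .inl (Subtype.ext e)
  · exact .inr (.inl (Subtype.ext e))
  · exact .inr (.inr (Subtype.ext e))
  · exact absurd e (key _ h₀)
  · exact absurd e (key _ h₀.bar)
  · exact absurd e (key _ h₁)
  · exact absurd e (key _ h₁.bar)

/-- Each of the three new vertices has two distinct edges, and these have non-trivial groups if
both old edges do. -/
theorem exists_edges (h : IsSplitAt SP SQ f φ v v' l₀ l₁ a₀ a₁ e₀ e₁) {u : P.Vert}
    (hu : f u.1 = v.1) (g₀ : SQ.gen (f e₀) ≠ 1) (g₁ : SQ.gen (f e₁) ≠ 1) :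
    ∃ x y, P.graph.src x = u.1 ∧ P.graph.src y = u.1 ∧ P.graph.IsEdge x ∧ P.graph.IsEdge y ∧
      x ≠ y ∧ SP.gen x ≠ 1 ∧ SP.gen y ≠ 1 := by
  have h₀ : P.graph.IsEdge a₀ := isEdge_of_o_ne_t (by
    rw [h.a₀_ends.1, h.a₀_ends.2]; exact h.distinct.1.symm)
  have h₁ : P.graph.IsEdge a₁ := isEdge_of_o_ne_t (by
    rw [h.a₁_ends.1, h.a₁_ends.2]; exact h.distinct.2.1.symm)
  have hf₀ : f a₀ = v.1 := (h.fiber _).2 (by simp)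
  have hf₀' : f (P.graph.bar a₀) = v.1 := (h.fiber _).2 (by simp)
  have hf₁ : f a₁ = v.1 := (h.fiber _).2 (by simp)
  have hf₁' : f (P.graph.bar a₁) = v.1 := (h.fiber _).2 (by simp)
  have m₀ : f e₀ ∈ {y | Q.graph.IsEdge y ∧ Q.graph.o y = v} := by rw [h.edges.1]; simp
  have m₁ : f e₁ ∈ {y | Q.graph.IsEdge y ∧ Q.graph.o y = v} := by rw [h.edges.1]; simp
  have hne : ∀ {y}, Q.graph.IsEdge y → y ≠ v.1 := by
    rintro _ hy rfl
    exact hy v.2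
  have hv : ∃ g : Q.G v.1, g ≠ 1 := ⟨_, SQ.minusTo_gen_ne_one (src_eq_of_o_eq m₀.2) g₀⟩
  have hgen : ∀ x, P.graph.IsEdge x → f x = v.1 → SP.gen x ≠ 1 := by
    intro x hx hfx e
    obtain ⟨g, hg⟩ : ∃ g : Q.G (f x), g ≠ 1 := by rw [hfx]; exact hv
    obtain ⟨k, rfl⟩ := (h.groups_bijective x).2 g
    have hk := SP.gen_generates x hx k
    rw [e, Subgroup.zpowers_one_eq_bot, Subgroup.mem_bot] at hk
    exact hg (by rw [hk, map_one])
  have hold : ∀ {x}, Q.graph.IsEdge (f x) → SQ.gen (f x) ≠ 1 → SP.gen x ≠ 1 := by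
    intro x hx hg e
    rw [← h.gen x (h.hom.graph.isEdge_of_isEdge_map hx) (hne hx), e, map_one] at hg
    exact hg rfl
  rcases h.eq_of_map_eq_v hu with rfl | rfl | rfl
  · refine ⟨P.graph.bar a₀, P.graph.bar a₁, src_eq_of_o_eq h.a₀_ends.2, src_eq_of_o_eq h.a₁_ends.2,
      h₀.bar, h₁.bar, fun e => h.distinct.2.2 ?_, hgen _ h₀.bar hf₀', hgen _ h₁.bar hf₁'⟩
    rw [← h.a₀_ends.1, ← h.a₁_ends.1, ← P.graph.t_bar, e, P.graph.t_bar]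
  · refine ⟨a₀, e₀, src_eq_of_o_eq h.a₀_ends.1, src_eq_of_o_eq h.edges_origin.1, h₀,
      h.hom.graph.isEdge_of_isEdge_map m₀.1, ?_, hgen _ h₀ hf₀, hold m₀.1 g₀⟩
    rintro rfl
    exact hne m₀.1 hf₀
  · refine ⟨a₁, e₁, src_eq_of_o_eq h.a₁_ends.1, src_eq_of_o_eq h.edges_origin.2, h₁,
      h.hom.graph.isEdge_of_isEdge_map m₁.1, ?_, hgen _ h₁ hf₁, hold m₁.1 g₁⟩
    rintro rfl
    exact hne m₁.1 hf₁

/-- No class at `v` is vacant, so each is occupied by one of the two edges at `v`. Since a sphere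
group never has exactly one peripheral class, a vacant class at `u` would force both edges to occupy
classes: there are then exactly two classes and both generators are non-trivial. But then `u` itself
has two edges with non-trivial groups, which leave nothing vacant. -/
theorem not_isVacant (h : IsSplitAt SP SQ f φ v v' l₀ l₁ a₀ a₁ e₀ e₁)
    (hv : ∀ c, ¬ SQ.IsVacant v c) {u : P.Vert} (hu : f u.1 = v.1) (C : ConjClasses (P.G u.1)) :
    ¬ SP.IsVacant u C := by
  intro hC
  have hom := h.hom
  obtain rfl : hom.graph.onVert u = v := Subtype.ext hu
  have hatt : ∀ D ∈ SQ.per (f u.1), ∃ (y : Q.graph.carrier) (hy : Q.graph.src y = f u.1),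
      (y = f e₀ ∨ y = f e₁) ∧ SQ.gen y ≠ 1 ∧ D = ConjClasses.mk (Q.minusTo hy (SQ.gen y)) := by
    intro D hD
    by_contra hcon
    refine hv D ⟨hD, fun y hy hy' e => hcon ⟨y, hy, ?_, ?_, e.symm⟩⟩
    · have : y ∈ {y | Q.graph.IsEdge y ∧ Q.graph.o y = hom.graph.onVert u} :=
        ⟨hy', Subtype.ext hy⟩
      rw [h.edges.1] at this
      exact this
    · exact SQ.gen_ne_one_of_mem hy (by rw [e]; exact hD)
  have hD := (h.per _ _).1 hC.1
  set D := ConjClasses.map (φ u.1) C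
  have hfin := (SQ.isSphere (f u.1)).finite
  obtain ⟨D', hD', hne⟩ : ∃ D' ∈ SQ.per (f u.1), D' ≠ D := by
    by_contra hcon
    push Not at hcon
    exact (SQ.isSphere (f u.1)).ncard_ne_one
      (Set.ncard_eq_one.2 ⟨D, Set.eq_singleton_iff_unique_mem.2 ⟨hD, hcon⟩⟩)
  obtain ⟨y, hy, hy1, hy2, hyD⟩ := hatt D hD
  obtain ⟨y', hy', hy1', hy2', hyD'⟩ := hatt D' hD'
  have hyy : y ≠ y' := by
    rintro rfl
    exact hne (hyD'.trans hyD.symm)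
  have h2 : SQ.per (f u.1) ⊆ {D, D'} := by
    intro D'' hD''
    obtain ⟨y'', hy'', hy1'', -, hyD''⟩ := hatt D'' hD''
    have : y'' = y ∨ y'' = y' := by
      rcases hy1 with rfl | rfl <;> rcases hy1' with rfl | rfl <;> rcases hy1'' with rfl | rfl <;>
        simp_all
    rcases this with rfl | rfl
    · exact .inl (hyD''.trans hyD.symm)
    · exact .inr (hyD''.trans hyD'.symm)
  have g₀ : SQ.gen (f e₀) ≠ 1 := by
    rcases hy1 with rfl | rfl <;> rcases hy1' with rfl | rfl <;> first | assumption | simp_all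
  have g₁ : SQ.gen (f e₁) ≠ 1 := by
    rcases hy1 with rfl | rfl <;> rcases hy1' with rfl | rfl <;> first | assumption | simp_all
  have h3 : (SP.per u.1).ncard ≤ 2 := by
    refine (Set.ncard_le_ncard_of_injOn (t := SQ.per (f u.1)) (ConjClasses.map (φ u.1))
      (fun c hc => (h.per _ _).1 hc)
      (ConjClasses.map_injective_of_bijective (h.groups_bijective _)).injOn hfin).trans ?_
    exact (Set.ncard_le_ncard h2 (Set.toFinite _)).trans ((Set.ncard_insert_le _ _).trans (by rw [Set.ncard_singleton]))
  obtain ⟨x, x', hx, hx', ex, ex', hxx, gx, gx'⟩ := h.exists_edges hu g₀ g₁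
  exact SP.not_isVacant_of_pair hx hx' ex ex' hxx gx gx' h3 C hC

/-- Neither `v` nor the three vertices over it have vacant classes, and outside this fibre `f` is
bijective. -/
theorem bijOn_vacant (h : IsSplitAt SP SQ f φ v v' l₀ l₁ a₀ a₁ e₀ e₁)
    (hv : ∀ c, ¬ SQ.IsVacant v c) :
    Set.BijOn (Label.map h.hom.graph φ) SP.vacant SQ.vacant := by
  have hoff : ∀ {u : P.Vert} {c}, f u.1 ≠ v.1 →
      (SP.IsVacant u c ↔ SQ.IsVacant (h.hom.graph.onVert u) (ConjClasses.map (φ u.1) c)) :=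
    fun hu => isVacant_iff_off h.hom h.off_fiber h.gen hu (h.groups_bijective _) (h.per _) _
  have hfib : ∀ {x : Label P}, x ∈ SP.vacant → f x.1.1 ≠ v.1 :=
    fun hx hu => h.not_isVacant hv hu _ hx
  refine ⟨fun x hx => (hoff (hfib hx)).1 hx, ?_, ?_⟩
  · rintro ⟨u, c⟩ hx ⟨u', c'⟩ - e
    obtain rfl : u' = u := Subtype.ext
      ((h.off_fiber _ (hfib hx)).unique (congrArg (fun x => x.1.1) e).symm rfl)
    have e1 : ConjClasses.map (φ u'.1) c = ConjClasses.map (φ u'.1) c' :=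
      eq_of_heq (Sigma.mk.inj e).2
    rw [ConjClasses.map_injective_of_bijective (h.groups_bijective _) e1]
  · rintro ⟨⟨y, hy⟩, d⟩ hd
    have hyv : y ≠ v.1 := by
      rintro rfl
      exact hv d hd
    obtain ⟨x, rfl, hx'⟩ := h.off_fiber y hyv
    have hx : P.graph.src x = x := hx' _ ((h.hom.graph.map_src x).trans hy)
    obtain ⟨c, rfl⟩ := ConjClasses.map_surjective_of_surjective (h.groups_bijective x).2 d
    exact ⟨⟨⟨x, hx⟩, c⟩, (hoff (u := ⟨x, hx⟩) hyv).2 hd, rfl⟩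

end IsSplitAt
end Split
end Refinement

open SphereStructure

section Refinement

variable {P Q : GraphOfGroups.{u}} {SP : SphereStructure P} {SQ : SphereStructure Q}
  {f : P.graph.carrier → Q.graph.carrier} {φ : ∀ x, P.G x →* Q.G (f x)} {v : Q.Vert}

theorem transport_injective {ι : Type*} (G : ι → Type*) [∀ i, Group (G i)] {x y : ι} (h : x = y) :
    Function.Injective (transport G h) := by
  subst h
  exact fun _ _ e => e

/-- The homomorphism from the group of `x` to the group of an element `y` over which `x` lies. -/
def fiberHom (φ : ∀ x, P.G x →* Q.G (f x)) {x : P.graph.carrier} {y : Q.graph.carrier}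
    (hx : f x = y) : P.G x →* Q.G y := (transport Q.G hx).comp (φ x)

/-- At a vertex of `Q` the map `g ↦ g⁻` is the identity. Elements of the various groups in one fibre
can therefore be compared, up to conjugacy, inside a single group. -/
theorem isConj_fiberHom_minusTo (h : IsGroupsMorphism f φ) {y : Q.graph.carrier}
    (hy : Q.graph.src y = y) {x u : P.graph.carrier}
    (hu : P.graph.src x = u) (hx : f x = y) (hx' : f u = y) (g : P.G x) :
    IsConj (fiberHom φ hx' (P.minusTo hu g)) (fiberHom φ hx g) := by
  have h1 := isConj_minusTo h hu g
  subst hx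
  have h2 := (transport Q.G hx').map_isConj h1
  have h3 : transport Q.G hx' (Q.minusTo ((h.graph.map_src x).symm.trans (congrArg f hu)) (φ x g)) =
      φ x g :=
    (transport_transport _ _ _ _).trans (Q.minus_vertex _ hy _)
  rw [h3] at h2
  exact h2

theorem fiberHom_inv (h : IsGroupsMorphism f φ) {y : Q.graph.carrier} (hy : Q.graph.src y = y)
    {x : P.graph.carrier} (hx : f x = y)
    (hx' : f (P.graph.bar x) = y) (g : P.G x) :
    fiberHom φ hx' (P.inv x g) = fiberHom φ hx g := by
  subst hx
  change transport Q.G _ (φ _ _) = φ x g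
  rw [h.map_inv]
  refine (transport_transport _ _ _ _).trans ?_
  exact Q.inv_vertex _ (Graph'.bar_eq_of_src_eq hy) _

theorem Label.map_eq_of_isConj (h : IsGraphMorphism P.graph Q.graph f) {u : P.Vert}
    (hu : f u.1 = v.1) {g : P.G u.1} {k : Q.G v.1} (hg : IsConj (fiberHom φ hu g) k) :
    Label.map h φ ⟨u, ConjClasses.mk g⟩ = ⟨v, ConjClasses.mk k⟩ := by
  have h' := h
  obtain rfl : h'.onVert u = v := Subtype.ext hu
  exact congrArg (Sigma.mk _) (ConjClasses.mk_eq_mk_iff_isConj.2 hg)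

theorem Label.exists_map_eq (h : IsGraphMorphism P.graph Q.graph f) {u : P.Vert}
    (hu : h.onVert u = v) (hs : Function.Surjective (φ u.1)) (d : ConjClasses (Q.G v.1)) :
    ∃ C, Label.map h φ ⟨u, C⟩ = ⟨v, d⟩ := by
  subst hu
  obtain ⟨C, rfl⟩ := ConjClasses.map_surjective_of_surjective hs d
  exact ⟨C, rfl⟩

namespace IsEdgeAddedAt

variable {h : Q.G v.1} {v' l w : P.Vert} {e₀ e₁ : P.graph.carrier}

theorem isEdge_e₀ (H : IsEdgeAddedAt SP SQ f φ v h v' l w e₀ e₁) : P.graph.IsEdge e₀ :=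
  isEdge_of_o_ne_t (by rw [H.e₀_ends.1, H.e₀_ends.2]; exact H.distinct.1)

theorem isEdge_e₁ (H : IsEdgeAddedAt SP SQ f φ v h v' l w e₀ e₁) : P.graph.IsEdge e₁ :=
  isEdge_of_o_ne_t (by rw [H.e₁_ends.1, H.e₁_ends.2]; exact H.distinct.2.2)

theorem eq_of_map_eq_v (H : IsEdgeAddedAt SP SQ f φ v h v' l w e₀ e₁) {u : P.Vert}
    (hu : f u.1 = v.1) : u = v' ∨ u = l ∨ u = w := by
  have key : ∀ x, P.graph.IsEdge x → u.1 ≠ x := by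
    rintro x hx rfl
    exact hx u.2
  rcases (H.fiber _).1 hu with e | e | e | e | e | e | e
  · exact .inl (Subtype.ext e)
  · exact .inr (.inl (Subtype.ext e))
  · exact .inr (.inr (Subtype.ext e))
  · exact absurd e (key _ H.isEdge_e₀)
  · exact absurd e (key _ H.isEdge_e₀.bar)
  · exact absurd e (key _ H.isEdge_e₁)
  · exact absurd e (key _ H.isEdge_e₁.bar)

/-- The edges over `v`. -/
theorem eq_of_isEdge (H : IsEdgeAddedAt SP SQ f φ v h v' l w e₀ e₁) {x : P.graph.carrier}
    (hx : P.graph.IsEdge x) (hu : f x = v.1) :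
    x = e₀ ∨ x = P.graph.bar e₀ ∨ x = e₁ ∨ x = P.graph.bar e₁ := by
  have key : ∀ u : P.Vert, x ≠ u.1 := by
    rintro u rfl
    exact hx u.2
  rcases (H.fiber _).1 hu with e | e | e | e | e | e | e
  · exact absurd e (key _)
  · exact absurd e (key _)
  · exact absurd e (key _)
  · exact .inl e
  · exact .inr (.inl e)
  · exact .inr (.inr (.inl e))
  · exact .inr (.inr (.inr e))

theorem map_of_mem (H : IsEdgeAddedAt SP SQ f φ v h v' l w e₀ e₁) {x : P.graph.carrier}
    (hx : x ∈ ({l.1, w.1, e₀, P.graph.bar e₀, e₁, P.graph.bar e₁} : Set P.graph.carrier)) :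
    f x = v.1 := (H.fiber x).2 (.inr hx)

theorem map_v' (H : IsEdgeAddedAt SP SQ f φ v h v' l w e₀ e₁) : f v'.1 = v.1 :=
  (H.fiber _).2 (.inl rfl)

/-- The vertex and edges of `P` other than the new ones. -/
theorem notMem_new (H : IsEdgeAddedAt SP SQ f φ v h v' l w e₀ e₁) {u : P.Vert} (hl : u ≠ l)
    (hw : u ≠ w) :
    u.1 ∉ ({l.1, w.1, e₀, P.graph.bar e₀, e₁, P.graph.bar e₁} : Set P.graph.carrier) := by
  have key : ∀ x, P.graph.IsEdge x → u.1 ≠ x := by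
    rintro x hx rfl
    exact hx u.2
  rintro (e | e | e | e | e | e)
  · exact hl (Subtype.ext e)
  · exact hw (Subtype.ext e)
  · exact absurd e (key _ H.isEdge_e₀)
  · exact absurd e (key _ H.isEdge_e₀.bar)
  · exact absurd e (key _ H.isEdge_e₁)
  · exact absurd e (key _ H.isEdge_e₁.bar)

theorem range_fiberHom (H : IsEdgeAddedAt SP SQ f φ v h v' l w e₀ e₁) {x : P.graph.carrier}
    (hx : x ∈ ({l.1, w.1, e₀, P.graph.bar e₀, e₁, P.graph.bar e₁} : Set P.graph.carrier)) :
    ∃ k, IsConj k h ∧ (fiberHom φ (H.map_of_mem hx)).range = Subgroup.zpowers k := by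
  obtain ⟨k, hk, hr⟩ := H.groups_new x hx (H.map_of_mem hx)
  refine ⟨_, hk, ?_⟩
  rw [fiberHom, MonoidHom.range_comp, hr, MonoidHom.map_zpowers]

theorem fiberHom_injective (H : IsEdgeAddedAt SP SQ f φ v h v' l w e₀ e₁) {x : P.graph.carrier}
    (hx : f x = v.1) : Function.Injective (fiberHom φ hx) :=
  (transport_injective _ hx).comp (H.groups_injective x)

theorem eq_one_of_new (H : IsEdgeAddedAt SP SQ f φ v h v' l w e₀ e₁) (h1 : h = 1)
    {x : P.graph.carrier}
    (hx : x ∈ ({l.1, w.1, e₀, P.graph.bar e₀, e₁, P.graph.bar e₁} : Set P.graph.carrier))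
    (g : P.G x) : g = 1 := by
  obtain ⟨k, hk, hr⟩ := H.range_fiberHom hx
  replace hk := isConj_one_left.1 (h1 ▸ hk)
  have : fiberHom φ (H.map_of_mem hx) g ∈ (fiberHom φ (H.map_of_mem hx)).range := ⟨g, rfl⟩
  rw [hr, hk, Subgroup.zpowers_one_eq_bot, Subgroup.mem_bot] at this
  exact H.fiberHom_injective _ (this.trans (map_one _).symm)

theorem exists_generator (H : IsEdgeAddedAt SP SQ f φ v h v' l w e₀ e₁) {x : P.graph.carrier}
    (hx : x ∈ ({l.1, w.1, e₀, P.graph.bar e₀, e₁, P.graph.bar e₁} : Set P.graph.carrier)) :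
    ∃ t : P.G x, (∀ g, g ∈ Subgroup.zpowers t) ∧ IsConj (fiberHom φ (H.map_of_mem hx) t) h := by
  obtain ⟨k, hk, hr⟩ := H.range_fiberHom hx
  obtain ⟨t, ht⟩ : k ∈ (fiberHom φ (H.map_of_mem hx)).range := by
    rw [hr]; exact Subgroup.mem_zpowers k
  refine ⟨t, fun g => ?_, ht ▸ hk⟩
  have : fiberHom φ (H.map_of_mem hx) g ∈ (fiberHom φ (H.map_of_mem hx)).range := ⟨g, rfl⟩
  rw [hr] at this
  obtain ⟨n, hn⟩ := Subgroup.mem_zpowers_iff.1 this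
  refine Subgroup.mem_zpowers_iff.2 ⟨n, H.fiberHom_injective (H.map_of_mem hx) ?_⟩
  rw [map_zpow, ht, hn]

theorem gen_ne_one (H : IsEdgeAddedAt SP SQ f φ v h v' l w e₀ e₁) (h1 : h ≠ 1)
    {x : P.graph.carrier} (hx' : P.graph.IsEdge x)
    (hx : x ∈ ({l.1, w.1, e₀, P.graph.bar e₀, e₁, P.graph.bar e₁} : Set P.graph.carrier)) :
    SP.gen x ≠ 1 := by
  intro e
  obtain ⟨t, -, ht⟩ := H.exists_generator hx
  have := SP.gen_generates x hx' t
  rw [e, Subgroup.zpowers_one_eq_bot, Subgroup.mem_bot] at this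
  rw [this, map_one] at ht
  exact h1 (isConj_one_right.1 ht)

theorem label_map_e₀ (H : IsEdgeAddedAt SP SQ f φ v h v' l w e₀ e₁)
    (he : P.graph.src e₀ = v'.1) : Label.map H.hom.graph φ
      ⟨v', ConjClasses.mk (P.minusTo he (SP.gen e₀))⟩ = ⟨v, ConjClasses.mk h⟩ :=
  Label.map_eq_of_isConj H.hom.graph H.map_v'
    ((isConj_fiberHom_minusTo H.hom v.2 he (H.map_of_mem (by simp)) H.map_v' _).trans
      (H.gen_new _))

theorem label_map_v'_injective (H : IsEdgeAddedAt SP SQ f φ v h v' l w e₀ e₁)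
    {C C' : ConjClasses (P.G v'.1)}
    (e : Label.map H.hom.graph φ ⟨v', C⟩ = Label.map H.hom.graph φ ⟨v', C'⟩) : C = C' := by
  have hv := H.notMem_new H.distinct.1 H.distinct.2.1
  exact ConjClasses.map_injective_of_bijective (H.groups_old v'.1 hv).1 (eq_of_heq (Sigma.mk.inj e).2)

/-- Among the new edges only `e₀` starts at `v'`, and it attaches to the class of `h`; all other
edges at `v'` correspond to those at `v`. -/
theorem isVacant_v'_iff (H : IsEdgeAddedAt SP SQ f φ v h v' l w e₀ e₁)
    (C : ConjClasses (P.G v'.1)) : SP.IsVacant v' C ↔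
      Label.map H.hom.graph φ ⟨v', C⟩ ∈ SQ.vacant ∧
        Label.map H.hom.graph φ ⟨v', C⟩ ≠ ⟨v, ConjClasses.mk h⟩ := by
  have he : P.graph.src e₀ = v'.1 := src_eq_of_o_eq H.e₀_ends.1
  have hv := H.notMem_new H.distinct.1 H.distinct.2.1
  have hper := (H.groups_old v'.1 hv).2
  have hb := (H.groups_old v'.1 hv).1
  have hfv := H.map_v'
  rw [← H.label_map_e₀ he]
  constructor
  · refine fun hC => ⟨⟨(hper _).1 hC.1, fun y hy hy' e => ?_⟩, fun e => ?_⟩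
    · have hyv : y ≠ v.1 := by
        rintro rfl
        exact hy' v.2
      obtain ⟨x, rfl, -⟩ := H.off_fiber y hyv
      have hxe := H.hom.graph.isEdge_of_isEdge_map hy'
      have hx : P.graph.src x = v'.1 := src_eq_of_o_eq (H.edges_origin x hyv
        ((H.hom.graph.map_src x).trans (hy.trans hfv)))
      refine hC.2 x hx hxe (ConjClasses.map_injective_of_bijective hb ?_)
      rw [map_mk_minusTo H.hom hx, H.gen x hxe hyv]
      exact e
    · exact hC.2 e₀ he H.isEdge_e₀ (H.label_map_v'_injective e).symm
  · rintro ⟨hC, hne⟩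
    refine ⟨(hper _).2 hC.1, fun x hx hx' e => ?_⟩
    by_cases hfx : f x = v.1
    · rcases H.eq_of_isEdge hx' hfx with rfl | rfl | rfl | rfl
      · exact hne (by rw [e])
      · exact H.distinct.1 ((Subtype.ext hx).symm.trans H.e₀_ends.2)
      · exact H.distinct.1 ((Subtype.ext hx).symm.trans H.e₁_ends.1)
      · exact H.distinct.2.1 ((Subtype.ext hx).symm.trans H.e₁_ends.2)
    · refine hC.2 (f x) ((H.hom.graph.map_src x).symm.trans (congrArg f hx))
        (H.hom.graph.isEdge_map hx' (H.off_fiber _ hfx)) ?_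
      refine Eq.trans ?_ ((map_mk_minusTo H.hom hx (SP.gen x)).symm.trans (congrArg _ e))
      exact congrArg (fun g => ConjClasses.mk (Q.minusTo _ g)) (H.gen x hx' hfx).symm

/-- The two edges at `l` attach to inverse classes. -/
theorem minusTo_gen_e₁ (H : IsEdgeAddedAt SP SQ f φ v h v' l w e₀ e₁) (h1 : h ≠ 1)
    (he : P.graph.src (P.graph.bar e₀) = l.1) (he' : P.graph.src e₁ = l.1) :
    P.minusTo he' (SP.gen e₁) = (P.minusTo he (SP.gen (P.graph.bar e₀)))⁻¹ := by
  obtain ⟨t, ht, -⟩ := H.exists_generator (x := l.1) (by simp)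
  have g₀ := H.gen_ne_one h1 H.isEdge_e₀.bar (by simp)
  have g₁ := H.gen_ne_one h1 H.isEdge_e₁ (by simp)
  refine (SP.isSphere l.1).eq_inv_of_zpowers ht (SP.mk_minusTo_gen_mem he H.isEdge_e₀.bar g₀)
    (SP.mk_minusTo_gen_mem he' H.isEdge_e₁ g₁) fun e => ?_
  have h3 := SP.attach_injective _ _ _ he he' H.isEdge_e₀.bar H.isEdge_e₁ g₀ g₁ e
  have h4 : P.graph.t (P.graph.bar e₀) = P.graph.t e₁ := by rw [h3]
  rw [P.graph.t_bar, H.e₀_ends.1, H.e₁_ends.2] at h4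
  exact H.distinct.2.1 h4

/-- If `h = 1` the group is trivial and has no peripheral classes. Otherwise it is cyclic with two
of them, occupied by the two edges at `l`. -/
theorem not_isVacant_l (H : IsEdgeAddedAt SP SQ f φ v h v' l w e₀ e₁) (C : ConjClasses (P.G l.1)) :
    ¬ SP.IsVacant l C := by
  intro hC
  by_cases h1 : h = 1
  · induction C using Quotient.inductionOn with | h g => ?_
    have h2 := hC.1
    rw [H.eq_one_of_new h1 (by simp) g] at h2
    exact (SP.isSphere l.1).mk_one_notMem h2
  · have he : P.graph.src (P.graph.bar e₀) = l.1 := src_eq_of_o_eq H.e₀_ends.2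
    have he' : P.graph.src e₁ = l.1 := src_eq_of_o_eq H.e₁_ends.1
    obtain ⟨t, ht, -⟩ := H.exists_generator (x := l.1) (by simp)
    have g₀ := H.gen_ne_one h1 H.isEdge_e₀.bar (by simp)
    induction C using Quotient.inductionOn with | h g => ?_
    have h3 := (SP.isSphere l.1).eq_inv_of_zpowers ht
      (SP.mk_minusTo_gen_mem he H.isEdge_e₀.bar g₀) hC.1 (hC.2 _ he H.isEdge_e₀.bar)
    refine hC.2 _ he' H.isEdge_e₁ ?_
    rw [H.minusTo_gen_e₁ h1 he he', h3]
    rfl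

/-- The edge `e₀` carries the class of `h` to `l`. The other edge at `l` attaches to the inverse
class, and it carries this class on to `w`. -/
theorem isConj_fiberHom_e₁ (H : IsEdgeAddedAt SP SQ f φ v h v' l w e₀ e₁) (h1 : h ≠ 1)
    (he : P.graph.src (P.graph.bar e₁) = w.1) (hw : f w.1 = v.1) :
    IsConj (fiberHom φ hw (P.minusTo he (SP.gen (P.graph.bar e₁)))) h⁻¹ := by
  have hb : P.graph.src (P.graph.bar e₀) = l.1 := src_eq_of_o_eq H.e₀_ends.2
  have hb' : P.graph.src e₁ = l.1 := src_eq_of_o_eq H.e₁_ends.1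
  have hl : f l.1 = v.1 := H.map_of_mem (by simp)
  have hf₀ : f e₀ = v.1 := H.map_of_mem (by simp)
  have hf₀' : f (P.graph.bar e₀) = v.1 := H.map_of_mem (by simp)
  have hf₁ : f e₁ = v.1 := H.map_of_mem (by simp)
  have hf₁' : f (P.graph.bar e₁) = v.1 := H.map_of_mem (by simp)
  have s1 := isConj_fiberHom_minusTo H.hom v.2 he hf₁' hw (SP.gen (P.graph.bar e₁))
  rw [← SP.inv_gen _ H.isEdge_e₁, fiberHom_inv H.hom v.2 hf₁] at s1
  rw [← SP.inv_gen _ H.isEdge_e₁]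
  refine s1.trans ((isConj_fiberHom_minusTo H.hom v.2 hb' hf₁ hl _).symm.trans ?_)
  rw [H.minusTo_gen_e₁ h1 hb hb', map_inv]
  refine IsConj.inv' ((isConj_fiberHom_minusTo H.hom v.2 hb hf₀' hl _).trans ?_)
  rw [← SP.inv_gen _ H.isEdge_e₀, fiberHom_inv H.hom v.2 hf₀]
  exact H.gen_new hf₀

/-- The only edge at `w` occupies one of the two peripheral classes of a cyclic group. -/
theorem isVacant_w_iff (H : IsEdgeAddedAt SP SQ f φ v h v' l w e₀ e₁) (h1 : h ≠ 1)
    (he : P.graph.src (P.graph.bar e₁) = w.1) (C : ConjClasses (P.G w.1)) :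
    SP.IsVacant w C ↔ C = ConjClasses.mk (P.minusTo he (SP.gen (P.graph.bar e₁)))⁻¹ := by
  obtain ⟨t, ht, -⟩ := H.exists_generator (x := w.1) (by simp)
  have g₁ := H.gen_ne_one h1 H.isEdge_e₁.bar (by simp)
  have hm := SP.mk_minusTo_gen_mem he H.isEdge_e₁.bar g₁
  constructor
  · intro hC
    induction C using Quotient.inductionOn with | h g => ?_
    rw [← (SP.isSphere w.1).eq_inv_of_zpowers ht hm hC.1 (hC.2 _ he H.isEdge_e₁.bar)]
    rfl
  · rintro rfl
    obtain ⟨D, hD, hne⟩ : ∃ D ∈ SP.per w.1,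
        D ≠ ConjClasses.mk (P.minusTo he (SP.gen (P.graph.bar e₁))) := by
      by_contra hcon
      push Not at hcon
      exact (SP.isSphere w.1).ncard_ne_one
        (Set.ncard_eq_one.2 ⟨_, Set.eq_singleton_iff_unique_mem.2 ⟨hm, hcon⟩⟩)
    induction D using Quotient.inductionOn with | h g => ?_
    rw [← (SP.isSphere w.1).eq_inv_of_zpowers ht hm hD fun e => hne e.symm]
    refine ⟨hD, fun x hx hx' e => ?_⟩
    have hxe : x = P.graph.bar e₁ := by
      have hfx : f x = v.1 := by
        by_contra hcon
        refine H.distinct.2.1 ((H.edges_origin x hcon ?_).symm.trans (Subtype.ext hx))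
        exact (congrArg f hx).trans (H.map_of_mem (by simp))
      rcases H.eq_of_isEdge hx' hfx with rfl | rfl | rfl | rfl
      · exact absurd (H.e₀_ends.1.symm.trans (Subtype.ext hx)) H.distinct.2.1
      · exact absurd (H.e₀_ends.2.symm.trans (Subtype.ext hx)) H.distinct.2.2
      · exact absurd (H.e₁_ends.1.symm.trans (Subtype.ext hx)) H.distinct.2.2
      · rfl
    subst hxe
    exact hne e.symm

/-- There are two inversions between `v'` and the vacant class of `w`, one at `l` and one at `w`,
and they cancel. -/
theorem label_map_w (H : IsEdgeAddedAt SP SQ f φ v h v' l w e₀ e₁) (h1 : h ≠ 1)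
    (he : P.graph.src (P.graph.bar e₁) = w.1) : Label.map H.hom.graph φ
      ⟨w, ConjClasses.mk (P.minusTo he (SP.gen (P.graph.bar e₁)))⁻¹⟩ = ⟨v, ConjClasses.mk h⟩ := by
  have hw : f w.1 = v.1 := H.map_of_mem (by simp)
  refine Label.map_eq_of_isConj H.hom.graph hw ?_
  have := (H.isConj_fiberHom_e₁ h1 he hw).inv'
  rw [inv_inv] at this
  rwa [map_inv]

theorem not_isVacant_w (H : IsEdgeAddedAt SP SQ f φ v h v' l w e₀ e₁) (h1 : h = 1)
    (C : ConjClasses (P.G w.1)) : ¬ SP.IsVacant w C := by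
  intro hC
  induction C using Quotient.inductionOn with | h g => ?_
  have h2 := hC.1
  rw [H.eq_one_of_new h1 (by simp) g] at h2
  exact (SP.isSphere w.1).mk_one_notMem h2

/-- The class of `h`, now occupied at `v'`, reappears as the vacant class of the new end `w`, and
all other vacant classes stay in place. If `h = 1`, nothing is occupied and the new vertices have no
vacant classes. -/
theorem bijOn_vacant (H : IsEdgeAddedAt SP SQ f φ v h v' l w e₀ e₁) :
    Set.BijOn (Label.map H.hom.graph φ) SP.vacant SQ.vacant := by
  have he : P.graph.src (P.graph.bar e₁) = w.1 := src_eq_of_o_eq H.e₁_ends.2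
  have hbij : ∀ {u : P.Vert}, f u.1 ≠ v.1 → Function.Bijective (φ u.1) ∧ _ := fun {u} hu =>
    H.groups_old u.1 fun hm => hu (H.map_of_mem hm)
  have hoff : ∀ {u : P.Vert} {c}, f u.1 ≠ v.1 →
      (SP.IsVacant u c ↔ SQ.IsVacant (H.hom.graph.onVert u) (ConjClasses.map (φ u.1) c)) :=
    fun hu => isVacant_iff_off H.hom H.off_fiber H.gen hu (hbij hu).1 (hbij hu).2 _
  have hcase : ∀ {x : Label P}, x ∈ SP.vacant → f x.1.1 = v.1 →
      (x.1 = v' ∧ Label.map H.hom.graph φ x ∈ SQ.vacant ∧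
        Label.map H.hom.graph φ x ≠ ⟨v, ConjClasses.mk h⟩) ∨
      (h ≠ 1 ∧ x = ⟨w, ConjClasses.mk (P.minusTo he (SP.gen (P.graph.bar e₁)))⁻¹⟩) := by
    rintro ⟨u, C⟩ hx hu
    rcases H.eq_of_map_eq_v hu with rfl | rfl | rfl
    · exact .inl ⟨rfl, (H.isVacant_v'_iff C).1 hx⟩
    · exact absurd hx (H.not_isVacant_l C)
    · by_cases h1 : h = 1
      · exact absurd hx (H.not_isVacant_w h1 C)
      · exact .inr ⟨h1, by rw [(H.isVacant_w_iff h1 he C).1 hx]⟩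
  refine ⟨fun x hx => ?_, ?_, ?_⟩
  · by_cases hu : f x.1.1 = v.1
    · rcases hcase hx hu with h2 | ⟨h1, rfl⟩
      · exact h2.2.1
      · rw [H.label_map_w h1]
        exact H.trivial_or_vacant.resolve_left h1
    · exact (hoff hu).1 hx
  · intro x hx x' hx' e
    have e' : f x.1.1 = f x'.1.1 := congrArg (fun x => x.1.1) e
    by_cases hu : f x.1.1 = v.1
    · rcases hcase hx hu with h2 | ⟨h1, rfl⟩ <;> rcases hcase hx' (e'.symm.trans hu) with h2' | ⟨h1', rfl⟩
      · obtain ⟨u, c⟩ := x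
        obtain ⟨u', c'⟩ := x'
        obtain rfl : u = v' := h2.1
        obtain rfl : u' = u := h2'.1
        rw [H.label_map_v'_injective e]
      · exact absurd (e.trans (H.label_map_w h1' he)) h2.2.2
      · exact absurd (e.symm.trans (H.label_map_w h1 he)) h2'.2.2
      · rfl
    · obtain ⟨u, c⟩ := x
      obtain ⟨u', c'⟩ := x'
      obtain rfl : u' = u := Subtype.ext ((H.off_fiber _ hu).unique e'.symm rfl)
      have e1 : ConjClasses.map (φ u'.1) c = ConjClasses.map (φ u'.1) c' :=
        eq_of_heq (Sigma.mk.inj e).2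
      rw [ConjClasses.map_injective_of_bijective (hbij hu).1 e1]
  · rintro ⟨⟨y, hy⟩, d⟩ hd
    by_cases hyv : y = v.1
    · obtain rfl : v = ⟨y, hy⟩ := Subtype.ext hyv.symm
      by_cases hdh : d = ConjClasses.mk h
      · have h1 : h ≠ 1 := by
          rintro rfl
          rw [hdh] at hd
          exact (SQ.isSphere _).mk_one_notMem hd.1
        exact ⟨_, (H.isVacant_w_iff h1 he _).2 rfl, (H.label_map_w h1 he).trans (by rw [hdh])⟩
      · have hv := H.notMem_new H.distinct.1 H.distinct.2.1
        have hfv : H.hom.graph.onVert v' = ⟨y, hy⟩ := Subtype.ext H.map_v'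
        obtain ⟨C, hC⟩ := Label.exists_map_eq H.hom.graph hfv (H.groups_old v'.1 hv).1.2 d
        refine ⟨⟨v', C⟩, (H.isVacant_v'_iff C).2 ?_, hC⟩
        rw [hC]
        refine ⟨hd, fun e => hdh ?_⟩
        exact eq_of_heq (Sigma.mk.inj e).2
    · obtain ⟨x, rfl, hx'⟩ := H.off_fiber y hyv
      have hx : P.graph.src x = x := hx' _ ((H.hom.graph.map_src x).trans hy)
      obtain ⟨c, rfl⟩ := ConjClasses.map_surjective_of_surjective (hbij (u := ⟨x, hx⟩) hyv).1.2 d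
      exact ⟨⟨⟨x, hx⟩, c⟩, (hoff (u := ⟨x, hx⟩) hyv).2 hd, rfl⟩

end IsEdgeAddedAt

theorem IsRefinement.graph {Y : GraphOfGroups.{u}} {SY : SphereStructure Y}
    {f : P.graph.carrier → Y.graph.carrier} {φ : ∀ x, P.G x →* Y.G (f x)}
    (h : IsRefinement SY SP f φ) : IsGraphMorphism P.graph Y.graph f := by
  induction h with
  | iso SP f φ h => exact h.hom.graph
  | split SP SQ f φ f' φ' v v' l₀ l₁ a₀ a₁ e₀ e₁ h h' ih =>
    exact ⟨fun x => by rw [h'.hom.graph.map_src, ih.map_src],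
      fun x => by rw [h'.hom.graph.map_bar, ih.map_bar]⟩
  | addEdge SP SQ f φ f' φ' v k v' l w e₀ e₁ h h' ih =>
    exact ⟨fun x => by rw [h'.hom.graph.map_src, ih.map_src],
      fun x => by rw [h'.hom.graph.map_bar, ih.map_bar]⟩

theorem ConjClasses.map_comp {G H K : Type*} [Group G] [Group H] [Group K] (φ : H →* K) (ψ : G →* H)
    (c : ConjClasses G) :
    ConjClasses.map (φ.comp ψ) c = ConjClasses.map φ (ConjClasses.map ψ c) := by
  induction c using Quotient.inductionOn with | h g => rfl

/-- A refinement has the same vacant classes. -/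
theorem IsRefinement.bijOn_vacant {Y : GraphOfGroups.{u}} {SY : SphereStructure Y}
    {f : P.graph.carrier → Y.graph.carrier} {φ : ∀ x, P.G x →* Y.G (f x)}
    (h : IsRefinement SY SP f φ) (hY : SY.IsStable) :
    (∀ u, SP.IsCurve u → ∀ C, ¬ SP.IsVacant u C) ∧
      Set.BijOn (Label.map h.graph φ) SP.vacant SY.vacant := by
  -- The absence of vacant classes at curve vertices is carried through the induction because
  -- `IsSplitAt.bijOn_vacant` needs it at the vertex that is split.
  induction h with
  | iso SP f φ h =>
    exact ⟨fun u hu C hC => ((h.isVacant_iff u C).1 hC).not_isCurve hY ((h.curve u).1 hu),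
      h.bijOn_vacant⟩
  | @split P Q SP SQ f φ f' φ' v v' l₀ l₁ a₀ a₁ e₀ e₁ h h' ih =>
    refine ⟨fun u hu C hC => ?_, ?_⟩
    · by_cases hv : f' u.1 = v.1
      · exact h'.not_isVacant (ih.1 v h'.v_curve) hv C hC
      · exact ih.1 _ ((h'.curve u hv).1 hu) _ ((isVacant_iff_off h'.hom h'.off_fiber h'.gen hv
          (h'.groups_bijective _) (h'.per _) _).1 hC)
    · refine (ih.2.comp (h'.bijOn_vacant (ih.1 v h'.v_curve))).congr fun x _ => ?_
      exact congrArg (Sigma.mk _) (ConjClasses.map_comp _ _ _).symm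
  | @addEdge P Q SP SQ f φ f' φ' v k v' l w e₀ e₁ h h' ih =>
    refine ⟨fun u hu C hC => ?_, ?_⟩
    · have hl : u ≠ l := by
        rintro rfl
        exact h'.not_isVacant_l C hC
      have hw : u ≠ w := by
        rintro rfl
        exact h'.curve_new.2 hu
      exact ih.1 _ ((h'.curve u hl hw).1 hu) (ConjClasses.map (φ' u.1) C)
        (h'.bijOn_vacant.mapsTo (show (⟨u, C⟩ : Label P) ∈ SP.vacant from hC))
    · refine (ih.2.comp h'.bijOn_vacant).congr fun x _ => ?_
      exact congrArg (Sigma.mk _) (ConjClasses.map_comp _ _ _).symm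

end Refinement

/-! ### Refinements as contractions: finiteness, vertices with three classes, and paths. -/

open SphereStructure

section Refinement

variable {P Q : GraphOfGroups.{u}} {SP : SphereStructure P} {SQ : SphereStructure Q}
  {f : P.graph.carrier → Q.graph.carrier} {φ : ∀ x, P.G x →* Q.G (f x)} {v : Q.Vert}

theorem SphereStructure.gen_bar_ne_one (S : SphereStructure P) {x : P.graph.carrier}
    (hx : P.graph.IsEdge x) (h : S.gen x ≠ 1) : S.gen (P.graph.bar x) ≠ 1 := by
  rw [← S.inv_gen x hx]
  intro e
  have := P.inv_inv x (S.gen x)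
  rw [e, map_one, map_one] at this
  exact h this.symm

theorem IsGraphMorphism.finite {Γ Δ : Graph'.{u}} (f : Γ.carrier → Δ.carrier)
    (hΔ : Finite Δ.carrier)
    (v : Δ.carrier) (hv : {x | f x = v}.Finite) (hoff : ∀ y, y ≠ v → ∃! x, f x = y) :
    Finite Γ.carrier := by
  refine Set.finite_univ_iff.1 (Set.Finite.of_finite_fibers f (Set.toFinite _) fun y _ => ?_)
  by_cases hy : y = v
  · subst hy
    exact hv.subset fun x hx => hx.2
  · refine Set.Subsingleton.finite fun a ha b hb => (hoff y hy).unique ha.2 hb.2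

theorem IsRefinement.finite {Y : GraphOfGroups.{u}} {SY : SphereStructure Y}
    {f : P.graph.carrier → Y.graph.carrier} {φ : ∀ x, P.G x →* Y.G (f x)}
    (h : IsRefinement SY SP f φ) (hY : Finite Y.graph.carrier) : Finite P.graph.carrier := by
  induction h with
  | iso SP f φ h => exact Finite.of_injective f h.bijective.1
  | split SP SQ f φ f' φ' v v' l₀ l₁ a₀ a₁ e₀ e₁ h h' ih =>
    exact IsGraphMorphism.finite f' ih v.1
      ((Set.toFinite _).subset fun x hx => (h'.fiber x).1 hx) h'.off_fiber
  | addEdge SP SQ f φ f' φ' v k v' l w e₀ e₁ h h' ih =>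
    exact IsGraphMorphism.finite f' ih v.1
      ((Set.toFinite _).subset fun x hx => (h'.fiber x).1 hx) h'.off_fiber

/-- Adjacency by an element of a fibre. -/
def FiberStep (P : GraphOfGroups.{u}) (f : P.graph.carrier → Q.graph.carrier) (a b : P.Vert) : Prop :=
  ∃ e, P.graph.o e = a ∧ P.graph.t e = b ∧ Q.graph.src (f e) = f e

/-- Adjacency by an edge with a non-trivial group. -/
def GenStep (SP : SphereStructure P) (a b : P.Vert) : Prop :=
  ∃ e, P.graph.IsEdge e ∧ P.graph.o e = a ∧ P.graph.t e = b ∧ SP.gen e ≠ 1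

theorem FiberStep.symm (hf : IsGraphMorphism P.graph Q.graph f) {a b : P.Vert}
    (h : FiberStep P f a b) : FiberStep P f b a := by
  obtain ⟨e, rfl, rfl, he⟩ := h
  refine ⟨P.graph.bar e, rfl, P.graph.t_bar e, ?_⟩
  rw [hf.map_bar, Graph'.bar_eq_of_src_eq he, he]

theorem GenStep.symm {a b : P.Vert} (h : GenStep SP a b) : GenStep SP b a := by
  obtain ⟨e, h, rfl, rfl, he⟩ := h
  exact ⟨P.graph.bar e, h.bar, rfl, P.graph.t_bar e, SP.gen_bar_ne_one h he⟩

/-- The common features of the two operations in a refinement: the vertices in `K` represent the fibres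
over the vertices. -/
structure IsContraction (SP : SphereStructure P) (SQ : SphereStructure Q)
    (f : P.graph.carrier → Q.graph.carrier) (φ : ∀ x, P.G x →* Q.G (f x)) (K : Set P.Vert) :
    Prop where
  graph : IsGraphMorphism P.graph Q.graph f
  exists_mem : ∀ y : Q.Vert, ∃ k ∈ K, f k.1 = y.1
  unique : ∀ k ∈ K, ∀ k' ∈ K, f k.1 = f k'.1 → k = k'
  bijective : ∀ k ∈ K, Function.Bijective (φ k.1)
  per : ∀ k ∈ K, ∀ c, c ∈ SP.per k.1 ↔ ConjClasses.map (φ k.1) c ∈ SQ.per (f k.1)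
  exists_edge : ∀ y, Q.graph.IsEdge y → ∃ x, P.graph.IsEdge x ∧ f x = y ∧
    (SQ.gen y ≠ 1 → SP.gen x ≠ 1)
  reach : ∀ k ∈ K, ∀ u : P.Vert, f u.1 = f k.1 → Relation.ReflTransGen (FiberStep P f) k u
  reach_gen : ∀ k ∈ K, ∀ u : P.Vert, f u.1 = f k.1 → (∃ g : P.G u.1, g ≠ 1) →
    Relation.ReflTransGen (GenStep SP) u k ∧ ∃ g : P.G k.1, g ≠ 1

theorem exists_edge_of_off (h : IsGroupsMorphism f φ) (hoff : ∀ y, y ≠ v.1 → ∃! x, f x = y)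
    (hgen : ∀ x, P.graph.IsEdge x → f x ≠ v.1 → φ x (SP.gen x) = SQ.gen (f x)) (y : Q.graph.carrier)
    (hy : Q.graph.IsEdge y) :
    ∃ x, P.graph.IsEdge x ∧ f x = y ∧ (SQ.gen y ≠ 1 → SP.gen x ≠ 1) := by
  have hyv : y ≠ v.1 := by
    rintro rfl
    exact hy v.2
  obtain ⟨x, rfl, -⟩ := hoff y hyv
  have hx := h.graph.isEdge_of_isEdge_map hy
  refine ⟨x, hx, rfl, fun hg e => hg ?_⟩
  rw [← hgen x hx hyv, e, map_one]

/-- The middle vertex `v'` represents its fibre. The edges `a₀` and `a₁` join the two other vertices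
to it, and their groups are all isomorphic to that of `v`. -/
theorem IsSplitAt.isContraction {v' l₀ l₁ : P.Vert} {a₀ a₁ e₀ e₁ : P.graph.carrier}
    (h : IsSplitAt SP SQ f φ v v' l₀ l₁ a₀ a₁ e₀ e₁) :
    IsContraction SP SQ f φ {u | u ≠ l₀ ∧ u ≠ l₁} := by
  have h₀ : P.graph.IsEdge a₀ := isEdge_of_o_ne_t (by
    rw [h.a₀_ends.1, h.a₀_ends.2]; exact h.distinct.1.symm)
  have h₁ : P.graph.IsEdge a₁ := isEdge_of_o_ne_t (by
    rw [h.a₁_ends.1, h.a₁_ends.2]; exact h.distinct.2.1.symm)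
  have hf₀ : f a₀ = v.1 := (h.fiber _).2 (by simp)
  have hf₁ : f a₁ = v.1 := (h.fiber _).2 (by simp)
  have hv' : f v'.1 = v.1 := (h.fiber _).2 (by simp)
  have hcase : ∀ k u : P.Vert, k ≠ l₀ → k ≠ l₁ → f u.1 = f k.1 →
      u = k ∨ (k = v' ∧ (u = l₀ ∨ u = l₁)) := by
    intro k u hk₀ hk₁ e
    by_cases hu : f u.1 = v.1
    · have hk := (h.eq_of_map_eq_v (e.symm.trans hu)).resolve_right (by tauto)
      subst hk
      rcases h.eq_of_map_eq_v hu with rfl | hl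
      · exact .inl rfl
      · exact .inr ⟨rfl, hl⟩
    · exact .inl (Subtype.ext ((h.off_fiber _ hu).unique rfl e.symm))
  refine ⟨h.hom.graph, fun y => ?_, fun k hk k' hk' e => (hcase k' k hk'.1 hk'.2 e).resolve_right
      fun hl => hl.2.elim hk.1 hk.2, fun k _ => h.groups_bijective _, fun k _ => h.per _,
    exists_edge_of_off h.hom h.off_fiber h.gen, ?_, ?_⟩
  · by_cases hy : y = v
    · exact ⟨v', ⟨h.distinct.1, h.distinct.2.1⟩, hy ▸ hv'⟩
    · have hyv : y.1 ≠ v.1 := fun e => hy (Subtype.ext e)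
      obtain ⟨x, hx, hu⟩ := h.off_fiber y.1 hyv
      have hx' : P.graph.src x = x := hu _ ((h.hom.graph.map_src x).trans (by rw [hx]; exact y.2))
      refine ⟨⟨x, hx'⟩, ⟨?_, ?_⟩, hx⟩
      · rintro rfl
        exact hyv (hx.symm.trans ((h.fiber _).2 (by simp)))
      · rintro rfl
        exact hyv (hx.symm.trans ((h.fiber _).2 (by simp)))
  · rintro k ⟨hk₀, hk₁⟩ u e
    rcases hcase k u hk₀ hk₁ e with rfl | ⟨rfl, rfl | rfl⟩
    · exact .refl
    · exact .single (FiberStep.symm h.hom.graph ⟨a₀, h.a₀_ends.1, h.a₀_ends.2, by rw [hf₀]; exact v.2⟩)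
    · exact .single (FiberStep.symm h.hom.graph ⟨a₁, h.a₁_ends.1, h.a₁_ends.2, by rw [hf₁]; exact v.2⟩)
  · rintro k ⟨hk₀, hk₁⟩ u e hg
    have hQ : ∃ g : Q.G (f u.1), g ≠ 1 := by
      obtain ⟨g, hg⟩ := hg
      exact ⟨φ u.1 g, fun e => hg ((h.groups_bijective _).1 (e.trans (map_one _).symm))⟩
    have hP : ∀ x, f x = f u.1 → ∃ g : P.G x, g ≠ 1 := by
      intro x hx
      obtain ⟨g, hg⟩ : ∃ g : Q.G (f x), g ≠ 1 := hx ▸ hQ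
      obtain ⟨g, rfl⟩ := (h.groups_bijective x).2 g
      exact ⟨g, fun e => hg (by rw [e, map_one])⟩
    have hgen : ∀ x, P.graph.IsEdge x → f x = f u.1 → SP.gen x ≠ 1 := by
      intro x hx hfx e
      obtain ⟨g, hg⟩ := hP x hfx
      have hk := SP.gen_generates x hx g
      rw [e, Subgroup.zpowers_one_eq_bot, Subgroup.mem_bot] at hk
      exact hg hk
    refine ⟨?_, hP _ e.symm⟩
    rcases hcase k u hk₀ hk₁ e with rfl | ⟨rfl, rfl | rfl⟩
    · exact .refl
    · exact .single ⟨a₀, h₀, h.a₀_ends.1, h.a₀_ends.2, hgen _ h₀ (hf₀.trans (hv'.symm.trans e.symm))⟩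
    · exact .single ⟨a₁, h₁, h.a₁_ends.1, h.a₁_ends.2, hgen _ h₁ (hf₁.trans (hv'.symm.trans e.symm))⟩

/-- The copy `v'` of the old vertex represents its fibre. A new vertex with a non-trivial group
occurs only for `h ≠ 1`, and then the edges leading back to `v'` have non-trivial groups as well. -/
theorem IsEdgeAddedAt.isContraction {h : Q.G v.1} {v' l w : P.Vert} {e₀ e₁ : P.graph.carrier}
    (H : IsEdgeAddedAt SP SQ f φ v h v' l w e₀ e₁) :
    IsContraction SP SQ f φ {u | u ≠ l ∧ u ≠ w} := by
  have hcase : ∀ k u : P.Vert, k ≠ l → k ≠ w → f u.1 = f k.1 →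
      u = k ∨ (k = v' ∧ (u = l ∨ u = w)) := by
    intro k u hk₀ hk₁ e
    by_cases hu : f u.1 = v.1
    · have hk := (H.eq_of_map_eq_v (e.symm.trans hu)).resolve_right (by tauto)
      subst hk
      rcases H.eq_of_map_eq_v hu with rfl | hl
      · exact .inl rfl
      · exact .inr ⟨rfl, hl⟩
    · exact .inl (Subtype.ext ((H.off_fiber _ hu).unique rfl e.symm))
  have hv : ∀ {x}, f x = v.1 → Q.graph.src (f x) = f x := by
    intro x hx
    rw [hx]
    exact v.2
  have hf₀ : f e₀ = v.1 := H.map_of_mem (by simp)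
  have hf₁ : f e₁ = v.1 := H.map_of_mem (by simp)
  refine ⟨H.hom.graph, fun y => ?_, fun k hk k' hk' e => (hcase k' k hk'.1 hk'.2 e).resolve_right
      fun hl => hl.2.elim hk.1 hk.2, fun k hk => (H.groups_old _ (H.notMem_new hk.1 hk.2)).1,
    fun k hk => (H.groups_old _ (H.notMem_new hk.1 hk.2)).2,
    exists_edge_of_off H.hom H.off_fiber H.gen, ?_, ?_⟩
  · by_cases hy : y = v
    · exact ⟨v', ⟨H.distinct.1, H.distinct.2.1⟩, hy ▸ H.map_v'⟩
    · have hyv : y.1 ≠ v.1 := fun e => hy (Subtype.ext e)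
      obtain ⟨x, hx, hu⟩ := H.off_fiber y.1 hyv
      have hx' : P.graph.src x = x := hu _ ((H.hom.graph.map_src x).trans (by rw [hx]; exact y.2))
      refine ⟨⟨x, hx'⟩, ⟨?_, ?_⟩, hx⟩
      · rintro rfl
        exact hyv (hx.symm.trans (H.map_of_mem (by simp)))
      · rintro rfl
        exact hyv (hx.symm.trans (H.map_of_mem (by simp)))
  · rintro k ⟨hk₀, hk₁⟩ u e
    have s₀ : FiberStep P f v' l := ⟨e₀, H.e₀_ends.1, H.e₀_ends.2, hv hf₀⟩
    have s₁ : FiberStep P f l w := ⟨e₁, H.e₁_ends.1, H.e₁_ends.2, hv hf₁⟩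
    rcases hcase k u hk₀ hk₁ e with rfl | ⟨rfl, rfl | rfl⟩
    · exact .refl
    · exact .single s₀
    · exact .tail (.single s₀) s₁
  · rintro k ⟨hk₀, hk₁⟩ u e hg
    rcases hcase k u hk₀ hk₁ e with rfl | ⟨rfl, hu⟩
    · exact ⟨.refl, hg⟩
    · have h1 : h ≠ 1 := by
        intro h1
        obtain ⟨g, hg⟩ := hg
        exact hg (H.eq_one_of_new h1 (by rcases hu with rfl | rfl <;> simp) g)
      have g₀ := H.gen_ne_one h1 H.isEdge_e₀ (by simp)
      have s₀ : GenStep SP k l := ⟨e₀, H.isEdge_e₀, H.e₀_ends.1, H.e₀_ends.2, g₀⟩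
      have s₁ : GenStep SP l w := ⟨e₁, H.isEdge_e₁, H.e₁_ends.1, H.e₁_ends.2,
        H.gen_ne_one h1 H.isEdge_e₁ (by simp)⟩
      refine ⟨?_, _, SP.minusTo_gen_ne_one (src_eq_of_o_eq H.e₀_ends.1) g₀⟩
      rcases hu with rfl | rfl
      · exact .single s₀.symm
      · exact .tail (.single s₁.symm) s₀.symm

theorem mem_of_reflTransGen {Z : Set P.Vert}
    (hZ : ∀ e, P.graph.IsEdge e → SP.gen e ≠ 1 → P.graph.o e ∈ Z → P.graph.t e ∈ Z) {a b : P.Vert}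
    (h : Relation.ReflTransGen (GenStep SP) a b) (ha : a ∈ Z) : b ∈ Z := by
  induction h with
  | refl => exact ha
  | tail _ h ih =>
    obtain ⟨e, he, rfl, rfl, hg⟩ := h
    exact hZ e he hg ih

/-- A closed set `Z` of vertices of `P` is replaced by the set of vertices of `Q` whose
representatives lie in `Z`. This set is again closed, because a fibre can be crossed between its
representative and any vertex with non-trivial group along edges with non-trivial groups. -/
theorem IsContraction.exists_three_le {K : Set P.Vert} (h : IsContraction SP SQ f φ K)
    (hQ : ∀ Z : Set Q.Vert,
      (∀ e, Q.graph.IsEdge e → SQ.gen e ≠ 1 → Q.graph.o e ∈ Z → Q.graph.t e ∈ Z) →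
      ∀ u ∈ Z, (∃ g : Q.G u.1, g ≠ 1) → ∃ z ∈ Z, 3 ≤ (SQ.per z.1).ncard)
    (Z : Set P.Vert) (hZ : ∀ e, P.graph.IsEdge e → SP.gen e ≠ 1 → P.graph.o e ∈ Z → P.graph.t e ∈ Z)
    (u : P.Vert) (hu : u ∈ Z) (hg : ∃ g : P.G u.1, g ≠ 1) : ∃ z ∈ Z, 3 ≤ (SP.per z.1).ncard := by
  have hsymm : ∀ {a b}, Relation.ReflTransGen (GenStep SP) a b →
      Relation.ReflTransGen (GenStep SP) b a := fun {a b} h => by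
    induction h with
    | refl => exact .refl
    | tail _ h ih => exact .head h.symm ih
  obtain ⟨k, hk, hku⟩ := h.exists_mem (h.graph.onVert u)
  obtain ⟨hr, g, hg⟩ := h.reach_gen k hk u hku.symm hg
  have hcl : ∀ e, Q.graph.IsEdge e → SQ.gen e ≠ 1 →
      Q.graph.o e ∈ {y : Q.Vert | ∃ k ∈ K, k ∈ Z ∧ f k.1 = y.1} →
      Q.graph.t e ∈ {y : Q.Vert | ∃ k ∈ K, k ∈ Z ∧ f k.1 = y.1} := by
    rintro y hy hg ⟨k, hk, hkZ, e⟩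
    obtain ⟨x, hx, rfl, hxg⟩ := h.exists_edge y hy
    have hxg := hxg hg
    have e1 : f (P.graph.o x).1 = f k.1 := (h.graph.map_src x).trans e.symm
    have h1 := (h.reach_gen k hk (P.graph.o x) e1 ⟨_, SP.minusTo_gen_ne_one rfl hxg⟩).1
    have h2 := hZ x hx hxg (mem_of_reflTransGen hZ (hsymm h1) hkZ)
    obtain ⟨k', hk', e2⟩ := h.exists_mem (Q.graph.t (f x))
    have e3 : f (P.graph.t x).1 = f k'.1 := (congrArg Subtype.val (h.graph.onVert_t x)).trans e2.symm
    have h3 := (h.reach_gen k' hk' (P.graph.t x) e3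
      ⟨_, SP.minusTo_gen_ne_one rfl (SP.gen_bar_ne_one hx hxg)⟩).1
    exact ⟨k', hk', mem_of_reflTransGen hZ h3 h2, e2⟩
  obtain ⟨z, ⟨k', hk', hk'Z, hz⟩, h3⟩ := hQ _ hcl (h.graph.onVert k)
    ⟨k, hk, mem_of_reflTransGen hZ hr hu, rfl⟩
    ⟨φ k.1 g, fun e => hg ((h.bijective k hk).1 (e.trans (map_one _).symm))⟩
  obtain rfl : h.graph.onVert k' = z := Subtype.ext hz
  refine ⟨k', hk'Z, h3.trans (le_of_eq ?_)⟩
  have e1 : SP.per k'.1 = ConjClasses.map (φ k'.1) ⁻¹' SQ.per (f k'.1) :=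
    Set.ext fun c => h.per k' hk' c
  rw [e1]
  exact (Set.ncard_preimage_of_injective_subset_range
    (ConjClasses.map_injective_of_bijective (h.bijective k' hk')) (fun d _ =>
    ConjClasses.map_surjective_of_surjective (h.bijective k' hk').2 d)).symm

theorem IsSphereIso.isContraction (h : IsSphereIso SP SQ f φ) :
    IsContraction SP SQ f φ Set.univ := by
  have key : ∀ k u : P.Vert, f u.1 = f k.1 → u = k := fun k u e => Subtype.ext (h.bijective.1 e)
  refine ⟨h.hom.graph, fun y => ?_, fun k _ k' _ e => key k' k e, fun k _ => h.groups_bijective _,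
    fun k _ => h.per _, fun y hy => ?_, fun k _ u e => ?_, fun k _ u e hg => ?_⟩
  · obtain ⟨x, hx⟩ := h.bijective.2 y.1
    exact ⟨⟨x, h.bijective.1 ((h.hom.graph.map_src x).trans (by rw [hx]; exact y.2))⟩, trivial, hx⟩
  · obtain ⟨x, rfl⟩ := h.bijective.2 y
    have hx := h.hom.graph.isEdge_of_isEdge_map hy
    exact ⟨x, hx, rfl, fun hg e => hg (by rw [← h.gen x hx, e, map_one])⟩
  · rw [key k u e]
  · obtain rfl := key k u e
    exact ⟨.refl, hg⟩

/-- In a stable tree all edge groups are non-trivial and every curve vertex has a sphere vertex as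
neighbour. -/
theorem SphereStructure.IsStable.exists_three_le (hQ : SQ.IsStable) (Z : Set Q.Vert)
    (hZ : ∀ e, Q.graph.IsEdge e → SQ.gen e ≠ 1 → Q.graph.o e ∈ Z → Q.graph.t e ∈ Z) (u : Q.Vert)
    (hu : u ∈ Z) : ∃ z ∈ Z, 3 ≤ (SQ.per z.1).ncard := by
  by_cases hc : SQ.IsCurve u
  · obtain ⟨x, hx, rfl⟩ : ∃ x, Q.graph.IsEdge x ∧ Q.graph.o x = u := by
      have := hQ.curve_valence u hc
      exact Set.nonempty_of_ncard_ne_zero (s := {x | Q.graph.IsEdge x ∧ Q.graph.o x = u})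
        (this.trans_ne two_ne_zero)
    refine ⟨Q.graph.t x, hZ x hx (hQ.edge_ne_one x hx) hu, hQ.three_le _ ?_⟩
    exact (hQ.bipartite x hx).1 hc
  · exact ⟨u, hu, hQ.three_le u hc⟩

/-- This is meant for the set of vertices at which the orientation of some lift is wrong: that set
is closed in the present sense but has no vertex with three classes. The condition on `u` excludes
the attached paths with trivial groups, which may be isolated from everything else. -/
theorem IsRefinement.exists_three_le {Y : GraphOfGroups.{u}} {SY : SphereStructure Y}
    {f : P.graph.carrier → Y.graph.carrier} {φ : ∀ x, P.G x →* Y.G (f x)}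
    (h : IsRefinement SY SP f φ) (hY : SY.IsStable) : ∀ (Z : Set P.Vert)
    (_ : ∀ e, P.graph.IsEdge e → SP.gen e ≠ 1 → P.graph.o e ∈ Z → P.graph.t e ∈ Z)
    (u : P.Vert) (_ : u ∈ Z) (_ : ∃ g : P.G u.1, g ≠ 1), ∃ z ∈ Z, 3 ≤ (SP.per z.1).ncard := by
  induction h with
  | iso SP f φ h =>
    exact h.isContraction.exists_three_le fun Z hZ u hu _ => hY.exists_three_le Z hZ u hu
  | split SP SQ f φ f' φ' v v' l₀ l₁ a₀ a₁ e₀ e₁ h h' ih => exact h'.isContraction.exists_three_le ih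
  | addEdge SP SQ f φ f' φ' v k v' l w e₀ e₁ h h' ih => exact h'.isContraction.exists_three_le ih

/-- `c` belongs to the image of a vertex group in the path group. -/
def GraphOfGroups.IsVertexElt (Y : GraphOfGroups.{u}) (y : Y.Vert) (c : Y.PathGroup) : Prop :=
  ∃ g, c = Y.ofVert y g

theorem GraphOfGroups.IsVertexElt.one {Y : GraphOfGroups.{u}} (y : Y.Vert) : Y.IsVertexElt y 1 :=
  ⟨1, (Y.ofVert_one y).symm⟩

theorem GraphOfGroups.IsVertexElt.mul {Y : GraphOfGroups.{u}} {y : Y.Vert} {a b : Y.PathGroup}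
    (ha : Y.IsVertexElt y a) (hb : Y.IsVertexElt y b) : Y.IsVertexElt y (a * b) := by
  obtain ⟨g, rfl⟩ := ha
  obtain ⟨k, rfl⟩ := hb
  exact ⟨g * k, Y.ofVert_mul _ _ _⟩

theorem GraphOfGroups.IsVertexElt.inv {Y : GraphOfGroups.{u}} {y : Y.Vert} {a : Y.PathGroup}
    (ha : Y.IsVertexElt y a) : Y.IsVertexElt y a⁻¹ := by
  obtain ⟨g, rfl⟩ := ha
  exact ⟨g⁻¹, (Y.ofVert_inv _ _).symm⟩

theorem GraphOfGroups.IsVertexElt.isPath {Y : GraphOfGroups.{u}} {y : Y.Vert} {a : Y.PathGroup}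
    (ha : Y.IsVertexElt y a) : Y.IsPath y y a := by
  obtain ⟨g, rfl⟩ := ha
  exact .vert y g

/-- `R z` are sets of group paths from `v₀` to `f z` that are stable under the vertex groups of `P` and,
up to elements of the vertex groups of `Y`, under the edges of `P`. -/
structure IsPathFamily {Y : GraphOfGroups.{u}} {f : P.graph.carrier → Y.graph.carrier}
    (hf : IsGraphMorphism P.graph Y.graph f) (φ : ∀ x, P.G x →* Y.G (f x)) (v₀ : Y.Vert)
    (R : P.Vert → Set Y.PathGroup) : Prop where
  isPath : ∀ z, ∀ q ∈ R z, Y.IsPath v₀ (hf.onVert z) q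
  mul_mem : ∀ z, ∀ q ∈ R z, ∀ g : P.G z.1, q * Y.ofVert (hf.onVert z) (φ z.1 g) ∈ R z
  edge_mem : ∀ e, ∃ c c', Y.IsVertexElt (hf.onVert (P.graph.o e)) c ∧
    Y.IsVertexElt (hf.onVert (P.graph.t e)) c' ∧
    ∀ q ∈ R (P.graph.o e), q * c * Y.ofEdge (f e) * c' ∈ R (P.graph.t e)

/-- A path family is complete as soon as it is non-empty. -/
def GeneratesPaths {Y : GraphOfGroups.{u}} {f : P.graph.carrier → Y.graph.carrier}
    (hf : IsGraphMorphism P.graph Y.graph f) (φ : ∀ x, P.G x →* Y.G (f x)) : Prop :=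
  ∀ (v₀ : Y.Vert) (R : P.Vert → Set Y.PathGroup), IsPathFamily hf φ v₀ R → (∃ z q, q ∈ R z) →
    ∀ z q, Y.IsPath v₀ (hf.onVert z) q → q ∈ R z

/-- All elements of the vertex groups of `Y` come from `P`, so the corrections `c` and `c'` along
edges can be undone, and the family is stable under right multiplication by arbitrary group paths.
-/
theorem GeneratesPaths.of_bijective {Y : GraphOfGroups.{u}} {f : P.graph.carrier → Y.graph.carrier}
    (hf : IsGraphMorphism P.graph Y.graph f) {φ : ∀ x, P.G x →* Y.G (f x)}
    (hb : Function.Bijective f) (hs : ∀ x, Function.Surjective (φ x)) : GeneratesPaths hf φ := by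
  rintro v₀ R h ⟨z₀, q₀, h₀⟩ z q hq
  have hmul : ∀ z, ∀ q ∈ R z, ∀ c, Y.IsVertexElt (hf.onVert z) c → q * c ∈ R z := by
    rintro z q hq _ ⟨g, rfl⟩
    obtain ⟨g, rfl⟩ := hs z.1 g
    exact h.mul_mem z q hq g
  have hinj : ∀ {z z'}, hf.onVert z = hf.onVert z' → z = z' := fun e =>
    Subtype.ext (hb.1 (congrArg Subtype.val e))
  have key : ∀ {y y' : Y.Vert} {a : Y.PathGroup}, Y.IsPath y y' a → ∀ z z', hf.onVert z = y →
      hf.onVert z' = y' → ∀ q ∈ R z, q * a ∈ R z' := by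
    intro y y' a ha
    induction ha with
    | vert y g =>
      rintro z z' rfl e q hq
      obtain rfl := hinj e
      exact hmul _ q hq _ ⟨g, rfl⟩
    | edge x =>
      intro z z' e e' q hq
      obtain ⟨x, rfl⟩ := hb.2 x
      obtain rfl : z = P.graph.o x := hinj (e.trans (hf.onVert_o x).symm)
      obtain rfl : z' = P.graph.t x := hinj (e'.trans (hf.onVert_t x).symm)
      obtain ⟨c, c', hc, hc', he⟩ := h.edge_mem x
      have h1 := hmul _ _ (he _ (hmul _ q hq _ hc.inv)) _ hc'.inv
      rwa [inv_mul_cancel_right, mul_inv_cancel_right] at h1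
    | @mul y₁ y₂ y₃ a b _ _ iha ihb =>
      intro z z' e e' q hq
      obtain ⟨x, hx⟩ := hb.2 y₂.1
      have hx' : P.graph.src x = x := hb.1 ((hf.map_src x).trans (by rw [hx]; exact y₂.2))
      have e2 : hf.onVert ⟨x, hx'⟩ = y₂ := Subtype.ext hx
      rw [← mul_assoc]
      exact ihb _ z' e2 e' _ (iha z _ e e2 q hq)
  have := key ((h.isPath _ _ h₀).inv.mul hq) z₀ z rfl rfl q₀ h₀
  rwa [mul_inv_cancel_left] at this

/-- Within a fibre, edges become trivial in `Y`, so moving there changes a path only by an element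
of one vertex group. The members at the representatives thus form a path family over `Q`; allowing
corrections by vertex elements in `IsPathFamily` is what makes this work. -/
theorem GeneratesPaths.of_isContraction {Y : GraphOfGroups.{u}}
    {f : Q.graph.carrier → Y.graph.carrier} {φ : ∀ x, Q.G x →* Y.G (f x)}
    {hf : IsGraphMorphism Q.graph Y.graph f} (hg : GeneratesPaths hf φ)
    {f' : P.graph.carrier → Q.graph.carrier} {φ' : ∀ x, P.G x →* Q.G (f' x)} {K : Set P.Vert}
    (h : IsContraction SP SQ f' φ' K) (hff : IsGraphMorphism P.graph Y.graph fun x => f (f' x)) :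
    GeneratesPaths hff fun x => (φ (f' x)).comp (φ' x) := by
  rintro v₀ R hR ⟨z₀, q₀, h₀⟩ z q hq
  have chain : ∀ {a b : P.Vert}, Relation.ReflTransGen (FiberStep P f') a b →
      ∃ c, Y.IsVertexElt (hff.onVert a) c ∧ hff.onVert a = hff.onVert b ∧
        ∀ q ∈ R a, q * c ∈ R b := by
    intro a b hab
    induction hab with
    | refl => exact ⟨1, .one _, rfl, fun q hq => by rwa [mul_one]⟩
    | tail _ hs ih =>
      obtain ⟨c, hc, e, h1⟩ := ih
      obtain ⟨x, rfl, rfl, hx⟩ := hs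
      obtain ⟨d, d', hd, hd', h2⟩ := hR.edge_mem x
      have hx' : Y.graph.src (f (f' x)) = f (f' x) := by rw [← hf.map_src, hx]
      have e2 : hff.onVert (P.graph.t x) = hff.onVert (P.graph.o x) := by
        rw [hff.onVert_t, hff.onVert_o, Graph'.t_eq_o_of_src_eq hx']
      rw [e2, ← e] at hd'
      rw [← e] at hd
      refine ⟨c * d * d', (hc.mul hd).mul hd', e.trans e2.symm, fun q hq => ?_⟩
      have h3 := h2 _ (h1 q hq)
      rw [GraphOfGroups.ofEdge_eq_one hx', mul_one] at h3
      rwa [← mul_assoc, ← mul_assoc]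
  have hsymm : ∀ {a b}, Relation.ReflTransGen (FiberStep P f') a b →
      Relation.ReflTransGen (FiberStep P f') b a := fun {a b} hab => by
    induction hab with
    | refl => exact .refl
    | tail _ hs ih => exact .head (hs.symm h.graph) ih
  let R' : Q.Vert → Set Y.PathGroup := fun y => {q | ∃ k ∈ K, h.graph.onVert k = y ∧ q ∈ R k}
  have hR' : IsPathFamily hf φ v₀ R' := by
    constructor
    · rintro _ q ⟨k, hk, rfl, hq⟩
      exact hR.isPath k q hq
    · rintro _ q ⟨k, hk, rfl, hq⟩ g
      obtain ⟨g, rfl⟩ := (h.bijective k hk).2 g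
      exact ⟨k, hk, rfl, hR.mul_mem k q hq g⟩
    · intro y
      by_cases hy : Q.graph.IsEdge y
      · obtain ⟨x, hx, rfl, -⟩ := h.exists_edge y hy
        obtain ⟨k, hk, ek⟩ := h.exists_mem (Q.graph.o (f' x))
        obtain ⟨k', hk', ek'⟩ := h.exists_mem (Q.graph.t (f' x))
        have e₁ : f' (P.graph.o x).1 = f' k.1 :=
          (congrArg Subtype.val (h.graph.onVert_o x)).trans ek.symm
        have e₂ : f' (P.graph.t x).1 = f' k'.1 :=
          (congrArg Subtype.val (h.graph.onVert_t x)).trans ek'.symm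
        obtain ⟨c₁, hc₁, h₁, hR₁⟩ := chain (h.reach k hk _ e₁)
        obtain ⟨c₂, hc₂, h₂, hR₂⟩ := chain (hsymm (h.reach k' hk' _ e₂))
        obtain ⟨c, c', hc, hc', hR₃⟩ := hR.edge_mem x
        have hk₁ : hf.onVert (Q.graph.o (f' x)) = hff.onVert (P.graph.o x) := by
          rw [hf.onVert_o, hff.onVert_o]
        have hk₂ : hf.onVert (Q.graph.t (f' x)) = hff.onVert (P.graph.t x) := by
          rw [hf.onVert_t, hff.onVert_t]
        rw [h₁] at hc₁
        rw [hk₁, hk₂]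
        refine ⟨c₁ * c, c' * c₂, hc₁.mul hc, hc'.mul hc₂, ?_⟩
        rintro q ⟨k₂, hk₂, ek₂, hq⟩
        obtain rfl := h.unique k₂ hk₂ k hk ((congrArg Subtype.val ek₂).trans ek.symm)
        refine ⟨k', hk', Subtype.ext ek', ?_⟩
        have h4 := hR₂ _ (hR₃ _ (hR₁ _ hq))
        rwa [← mul_assoc, ← mul_assoc]
      · have hy := not_not.1 hy
        have hy' : Y.graph.src (f y) = f y := by rw [← hf.map_src, hy]
        refine ⟨1, 1, .one _, .one _, fun q hq => ?_⟩
        rwa [GraphOfGroups.ofEdge_eq_one hy', mul_one, mul_one, mul_one, Graph'.t_eq_o_of_src_eq hy]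
  obtain ⟨k₀, hk₀, e₀⟩ := h.exists_mem (h.graph.onVert z₀)
  obtain ⟨c, -, -, hc⟩ := chain (hsymm (h.reach k₀ hk₀ z₀ e₀.symm))
  obtain ⟨k, hk, e⟩ := h.exists_mem (h.graph.onVert z)
  obtain ⟨d, hd, e', hd'⟩ := chain (h.reach k hk z e.symm)
  rw [← e'] at hq
  obtain ⟨k', hk', e'', hq'⟩ := hg v₀ R' hR' ⟨_, _, k₀, hk₀, rfl, hc q₀ h₀⟩ (h.graph.onVert k)
    (q * d⁻¹) (hq.mul hd.inv.isPath)
  obtain rfl := h.unique k' hk' k hk (congrArg Subtype.val e'')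
  have h5 := hd' _ hq'
  rwa [inv_mul_cancel_right] at h5

theorem IsRefinement.generatesPaths {Y : GraphOfGroups.{u}} {SY : SphereStructure Y}
    {f : P.graph.carrier → Y.graph.carrier} {φ : ∀ x, P.G x →* Y.G (f x)}
    (h : IsRefinement SY SP f φ) : GeneratesPaths h.graph φ := by
  induction h with
  | iso SP f φ h => exact .of_bijective _ h.bijective fun x => (h.groups_bijective x).2
  | split SP SQ f φ f' φ' v v' l₀ l₁ a₀ a₁ e₀ e₁ h h' ih => exact ih.of_isContraction h'.isContraction _
  | addEdge SP SQ f φ f' φ' v k v' l w e₀ e₁ h h' ih => exact ih.of_isContraction h'.isContraction _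

end Refinement

/-! ## The edges of a sphere tree of bisets -/

namespace GraphOfBisets

variable {Y X : GraphOfGroups.{u}} {𝔅 : GraphOfBisets Y X}

theorem rho_src {z v : 𝔅.graph.carrier} (h : 𝔅.graph.src z = v) :
    X.graph.src (𝔅.rho z) = 𝔅.rho v := by
  rw [← 𝔅.rho_morphism.map_src, h]

theorem minusTo_smul {e z : 𝔅.graph.carrier} (he : 𝔅.graph.src e = z) (h : Y.G (𝔅.lam e))
    (b : 𝔅.B e) :
    𝔅.minusTo he (h • b) = Y.minusTo (𝔅.lam_src he) h • 𝔅.minusTo he b := by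
  subst he
  exact 𝔅.minus_smul e h b

theorem minusTo_op_smul {e z : 𝔅.graph.carrier} (he : 𝔅.graph.src e = z) (g : X.G (𝔅.rho e))
    (b : 𝔅.B e) :
    𝔅.minusTo he (op g • b) = op (X.minusTo (rho_src he) g) • 𝔅.minusTo he b := by
  subst he
  exact 𝔅.minus_op_smul e g b

namespace BaseChoice

variable (c : 𝔅.BaseChoice)

/-- `γ e`, with its target named up to equality. -/
def γTo {e z : 𝔅.graph.carrier} (he : 𝔅.graph.src e = z) : Y.G (𝔅.lam z) := he ▸ c.γ e

/-- `h ↦ (γ e)⁻¹ h⁻ (γ e)`, with its target named up to equality. -/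
def stabMinus {e z : 𝔅.graph.carrier} (he : 𝔅.graph.src e = z) : c.stab e →* c.stab z :=
  c.groups.minusTo he

theorem coe_stabMinus {e z : 𝔅.graph.carrier} (he : 𝔅.graph.src e = z) (h : c.stab e) :
    (c.stabMinus he h : Y.G (𝔅.lam z)) =
      (c.γTo he)⁻¹ * Y.minusTo (𝔅.lam_src he) (h : Y.G (𝔅.lam e)) * c.γTo he := by
  subst he
  rfl

/-- The element `b z` of the biset `B' z`. -/
def base (z : 𝔅.graph.carrier) : c.part z := ⟨c.b z, MulAction.mem_orbit_self _⟩

theorem exists_op_smul_base {z : 𝔅.graph.carrier} (b : c.part z) :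
    ∃ g : X.G (𝔅.rho z), op g • c.base z = b := by
  obtain ⟨_, g, rfl⟩ := b
  exact ⟨g.unop, rfl⟩

theorem edgeMap_mem {e z : 𝔅.graph.carrier} (he : 𝔅.graph.src e = z) (b : c.part e) :
    (c.γTo he)⁻¹ • 𝔅.minusTo he b.1 ∈ MulAction.orbit (X.G (𝔅.rho z))ᵐᵒᵖ (c.b z) := by
  obtain ⟨_, g, rfl⟩ := b
  subst he
  obtain ⟨k, hk⟩ := c.γ_spec e
  refine ⟨op (X.minusTo (rho_src rfl) g.unop) * k, ?_⟩
  change (op _ * k) • _ = (c.γ e)⁻¹ • 𝔅.minusTo rfl (op g.unop • c.b e)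
  rw [minusTo_op_smul, smul_comm, mul_smul]
  exact congrArg _ hk

/-- The map `b ↦ (γ e)⁻¹ b⁻` from `B' e` to `B' e⁻`. -/
def edgeMap {e z : 𝔅.graph.carrier} (he : 𝔅.graph.src e = z) (b : c.part e) : c.part z :=
  ⟨_, c.edgeMap_mem he b⟩

theorem edgeMap_smul {e z : 𝔅.graph.carrier} (he : 𝔅.graph.src e = z) (h : c.stab e)
    (b : c.part e) :
    c.edgeMap he (h • b) = c.stabMinus he h • c.edgeMap he b := by
  refine Subtype.ext ?_
  change (c.γTo he)⁻¹ • 𝔅.minusTo he ((h : Y.G (𝔅.lam e)) • b.1) =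
    (c.stabMinus he h : Y.G (𝔅.lam z)) • (c.γTo he)⁻¹ • 𝔅.minusTo he b.1
  rw [coe_stabMinus, minusTo_smul, smul_smul, smul_smul, mul_inv_cancel_right]

theorem edgeMap_op_smul {e z : 𝔅.graph.carrier} (he : 𝔅.graph.src e = z) (g : X.G (𝔅.rho e))
    (b : c.part e) : c.edgeMap he (op g • b) = op (X.minusTo (rho_src he) g) • c.edgeMap he b := by
  refine Subtype.ext ?_
  change (c.γTo he)⁻¹ • 𝔅.minusTo he (op g • b.1) = op _ • (c.γTo he)⁻¹ • 𝔅.minusTo he b.1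
  rw [minusTo_op_smul, smul_comm]

/-- Left-fibrancy, restricted to the right orbits of the base points: crossing out the group `G (lam
z)` leaves the stabilizers `P e` and `P z`. -/
theorem isDecomposition_edges (hF : 𝔅.IsLeftFree)
    (htr : ∀ z, Biset.IsTransitive (Y.G (𝔅.lam z)) (X.G (𝔅.rho z)) (𝔅.B z)) (z : 𝔅.graph.Vert)
    {f : X.graph.carrier} (hf : X.graph.IsEdge f) (hz : X.graph.src f = 𝔅.rho z.1) :
    Biset.IsDecomposition (I := {e : 𝔅.graph.carrier // 𝔅.graph.src e = z.1 ∧ 𝔅.rho e = f})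
      (H := fun i => c.stab i.1) (G := fun i => X.G (𝔅.rho i.1)) (B := fun i => c.part i.1)
      (B' := c.part z.1)
      (fun i => c.stabMinus i.2.1) (fun i => X.minusTo (rho_src i.2.1))
      (fun i => c.edgeMap i.2.1) := by
  constructor
  · exact fun i => c.edgeMap_smul i.2.1
  · exact fun i => c.edgeMap_op_smul i.2.1
  · rintro ⟨e, he, hef⟩ b ⟨e', he', hef'⟩ b' h hh
    have h1 : ((h : Y.G (𝔅.lam z.1)) * (c.γTo he)⁻¹) • 𝔅.minusTo he b.1 =
        (c.γTo he')⁻¹ • 𝔅.minusTo he' b'.1 := by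
      rw [mul_smul]
      exact congrArg Subtype.val hh
    obtain ⟨rfl, k, -, hk⟩ := hF.fibrant_injective z e e' he he'
      (𝔅.rho_morphism.isEdge_of_isEdge_map (hef.symm ▸ hf))
      (𝔅.rho_morphism.isEdge_of_isEdge_map (hef'.symm ▸ hf)) (hef.trans hef'.symm) _ _ _ _ h1
    refine congrArg (Sigma.mk _) (Biset.leftOrbit_eq_iff.2 ?_)
    exact ⟨⟨k, c.mem_stab_of_smul_eq hk⟩, Subtype.ext hk⟩
  · intro b'
    obtain ⟨e, he, h, b, hef, hb⟩ := hF.fibrant_surjective z f hf hz b'.1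
    obtain ⟨k, g, rfl⟩ := (htr e).2 (c.b e) b
    have h1 : (h * Y.minusTo (𝔅.lam_src he) k * c.γTo he) •
        (c.edgeMap he (op g • c.base e) : c.part z.1).1 = b'.1 := by
      rw [← hb, minusTo_smul, mul_smul, mul_smul]
      exact congrArg (fun x => h • _ • x) (smul_inv_smul _ _)
    exact ⟨⟨e, he, hef⟩, op g • c.base e, ⟨_, c.mem_stab_of_smul_eq h1⟩, Subtype.ext h1⟩

/-- The sphere trees of bisets, with the data of the left epic-monic factorization. -/
structure IsSphere (SY : SphereStructure Y) (SX : SphereStructure X) (SP : SphereStructure c.groups) :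
    Prop where
  isTree : 𝔅.graph.IsTree
  left_stable : SY.IsStable
  right_stable : SX.IsStable
  left_free : 𝔅.IsLeftFree
  transitive : ∀ z, Biset.IsTransitive (Y.G (𝔅.lam z)) (X.G (𝔅.rho z)) (𝔅.B z)
  refinement : IsRefinement SY SP 𝔅.lam c.incl
  sphere : ∀ z, Biset.IsSphereBiset (H := c.stab z) (SP.per z) (SX.per (𝔅.rho z)) (c.part z)

variable {c} {SY : SphereStructure Y} {SX : SphereStructure X} {SP : SphereStructure c.groups}

/-- The biset `B' e` is one right orbit of a group generated by `SX.gen (𝔅.rho e)`. -/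
theorem cyc_eq_cyc_base (SX : SphereStructure X) {e : 𝔅.graph.carrier}
    (he : X.graph.IsEdge (𝔅.rho e)) (b : c.part e) :
    Biset.cyc (c.stab e) (SX.gen (𝔅.rho e)) b =
      Biset.cyc (c.stab e) (SX.gen (𝔅.rho e)) (c.base e) := by
  obtain ⟨g, rfl⟩ := c.exists_op_smul_base b
  obtain ⟨n, rfl⟩ := Subgroup.mem_zpowers_iff.1 (SX.gen_generates _ he g)
  exact Biset.cyc_eq_iff.2 ⟨n, 1, one_smul _ _⟩

/-- The number of cycles of the generator of an edge group. -/
theorem ncyc_edge (hF : 𝔅.IsLeftFree)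
    (htr : ∀ z, Biset.IsTransitive (Y.G (𝔅.lam z)) (X.G (𝔅.rho z)) (𝔅.B z)) (SX : SphereStructure X)
    (z : 𝔅.graph.Vert)
    {f : X.graph.carrier} (hf : X.graph.IsEdge f) (hz : X.graph.src f = 𝔅.rho z.1) :
    Biset.ncyc (c.stab z.1) (c.part z.1) (X.minusTo hz (SX.gen f)) =
      Nat.card {e : 𝔅.graph.carrier // 𝔅.graph.src e = z.1 ∧ 𝔅.rho e = f} := by
  have D := c.isDecomposition_edges hF htr z hf hz
  obtain ⟨F, hF, -⟩ := D.exists_cycles_bijective (g := fun i => SX.gen (𝔅.rho i.1))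
    (g' := X.minusTo hz (SX.gen f)) (by rintro ⟨e, he, rfl⟩; rfl)
  rw [Biset.ncyc, ← Nat.card_eq_of_bijective F hF]
  -- Each edge above `f` contributes a single cycle.
  refine congrArg _ (Nat.card_eq_of_bijective (fun x => x.1) ⟨?_, fun i => ?_⟩)
  · rintro ⟨i, x⟩ ⟨j, y⟩ (rfl : i = j)
    obtain ⟨b, rfl⟩ := Biset.exists_cyc_eq x
    obtain ⟨b', rfl⟩ := Biset.exists_cyc_eq y
    have he : X.graph.IsEdge (𝔅.rho i.1) := by rw [i.2.2]; exact hf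
    rw [cyc_eq_cyc_base SX he b, cyc_eq_cyc_base SX he b']
  · exact ⟨⟨i, Biset.cyc _ _ (c.base i.1)⟩, rfl⟩

end BaseChoice
end GraphOfBisets

theorem Biset.IsLeftFree.smul_left_injective {H B : Type*} [Group H] [MulAction H B]
    (h : Biset.IsLeftFree H B) {k k' : H} {b : B} (e : k • b = k' • b) : k = k' := by
  have h1 : (k'⁻¹ * k) • b = b := by rw [mul_smul, e, inv_smul_smul]
  exact (inv_mul_eq_one.1 (h _ _ h1)).symm

theorem Biset.eq_of_sigma_cyc_eq {H G B I : Type*} [Group H] [Group G] [MulAction H B]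
    [MulAction Gᵐᵒᵖ B] [SMulCommClass H Gᵐᵒᵖ B] {γ : I → G} {i j : I} {b b' : B}
    (e : (⟨i, Biset.cyc H (γ i) b⟩ : Σ i, Biset.Cycle H B (γ i)) = ⟨j, Biset.cyc H (γ j) b'⟩) :
    i = j ∧ Biset.cyc H (γ i) b = Biset.cyc H (γ i) b' := by
  obtain rfl : i = j := congrArg Sigma.fst e
  exact ⟨rfl, eq_of_heq (Sigma.mk.inj e).2⟩

theorem Biset.length_cyc_inv {H G B : Type*} [Group H] [Group G] [MulAction H B]
    [MulAction Gᵐᵒᵖ B] [SMulCommClass H Gᵐᵒᵖ B] (g : G) (b : B) :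
    (Biset.cyc H g⁻¹ b).length = (Biset.cyc H g b).length := by
  have key : ∀ k : ℤ, ((Biset.cyc H g⁻¹ b).length : ℤ) ∣ k ↔ ((Biset.cyc H g b).length : ℤ) ∣ k := by
    intro k
    rw [Biset.length_dvd_iff, ← dvd_neg, Biset.length_dvd_iff, inv_zpow', zpow_neg]
  exact Nat.dvd_antisymm (Int.natCast_dvd_natCast.1 ((key _).2 dvd_rfl))
    (Int.natCast_dvd_natCast.1 ((key _).1 dvd_rfl))

theorem ConjClasses.exists_representatives {G : Type*} [Group G] {P : Set (ConjClasses G)} {g : G}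
    (hg : ConjClasses.mk g ∈ P) :
    ∃ γ : P → G, (∀ c, ConjClasses.mk (γ c) = c) ∧ γ ⟨ConjClasses.mk g, hg⟩ = g := by
  classical
  refine ⟨fun c => if c = ⟨ConjClasses.mk g, hg⟩ then g else c.1.exists_rep.choose, fun c => ?_,
    if_pos rfl⟩
  dsimp only
  split_ifs with h
  · rw [h]
  · exact c.1.exists_rep.choose_spec

/-- Representatives of the peripheral classes that are given by the edges on the classes that are not
vacant. -/
theorem SphereStructure.exists_representatives {X : GraphOfGroups.{u}} (S : SphereStructure X)
    (hS : S.IsStable) (x : X.Vert) (γ₀ : S.per x.1 → X.G x.1) (hγ₀ : ∀ c, ConjClasses.mk (γ₀ c) = c) :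
    ∃ γ : S.per x.1 → X.G x.1, (∀ c, ConjClasses.mk (γ c) = c) ∧
      (∀ (f : X.graph.carrier) (hf : X.graph.src f = x.1) (_ : X.graph.IsEdge f)
        (hm : ConjClasses.mk (X.minusTo hf (S.gen f)) ∈ S.per x.1),
        γ ⟨_, hm⟩ = X.minusTo hf (S.gen f)) ∧ ∀ c, S.IsVacant x c.1 → γ c = γ₀ c := by
  classical
  let Q : S.per x.1 → Prop := fun c => ∃ f, ∃ hf : X.graph.src f = x.1, X.graph.IsEdge f ∧
    ConjClasses.mk (X.minusTo hf (S.gen f)) = c.1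
  have hex : ∀ c : S.per x.1, ∃ g, ConjClasses.mk g = c.1 ∧ (∀ (f : X.graph.carrier)
      (hf : X.graph.src f = x.1) (_ : X.graph.IsEdge f),
      ConjClasses.mk (X.minusTo hf (S.gen f)) = c.1 → g = X.minusTo hf (S.gen f)) ∧
      (S.IsVacant x c.1 → g = γ₀ c) := by
    intro c
    by_cases h : Q c
    · obtain ⟨f, hf, hf', e⟩ := h
      refine ⟨_, e, fun f₂ hf₂ hf₂' e₂ => ?_, fun hv => absurd e (hv.2 f hf hf')⟩
      obtain rfl := S.eq_of_attach hS hf hf₂ hf' hf₂' (e.trans e₂.symm)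
      rfl
    · exact ⟨γ₀ c, hγ₀ c, fun f hf hf' e => absurd ⟨f, hf, hf', e⟩ h, fun _ => rfl⟩
  choose γ h₁ h₂ h₃ using hex
  exact ⟨γ, h₁, fun f hf hf' hm => h₂ _ f hf hf' rfl, h₃⟩

namespace GraphOfBisets

namespace BaseChoice

variable {Y X : GraphOfGroups.{u}} {𝔅 : GraphOfBisets Y X} {c : 𝔅.BaseChoice}
  {SY : SphereStructure Y} {SX : SphereStructure X} {SP : SphereStructure c.groups}

variable (c) (SX) in
/-- The length of the cycle of the generator of an edge group. -/
noncomputable def edgeDegree (e : 𝔅.graph.carrier) : ℕ :=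
  (Biset.cyc (c.stab e) (SX.gen (𝔅.rho e)) (c.base e)).length

variable (c) (SX) in
/-- The lift of the generator of an edge group. -/
noncomputable def edgeLift (e : 𝔅.graph.carrier) : c.stab e :=
  (Biset.exists_isLift (H := c.stab e) (g := SX.gen (𝔅.rho e)) (c.base e)).choose

theorem edgeLift_smul (e : 𝔅.graph.carrier) : c.edgeLift SX e • c.base e =
    op (SX.gen (𝔅.rho e) ^ c.edgeDegree SX e) • c.base e :=
  (Biset.exists_isLift (H := c.stab e) (g := SX.gen (𝔅.rho e)) (c.base e)).choose_spec.1

variable (c) (SP) in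
/-- The generator of the group `P e`. -/
def edgeGen (e : 𝔅.graph.carrier) : c.stab e := SP.gen e

variable (c) (SP) in
/-- The peripheral classes of the group `P z`. -/
def stabPer (z : 𝔅.graph.carrier) : Set (ConjClasses (c.stab z)) := SP.per z

theorem isSphereGroup_stabPer (z : 𝔅.graph.carrier) :
    IsSphereGroup (c.stabPer SP z) := SP.isSphere z

theorem edgeGen_generates {e : 𝔅.graph.carrier} (he : 𝔅.graph.IsEdge e) (k : c.stab e) :
    k ∈ Subgroup.zpowers (c.edgeGen SP e) := SP.gen_generates e he k

/-- `h ↦ h̄`. -/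
def stabInv (e : 𝔅.graph.carrier) : c.stab e →* c.stab (𝔅.graph.bar e) := c.groups.inv e

theorem stabInv_smul_base {e : 𝔅.graph.carrier} {k : c.stab e} {g : X.G (𝔅.rho e)}
    (h : k • c.base e = op g • c.base e) : stabInv e k • c.base (𝔅.graph.bar e) =
      op (X.invTo (𝔅.rho_morphism.map_bar e).symm g) • c.base (𝔅.graph.bar e) := by
  have h1 := congrArg (𝔅.inv e) (congrArg Subtype.val h)
  have h2 := 𝔅.inv_smul e (k : Y.G (𝔅.lam e)) (c.b e)
  have h3 := 𝔅.inv_op_smul e g (c.b e)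
  rw [c.b_inv] at h2 h3
  exact Subtype.ext (h2.symm.trans (h1.trans h3))

theorem _root_.SphereStructure.invTo_gen {X : GraphOfGroups.{u}} (S : SphereStructure X)
    {x y : X.graph.carrier} (h : X.graph.bar x = y) (hx : X.graph.IsEdge x) :
    X.invTo h (S.gen x) = S.gen y := by
  subst h
  exact S.inv_gen x hx

theorem stabInv_edgeLift_smul {e : 𝔅.graph.carrier} (he : X.graph.IsEdge (𝔅.rho e)) :
    stabInv e (c.edgeLift SX e) • c.base (𝔅.graph.bar e) =
      op (SX.gen (𝔅.rho (𝔅.graph.bar e)) ^ c.edgeDegree SX e) • c.base (𝔅.graph.bar e) := by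
  have h := stabInv_smul_base (edgeLift_smul (c := c) (SX := SX) e)
  rwa [map_pow, SX.invTo_gen _ he] at h

theorem edgeDegree_bar_dvd {e : 𝔅.graph.carrier} (he : X.graph.IsEdge (𝔅.rho e)) :
    c.edgeDegree SX (𝔅.graph.bar e) ∣ c.edgeDegree SX e := by
  refine Int.natCast_dvd_natCast.1 ((Biset.length_dvd_iff _ _ _).2 ⟨stabInv e (c.edgeLift SX e), ?_⟩)
  rw [zpow_natCast]
  exact stabInv_edgeLift_smul he

namespace IsSphere

theorem isEdge_rho (h : c.IsSphere SY SX SP) {e : 𝔅.graph.carrier} (he : 𝔅.graph.IsEdge e) :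
    X.graph.IsEdge (𝔅.rho e) := h.left_free.simplicial e he

theorem edgeDegree_bar (h : c.IsSphere SY SX SP) {e : 𝔅.graph.carrier} (he : 𝔅.graph.IsEdge e) :
    c.edgeDegree SX (𝔅.graph.bar e) = c.edgeDegree SX e := by
  refine Nat.dvd_antisymm (edgeDegree_bar_dvd (h.isEdge_rho he)) ?_
  have := edgeDegree_bar_dvd (c := c) (SX := SX) (h.isEdge_rho he.bar)
  rwa [𝔅.graph.bar_bar] at this

theorem stabInv_edgeLift (h : c.IsSphere SY SX SP) {e : 𝔅.graph.carrier} (he : 𝔅.graph.IsEdge e) :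
    stabInv e (c.edgeLift SX e) = c.edgeLift SX (𝔅.graph.bar e) := by
  refine (c.part_isLeftFree h.left_free _).smul_left_injective (b := c.base _) ?_
  rw [edgeLift_smul, stabInv_edgeLift_smul (h.isEdge_rho he), h.edgeDegree_bar he]

/-- A correct orientation is a property of the unoriented edge, so that a wrong one passes from one
end to the other. -/
theorem edgeLift_bar_eq (h : c.IsSphere SY SX SP) {e : 𝔅.graph.carrier} (he : 𝔅.graph.IsEdge e)
    (hu : c.edgeLift SX e = c.edgeGen SP e) : c.edgeLift SX (𝔅.graph.bar e) = c.edgeGen SP (𝔅.graph.bar e) := by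
  rw [← h.stabInv_edgeLift he, hu]
  exact SP.inv_gen e he

/-- If the group `P e` is non-trivial, its generator is a peripheral class, hence a lift of the
generator of the cyclic group `G (rho e)` or of the inverse generator. Both of these have only the
one cycle of `B' e`, with the same length, which leaves just the sign undetermined. -/
theorem edgeLift_eq_or (h : c.IsSphere SY SX SP) {e : 𝔅.graph.carrier} (he : 𝔅.graph.IsEdge e) :
    c.edgeLift SX e = c.edgeGen SP e ∨ c.edgeLift SX e = (c.edgeGen SP e)⁻¹ := by
  by_cases ht : c.edgeGen SP e = 1
  · left
    have := edgeGen_generates (SP := SP) he (c.edgeLift SX e)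
    rw [ht, Subgroup.zpowers_one_eq_bot, Subgroup.mem_bot] at this
    exact this.trans ht.symm
  · have hρ := h.isEdge_rho he
    have hmem : ConjClasses.mk (c.edgeGen SP e) ∈ c.stabPer SP e := by
      rw [(isSphereGroup_stabPer e).eq_pair_of_cyclic (edgeGen_generates he) ht]
      exact .inl rfl
    have hX := (SX.isSphere (𝔅.rho e)).eq_pair_of_cyclic (SX.gen_generates _ hρ)
      (h.right_stable.edge_ne_one _ hρ)
    obtain ⟨γ, hγ⟩ : ∃ γ : SX.per (𝔅.rho e) → X.G (𝔅.rho e), ∀ c, ConjClasses.mk (γ c) = c :=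
      ⟨fun c => c.1.exists_rep.choose, fun c => c.1.exists_rep.choose_spec⟩
    obtain ⟨⟨C, x⟩, hx, -⟩ := (h.sphere e).lift_unique γ hγ _ hmem
    obtain ⟨s, k, hs, hk, hkt⟩ := Biset.isLift_iff.1 hx
    dsimp only at s hs hk
    subst hs
    obtain rfl : c.edgeGen SP e = k :=
      (ConjClasses.mk_eq_mk_iff_isConj.1 hkt).eq_of_zpowers (edgeGen_generates (SP := SP) he)
    obtain ⟨g, rfl⟩ := c.exists_op_smul_base s
    have hcomm : ∀ a b : X.G (𝔅.rho e), a * b = b * a := by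
      intro a b
      obtain ⟨i, rfl⟩ := Subgroup.mem_zpowers_iff.1 (SX.gen_generates _ hρ a)
      obtain ⟨j, rfl⟩ := Subgroup.mem_zpowers_iff.1 (SX.gen_generates _ hρ b)
      rw [← zpow_add, ← zpow_add, add_comm]
    have hγC : γ C = SX.gen (𝔅.rho e) ∨ γ C = (SX.gen (𝔅.rho e))⁻¹ := by
      have := (Set.ext_iff.1 hX _).1 ((hγ C).symm ▸ C.2 : ConjClasses.mk (γ C) ∈ SX.per (𝔅.rho e))
      rcases this with e1 | e1
      · exact .inl ((ConjClasses.mk_eq_mk_iff_isConj.1 e1).eq_of_zpowers (SX.gen_generates _ hρ))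
      · exact .inr ((ConjClasses.mk_eq_mk_iff_isConj.1 e1).eq_of_zpowers (SX.gen_generates _ hρ))
    have hlen : (Biset.cyc (c.stab e) (γ C) (op g • c.base e)).length = c.edgeDegree SX e := by
      rcases hγC with e1 | e1
      · rw [e1, cyc_eq_cyc_base SX hρ]
        rfl
      · rw [e1, Biset.length_cyc_inv, cyc_eq_cyc_base SX hρ]
        rfl
    rw [hlen] at hk
    have hk' : c.edgeGen SP e • c.base e = op (γ C ^ c.edgeDegree SX e) • c.base e := by
      rw [smul_comm, smul_smul, ← op_mul, hcomm, op_mul, mul_smul] at hk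
      exact smul_left_cancel _ hk
    rcases hγC with e1 | e1
    · left
      refine (c.part_isLeftFree h.left_free _).smul_left_injective (b := c.base _) ?_
      rw [edgeLift_smul, hk', e1]
    · right
      refine (c.part_isLeftFree h.left_free _).smul_left_injective (b := c.base _) ?_
      rw [edgeLift_smul, eq_inv_smul_iff, smul_comm, hk', e1, smul_smul, ← op_mul, inv_pow,
        inv_mul_cancel, op_one, one_smul]

end IsSphere
end BaseChoice
end GraphOfBisets

namespace GraphOfBisets

namespace BaseChoice

variable {Y X : GraphOfGroups.{u}} {𝔅 : GraphOfBisets Y X} {c : 𝔅.BaseChoice}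
  {SY : SphereStructure Y} {SX : SphereStructure X} {SP : SphereStructure c.groups}

theorem mk_stabMinus_mem {e z : 𝔅.graph.carrier} (hz : 𝔅.graph.src e = z) (he : 𝔅.graph.IsEdge e)
    (hg : c.edgeGen SP e ≠ 1) : ConjClasses.mk (c.stabMinus hz (c.edgeGen SP e)) ∈ c.stabPer SP z :=
  SP.mk_minusTo_gen_mem hz he hg

theorem eq_of_mk_stabMinus {e e' z : 𝔅.graph.carrier} (hz : 𝔅.graph.src e = z)
    (hz' : 𝔅.graph.src e' = z) (he : 𝔅.graph.IsEdge e) (he' : 𝔅.graph.IsEdge e')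
    (hg : c.edgeGen SP e ≠ 1) (hg' : c.edgeGen SP e' ≠ 1)
    (h : ConjClasses.mk (c.stabMinus hz (c.edgeGen SP e)) =
      ConjClasses.mk (c.stabMinus hz' (c.edgeGen SP e'))) : e = e' :=
  SP.attach_injective z e e' hz hz' he he' hg hg' h

namespace IsSphere

theorem mk_minusTo_mem (h : c.IsSphere SY SX SP) {e z : 𝔅.graph.carrier} (hz : 𝔅.graph.src e = z)
    (he : 𝔅.graph.IsEdge e) :
    ConjClasses.mk (X.minusTo (rho_src hz) (SX.gen (𝔅.rho e))) ∈ SX.per (𝔅.rho z) :=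
  SX.mk_minusTo_gen_mem _ (h.isEdge_rho he) (h.right_stable.edge_ne_one _ (h.isEdge_rho he))

theorem minusTo_gen_eq {z : 𝔅.graph.carrier} {f : X.graph.carrier}
    (hz : X.graph.src f = 𝔅.rho z)
    (i : {e : 𝔅.graph.carrier // 𝔅.graph.src e = z ∧ 𝔅.rho e = f}) :
    X.minusTo (rho_src i.2.1) (SX.gen (𝔅.rho i.1)) = X.minusTo hz (SX.gen f) := by
  obtain ⟨e, he, rfl⟩ := i
  rfl

theorem exists_representatives (h : c.IsSphere SY SX SP) (z : 𝔅.graph.Vert)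
    (γ₀ : SX.per (𝔅.rho z.1) → X.G (𝔅.rho z.1)) (hγ₀ : ∀ c, ConjClasses.mk (γ₀ c) = c) :
    ∃ γ : SX.per (𝔅.rho z.1) → X.G (𝔅.rho z.1), (∀ c, ConjClasses.mk (γ c) = c) ∧
      (∀ (f : X.graph.carrier) (hf : X.graph.src f = 𝔅.rho z.1) (_ : X.graph.IsEdge f)
        (hm : ConjClasses.mk (X.minusTo hf (SX.gen f)) ∈ SX.per (𝔅.rho z.1)),
        γ ⟨_, hm⟩ = X.minusTo hf (SX.gen f)) ∧ ∀ c, SX.IsVacant (𝔅.rhoV z) c.1 → γ c = γ₀ c :=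
  SX.exists_representatives h.right_stable (𝔅.rhoV z) γ₀ hγ₀

theorem exists_representatives' (h : c.IsSphere SY SX SP) (z : 𝔅.graph.Vert) :
    ∃ γ : SX.per (𝔅.rho z.1) → X.G (𝔅.rho z.1), (∀ c, ConjClasses.mk (γ c) = c) ∧
      ∀ (f : X.graph.carrier) (hf : X.graph.src f = 𝔅.rho z.1) (_ : X.graph.IsEdge f)
        (hm : ConjClasses.mk (X.minusTo hf (SX.gen f)) ∈ SX.per (𝔅.rho z.1)),
        γ ⟨_, hm⟩ = X.minusTo hf (SX.gen f) := by
  obtain ⟨γ, h₁, h₂, -⟩ := h.exists_representatives z (fun c => c.1.exists_rep.choose)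
    fun c => c.1.exists_rep.choose_spec
  exact ⟨γ, h₁, h₂⟩

theorem isLift_edge (h : c.IsSphere SY SX SP) {e : 𝔅.graph.carrier} {z : 𝔅.graph.Vert}
    (hz : 𝔅.graph.src e = z.1) (he : 𝔅.graph.IsEdge e) :
    (Biset.cyc (c.stab z.1) (X.minusTo (rho_src hz) (SX.gen (𝔅.rho e)))
      (c.edgeMap hz (c.base e))).IsLift (ConjClasses.mk (c.stabMinus hz (c.edgeLift SX e))) := by
  have D := c.isDecomposition_edges h.left_free h.transitive z (h.isEdge_rho he) (rho_src hz)
  have hlen := D.length_eq (g := fun i => SX.gen (𝔅.rho i.1))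
    (g' := X.minusTo (rho_src hz) (SX.gen (𝔅.rho e)))
    (minusTo_gen_eq (rho_src hz)) ⟨e, hz, rfl⟩ (c.base e)
  refine Biset.isLift_iff.2 ⟨_, _, rfl, ?_, rfl⟩
  rw [hlen, ← edgeMap_smul, edgeLift_smul, edgeMap_op_smul, map_pow]
  rfl

/-- Different edges at a vertex correspond to different cycles. -/
theorem edgeLift_injective (h : c.IsSphere SY SX SP) {e e' : 𝔅.graph.carrier} {z : 𝔅.graph.Vert}
    (hz : 𝔅.graph.src e = z.1) (hz' : 𝔅.graph.src e' = z.1) (he : 𝔅.graph.IsEdge e)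
    (he' : 𝔅.graph.IsEdge e')
    (hm : ConjClasses.mk (c.stabMinus hz (c.edgeLift SX e)) ∈ c.stabPer SP z.1)
    (heq : ConjClasses.mk (c.stabMinus hz (c.edgeLift SX e)) =
      ConjClasses.mk (c.stabMinus hz' (c.edgeLift SX e'))) : e = e' := by
  obtain ⟨γ, hγ, hγ'⟩ := h.exists_representatives' z
  have hl := h.isLift_edge hz he
  have hl' := h.isLift_edge hz' he'
  rw [← heq] at hl'
  have h1 := hγ' _ (rho_src hz) (h.isEdge_rho he) (h.mk_minusTo_mem hz he)
  have h1' := hγ' _ (rho_src hz') (h.isEdge_rho he') (h.mk_minusTo_mem hz' he')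
  rw [← h1] at hl
  rw [← h1'] at hl'
  -- A peripheral class is the lift of only one cycle. This identifies first the class in `G (rho
  -- z)`, hence the edge of `X`, and then the cycle, hence the edge of `𝔅`.
  have h2 := ((h.sphere z.1).lift_unique γ hγ _ hm).unique (y₁ := ⟨_, _⟩) (y₂ := ⟨_, _⟩) hl hl'
  obtain ⟨h3, h4⟩ := Biset.eq_of_sigma_cyc_eq h2
  rw [h1] at h4
  have hρ : 𝔅.rho e = 𝔅.rho e' := SX.eq_of_attach h.right_stable (rho_src hz) (rho_src hz')
    (h.isEdge_rho he) (h.isEdge_rho he') (congrArg Subtype.val h3)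
  have D := c.isDecomposition_edges h.left_free h.transitive z (h.isEdge_rho he) (rho_src hz)
  have h5 := (D.cyc_eq_cyc_iff (g := fun i => SX.gen (𝔅.rho i.1))
    (g' := X.minusTo (rho_src hz) (SX.gen (𝔅.rho e))) (minusTo_gen_eq (rho_src hz)) (i := ⟨e, hz, rfl⟩)
    (j := ⟨e', hz', hρ.symm⟩) (b := c.base e) (b' := c.base e')).1 h4
  exact congrArg (fun x => x.1.1) h5

/-- If the lift along an edge is not the chosen generator, then the same holds for all edges at its
origin that have a non-trivial group, and there are only two peripheral classes. -/
theorem edgeLift_ne (h : c.IsSphere SY SX SP) {e : 𝔅.graph.carrier} {z : 𝔅.graph.Vert}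
    (hz : 𝔅.graph.src e = z.1) (he : 𝔅.graph.IsEdge e) (hne : c.edgeLift SX e ≠ c.edgeGen SP e) :
    (c.stabPer SP z.1).ncard ≤ 2 ∧ ∀ e', 𝔅.graph.src e' = z.1 → 𝔅.graph.IsEdge e' →
      c.edgeGen SP e' ≠ 1 → c.edgeLift SX e' ≠ c.edgeGen SP e' := by
  have hinv := (h.edgeLift_eq_or he).resolve_left hne
  have hg : c.edgeGen SP e ≠ 1 := by
    intro e1
    rw [e1, inv_one] at hinv
    exact hne (hinv.trans e1.symm)
  have hD := mk_stabMinus_mem hz he hg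
  obtain ⟨γ, hγ, hγ'⟩ := h.exists_representatives' z
  have hl := h.isLift_edge hz he
  have h1 := hγ' _ (rho_src hz) (h.isEdge_rho he) (h.mk_minusTo_mem hz he)
  rw [← h1] at hl
  -- The inverse of the chosen generator gives a non-trivial lift of a peripheral class, so it is
  -- peripheral too. A peripheral class together with its inverse exhausts the peripheral classes.
  have hD' : ConjClasses.mk (c.stabMinus hz (c.edgeLift SX e)) ∈ c.stabPer SP z.1 := by
    refine ((h.sphere z.1).lift_trivial γ hγ ⟨_, _⟩ _ hl).resolve_right fun e1 => ?_
    have e2 := isConj_one_left.1 (ConjClasses.mk_eq_mk_iff_isConj.1 e1)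
    rw [hinv, map_inv, inv_eq_one] at e2
    rw [e2] at hD
    exact (isSphereGroup_stabPer _).mk_one_notMem hD
  have hD'' := hD'
  rw [hinv, map_inv] at hD''
  have hpair := (isSphereGroup_stabPer z.1).eq_pair_of_inv_mem hD hD''
  refine ⟨?_, fun e' hz' he' hg' hu => ?_⟩
  · rw [hpair.1]
    exact (Set.ncard_insert_le _ _).trans (by rw [Set.ncard_singleton])
  · have hE := mk_stabMinus_mem hz' he' hg'
    have hee : e ≠ e' := by
      rintro rfl
      exact hne hu
    rw [hpair.1] at hE
    -- An edge `e'` with the right sign would lead either to the class of the generator, to which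
    -- only `e` attaches, or to the inverse class, which is the lift along `e` and along no other
    -- edge.
    rcases hE with hE | hE
    · exact hee (eq_of_mk_stabMinus hz hz' he he' hg hg' hE.symm)
    · refine hee (h.edgeLift_injective hz hz' he he' hD' ?_)
      rw [hu, hinv, map_inv]
      exact hE.symm

/-- By `edgeLift_ne`, a wrong sign at one edge spreads to all edges with non-trivial group at the
same vertex, and then to their other ends, always at vertices with at most two peripheral classes.
This contradicts `IsRefinement.exists_three_le`. -/
theorem edgeLift_eq (h : c.IsSphere SY SX SP) {e : 𝔅.graph.carrier} (he : 𝔅.graph.IsEdge e) :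
    c.edgeLift SX e = c.edgeGen SP e := by
  by_contra hne
  have hgen : ∀ {e}, 𝔅.graph.IsEdge e → c.edgeLift SX e ≠ c.edgeGen SP e → c.edgeGen SP e ≠ 1 := by
    intro e he hne e1
    have := h.edgeLift_eq_or he
    rw [e1, inv_one, or_self] at this
    exact hne (this.trans e1.symm)
  obtain ⟨z, ⟨e', hz', he', hne'⟩, h3⟩ := h.refinement.exists_three_le h.left_stable
    {z : 𝔅.graph.Vert | ∃ e, 𝔅.graph.src e = z.1 ∧ 𝔅.graph.IsEdge e ∧
      c.edgeLift SX e ≠ c.edgeGen SP e} (by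
      intro (e' : 𝔅.graph.carrier) (he' : 𝔅.graph.IsEdge e') hg' hZ
      obtain ⟨e, hz, he, hne⟩ := hZ
      refine ⟨𝔅.graph.bar e', rfl, he'.bar, fun hb => ?_⟩
      have h1 := h.edgeLift_bar_eq (e := 𝔅.graph.bar e') (Graph'.IsEdge.bar he') hb
      rw [𝔅.graph.bar_bar] at h1
      exact (h.edgeLift_ne hz he hne).2 e' rfl he' hg' h1)
    (𝔅.graph.o e) ⟨e, rfl, he, hne⟩
    ⟨_, SP.minusTo_gen_ne_one rfl (hgen he hne)⟩
  have := (h.edgeLift_ne hz' he' hne').1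
  change 3 ≤ (c.stabPer SP z.1).ncard at h3
  omega

theorem isLift_edgeGen (h : c.IsSphere SY SX SP) {e : 𝔅.graph.carrier} {z : 𝔅.graph.Vert}
    (hz : 𝔅.graph.src e = z.1) (he : 𝔅.graph.IsEdge e) :
    (Biset.cyc (c.stab z.1) (X.minusTo (rho_src hz) (SX.gen (𝔅.rho e)))
      (c.edgeMap hz (c.base e))).IsLift (ConjClasses.mk (c.stabMinus hz (c.edgeGen SP e))) := by
  rw [← h.edgeLift_eq he]
  exact h.isLift_edge hz he

/-- The lifts of vacant classes are trivial or vacant. -/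
theorem isVacant_of_isLift (h : c.IsSphere SY SX SP) (z : 𝔅.graph.Vert) {g : X.G (𝔅.rho z.1)}
    (hg : SX.IsVacant (𝔅.rhoV z) (ConjClasses.mk g)) {b : c.part z.1} {D : ConjClasses (c.stab z.1)}
    (hD : (Biset.cyc (c.stab z.1) g b).IsLift D) :
    D = ConjClasses.mk 1 ∨ SP.IsVacant z D := by
  obtain ⟨γ₀, hγ₀, hg₀⟩ := ConjClasses.exists_representatives (P := SX.per (𝔅.rho z.1)) hg.1
  obtain ⟨γ, hγ, hγ', hγv⟩ := h.exists_representatives z γ₀ hγ₀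
  have hγg : γ ⟨ConjClasses.mk g, hg.1⟩ = g := (hγv _ hg).trans hg₀
  rw [← hγg] at hD
  rcases (h.sphere z.1).lift_trivial γ hγ ⟨_, _⟩ D hD with hm | hm
  -- If an edge `e` attached to `D`, then `D` would also be the lift of the cycle of `e`. By
  -- uniqueness the class of `g` would be the one to which `rho e` attaches, and so not vacant.
  · refine .inr ⟨hm, fun e hz he heD => ?_⟩
    have hl := h.isLift_edgeGen hz he
    rw [show ConjClasses.mk (c.stabMinus hz (c.edgeGen SP e)) = D from heD] at hl
    have h1 := hγ' _ (rho_src hz) (h.isEdge_rho he) (h.mk_minusTo_mem hz he)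
    rw [← h1] at hl
    have h2 := ((h.sphere z.1).lift_unique γ hγ _ hm).unique (y₁ := ⟨_, _⟩) (y₂ := ⟨_, _⟩) hD hl
    exact hg.2 _ (rho_src hz) (h.isEdge_rho he)
      (congrArg Subtype.val (Biset.eq_of_sigma_cyc_eq h2).1).symm
  · exact .inl hm

/-- A vacant class is a lift of a vacant class. -/
theorem exists_isLift_of_isVacant (h : c.IsSphere SY SX SP) (z : 𝔅.graph.Vert)
    {D : ConjClasses (c.stab z.1)} (hD : SP.IsVacant z D)
    (γ₀ : SX.per (𝔅.rho z.1) → X.G (𝔅.rho z.1)) (hγ₀ : ∀ C, ConjClasses.mk (γ₀ C) = C) :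
    ∃ C : SX.per (𝔅.rho z.1), SX.IsVacant (𝔅.rhoV z) C.1 ∧
      ∃ b : c.part z.1, (Biset.cyc (c.stab z.1) (γ₀ C) b).IsLift D := by
  obtain ⟨γ, hγ, hγ', hγv⟩ := h.exists_representatives z γ₀ hγ₀
  obtain ⟨⟨C, x⟩, hx, -⟩ := (h.sphere z.1).lift_unique γ hγ D hD.1
  obtain ⟨b, rfl⟩ := Biset.exists_cyc_eq x
  dsimp only at hx
  -- A cycle of an occupied class is the cycle of some edge `e` of `𝔅`, and it lifts to the class to
  -- which `e` attaches, which is not vacant.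
  have hC : SX.IsVacant (𝔅.rhoV z) C.1 := by
    refine ⟨C.2, fun f hf hf' eC => ?_⟩
    replace hf : X.graph.src f = 𝔅.rho z.1 := hf
    have h1 : γ C = X.minusTo hf (SX.gen f) := by
      obtain ⟨_, hm⟩ := C
      dsimp only at eC
      subst eC
      exact hγ' f hf hf' hm
    rw [h1] at hx
    have D' := c.isDecomposition_edges h.left_free h.transitive z hf' hf
    obtain ⟨⟨e, hz, rfl⟩, b', k, rfl⟩ := D'.surjective b
    have he : 𝔅.graph.IsEdge e := 𝔅.rho_morphism.isEdge_of_isEdge_map hf'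
    have h2 : Biset.cyc (c.stab z.1) (X.minusTo hf (SX.gen (𝔅.rho e))) (k • c.edgeMap hz b') =
        Biset.cyc (c.stab z.1) (X.minusTo hf (SX.gen (𝔅.rho e))) (c.edgeMap hz (c.base e)) := by
      refine Eq.trans (Biset.cyc_eq_iff.2 ⟨0, k⁻¹, ?_⟩)
        ((D'.cyc_eq_cyc_iff (g := fun i => SX.gen (𝔅.rho i.1)) (minusTo_gen_eq hf)
          (i := ⟨e, hz, rfl⟩) (j := ⟨e, hz, rfl⟩)).2 (congrArg (Sigma.mk _)
            (cyc_eq_cyc_base SX hf' b')))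
      rw [zpow_zero, op_one, one_smul, inv_smul_smul]
    rw [h2] at hx
    exact hD.2 e hz he
      ((h.isLift_edgeGen hz he).unique (c.part_isLeftFree h.left_free z.1) hx)
  exact ⟨C, hC, b, by rw [← hγv C hC]; exact hx⟩

end IsSphere
end BaseChoice
end GraphOfBisets

/-! ### Right-transitivity and lifts in the fundamental biset. -/

open SphereStructure GraphOfGroups

/-- Representatives of the peripheral classes of the fundamental group, and the vacant classes to which
they belong. -/
structure SphereStructure.Representatives {X : GraphOfGroups.{u}} (S : SphereStructure X) {w₀ : X.Vert}
    (γ : S.fundPer w₀ → X.fundGroup w₀) where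
  σ : S.vacant → S.fundPer w₀
  bijective : Function.Bijective σ
  p : S.vacant → X.PathGroup
  isPath : ∀ ℓ, X.IsPath w₀ ℓ.1.1 (p ℓ)
  g : ∀ ℓ : S.vacant, X.G ℓ.1.1.1
  mk_g : ∀ ℓ, ConjClasses.mk (g ℓ) = ℓ.1.2
  γ_σ : ∀ ℓ, γ (σ ℓ) = conjHom (isPath ℓ) (g ℓ)

theorem SphereStructure.IsStable.map_conjHom_mem {X : GraphOfGroups.{u}} {S : SphereStructure X}
    {w₀ v : X.Vert} {C : ConjClasses (X.G v.1)} (hC : S.IsVacant v C) {p : X.PathGroup}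
    (hp : X.IsPath w₀ v p) : ConjClasses.map (conjHom hp) C ∈ S.fundPer w₀ := by
  induction C using Quotient.inductionOn with | h g => ?_
  exact ⟨conjHom hp g, v, g, p, hp, hC, rfl, rfl⟩

theorem ConjClasses.map_conjHom_eq {X : GraphOfGroups.{u}} {w₀ v : X.Vert}
    (C : ConjClasses (X.G v.1))
    {p p' : X.PathGroup} (hp : X.IsPath w₀ v p) (hp' : X.IsPath w₀ v p') :
    ConjClasses.map (conjHom hp) C = ConjClasses.map (conjHom hp') C := by
  induction C using Quotient.inductionOn with | h g => ?_
  exact ConjClasses.mk_eq_mk_iff_isConj.2 (isConj_conjHom hp hp' g)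

/-- A given representative is at first only conjugate to `p₀ g p₀⁻¹`. The conjugating element
belongs to the fundamental group and is absorbed into the path, so that `γ_σ` holds exactly. -/
theorem SphereStructure.IsStable.exists_representatives {X : GraphOfGroups.{u}}
    {S : SphereStructure X}
    (hS : S.IsStable) {w₀ : X.Vert} (γ : S.fundPer w₀ → X.fundGroup w₀)
    (hγ : ∀ C, ConjClasses.mk (γ C) = C) : Nonempty (S.Representatives γ) := by
  choose p₀ hp₀ using exists_isPath hS.isTree w₀
  let σ : S.vacant → S.fundPer w₀ := fun ℓ => ⟨_, IsStable.map_conjHom_mem ℓ.2 (hp₀ ℓ.1.1)⟩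
  have hσ : Function.Bijective σ := by
    constructor
    · intro ℓ ℓ' e
      exact Subtype.ext ((hS.fundGroup w₀).2 hp₀ _ _ ℓ.2 ℓ'.2 (congrArg Subtype.val e))
    · rintro ⟨_, a, v, g, p, hp, hv, ha, rfl⟩
      refine ⟨⟨⟨v, ConjClasses.mk g⟩, hv⟩, Subtype.ext ?_⟩
      refine (ConjClasses.map_conjHom_eq (ConjClasses.mk g) (hp₀ v) hp).trans ?_
      change ConjClasses.mk (conjHom hp g) = ConjClasses.mk a
      exact congrArg ConjClasses.mk (Subtype.ext ha.symm)
  have hex : ∀ ℓ : S.vacant, ∃ (p : X.PathGroup) (hp : X.IsPath w₀ ℓ.1.1 p) (g : X.G ℓ.1.1.1),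
      ConjClasses.mk g = ℓ.1.2 ∧ γ (σ ℓ) = conjHom hp g := by
    intro ℓ
    obtain ⟨g, hg⟩ := ConjClasses.exists_rep ℓ.1.2
    have h1 : ConjClasses.mk (conjHom (hp₀ ℓ.1.1) g) = ConjClasses.mk (γ (σ ℓ)) := by
      rw [hγ]
      exact congrArg (ConjClasses.map _) hg
    obtain ⟨u, hu⟩ := isConj_iff.1 (ConjClasses.mk_eq_mk_iff_isConj.1 h1)
    refine ⟨u * p₀ ℓ.1.1, .mul u.2 (hp₀ _), g, hg, ?_⟩
    rw [← hu]
    refine Subtype.ext ?_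
    change (u : X.PathGroup) * (p₀ ℓ.1.1 * X.ofVert ℓ.1.1 g * (p₀ ℓ.1.1)⁻¹) * (u : X.PathGroup)⁻¹ =
      u * p₀ ℓ.1.1 * X.ofVert ℓ.1.1 g * (u * p₀ ℓ.1.1)⁻¹
    group
  choose p hp g hg hγσ using hex
  exact ⟨⟨σ, hσ, p, hp, g, hg, hγσ⟩⟩

namespace GraphOfBisets

variable {Y X : GraphOfGroups.{u}} {𝔅 : GraphOfBisets Y X} {c : 𝔅.BaseChoice}
  {SY : SphereStructure Y} {SX : SphereStructure X} {SP : SphereStructure c.groups}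
  {v₀ : Y.Vert} {w₀ : X.Vert}

theorem fmk_op_smul (z : 𝔅.graph.Vert) (q : Y.PathGroup) (hq : Y.IsPath v₀ (𝔅.lamV z) q)
    (g : X.G (𝔅.rho z.1)) (b : 𝔅.B z.1) (p : X.PathGroup) (hp : X.IsPath (𝔅.rhoV z) w₀ p) :
    ∃ p' hp', fmk z q hq (op g • b) p hp = fmk z q hq b p' hp' :=
  ⟨_, .mul (.vert (𝔅.rhoV z) g) hp, fmk_right z q hq g b p hp _⟩

theorem fmk_eq_op_smul (z : 𝔅.graph.Vert) (q : Y.PathGroup) (hq : Y.IsPath v₀ (𝔅.lamV z) q)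
    (g : X.G (𝔅.rho z.1)) (b : 𝔅.B z.1) (p : X.PathGroup) (hp : X.IsPath (𝔅.rhoV z) w₀ p) :
    ∃ p' hp', fmk z q hq b p hp = fmk z q hq (op g • b) p' hp' := by
  refine ⟨X.ofVert (𝔅.rhoV z) g⁻¹ * p, .mul (.vert (𝔅.rhoV z) g⁻¹) hp, ?_⟩
  refine Eq.trans ?_ (fmk_right z q hq g b _ _ (.mul (.vert _ _) (.mul (.vert _ _) hp))).symm
  refine fmk_congr rfl rfl ?_
  have h : X.ofVert (𝔅.rhoV z) g⁻¹ = (X.ofVert (𝔅.rhoV z) g)⁻¹ := X.ofVert_inv _ _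
  exact ((congrArg (fun x => X.ofVert (𝔅.rhoV z) g * (x * p)) h).trans
    (mul_inv_cancel_left _ _)).symm

variable (c) in
/-- Every element has the form `q ⊗ b z ⊗ p`. -/
theorem BaseChoice.exists_fmk_base_eq
    (htr : ∀ z, Biset.IsTransitive (Y.G (𝔅.lam z)) (X.G (𝔅.rho z)) (𝔅.B z))
    (ξ : 𝔅.FundBiset v₀ w₀) : ∃ z q hq p hp, fmk z q hq (c.b z.1) p hp = ξ := by
  obtain ⟨z, q, hq, b, p, hp, rfl⟩ := exists_fmk_eq ξ
  obtain ⟨h, g, rfl⟩ := (htr z.1).2 (c.b z.1) b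
  obtain ⟨p', hp', e⟩ := fmk_op_smul z (q * Y.ofVert (𝔅.lamV z) h) (hq.mul (.vert _ _)) g (c.b z.1) p hp
  exact ⟨z, _, _, p', hp', e.symm.trans (fmk_left z q hq h _ _ p hp)⟩

theorem fmk_eq_op_smul_fmk (z : 𝔅.graph.Vert) (q : Y.PathGroup) (hq : Y.IsPath v₀ (𝔅.lamV z) q)
    (b : 𝔅.B z.1) (p p' : X.PathGroup) (hp : X.IsPath (𝔅.rhoV z) w₀ p)
    (hp' : X.IsPath (𝔅.rhoV z) w₀ p') :
    ∃ a : X.fundGroup w₀, op a • fmk z q hq b p hp = fmk z q hq b p' hp' :=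
  ⟨⟨p⁻¹ * p', hp.inv.mul hp'⟩, fmk_congr rfl rfl (mul_inv_cancel_left _ _)⟩

-- The set attached to `z` consists of the `q` for which some `q ⊗ b z ⊗ p` lies in the right orbit
-- of `ξ₀`. Elements of `P z` move `b z` only by right translations, and the edge relation of the
-- fundamental biset carries base points to base points up to the elements `γ`.
variable (c) in
theorem BaseChoice.isPathFamily (ξ₀ : 𝔅.FundBiset v₀ w₀)
    (hf : IsGraphMorphism c.groups.graph Y.graph 𝔅.lam) :
    IsPathFamily (P := c.groups) hf c.incl v₀ fun (z : 𝔅.graph.Vert) =>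
      {q | ∃ (hq : Y.IsPath v₀ (𝔅.lamV z) q) (p : X.PathGroup) (hp : X.IsPath (𝔅.rhoV z) w₀ p)
        (a : X.fundGroup w₀), op a • ξ₀ = fmk z q hq (c.b z.1) p hp} := by
  constructor
  · rintro z q ⟨hq, -⟩
    exact hq
  · rintro (z : 𝔅.graph.Vert) q ⟨hq, p, hp, a, e⟩ (g : c.stab z.1)
    obtain ⟨k, hk⟩ := g.2
    change k • c.b z.1 = (g : Y.G (𝔅.lam z.1)) • c.b z.1 at hk
    obtain ⟨p', hp', e'⟩ := fmk_eq_op_smul z q hq k.unop (c.b z.1) p hp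
    have hq' : Y.IsPath v₀ (𝔅.lamV z) (q * Y.ofVert (𝔅.lamV z) (g : Y.G (𝔅.lam z.1))) :=
      hq.mul (.vert _ _)
    refine ⟨hq', p', hp', a, e.trans (e'.trans ?_)⟩
    exact (fmk_congr rfl hk rfl).trans (fmk_left z q hq _ hq' (c.b z.1) p' hp').symm
  · intro (e : 𝔅.graph.carrier)
    obtain ⟨k, hk⟩ := c.γ_spec e
    obtain ⟨k', hk'⟩ := c.γ_spec (𝔅.graph.bar e)
    change k • c.b (𝔅.graph.src e) = (c.γ e)⁻¹ • 𝔅.minus e (c.b e) at hk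
    change k' • c.b (𝔅.graph.src (𝔅.graph.bar e)) =
      (c.γ (𝔅.graph.bar e))⁻¹ • 𝔅.minus (𝔅.graph.bar e) (c.b (𝔅.graph.bar e)) at hk'
    refine ⟨Y.ofVert (𝔅.lamV (𝔅.graph.o e)) (c.γ e)⁻¹,
      Y.ofVert (𝔅.lamV (𝔅.graph.t e)) (c.γ (𝔅.graph.bar e)), ⟨_, rfl⟩, ⟨_, rfl⟩, ?_⟩
    rintro q ⟨hq, p, hp, a, ea⟩
    obtain ⟨p₁, hp₁, e₁⟩ := fmk_eq_op_smul (𝔅.graph.o e) q hq k.unop (c.b _) p hp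
    have hq₁ : Y.IsPath v₀ (𝔅.lamV (𝔅.graph.o e)) (q * Y.ofVert (𝔅.lamV (𝔅.graph.o e)) (c.γ e)⁻¹) :=
      hq.mul (.vert _ _)
    have hq₂ := hq₁.mul (isPath_lam e)
    have hq₃ : Y.IsPath v₀ (𝔅.lamV (𝔅.graph.t e)) (q * Y.ofVert (𝔅.lamV (𝔅.graph.o e)) (c.γ e)⁻¹ *
      Y.ofEdge (𝔅.lam e) * Y.ofVert (𝔅.lamV (𝔅.graph.t e)) (c.γ (𝔅.graph.bar e))) :=
      hq₂.mul (.vert _ _)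
    have e₂ := fmk_left (𝔅.graph.o e) q hq (c.γ e)⁻¹ hq₁ (𝔅.minus e (c.b e)) p₁ hp₁
    have e₃ := fmk_edge e _ hq₁ (c.b e) p₁ hp₁
    have e₄ : 𝔅.minus (𝔅.graph.bar e) (𝔅.inv e (c.b e)) =
        c.γ (𝔅.graph.bar e) • k' • c.b (𝔅.graph.src (𝔅.graph.bar e)) := by
      rw [hk', smul_inv_smul, c.b_inv]
    have hp₂ := (isPath_rho_bar e).mul hp₁
    obtain ⟨p₃, hp₃, e₅⟩ := fmk_op_smul (𝔅.graph.t e) _ hq₃ k'.unop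
      (c.b (𝔅.graph.src (𝔅.graph.bar e))) _ hp₂
    refine ⟨hq₃, p₃, hp₃, a, ea.trans (e₁.trans ?_)⟩
    refine (fmk_congr rfl hk rfl).trans (e₂.symm.trans (e₃.trans ?_))
    refine (fmk_congr (hq' := hq₂) (hp' := hp₂) rfl e₄ rfl).trans (Eq.trans ?_ e₅)
    exact (fmk_left (𝔅.graph.t e) _ hq₂ (c.γ (𝔅.graph.bar e)) hq₃ _ _ hp₂).symm

/-- Every element has the form `q ⊗ b z ⊗ p`. The path family of `ξ₀` is non-empty, hence contains
every `q` because `P` is a refinement of `Y`; what remains is to adjust `p`, which an element of the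
fundamental group of `X` does. -/
theorem BaseChoice.IsSphere.isRightTransitive (h : c.IsSphere SY SX SP) :
    Biset.IsRightTransitive (X.fundGroup w₀) (𝔅.FundBiset v₀ w₀) := by
  constructor
  · obtain ⟨z⟩ := h.isTree.isTree.connected.nonempty
    obtain ⟨q, hq⟩ := exists_isPath h.left_stable.isTree v₀ (𝔅.lamV z)
    obtain ⟨p, hp⟩ := exists_isPath h.right_stable.isTree (𝔅.rhoV z) w₀
    exact ⟨fmk z q hq (c.b z.1) p hp⟩
  · intro ξ₀ ξ
    obtain ⟨z₀, q₀, hq₀, p₀, hp₀, e₀⟩ := c.exists_fmk_base_eq h.transitive ξ₀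
    obtain ⟨z, q, hq, p, hp, rfl⟩ := c.exists_fmk_base_eq h.transitive ξ
    obtain ⟨hq', p', hp', a, e⟩ := h.refinement.generatesPaths v₀ _
      (c.isPathFamily ξ₀ h.refinement.graph) ⟨z₀, q₀, hq₀, p₀, hp₀, 1, by
        rw [op_one, one_smul, e₀]⟩ z q hq
    obtain ⟨a', e'⟩ := fmk_eq_op_smul_fmk z q hq (c.b z.1) p' p hp' hp
    refine ⟨a * a', ?_⟩
    rw [op_mul, mul_smul, e]
    exact e'

end GraphOfBisets

namespace SphereStructure.Representatives

variable {X : GraphOfGroups.{u}} {S : SphereStructure X} {w₀ : X.Vert}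
  {γ : S.fundPer w₀ → X.fundGroup w₀}

/-- Representatives of the peripheral classes of a vertex group. -/
theorem exists_local (R : S.Representatives γ) (x : X.Vert) : ∃ γ₀ : S.per x.1 → X.G x.1,
    (∀ C, ConjClasses.mk (γ₀ C) = C) ∧
      ∀ (C : S.per x.1) (hC : S.IsVacant x C.1), γ₀ C = R.g ⟨⟨x, C.1⟩, hC⟩ := by
  classical
  refine ⟨fun C => if hC : S.IsVacant x C.1 then R.g ⟨⟨x, C.1⟩, hC⟩ else C.1.exists_rep.choose,
    fun C => ?_, fun C hC => dif_pos hC⟩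
  dsimp only
  split_ifs with hC
  · exact R.mk_g ⟨⟨x, C.1⟩, hC⟩
  · exact C.1.exists_rep.choose_spec

end SphereStructure.Representatives

namespace GraphOfBisets

variable {Y X : GraphOfGroups.{u}} {𝔅 : GraphOfBisets Y X} {c : 𝔅.BaseChoice}
  {SY : SphereStructure Y} {SX : SphereStructure X} {SP : SphereStructure c.groups}
  {v₀ : Y.Vert} {w₀ : X.Vert} {γ : SX.fundPer w₀ → X.fundGroup w₀}

namespace BaseChoice

/-- The element `q ⊗ b ⊗ p⁻¹`, where `p` is the path to the vacant class `C`. -/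
def liftPoint (R : SX.Representatives γ) {q : Y.Vert → Y.PathGroup} (hq : ∀ v, Y.IsPath v₀ v (q v))
    (z : 𝔅.graph.Vert) {C : ConjClasses (X.G (𝔅.rhoV z).1)} (hC : SX.IsVacant (𝔅.rhoV z) C)
    (b : c.part z.1) : 𝔅.FundBiset v₀ w₀ :=
  fmk z (q (𝔅.lamV z)) (hq _) b.1 (R.p ⟨⟨𝔅.rhoV z, C⟩, hC⟩)⁻¹ (R.isPath ⟨⟨𝔅.rhoV z, C⟩, hC⟩).inv

/-- The representative of the vacant class `C`. -/
def vacantRep (R : SX.Representatives γ) (z : 𝔅.graph.Vert) {C : ConjClasses (X.G (𝔅.rhoV z).1)}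
    (hC : SX.IsVacant (𝔅.rhoV z) C) : X.G (𝔅.rho z.1) := R.g ⟨⟨𝔅.rhoV z, C⟩, hC⟩

variable (c) in
theorem map_conjHom_comp {q : Y.Vert → Y.PathGroup} (hq : ∀ v, Y.IsPath v₀ v (q v))
    (z : 𝔅.graph.Vert) (E : ConjClasses (c.stab z.1)) :
    ConjClasses.map ((GraphOfGroups.conjHom (hq (𝔅.lamV z))).comp (c.stab z.1).subtype) E =
      ConjClasses.map (GraphOfGroups.conjHom (hq (𝔅.lamV z)))
        (ConjClasses.map (c.stab z.1).subtype E) := by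
  induction E using Quotient.inductionOn with | h g => rfl

/-- The cycle of `liftPoint`, together with the peripheral class. -/
def liftCycle (R : SX.Representatives γ) {q : Y.Vert → Y.PathGroup} (hq : ∀ v, Y.IsPath v₀ v (q v))
    (z : 𝔅.graph.Vert) {C : ConjClasses (X.G (𝔅.rhoV z).1)} (hC : SX.IsVacant (𝔅.rhoV z) C)
    (b : c.part z.1) : Σ C, Biset.Cycle (Y.fundGroup v₀) (𝔅.FundBiset v₀ w₀) (γ C) :=
  ⟨R.σ ⟨⟨𝔅.rhoV z, C⟩, hC⟩, Biset.cyc _ _ (liftPoint R hq z hC b)⟩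

namespace IsSphere

theorem conjHom_rcast_eq (R : SX.Representatives γ) (ℓ : SX.vacant)
    (i : {z : 𝔅.graph.Vert // 𝔅.rhoV z = ℓ.1.1}) :
    GraphOfGroups.conjHom (v := 𝔅.rhoV i.1) (p := R.p ℓ) (i.2.symm ▸ R.isPath ℓ) (rcast i.2 (R.g ℓ)) =
      γ (R.σ ℓ) :=
  (conjHom_rcast (R.isPath ℓ) i.1 i.2 (R.g ℓ)).trans (R.γ_σ ℓ).symm

/-- A peripheral class comes from a vacant class at some vertex of `X`, and the decomposition is
taken over that same vertex, so the cycles of its representative are cycles of vertex bisets. -/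
theorem exists_liftCycle_eq (h : c.IsSphere SY SX SP) (R : SX.Representatives γ)
    {q : Y.Vert → Y.PathGroup} (hq : ∀ v, Y.IsPath v₀ v (q v))
    (i : Σ C, Biset.Cycle (Y.fundGroup v₀) (𝔅.FundBiset v₀ w₀) (γ C)) :
    ∃ (z : 𝔅.graph.Vert) (C : ConjClasses (X.G (𝔅.rhoV z).1)) (hC : SX.IsVacant (𝔅.rhoV z) C)
      (b : c.part z.1), liftCycle R hq z hC b = i := by
  obtain ⟨C', x⟩ := i
  obtain ⟨⟨⟨y, C⟩, hC⟩, rfl⟩ := R.bijective.2 C'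
  have D := c.isDecomposition h.left_free h.right_stable.isTree h.transitive
    (R.isPath ⟨⟨y, C⟩, hC⟩) fun z => hq (𝔅.lamV z)
  obtain ⟨F, hF, hF', -⟩ := D.exists_cycles_bijective (conjHom_rcast_eq R ⟨⟨y, C⟩, hC⟩)
  obtain ⟨⟨⟨z, hz⟩, x'⟩, rfl⟩ := hF.2 x
  obtain ⟨b, rfl⟩ := Biset.exists_cyc_eq x'
  change 𝔅.rhoV z = y at hz
  subst hz
  exact ⟨z, C, hC, b, congrArg (Sigma.mk _) (hF' ⟨z, rfl⟩ b).symm⟩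

theorem isLift_liftCycle (h : c.IsSphere SY SX SP) (R : SX.Representatives γ)
    {q : Y.Vert → Y.PathGroup} (hq : ∀ v, Y.IsPath v₀ v (q v))
    {z : 𝔅.graph.Vert} {C : ConjClasses (X.G (𝔅.rhoV z).1)} (hC : SX.IsVacant (𝔅.rhoV z) C)
    {b : c.part z.1} {E : ConjClasses (c.stab z.1)}
    (hE : (Biset.cyc (c.stab z.1) (vacantRep R z hC) b).IsLift E) :
    (liftCycle R hq z hC b).2.IsLift (ConjClasses.map
      ((GraphOfGroups.conjHom (hq (𝔅.lamV z))).comp (c.stab z.1).subtype) E) := by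
  have D := c.isDecomposition h.left_free h.right_stable.isTree h.transitive
    (R.isPath ⟨⟨𝔅.rhoV z, C⟩, hC⟩) fun z => hq (𝔅.lamV z)
  obtain ⟨F, -, hF', hF⟩ := D.exists_cycles_bijective (conjHom_rcast_eq R ⟨⟨𝔅.rhoV z, C⟩, hC⟩)
  have h1 := hF ⟨z, rfl⟩ _ E hE
  have h2 : F ⟨⟨z, rfl⟩, Biset.cyc (c.stab z.1) (vacantRep R z hC) b⟩ = (liftCycle R hq z hC b).2 :=
    hF' ⟨z, rfl⟩ b
  rw [← h2]
  exact h1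

theorem liftCycle_congr (h : c.IsSphere SY SX SP) (R : SX.Representatives γ)
    {q : Y.Vert → Y.PathGroup} (hq : ∀ v, Y.IsPath v₀ v (q v))
    {z : 𝔅.graph.Vert} {C : ConjClasses (X.G (𝔅.rhoV z).1)} (hC : SX.IsVacant (𝔅.rhoV z) C)
    {b b' : c.part z.1}
    (hb : Biset.cyc (c.stab z.1) (vacantRep R z hC) b =
      Biset.cyc (c.stab z.1) (vacantRep R z hC) b') :
    liftCycle R hq z hC b = liftCycle R hq z hC b' := by
  have D := c.isDecomposition h.left_free h.right_stable.isTree h.transitive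
    (R.isPath ⟨⟨𝔅.rhoV z, C⟩, hC⟩) fun z => hq (𝔅.lamV z)
  exact congrArg (Sigma.mk _) ((D.cyc_eq_cyc_iff (conjHom_rcast_eq R ⟨⟨𝔅.rhoV z, C⟩, hC⟩)
    (i := ⟨z, rfl⟩) (j := ⟨z, rfl⟩)).2 (congrArg (Sigma.mk _) hb))

/-- The lifts of a vacant class are trivial or the images of vacant classes. -/
theorem exists_isVacant_of_isLift (h : c.IsSphere SY SX SP) (R : SX.Representatives γ)
    {q : Y.Vert → Y.PathGroup} (hq : ∀ v, Y.IsPath v₀ v (q v))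
    {z : 𝔅.graph.Vert} {C : ConjClasses (X.G (𝔅.rhoV z).1)} (hC : SX.IsVacant (𝔅.rhoV z) C)
    {b : c.part z.1} {D : ConjClasses (Y.fundGroup v₀)} (hD : (liftCycle R hq z hC b).2.IsLift D) :
    ∃ E : ConjClasses (c.stab z.1), D = ConjClasses.map
      ((GraphOfGroups.conjHom (hq (𝔅.lamV z))).comp (c.stab z.1).subtype) E ∧
      (Biset.cyc (c.stab z.1) (vacantRep R z hC) b).IsLift E ∧
      (D = ConjClasses.mk 1 ∨ SP.IsVacant z E) := by
  obtain ⟨E, hE⟩ := Biset.exists_isLift'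
    (Biset.cyc (c.stab z.1) (vacantRep R z hC) b)
  have h1 := hD.unique (fundBiset_isLeftFree h.left_free h.right_stable.isTree)
    (h.isLift_liftCycle R hq hC hE)
  refine ⟨E, h1, hE, ?_⟩
  have h2 := R.mk_g ⟨⟨𝔅.rhoV z, C⟩, hC⟩
  rcases h.isVacant_of_isLift z (h2.symm ▸ hC) hE with rfl | hv
  · left
    rw [h1]
    exact congrArg ConjClasses.mk (map_one _)
  · exact .inr hv

theorem isVacant_lam (h : c.IsSphere SY SX SP) {z : 𝔅.graph.Vert} {E : ConjClasses (c.stab z.1)}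
    (hE : SP.IsVacant z E) : SY.IsVacant (𝔅.lamV z) (ConjClasses.map (c.stab z.1).subtype E) :=
  (h.refinement.bijOn_vacant h.left_stable).2.mapsTo
    (show (⟨z, E⟩ : SphereStructure.Label c.groups) ∈ SP.vacant from hE)

theorem lift_trivial (h : c.IsSphere SY SX SP) (hγ : ∀ C, ConjClasses.mk (γ C) = C)
    (i : Σ C, Biset.Cycle (Y.fundGroup v₀) (𝔅.FundBiset v₀ w₀) (γ C))
    (D : ConjClasses (Y.fundGroup v₀)) (hD : i.2.IsLift D) :
    D ∈ SY.fundPer v₀ ∨ D = ConjClasses.mk 1 := by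
  obtain ⟨R⟩ := h.right_stable.exists_representatives γ hγ
  choose q hq using GraphOfGroups.exists_isPath h.left_stable.isTree v₀
  obtain ⟨z, C, hC, b, rfl⟩ := h.exists_liftCycle_eq R hq i
  obtain ⟨E, rfl, -, h1 | h1⟩ := h.exists_isVacant_of_isLift R hq hC hD
  · exact .inr h1
  · left
    refine (map_conjHom_comp c hq z E).symm ▸ ?_
    exact SphereStructure.IsStable.map_conjHom_mem (h.isVacant_lam h1) _

/-- A vacant class of `Y` comes from exactly one vacant class of `P`, which is a lift at its vertex.
Conversely, if two cycles lift to `D`, the distinctness of the peripheral classes of the fundamental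
group of `Y` and injectivity on vacant classes of `P` give the same vertex and class, and uniqueness
in the biset at this vertex gives the same cycle. -/
theorem lift_unique (h : c.IsSphere SY SX SP) (hγ : ∀ C, ConjClasses.mk (γ C) = C)
    (D : ConjClasses (Y.fundGroup v₀)) (hD : D ∈ SY.fundPer v₀) :
    ∃! i : Σ C, Biset.Cycle (Y.fundGroup v₀) (𝔅.FundBiset v₀ w₀) (γ C), i.2.IsLift D := by
  obtain ⟨R⟩ := h.right_stable.exists_representatives γ hγ
  choose q hq using GraphOfGroups.exists_isPath h.left_stable.isTree v₀
  have hB := h.refinement.bijOn_vacant h.left_stable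
  refine existsUnique_of_exists_of_unique ?_ ?_
  · obtain ⟨a, v, g, p, hp, hv, ha, rfl⟩ := hD
    obtain ⟨⟨z, E⟩, hE, e⟩ := hB.2.surjOn
      (show (⟨v, ConjClasses.mk g⟩ : SphereStructure.Label Y) ∈ SY.vacant from hv)
    replace hE : SP.IsVacant z E := hE
    obtain ⟨γ₀, hγ₀, hγR⟩ := R.exists_local (𝔅.rhoV z)
    obtain ⟨C, hC, b, hb⟩ := h.exists_isLift_of_isVacant z hE γ₀ hγ₀
    rw [show γ₀ C = vacantRep R z hC from hγR C hC] at hb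
    refine ⟨liftCycle R hq z hC b, ?_⟩
    have h1 : ConjClasses.mk a = ConjClasses.map
        ((GraphOfGroups.conjHom (hq (𝔅.lamV z))).comp (c.stab z.1).subtype) E := by
      have h2 : ∀ y : SphereStructure.Label Y, y = ⟨v, ConjClasses.mk g⟩ →
          ConjClasses.mk a = ConjClasses.map (GraphOfGroups.conjHom (hq y.1)) y.2 := by
        rintro _ rfl
        refine Eq.trans ?_ (ConjClasses.map_conjHom_eq (ConjClasses.mk g) hp (hq v))
        exact congrArg ConjClasses.mk (Subtype.ext ha)
      exact (h2 _ e).trans (map_conjHom_comp c hq z E).symm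
    rw [h1]
    exact h.isLift_liftCycle R hq hC hb
  · intro i i' hi hi'
    obtain ⟨z, C, hC, b, rfl⟩ := h.exists_liftCycle_eq R hq i
    obtain ⟨z', C', hC', b', rfl⟩ := h.exists_liftCycle_eq R hq i'
    have hne : D ≠ ConjClasses.mk 1 := by
      rintro rfl
      exact (h.left_stable.fundGroup v₀).1.mk_one_notMem hD
    obtain ⟨E, e, hE, hv⟩ := h.exists_isVacant_of_isLift R hq hC hi
    obtain ⟨E', e', hE', hv'⟩ := h.exists_isVacant_of_isLift R hq hC' hi'
    replace hv := hv.resolve_left hne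
    replace hv' := hv'.resolve_left hne
    replace e := e.trans (map_conjHom_comp c hq z E)
    replace e' := e'.trans (map_conjHom_comp c hq z' E')
    have h1 := (h.left_stable.fundGroup v₀).2 hq ⟨_, _⟩ ⟨_, _⟩ (h.isVacant_lam hv)
      (h.isVacant_lam hv') (e.symm.trans e')
    have h2 : (⟨z, E⟩ : SphereStructure.Label c.groups) = ⟨z', E'⟩ := hB.2.injOn
      (show (⟨z, E⟩ : SphereStructure.Label c.groups) ∈ SP.vacant from hv)
      (show (⟨z', E'⟩ : SphereStructure.Label c.groups) ∈ SP.vacant from hv') h1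
    obtain rfl : z = z' := congrArg Sigma.fst h2
    obtain rfl : E = E' := eq_of_heq (Sigma.mk.inj h2).2
    obtain ⟨γ₀, hγ₀, hγR⟩ := R.exists_local (𝔅.rhoV z)
    have h3 : γ₀ ⟨C, hC.1⟩ = vacantRep R z hC := hγR ⟨C, hC.1⟩ hC
    have h3' : γ₀ ⟨C', hC'.1⟩ = vacantRep R z hC' := hγR ⟨C', hC'.1⟩ hC'
    rw [← h3] at hE
    rw [← h3'] at hE'
    have h4 := ((h.sphere z.1).lift_unique γ₀ hγ₀ E hv.1).unique (y₁ := ⟨_, _⟩) (y₂ := ⟨_, _⟩) hE hE'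
    obtain ⟨h5, h6⟩ := Biset.eq_of_sigma_cyc_eq h4
    obtain rfl : C = C' := congrArg Subtype.val h5
    rw [h3] at h6
    exact h.liftCycle_congr R hq hC h6

end IsSphere
end BaseChoice
end GraphOfBisets

/-! ### The Riemann–Hurwitz formula. -/

namespace SphereStructure

variable {X : GraphOfGroups.{u}} {S : SphereStructure X}

/-- The peripheral class to which an edge attaches. -/
def IsStable.attach (hS : S.IsStable) (x : X.Vert)
    (f : {f // X.graph.IsEdge f ∧ X.graph.src f = x.1}) : S.per x.1 :=
  ⟨ConjClasses.mk (X.minusTo f.2.2 (S.gen f.1)),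
    S.mk_minusTo_gen_mem f.2.2 f.2.1 (hS.edge_ne_one _ f.2.1)⟩

/-- The peripheral classes of a vertex group correspond to the edges and the vacant classes. -/
theorem IsStable.attach_bijective (hS : S.IsStable) (x : X.Vert) :
    Function.Bijective (Sum.elim (hS.attach x)
      fun C : {C // S.IsVacant x C} => (⟨C.1, C.2.1⟩ : S.per x.1)) := by
  classical
  constructor
  · rintro (f | C) (f' | C') e
    · exact congrArg _ (Subtype.ext (eq_of_attach hS f.2.2 f'.2.2 f.2.1 f'.2.1
        (congrArg Subtype.val e)))
    · exact absurd (congrArg Subtype.val e) (C'.2.2 _ f.2.2 f.2.1)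
    · exact absurd (congrArg Subtype.val e).symm (C.2.2 _ f'.2.2 f'.2.1)
    · have h : C.1 = C'.1 := congrArg (fun D : S.per x.1 => D.1) e
      exact congrArg _ (Subtype.ext h)
  · rintro ⟨C, hC⟩
    by_cases h : ∃ f, ∃ hf : X.graph.src f = x.1, X.graph.IsEdge f ∧
        ConjClasses.mk (X.minusTo hf (S.gen f)) = C
    · obtain ⟨f, hf, hf', rfl⟩ := h
      exact ⟨.inl ⟨f, hf', hf⟩, rfl⟩
    · exact ⟨.inr ⟨C, hC, fun f hf hf' e => h ⟨f, hf, hf', e⟩⟩, rfl⟩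

theorem IsStable.finite_vacant (hS : S.IsStable) : Finite S.vacant := by
  have := hS.finite
  have : Finite X.Vert := Subtype.finite
  have : ∀ x : X.Vert, Finite (S.per x.1) := fun x => (S.isSphere x.1).finite.to_subtype
  refine Finite.of_injective (β := Σ x : X.Vert, S.per x.1)
    (fun ℓ => ⟨ℓ.1.1, ⟨ℓ.1.2, ℓ.2.1⟩⟩) ?_
  rintro ⟨⟨x, C⟩, h⟩ ⟨⟨x', C'⟩, h'⟩ e
  obtain rfl : x = x' := congrArg Sigma.fst e
  obtain rfl : C = C' := congrArg Subtype.val (eq_of_heq (Sigma.mk.inj e).2)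
  rfl

end SphereStructure

namespace GraphOfBisets

variable {Y X : GraphOfGroups.{u}} {𝔅 : GraphOfBisets Y X} {c : 𝔅.BaseChoice}
  {SY : SphereStructure Y} {SX : SphereStructure X} {SP : SphereStructure c.groups}
  {v₀ : Y.Vert} {w₀ : X.Vert} {γ : SX.fundPer w₀ → X.fundGroup w₀}

namespace BaseChoice

variable (c) in
/-- The degree of the biset `B' z`. -/
noncomputable def degree (z : 𝔅.graph.Vert) : ℤ :=
  Nat.card (Biset.LeftOrbits (c.stab z.1) (c.part z.1))

namespace IsSphere

theorem finite_degree (h : c.IsSphere SY SX SP) (z : 𝔅.graph.carrier) :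
    Finite (Biset.LeftOrbits (c.stab z) (c.part z)) := (h.sphere z).finite_degree

theorem finite_graph (h : c.IsSphere SY SX SP) : Finite 𝔅.graph.carrier :=
  h.refinement.finite h.left_stable.finite

/-- The Riemann-Hurwitz formula for the biset of a vertex, in terms of the vacant classes. -/
theorem riemann_hurwitz_vertex (h : c.IsSphere SY SX SP) (R : SX.Representatives γ)
    (z : 𝔅.graph.Vert) [Fintype {f // X.graph.IsEdge f ∧ X.graph.src f = 𝔅.rho z.1}]
    [Fintype {C // SX.IsVacant (𝔅.rhoV z) C}] :
    ∑ C : {C // SX.IsVacant (𝔅.rhoV z) C},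
      (c.degree z - Biset.ncyc (c.stab z.1) (c.part z.1) (vacantRep R z C.2)) =
    2 * c.degree z - 2 - ∑ f : {f // X.graph.IsEdge f ∧ X.graph.src f = 𝔅.rho z.1},
      (c.degree z - Nat.card {e : 𝔅.graph.carrier // 𝔅.graph.src e = z.1 ∧ 𝔅.rho e = f.1}) := by
  obtain ⟨γ₀, hγ₀, hγR⟩ := R.exists_local (𝔅.rhoV z)
  obtain ⟨γ', hγ', hγe, hγv⟩ := h.exists_representatives z γ₀ hγ₀
  have h1 := (h.sphere z.1).finsum_ncyc γ' hγ'
  have hb := h.right_stable.attach_bijective (𝔅.rhoV z)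
  rw [eq_sub_iff_add_eq', degree, ← h1]
  refine Eq.trans ?_ (finsum_eq_of_bijective (f := fun x => (Nat.card (Biset.LeftOrbits (c.stab z.1)
    (c.part z.1)) : ℤ) - Biset.ncyc (c.stab z.1) (c.part z.1) (γ' (Sum.elim _ _ x))) _ hb
    fun x => rfl)
  let _ : Fintype {f // X.graph.IsEdge f ∧ X.graph.src f = (𝔅.rhoV z).1} :=
    inferInstanceAs (Fintype {f // X.graph.IsEdge f ∧ X.graph.src f = 𝔅.rho z.1})
  rw [finsum_eq_sum_of_fintype, Fintype.sum_sum_type]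
  refine congrArg₂ (· + ·) (Fintype.sum_congr _ _ fun f => ?_) (Fintype.sum_congr _ _ fun C => ?_)
  -- For an occupied class the cycles are the edges of `𝔅` at `z` above `f`.
  · have h2 : γ' (h.right_stable.attach (𝔅.rhoV z) f) = X.minusTo f.2.2 (SX.gen f.1) :=
      hγe f.1 f.2.2 f.2.1 (h.right_stable.attach (𝔅.rhoV z) f).2
    have h3 := ncyc_edge (c := c) h.left_free h.transitive SX z f.2.1 f.2.2
    rw [← h3, ← h2]
    rfl
  · have h2 : γ' ⟨C.1, C.2.1⟩ = vacantRep R z C.2 := (hγv ⟨C.1, C.2.1⟩ C.2).trans (hγR ⟨C.1, C.2.1⟩ C.2)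
    rw [← h2]
    rfl

/-- The fundamental biset has finite degree, the total degree over any vertex of `X`. -/
theorem finite_degree_fundBiset (h : c.IsSphere SY SX SP) (v₀ : Y.Vert) (w₀ x : X.Vert)
    [Fintype {z : 𝔅.graph.Vert // 𝔅.rhoV z = x}] :
    Finite (Biset.LeftOrbits (Y.fundGroup v₀) (𝔅.FundBiset v₀ w₀)) ∧
      (Nat.card (Biset.LeftOrbits (Y.fundGroup v₀) (𝔅.FundBiset v₀ w₀)) : ℤ) =
        ∑ i : {z : 𝔅.graph.Vert // 𝔅.rhoV z = x}, c.degree i.1 := by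
  choose q hq using GraphOfGroups.exists_isPath h.left_stable.isTree v₀
  obtain ⟨p, hp⟩ := GraphOfGroups.exists_isPath h.right_stable.isTree w₀ x
  have := fun z => h.finite_degree z
  exact (c.isDecomposition h.left_free h.right_stable.isTree h.transitive hp
    fun z => hq (𝔅.lamV z)).card_leftOrbits

theorem ncyc_fundBiset (h : c.IsSphere SY SX SP) (v₀ : Y.Vert) (R : SX.Representatives γ)
    (ℓ : SX.vacant) [Fintype {z : 𝔅.graph.Vert // 𝔅.rhoV z = ℓ.1.1}] :
    Biset.ncyc (Y.fundGroup v₀) (𝔅.FundBiset v₀ w₀) (γ (R.σ ℓ)) =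
      ∑ i : {z : 𝔅.graph.Vert // 𝔅.rhoV z = ℓ.1.1},
        Biset.ncyc (c.stab i.1.1) (c.part i.1.1) (rcast i.2 (R.g ℓ)) := by
  choose q hq using GraphOfGroups.exists_isPath h.left_stable.isTree v₀
  have := fun z => h.finite_degree z
  exact (c.isDecomposition h.left_free h.right_stable.isTree h.transitive (R.isPath ℓ)
    fun z => hq (𝔅.lamV z)).ncyc_eq (conjHom_rcast_eq R ℓ)

/-- The sum is regrouped by the vertices `z` of `𝔅`, where the formula of the vertex biset applies.
The remaining terms count vertices and oriented edges of `X`, each weighted by `d`, and vertices and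
oriented edges of `𝔅`; both graphs are trees, so the counts collapse to `2 d - 2`. -/
theorem riemann_hurwitz (h : c.IsSphere SY SX SP) (v₀ : Y.Vert)
    (hγ : ∀ C, ConjClasses.mk (γ C) = C) :
    ∑ᶠ (C : SX.fundPer w₀) (o : Biset.Cycle (Y.fundGroup v₀) (𝔅.FundBiset v₀ w₀) (γ C)),
      ((o.length : ℤ) - 1) =
        2 * (Nat.card (Biset.LeftOrbits (Y.fundGroup v₀) (𝔅.FundBiset v₀ w₀)) : ℤ) - 2 := by
  classical
  obtain ⟨R⟩ := h.right_stable.exists_representatives γ hγ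
  have := h.finite_graph
  have := h.right_stable.finite
  have : Finite 𝔅.graph.Vert := Subtype.finite
  have : Finite X.Vert := Subtype.finite
  have := h.right_stable.finite_vacant
  have hfv : ∀ z : 𝔅.graph.Vert, Finite {C // SX.IsVacant (𝔅.rhoV z) C} := fun z => by
    have := (SX.isSphere (𝔅.rhoV z).1).finite.to_subtype
    exact Finite.of_injective (β := SX.per (𝔅.rhoV z).1) (fun C => ⟨C.1, C.2.1⟩) fun C C' e =>
      Subtype.ext (congrArg (fun D : SX.per (𝔅.rhoV z).1 => D.1) e)
  have := Fintype.ofFinite 𝔅.graph.Vert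
  have := Fintype.ofFinite X.Vert
  have := Fintype.ofFinite SX.vacant
  have := fun z => Fintype.ofFinite {C // SX.IsVacant (𝔅.rhoV z) C}
  have := fun z : 𝔅.graph.Vert =>
    Fintype.ofFinite {f // X.graph.IsEdge f ∧ X.graph.src f = 𝔅.rho z.1}
  have := fun x => Fintype.ofFinite {z : 𝔅.graph.Vert // 𝔅.rhoV z = x}
  have := Fintype.ofFinite {f // X.graph.IsEdge f}
  have hfin := (h.finite_degree_fundBiset v₀ w₀ w₀).1
  have hdeg := fun x => (h.finite_degree_fundBiset v₀ w₀ x).2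
  set d : ℤ := ((Nat.card (Biset.LeftOrbits (Y.fundGroup v₀) (𝔅.FundBiset v₀ w₀)) : ℕ) : ℤ)
  have h1 : ∑ᶠ (C : SX.fundPer w₀)
      (o : Biset.Cycle (Y.fundGroup v₀) (𝔅.FundBiset v₀ w₀) (γ C)), ((o.length : ℤ) - 1) =
      ∑ ℓ : SX.vacant, ∑ i : {z : 𝔅.graph.Vert // 𝔅.rhoV z = ℓ.1.1}, (c.degree i.1 -
        Biset.ncyc (c.stab i.1.1) (c.part i.1.1) (rcast i.2 (R.g ℓ))) := by
    rw [← finsum_eq_sum_of_fintype]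
    refine (finsum_eq_of_bijective R.σ R.bijective fun ℓ => ?_).symm
    rw [Biset.finsum_length_sub_one, Finset.sum_sub_distrib, ← hdeg, ← h.ncyc_fundBiset v₀ R ℓ]
  have h2 : ∑ ℓ : SX.vacant, ∑ i : {z : 𝔅.graph.Vert // 𝔅.rhoV z = ℓ.1.1}, (c.degree i.1 -
        Biset.ncyc (c.stab i.1.1) (c.part i.1.1) (rcast i.2 (R.g ℓ))) =
      ∑ z : 𝔅.graph.Vert, ∑ C : {C // SX.IsVacant (𝔅.rhoV z) C},
        (c.degree z - Biset.ncyc (c.stab z.1) (c.part z.1) (vacantRep R z C.2)) := by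
    rw [← Fintype.sum_sigma', ← Fintype.sum_sigma']
    refine (Fintype.sum_bijective (fun x : Σ z : 𝔅.graph.Vert, {C // SX.IsVacant (𝔅.rhoV z) C} =>
      (⟨⟨⟨𝔅.rhoV x.1, x.2.1⟩, x.2.2⟩, ⟨x.1, rfl⟩⟩ :
        Σ ℓ : SX.vacant, {z : 𝔅.graph.Vert // 𝔅.rhoV z = ℓ.1.1})) ⟨?_, ?_⟩ _ _ fun x => rfl).symm
    · rintro ⟨z, C, hC⟩ ⟨z', C', hC'⟩ e
      obtain rfl : z = z' := congrArg (fun y => y.2.1) e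
      have h3 : (⟨𝔅.rhoV z, C⟩ : SphereStructure.Label X) = ⟨𝔅.rhoV z, C'⟩ :=
        congrArg (fun y => y.1.1) e
      obtain rfl : C = C' := eq_of_heq (Sigma.mk.inj h3).2
      rfl
    · rintro ⟨⟨⟨x, C⟩, hC⟩, ⟨z, hz⟩⟩
      change 𝔅.rhoV z = x at hz
      subst hz
      exact ⟨⟨z, C, hC⟩, rfl⟩
  -- The total degree above every vertex of `X` is the degree `d` of the fundamental biset, because
  -- the decomposition can be made over any vertex.
  have h3 : ∑ z : 𝔅.graph.Vert, c.degree z = Nat.card X.Vert * d := by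
    rw [← (Equiv.sigmaFiberEquiv 𝔅.rhoV).sum_comp, Fintype.sum_sigma]
    refine (Fintype.sum_congr _ (fun _ => d) fun x => (hdeg x).symm).trans ?_
    simp
  have h4 : ∑ z : 𝔅.graph.Vert, ∑ f : {f // X.graph.IsEdge f ∧ X.graph.src f = 𝔅.rho z.1},
      c.degree z = Nat.card {f // X.graph.IsEdge f} * d := by
    rw [← Fintype.sum_sigma', Fintype.sum_bijective (fun x : Σ z : 𝔅.graph.Vert,
      {f // X.graph.IsEdge f ∧ X.graph.src f = 𝔅.rho z.1} => (⟨⟨x.2.1, x.2.2.1⟩, ⟨x.1,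
        (Subtype.ext x.2.2.2.symm : 𝔅.rhoV x.1 = X.graph.o x.2.1)⟩⟩ : Σ f : {f // X.graph.IsEdge f},
          {z : 𝔅.graph.Vert // 𝔅.rhoV z = X.graph.o f.1})) ⟨?_, ?_⟩ _ (fun y => c.degree y.2.1)
            fun x => rfl, Fintype.sum_sigma]
    · refine (Fintype.sum_congr _ (fun _ => d) fun f : {f // X.graph.IsEdge f} =>
        (hdeg (X.graph.o f.1)).symm).trans ?_
      simp
    · rintro ⟨z, f, hf⟩ ⟨z', f', hf'⟩ e
      obtain rfl : z = z' := congrArg (fun y => y.2.1) e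
      obtain rfl : f = f' := congrArg (fun y => y.1.1) e
      rfl
    · rintro ⟨⟨f, hf⟩, ⟨z, hz⟩⟩
      exact ⟨⟨z, f, hf, (congrArg Subtype.val hz).symm⟩, rfl⟩
  -- Every oriented edge of `𝔅` is counted once, at its origin and above its image, which is an edge
  -- of `X` by left-freeness.
  have h5 : ∑ z : 𝔅.graph.Vert, ∑ f : {f // X.graph.IsEdge f ∧ X.graph.src f = 𝔅.rho z.1},
      (Nat.card {e : 𝔅.graph.carrier // 𝔅.graph.src e = z.1 ∧ 𝔅.rho e = f.1} : ℤ) =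
        Nat.card {e // 𝔅.graph.IsEdge e} := by
    rw [← Fintype.sum_sigma', ← Nat.cast_sum, ← Nat.card_sigma]
    refine congrArg _ (Nat.card_eq_of_bijective (fun x => ⟨x.2.1,
      𝔅.rho_morphism.isEdge_of_isEdge_map (x.2.2.2.symm ▸ x.1.2.2.1)⟩) ⟨?_, ?_⟩)
    · rintro ⟨⟨z, f, hf⟩, e, he, he'⟩ ⟨⟨z', f', hf'⟩, e', he₂, he₂'⟩ h6
      obtain rfl : e = e' := congrArg Subtype.val h6
      obtain rfl : z = z' := Subtype.ext (he.symm.trans he₂)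
      dsimp only at he' he₂'
      subst he'
      obtain rfl := he₂'
      rfl
    · rintro ⟨e, he⟩
      exact ⟨⟨⟨𝔅.graph.o e, 𝔅.rho e, h.isEdge_rho he, rho_src rfl⟩, e, rfl, rfl⟩, rfl⟩
  have h6 := h.isTree.card_edges
  have h7 := h.right_stable.isTree.card_edges
  rw [h1, h2, Fintype.sum_congr _ _ fun z => h.riemann_hurwitz_vertex R z]
  simp only [Finset.sum_sub_distrib]
  rw [← Finset.mul_sum, h3, h4, h5, h6, h7]
  simp
  ring

end IsSphere
end BaseChoice
end GraphOfBisets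

theorem mainTheorem6 {Y X : GraphOfGroups.{u}} (SY : SphereStructure Y) (SX : SphereStructure X)
    (𝔅 : GraphOfBisets Y X) (h𝔅 : IsSphereTreeOfBisets SY SX 𝔅) (v₀ : Y.Vert) (w₀ : X.Vert) :
    Biset.IsSphereBiset (SY.fundPer v₀) (SX.fundPer w₀) (𝔅.FundBiset v₀ w₀) := by
  obtain ⟨c, SP, hr, hs⟩ := h𝔅.refinement
  have h : c.IsSphere SY SX SP := ⟨h𝔅.isTree, h𝔅.left_stable, h𝔅.right_stable, h𝔅.left_free,
    h𝔅.transitive, hr, hs⟩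
  exact
    { left_sphere := (h.left_stable.fundGroup v₀).1
      right_sphere := (h.right_stable.fundGroup w₀).1
      left_free := GraphOfBisets.fundBiset_isLeftFree h.left_free h.right_stable.isTree
      right_transitive := h.isRightTransitive
      finite_degree := by
        have := h.finite_graph
        have : Finite 𝔅.graph.Vert := Subtype.finite
        have := Fintype.ofFinite {z : 𝔅.graph.Vert // 𝔅.rhoV z = w₀}
        exact (h.finite_degree_fundBiset v₀ w₀ w₀).1
      riemann_hurwitz := fun γ hγ => h.riemann_hurwitz v₀ hγ
      lift_unique := fun γ hγ => h.lift_unique hγ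
      lift_trivial := fun γ hγ => h.lift_trivial hγ }
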